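/- **Setting.** Let $n\ge 1$, let $V=\mathbb C^n$ with the bilinear scalar product $(x,y)=\sum_i x_iy_i$, let $\mathrm{Im}\,\tau>0$, and let $\mathcal A$ be a finite set of affine-linear functions $\alpha(x)=(\alpha_0,x)+a_0$ on $V$ with $(\alpha_0,\alpha_0)\neq0$ and with positive integers $m_\alpha$. Put $$u(x)=\sum_{\alpha\in\mathcal A}m_\alpha(m_\alpha+1)(\alpha_0,\alpha_0)\,\wp(\alpha(x)\,|\,\tau),$$ where $\wp(\cdot|\tau)$ has the periods $1,\tau$. Assume that the hyperplanes $\pi_\alpha^{p,q}=\{\alpha(x)=p+q\tau\}$ ($\alpha\in\mathcal A$, $p,q\in\mathbb Z$) are pairwise different and that the gradients $\alpha_0$ span the dual space over $\mathbb C$ and generate over $\mathbb Z$ a group of rank $n$. Let $Sing=\bigcup\pi_\alpha^{p,q}$, let $\mathcal L=\{x\in V:(\alpha_0,x)\in\mathbb Z\ \text{for all}\ \alpha\in\mathcal A\}$, and let $T=V/(\mathcal L+\tau\mathcal L)$; the image of $Sing$ in $T$ is also denoted $Sing$. Assume that $u$ is *quasi-invariant*: for each $\pi=\pi_\alpha^{p,q}$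 with orthogonal reflection $s_\pi$, the function $u(x)-u(s_\pi x)$ is divisible by $(\alpha(x)-p-q\tau)^{2m_\alpha+1}$ at the generic points of $\pi$ (those that lie on no other singular hyperplane). Assume that $L=-\Delta+u$ is *strongly integrable*: there are pairwise commuting partial differential operators $L_1=L,L_2,\dots,L_n$ with meromorphic, $(\mathcal L+\tau\mathcal L)$-periodic coefficients, whose highest symbols $s_1,\dots,s_n$ are constant-coefficient, homogeneous and algebraically independent, such that $\mathbb C[\xi_1,\dots,\xi_n]$ is a finite module over $\mathbb C[s_1,\dots,s_n]$. **Statement.** For every $\lambda\in\mathbb C^n$ the following holds for the system $L_i\psi=\lambda_i\psi$, $i=1,\dots,n$. 1. (*Local monodromy is trivial.*) Every generic point $P$ of a hyperplane $\pi=\pi_\alpha^{p,q}$ has an open ball (for the maximum norm) $B$ around it with $B\cap Sing\subset\pi$ such that: every local solution $\psi\not\equiv0$ near a point of $B\setminus\pi$ has there the form $\psi=(\alpha(x)-p-q\tau)^{e}h(x)$ with $e\in\{-m_\alpha,\,m_\alpha+1\}$ and $h$ holomorphic on $B$ and not identically zero on $\pi\cap B$ (integer exponents, no logarithms); and the analytic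 continuation of every solution germ along every loop in $B\setminus\pi$ is the germ itself. 2. (*Commutative monodromy.*) For every $t_0\in T\setminus Sing$, analytic continuation of solution germs along loops defines a unique monodromy representation $\rho$ of $\pi_1(T\setminus Sing,t_0)$ in the space of solution germs at $t_0$. It factors as $\rho=\rho'\circ i_*$, where $i:T\setminus Sing\to T$ is the inclusion and $\rho'$ is a representation of $\pi_1(T,t_0)$ with the same image as $\rho$. The monodromy group $\mathrm{Im}\,\rho$ is commutative. 3. (*Meromorphic solutions.*) Every local solution near a point of $V\setminus Sing$ extends to a meromorphic function on $\mathbb C^n$ which is holomorphic and satisfies the system on $V\setminus Sing$. 4. (*Commutative differential Galois group.*) Let $x_0\in V\setminus Sing$, let $F$ be the field of meromorphic functions on $T$, regarded as germs at $x_0$, and let $K$ be the smallest subfield of the field of meromorphic germs at $x_0$ which contains $F$ and all germs of solutions at $x_0$ and is closed under $\partial_1,\dots,\partial_n$. The differential Galois group, that is, the group of field automorphisms of $K$ which commute with all $\partial_i$ and fix $F$ pointwise, is commutative. -/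

import Mathlib

open Filter Topology

namespace GenLame

noncomputable section

/-! ### Meromorphic functions and partial differential operators on `ℂⁿ` -/

/-- The complex Euclidean space `ℂⁿ`; its (bilinear) scalar product is `⬝ᵥ`. -/
abbrev Vec (n : ℕ) : Type := Fin n → ℂ

/-- The partial derivative `∂f/∂xᵢ`. -/
def pd {n : ℕ} (i : Fin n) (f : Vec n → ℂ) : Vec n → ℂ :=
  fun x => fderiv ℂ f x (Pi.single i 1)

/-- The mixed partial derivative `∂₁^{k₁} ⋯ ∂ₙ^{kₙ} f`. -/
def mixedPd {n : ℕ} (k : Fin n →₀ ℕ) (f : Vec n → ℂ) : Vec n → ℂ :=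
  (List.finRange n).foldr (fun i g => (pd i)^[k i] g) f

/-- `f` represents a meromorphic function on `ℂⁿ`: near every point it is a quotient `g / h` of
holomorphic functions with `h` not identically zero (the values of `f` where the denominator
vanishes are irrelevant). -/
def IsMeromorphic {n : ℕ} (f : Vec n → ℂ) : Prop :=
  ∀ p : Vec n, ∃ g h : Vec n → ℂ, AnalyticAt ℂ g p ∧ AnalyticAt ℂ h p ∧
    (¬ ∀ᶠ x in 𝓝 p, h x = 0) ∧ ∀ᶠ x in 𝓝 p, h x ≠ 0 → f x = g x / h x

/-- A partial differential operator `∑ₖ cₖ(x) ∂ᵏ` (a finite sum), given by its coefficients. -/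
abbrev DiffOp (n : ℕ) : Type := (Fin n →₀ ℕ) →₀ (Vec n → ℂ)

/-- The action of a differential operator on functions. -/
def DiffOp.apply {n : ℕ} (D : DiffOp n) (f : Vec n → ℂ) : Vec n → ℂ :=
  fun x => D.sum fun k c => c x * mixedPd k f x

/-- All coefficients of the operator are holomorphic near `x`. -/
def DiffOp.RegularAt {n : ℕ} (D : DiffOp n) (x : Vec n) : Prop :=
  ∀ k, AnalyticAt ℂ (D k) x

/-- Two operators commute: `D (E f) = E (D f)` at every point where the coefficients of both
operators are holomorphic, for all `f` holomorphic there. -/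
def DiffOp.Commutes {n : ℕ} (D E : DiffOp n) : Prop :=
  ∀ x : Vec n, D.RegularAt x → E.RegularAt x → ∀ f : Vec n → ℂ, AnalyticAt ℂ f x →
    D.apply (E.apply f) x = E.apply (D.apply f) x

/-- `D = s(∂) + (terms of order < d)` with `s` homogeneous of degree `d`. -/
def DiffOp.HasHighestSymbol {n : ℕ} (D : DiffOp n) (s : MvPolynomial (Fin n) ℂ) (d : ℕ) : Prop :=
  s.IsHomogeneous d ∧ (∀ k, d < k.degree → D k = 0) ∧
    ∀ k, k.degree = d → D k = fun _ => s.coeff k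

/-! ### Elliptic potentials -/

lemma linearIndependent_one_tau {τ : ℂ} (h : 0 < τ.im) :
    LinearIndependent ℝ ![(1 : ℂ), τ] := by
  rw [LinearIndependent.pair_iff]
  intro s t hst
  have him := congrArg Complex.im hst
  have hre := congrArg Complex.re hst
  simp at him hre
  have ht : t = 0 := by
    rcases him with h' | h'
    · exact h'
    · exact absurd h' h.ne'
  subst ht
  simpa using hre

/-- The pair of periods `1, τ`. -/
def periodPair (τ : ℂ) (h : 0 < τ.im) : PeriodPair := ⟨1, τ, linearIndependent_one_tau h⟩

/-- An affine-linear function `α(x) = a₁ x₁ + ⋯ + aₙ xₙ + a₀`, given as the pair consisting of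
its gradient `α₀ = (a₁, …, aₙ)` and its constant term `a₀`. -/
abbrev AffineFun (n : ℕ) : Type := Vec n × ℂ

/-- `α(x) - p - q τ`. -/
def shifted {n : ℕ} (τ : ℂ) (α : AffineFun n) (p q : ℤ) (x : Vec n) : ℂ :=
  α.1 ⬝ᵥ x + α.2 - p - q * τ

/-- The hyperplane `α(x) = p + q τ`. -/
def hyperplane {n : ℕ} (τ : ℂ) (α : AffineFun n) (p q : ℤ) : Set (Vec n) :=
  {x | shifted τ α p q x = 0}

/-- The orthogonal reflection with respect to the hyperplane `α(x) = p + q τ`. -/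
def reflection {n : ℕ} (τ : ℂ) (α : AffineFun n) (p q : ℤ) (x : Vec n) : Vec n :=
  x - (2 * shifted τ α p q x / (α.1 ⬝ᵥ α.1)) • α.1

/-- The data of an elliptic potential
`u(x) = ∑_{α ∈ A} m_α (m_α + 1) (α₀, α₀) ℘(α(x) | τ)` with the standing assumptions on `A`:
non-isotropic gradients, pairwise different singular hyperplanes, and gradients which generate a
lattice of rank `n` in the dual space. -/
structure EllipticPotential (n : ℕ) where
  τ : ℂ
  im_pos : 0 < τ.im
  A : Finset (AffineFun n)
  m : AffineFun n → ℕ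
  m_pos : ∀ α ∈ A, 0 < m α
  nonisotropic : ∀ α ∈ A, α.1 ⬝ᵥ α.1 ≠ 0
  distinct : ∀ α ∈ A, ∀ β ∈ A, ∀ p q p' q' : ℤ,
    hyperplane τ α p q = hyperplane τ β p' q' → α = β ∧ p = p' ∧ q = q'
  span_eq_top : Submodule.span ℂ (Prod.fst '' (A : Set (AffineFun n))) = ⊤
  rank_eq : Module.finrank ℤ (Submodule.span ℤ (Prod.fst '' (A : Set (AffineFun n)))) = n

namespace EllipticPotential

variable {n : ℕ} (P : EllipticPotential n)

/-- The potential `u`. -/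
def u (x : Vec n) : ℂ :=
  ∑ α ∈ P.A, (P.m α * (P.m α + 1) * (α.1 ⬝ᵥ α.1)) *
    (periodPair P.τ P.im_pos).weierstrassP (α.1 ⬝ᵥ x + α.2)

/-- The Schrödinger operator `L = -Δ + u`. -/
def schrodinger : DiffOp n :=
  Finsupp.single 0 P.u - ∑ j : Fin n, Finsupp.single (Finsupp.single j 2) 1

/-- The singular locus: the union of all hyperplanes `α(x) = p + q τ`. -/
def sing : Set (Vec n) :=
  {x | ∃ α ∈ P.A, ∃ p q : ℤ, x ∈ hyperplane P.τ α p q}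

/-- `x` lies on the hyperplane `α(x) = p + q τ` and on no other singular hyperplane. -/
def IsGenericPoint (α : AffineFun n) (p q : ℤ) (x : Vec n) : Prop :=
  x ∈ hyperplane P.τ α p q ∧
    ∀ β ∈ P.A, ∀ p' q' : ℤ, x ∈ hyperplane P.τ β p' q' → β = α ∧ p' = p ∧ q' = q

/-- Quasi-invariance: for each singular hyperplane `π` the function `u(x) - u(s_π x)` is
divisible by `(α(x) - p - q τ)^(2 m_α + 1)` along `π`, that is, the quotient is holomorphic near
each generic point of `π`. -/
def QuasiInvariant : Prop :=
  ∀ α ∈ P.A, ∀ p q : ℤ, ∀ x₀ : Vec n, P.IsGenericPoint α p q x₀ →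
    ∃ g : Vec n → ℂ, AnalyticAt ℂ g x₀ ∧ ∀ᶠ x in 𝓝 x₀,
      P.u x - P.u (reflection P.τ α p q x) = shifted P.τ α p q x ^ (2 * P.m α + 1) * g x

/-- The lattice `ℒ ⊂ ℂⁿ` dual to the one generated by the gradients. -/
def dualLattice : AddSubgroup (Vec n) where
  carrier := {x | ∀ α ∈ P.A, ∃ k : ℤ, α.1 ⬝ᵥ x = k}
  zero_mem' := fun α _ => ⟨0, by simp⟩
  add_mem' := fun {x y} hx hy α hα => by
    obtain ⟨k, hk⟩ := hx α hα
    obtain ⟨l, hl⟩ := hy α hα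
    exact ⟨k + l, by simp [dotProduct_add, hk, hl]⟩
  neg_mem' := fun {x} hx α hα => by
    obtain ⟨k, hk⟩ := hx α hα
    exact ⟨-k, by simp [hk]⟩

/-- The period lattice `ℒ + τ ℒ`. -/
def periods : AddSubgroup (Vec n) :=
  P.dualLattice ⊔ P.dualLattice.map (DistribSMul.toAddMonoidHom (Vec n) P.τ)

/-- The torus `T = ℂⁿ / (ℒ + τ ℒ)`. -/
abbrev Torus : Type := Vec n ⧸ P.periods

/-- The projection `ℂⁿ → T`. -/
def proj (x : Vec n) : P.Torus := QuotientAddGroup.mk x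

/-- The complement `T ∖ Sing`. -/
abbrev RegTorus : Type := {t : P.Torus // t ∉ P.proj '' P.sing}

/-- The inclusion `T ∖ Sing → T`. -/
def incl : C(P.RegTorus, P.Torus) := ⟨Subtype.val, continuous_subtype_val⟩

/-- `L₁, …, Lₙ` are commuting operators with meromorphic coefficients on the torus which make
`L₁ = L = -Δ + u` strongly integrable: their highest symbols are constant, homogeneous and
algebraically independent, and the polynomial ring is a finite module over the algebra which
they generate. -/
structure StronglyIntegrable [NeZero n] (L : Fin n → DiffOp n) : Prop where
  first : L 0 = P.schrodinger
  meromorphic : ∀ i k, IsMeromorphic (L i k)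
  periodic : ∀ i k, ∀ l ∈ P.periods, ∀ x, L i k (x + l) = L i k x
  commutes : ∀ i j, (L i).Commutes (L j)
  symbols : ∃ (s : Fin n → MvPolynomial (Fin n) ℂ) (d : Fin n → ℕ),
    (∀ i, (L i).HasHighestSymbol (s i) (d i)) ∧ AlgebraicIndependent ℂ s ∧
      Module.Finite (Algebra.adjoin ℂ (Set.range s)) (MvPolynomial (Fin n) ℂ)

end EllipticPotential

/-! ### Solutions of the eigenvalue problem -/

/-- `ψ` is holomorphic near `x` and satisfies `Lᵢ ψ = λᵢ ψ` near `x` for all `i` (as an equality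
of meromorphic functions, that is, wherever the coefficients of `Lᵢ` are holomorphic). -/
def IsSol {n : ℕ} (L : Fin n → DiffOp n) (lam : Fin n → ℂ) (ψ : Vec n → ℂ) (x : Vec n) : Prop :=
  AnalyticAt ℂ ψ x ∧ ∀ᶠ y in 𝓝 x, ∀ i, (L i).RegularAt y → (L i).apply ψ y = lam i * ψ y

section Lemmas

variable {n : ℕ}

lemma analyticAt_pd {f : Vec n → ℂ} {x : Vec n} (i : Fin n) (hf : AnalyticAt ℂ f x) :
    AnalyticAt ℂ (pd i f) x :=
  ((ContinuousLinearMap.apply ℂ ℂ (Pi.single i 1 : Vec n)).analyticAt _).comp hf.fderiv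

lemma pd_congr {f g : Vec n → ℂ} {x : Vec n} (i : Fin n) (h : f =ᶠ[𝓝 x] g) :
    pd i f =ᶠ[𝓝 x] pd i g := by
  filter_upwards [h.fderiv (𝕜 := ℂ)] with y hy
  simp [pd, hy]

/-- An operation on germs which preserves analyticity and is linear on analytic germs. -/
structure GoodOp (x : Vec n) (T : (Vec n → ℂ) → Vec n → ℂ) : Prop where
  analytic : ∀ f, AnalyticAt ℂ f x → AnalyticAt ℂ (T f) x
  congr : ∀ f g, f =ᶠ[𝓝 x] g → T f =ᶠ[𝓝 x] T g
  add : ∀ f g, AnalyticAt ℂ f x → AnalyticAt ℂ g x → T (f + g) =ᶠ[𝓝 x] T f + T g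
  smul : ∀ (c : ℂ) f, AnalyticAt ℂ f x → T (c • f) =ᶠ[𝓝 x] c • T f

lemma goodOp_id (x : Vec n) : GoodOp x (fun f => f) :=
  ⟨fun _ h => h, fun _ _ h => h, fun _ _ _ _ => .rfl, fun _ _ _ => .rfl⟩

lemma goodOp_pd (i : Fin n) (x : Vec n) : GoodOp x (pd i) where
  analytic _ hf := analyticAt_pd i hf
  congr _ _ h := pd_congr i h
  add f g hf hg := by
    filter_upwards [hf.eventually_analyticAt, hg.eventually_analyticAt] with y h1 h2
    simp [pd, fderiv_add h1.differentiableAt h2.differentiableAt]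
  smul c f hf := by
    filter_upwards [hf.eventually_analyticAt] with y h1
    simp [pd, fderiv_const_smul h1.differentiableAt]

lemma GoodOp.comp {x : Vec n} {S T : (Vec n → ℂ) → Vec n → ℂ} (hS : GoodOp x S)
    (hT : GoodOp x T) : GoodOp x (fun f => S (T f)) where
  analytic _ hf := hS.analytic _ (hT.analytic _ hf)
  congr _ _ h := hS.congr _ _ (hT.congr _ _ h)
  add f g hf hg := (hS.congr _ _ (hT.add f g hf hg)).trans
    (hS.add _ _ (hT.analytic _ hf) (hT.analytic _ hg))
  smul c f hf := (hS.congr _ _ (hT.smul c f hf)).trans (hS.smul c _ (hT.analytic _ hf))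

lemma goodOp_mixedPd (k : Fin n →₀ ℕ) (x : Vec n) : GoodOp x (mixedPd k) := by
  unfold mixedPd
  generalize List.finRange n = l
  induction l with
  | nil => exact goodOp_id x
  | cons i l ih =>
    have hit : ∀ r : ℕ, GoodOp x (fun f => (pd i)^[r] f) := by
      intro r
      induction r with
      | zero => exact goodOp_id x
      | succ r ihr =>
        simp only [Function.iterate_succ']
        exact (goodOp_pd i x).comp ihr
    exact (hit (k i)).comp ih

lemma apply_add_eventually (D : DiffOp n) {f g : Vec n → ℂ} {x : Vec n} (hf : AnalyticAt ℂ f x)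
    (hg : AnalyticAt ℂ g x) :
    ∀ᶠ y in 𝓝 x, D.apply (f + g) y = D.apply f y + D.apply g y := by
  have h : ∀ᶠ y in 𝓝 x, ∀ k ∈ D.support,
      mixedPd k (f + g) y = mixedPd k f y + mixedPd k g y := by
    rw [Filter.eventually_all_finset]
    exact fun k _ => (goodOp_mixedPd k x).add f g hf hg
  filter_upwards [h] with y hy
  simp only [DiffOp.apply, Finsupp.sum]
  rw [← Finset.sum_add_distrib]
  exact Finset.sum_congr rfl fun k hk => by rw [hy k hk, mul_add]

lemma apply_smul_eventually (D : DiffOp n) (c : ℂ) {f : Vec n → ℂ} {x : Vec n}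
    (hf : AnalyticAt ℂ f x) :
    ∀ᶠ y in 𝓝 x, D.apply (c • f) y = c * D.apply f y := by
  have h : ∀ᶠ y in 𝓝 x, ∀ k ∈ D.support, mixedPd k (c • f) y = c * mixedPd k f y := by
    rw [Filter.eventually_all_finset]
    exact fun k _ => (goodOp_mixedPd k x).smul c f hf
  filter_upwards [h] with y hy
  simp only [DiffOp.apply, Finsupp.sum]
  rw [Finset.mul_sum]
  exact Finset.sum_congr rfl fun k hk => by rw [hy k hk]; ring

lemma IsSol.add {L : Fin n → DiffOp n} {lam : Fin n → ℂ} {f g : Vec n → ℂ} {x : Vec n}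
    (hf : IsSol L lam f x) (hg : IsSol L lam g x) : IsSol L lam (f + g) x := by
  refine ⟨hf.1.add hg.1, ?_⟩
  filter_upwards [hf.2, hg.2, Filter.eventually_all.2 fun i =>
    apply_add_eventually (L i) hf.1 hg.1] with y h1 h2 h3 i hi
  rw [h3 i, h1 i hi, h2 i hi, Pi.add_apply, mul_add]

lemma IsSol.smul {L : Fin n → DiffOp n} {lam : Fin n → ℂ} {f : Vec n → ℂ} {x : Vec n} (c : ℂ)
    (hf : IsSol L lam f x) : IsSol L lam (c • f) x := by
  refine ⟨analyticAt_const.smul hf.1, ?_⟩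
  filter_upwards [hf.2, Filter.eventually_all.2 fun i =>
    apply_smul_eventually (L i) c hf.1] with y h1 h3 i hi
  rw [h3 i, h1 i hi, Pi.smul_apply, smul_eq_mul]; ring

lemma IsSol.zero (L : Fin n → DiffOp n) (lam : Fin n → ℂ) (x : Vec n) :
    IsSol L lam 0 x := by
  refine ⟨analyticAt_const, ?_⟩
  filter_upwards [Filter.eventually_all.2 fun i => apply_smul_eventually (L i) 0
    (f := 0) (x := x) analyticAt_const] with y h3 i hi
  have := h3 i
  simp only [smul_zero, zero_mul] at this
  simp [this]

end Lemmas

/-! ### Monodromy -/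

namespace EllipticPotential

variable {n : ℕ} (P : EllipticPotential n) (L : Fin n → DiffOp n) (lam : Fin n → ℂ)

/-- The function `f` on the torus is a (holomorphic) solution of the system near `t`. -/
def IsSolAt (f : P.Torus → ℂ) (t : P.Torus) : Prop :=
  ∀ x : Vec n, P.proj x = t → IsSol L lam (fun y => f (P.proj y)) x

/-- The space of germs of solutions at a point of the torus. -/
def solutionSpace (t : P.Torus) : Submodule ℂ (Germ (𝓝 t) ℂ) where
  carrier := {φ | ∃ f : P.Torus → ℂ, P.IsSolAt L lam f t ∧ (f : Germ (𝓝 t) ℂ) = φ}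
  zero_mem' := ⟨0, fun x _ => IsSol.zero L lam x, rfl⟩
  add_mem' := by
    rintro _ _ ⟨f, hf, rfl⟩ ⟨g, hg, rfl⟩
    exact ⟨f + g, fun x hx => (hf x hx).add (hg x hx), rfl⟩
  smul_mem' := by
    rintro c _ ⟨f, hf, rfl⟩
    exact ⟨c • f, fun x hx => (hf x hx).smul c, rfl⟩

/-- The germ `χ` is obtained from the germ `φ` by analytic continuation, as a solution of the
system, along the path `γ` in `T ∖ Sing`. -/
def ContinuesAlong {a b : P.RegTorus} (γ : Path a b)
    (φ : Germ (𝓝 (a : P.Torus)) ℂ) (χ : Germ (𝓝 (b : P.Torus)) ℂ) : Prop :=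
  ∃ F : unitInterval → P.Torus → ℂ,
    (∀ r, P.IsSolAt L lam (F r) (γ r)) ∧
    (∀ r, ∀ᶠ s in 𝓝 r, F s =ᶠ[𝓝 (γ s : P.Torus)] F r) ∧
    (F 0 : Germ (𝓝 (a : P.Torus)) ℂ) = φ ∧ (F 1 : Germ (𝓝 (b : P.Torus)) ℂ) = χ

/-- `ρ` is the monodromy representation of the system at the base point `t₀`: it sends the class
of a loop to the analytic continuation along that loop. -/
def IsMonodromyRep (t₀ : P.RegTorus)
    (ρ : FundamentalGroup P.RegTorus t₀ →*
      (P.solutionSpace L lam t₀ ≃ₗ[ℂ] P.solutionSpace L lam t₀)) : Prop :=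
  ∀ (γ : Path t₀ t₀) (ψ : P.solutionSpace L lam t₀),
    P.ContinuesAlong L lam γ ψ.1
      (ρ (FundamentalGroup.fromPath (Path.Homotopic.Quotient.mk γ)) ψ).1

end EllipticPotential

/-! ### The differential field of meromorphic germs -/

section Germs

variable {n : ℕ}

/-- The ring of germs at `x` of holomorphic functions. -/
def AnGerm (x : Vec n) : Subring (Germ (𝓝 x) ℂ) where
  carrier := {φ | ∃ f : Vec n → ℂ, AnalyticAt ℂ f x ∧ (f : Germ (𝓝 x) ℂ) = φ}
  zero_mem' := ⟨0, analyticAt_const, rfl⟩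
  one_mem' := ⟨1, analyticAt_const, rfl⟩
  add_mem' := by
    rintro _ _ ⟨f, hf, rfl⟩ ⟨g, hg, rfl⟩
    exact ⟨f + g, hf.add hg, rfl⟩
  mul_mem' := by
    rintro _ _ ⟨f, hf, rfl⟩ ⟨g, hg, rfl⟩
    exact ⟨f * g, hf.mul hg, rfl⟩
  neg_mem' := by
    rintro _ ⟨f, hf, rfl⟩
    exact ⟨-f, hf.neg, rfl⟩

/-- The germ at `x` of a function which is holomorphic near `x`. -/
def AnGerm.of {x : Vec n} (f : Vec n → ℂ) (hf : AnalyticAt ℂ f x) : AnGerm x :=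
  ⟨(f : Germ (𝓝 x) ℂ), f, hf, rfl⟩

instance (x : Vec n) : Nontrivial (AnGerm x) := by
  refine ⟨0, 1, fun h => ?_⟩
  have h1 : ((0 : Vec n → ℂ) : Germ (𝓝 x) ℂ) = ((1 : Vec n → ℂ) : Germ (𝓝 x) ℂ) :=
    congrArg Subtype.val h
  have h2 := (Germ.coe_eq.1 h1).self_of_nhds
  simp at h2

instance (x : Vec n) : NoZeroDivisors (AnGerm x) where
  eq_zero_or_eq_zero_of_mul_eq_zero := by
    rintro ⟨_, f, hf, rfl⟩ ⟨_, g, hg, rfl⟩ h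
    have h1 : ((f * g : Vec n → ℂ) : Germ (𝓝 x) ℂ) = ((0 : Vec n → ℂ) : Germ (𝓝 x) ℂ) :=
      congrArg Subtype.val h
    have h2 := Germ.coe_eq.1 h1
    obtain ⟨ε, hε, hb⟩ := Metric.eventually_nhds_iff_ball.1
      (hf.eventually_analyticAt.and (hg.eventually_analyticAt.and h2))
    have hxb : x ∈ Metric.ball x ε := Metric.mem_ball_self hε
    by_cases hz : ∀ y ∈ Metric.ball x ε, f y = 0
    · left
      refine Subtype.ext (Germ.coe_eq.2 ?_)
      filter_upwards [Metric.ball_mem_nhds x hε] with y hy using hz y hy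
    · right
      push Not at hz
      obtain ⟨y, hy, hfy⟩ := hz
      have hgy : g =ᶠ[𝓝 y] 0 := by
        filter_upwards [(hb y hy).1.continuousAt.eventually_ne hfy,
          Metric.isOpen_ball.mem_nhds hy] with z hz hzb
        have h3 : f z * g z = 0 := (hb z hzb).2.2
        exact (mul_eq_zero.1 h3).resolve_left hz
      have hga : AnalyticOnNhd ℂ g (Metric.ball x ε) := fun z hz => (hb z hz).2.1
      have h4 := hga.eqOn_zero_of_preconnected_of_eventuallyEq_zero
        (convex_ball x ε).isPreconnected hy hgy
      refine Subtype.ext (Germ.coe_eq.2 ?_)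
      filter_upwards [Metric.ball_mem_nhds x hε] with z hz using h4 hz

instance (x : Vec n) : IsDomain (AnGerm x) := NoZeroDivisors.to_isDomain _

/-- The partial derivative of a holomorphic germ. -/
def AnGerm.pd {x : Vec n} (i : Fin n) (φ : AnGerm x) : AnGerm x :=
  ⟨Quotient.map' (GenLame.pd i) (fun _ _ h => pd_congr i h) φ.1, by
    obtain ⟨_, f, hf, rfl⟩ := φ
    exact ⟨GenLame.pd i f, analyticAt_pd i hf, rfl⟩⟩

lemma AnGerm.pd_add {x : Vec n} (i : Fin n) (φ χ : AnGerm x) :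
    AnGerm.pd i (φ + χ) = AnGerm.pd i φ + AnGerm.pd i χ := by
  obtain ⟨_, f, hf, rfl⟩ := φ
  obtain ⟨_, g, hg, rfl⟩ := χ
  exact Subtype.ext (Germ.coe_eq.2 ((goodOp_pd i x).add f g hf hg))

lemma AnGerm.pd_mul {x : Vec n} (i : Fin n) (φ χ : AnGerm x) :
    AnGerm.pd i (φ * χ) = φ * AnGerm.pd i χ + χ * AnGerm.pd i φ := by
  obtain ⟨_, f, hf, rfl⟩ := φ
  obtain ⟨_, g, hg, rfl⟩ := χ
  suffices key : GenLame.pd i (f * g) =ᶠ[𝓝 x] f * GenLame.pd i g + g * GenLame.pd i f from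
    Subtype.ext (Germ.coe_eq.2 key)
  filter_upwards [hf.eventually_analyticAt, hg.eventually_analyticAt] with y h1 h2
  simp [GenLame.pd, fderiv_mul h1.differentiableAt h2.differentiableAt]

lemma AnGerm.pd_one {x : Vec n} (i : Fin n) : AnGerm.pd i (1 : AnGerm x) = 0 := by
  have h := AnGerm.pd_mul i (1 : AnGerm x) 1
  simpa using h

lemma AnGerm.pd_zero {x : Vec n} (i : Fin n) : AnGerm.pd i (0 : AnGerm x) = 0 := by
  have h := AnGerm.pd_add i (0 : AnGerm x) 0
  simpa using h

/-- The field of germs at `x` of meromorphic functions. -/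
abbrev MerGerm (x : Vec n) : Type := FractionRing (AnGerm x)

/-- The ring homomorphism `φ ↦ φ + (∂ᵢ φ) ε` into the dual numbers over the field of meromorphic
germs, which encodes the derivation `∂ᵢ`. -/
def AnGerm.dual {x : Vec n} (i : Fin n) : AnGerm x →+* DualNumber (MerGerm x) where
  toFun φ := (algebraMap (AnGerm x) (MerGerm x) φ, algebraMap (AnGerm x) (MerGerm x) (AnGerm.pd i φ))
  map_one' := by rw [AnGerm.pd_one, map_one, map_zero]; rfl
  map_zero' := by rw [AnGerm.pd_zero, map_zero]; rfl
  map_add' φ χ := by rw [AnGerm.pd_add, map_add, map_add]; rfl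
  map_mul' φ χ := by
    refine TrivSqZeroExt.ext ?_ ?_
    · exact map_mul _ _ _
    · refine Eq.trans ?_ (DualNumber.snd_mul _ _).symm
      change algebraMap (AnGerm x) (MerGerm x) (AnGerm.pd i (φ * χ)) =
        algebraMap (AnGerm x) (MerGerm x) φ * algebraMap (AnGerm x) (MerGerm x) (AnGerm.pd i χ) +
        algebraMap (AnGerm x) (MerGerm x) (AnGerm.pd i φ) * algebraMap (AnGerm x) (MerGerm x) χ
      rw [AnGerm.pd_mul, map_add, map_mul, map_mul]
      ring

lemma AnGerm.isUnit_dual {x : Vec n} (i : Fin n) (y : nonZeroDivisors (AnGerm x)) :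
    IsUnit (AnGerm.dual i (y : AnGerm x)) := by
  rw [TrivSqZeroExt.isUnit_iff_isUnit_fst]
  exact IsLocalization.map_units (MerGerm x) y

/-- The extension of `AnGerm.dual` to meromorphic germs. -/
def MerGerm.dual {x : Vec n} (i : Fin n) : MerGerm x →+* DualNumber (MerGerm x) :=
  IsLocalization.lift (M := nonZeroDivisors (AnGerm x)) (AnGerm.isUnit_dual i)

lemma MerGerm.dual_algebraMap {x : Vec n} (i : Fin n) (φ : AnGerm x) :
    MerGerm.dual i (algebraMap (AnGerm x) (MerGerm x) φ) = AnGerm.dual i φ :=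
  IsLocalization.lift_eq _ φ

lemma MerGerm.fst_dual {x : Vec n} (i : Fin n) (k : MerGerm x) :
    (MerGerm.dual i k).fst = k := by
  have h : ((TrivSqZeroExt.fstHom (MerGerm x) (MerGerm x) (MerGerm x)).toRingHom.comp
      (MerGerm.dual i)) = RingHom.id (MerGerm x) := by
    refine IsLocalization.ringHom_ext (nonZeroDivisors (AnGerm x)) (RingHom.ext fun φ => ?_)
    change (MerGerm.dual i (algebraMap (AnGerm x) (MerGerm x) φ)).fst = _
    rw [MerGerm.dual_algebraMap]
    rfl
  exact congrArg (fun r : MerGerm x →+* MerGerm x => r k) h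

/-- The partial derivative `∂ᵢ` on the field of meromorphic germs: the unique extension of `∂ᵢ`
from holomorphic germs to a derivation. -/
def MerGerm.pd {x : Vec n} (i : Fin n) (k : MerGerm x) : MerGerm x := (MerGerm.dual i k).snd

lemma MerGerm.pd_add {x : Vec n} (i : Fin n) (a b : MerGerm x) :
    MerGerm.pd i (a + b) = MerGerm.pd i a + MerGerm.pd i b :=
  congrArg TrivSqZeroExt.snd (RingHom.map_add (MerGerm.dual i) a b)

lemma MerGerm.pd_mul {x : Vec n} (i : Fin n) (a b : MerGerm x) :
    MerGerm.pd i (a * b) = a * MerGerm.pd i b + b * MerGerm.pd i a := by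
  unfold MerGerm.pd
  rw [RingHom.map_mul, DualNumber.snd_mul, MerGerm.fst_dual, MerGerm.fst_dual]
  ring

/-- On holomorphic germs `MerGerm.pd` is the usual partial derivative. -/
lemma MerGerm.pd_algebraMap {x : Vec n} (i : Fin n) (φ : AnGerm x) :
    MerGerm.pd i (algebraMap (AnGerm x) (MerGerm x) φ) =
      algebraMap (AnGerm x) (MerGerm x) (AnGerm.pd i φ) := by
  change (MerGerm.dual i (algebraMap (AnGerm x) (MerGerm x) φ)).snd = _
  rw [MerGerm.dual_algebraMap]
  rfl

/-- The meromorphic germ `k` at `x` is the germ of the function `f`: `k = g / h` with `g`, `h`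
holomorphic near `x`, `h` not identically zero, and `f = g / h` near `x` where `h ≠ 0`. -/
def MerGerm.Represents {x : Vec n} (k : MerGerm x) (f : Vec n → ℂ) : Prop :=
  ∃ (g h : Vec n → ℂ) (hg : AnalyticAt ℂ g x) (hh : AnalyticAt ℂ h x),
    AnGerm.of h hh ≠ 0 ∧
    k = algebraMap (AnGerm x) (MerGerm x) (AnGerm.of g hg) /
      algebraMap (AnGerm x) (MerGerm x) (AnGerm.of h hh) ∧
    ∀ᶠ y in 𝓝 x, h y ≠ 0 → f y = g y / h y

end Germs

/-! ### The differential Galois group -/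

namespace EllipticPotential

variable {n : ℕ} (P : EllipticPotential n) (L : Fin n → DiffOp n) (lam : Fin n → ℂ)

/-- The elliptic functions, that is, the meromorphic functions on the torus `T`, as germs at
`x`. -/
def ellipticGerms (x : Vec n) : Set (MerGerm x) :=
  {k | ∃ f : Vec n → ℂ, IsMeromorphic f ∧ (∀ l ∈ P.periods, ∀ y, f (y + l) = f y) ∧
    k.Represents f}

/-- The germs at `x` of solutions of the system. -/
def solutionGerms (x : Vec n) : Set (MerGerm x) :=
  {k | ∃ (ψ : Vec n → ℂ) (h : IsSol L lam ψ x),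
    k = algebraMap (AnGerm x) (MerGerm x) (AnGerm.of ψ h.1)}

/-- The solution field: the smallest differential field which contains the elliptic functions
and all solutions of the system. -/
def solutionField (x : Vec n) : Subfield (MerGerm x) :=
  sInf {S | P.ellipticGerms x ⊆ S ∧ solutionGerms L lam x ⊆ S ∧
    ∀ i, ∀ k ∈ S, MerGerm.pd i k ∈ S}

lemma pd_mem_solutionField {x : Vec n} (i : Fin n) {k : MerGerm x}
    (hk : k ∈ P.solutionField L lam x) : MerGerm.pd i k ∈ P.solutionField L lam x := by
  simp only [solutionField, Subfield.mem_sInf] at hk ⊢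
  exact fun S hS => hS.2.2 i k (hk S hS)

/-- The derivation `∂ᵢ` on the solution field. -/
def solutionField.pd {x : Vec n} (i : Fin n) (k : P.solutionField L lam x) :
    P.solutionField L lam x :=
  ⟨MerGerm.pd i k.1, P.pd_mem_solutionField L lam i k.2⟩

/-- The differential Galois group of the system: the field automorphisms of the solution field
which commute with all `∂ᵢ` and fix all elliptic functions. -/
def Dgal (x : Vec n) : Subgroup (RingAut (P.solutionField L lam x)) where
  carrier := {σ | (∀ i k, σ (solutionField.pd P L lam i k) = solutionField.pd P L lam i (σ k)) ∧
    ∀ k : P.solutionField L lam x, (k : MerGerm x) ∈ P.ellipticGerms x → σ k = k}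
  one_mem' := ⟨fun _ _ => rfl, fun _ _ => rfl⟩
  mul_mem' := by
    rintro σ τ ⟨h1, h2⟩ ⟨h3, h4⟩
    refine ⟨fun i k => ?_, fun k hk => ?_⟩
    · change σ (τ _) = solutionField.pd P L lam i (σ (τ k))
      rw [h3, h1]
    · change σ (τ k) = k
      rw [h4 k hk, h2 k hk]
  inv_mem' := by
    rintro σ ⟨h1, h2⟩
    refine ⟨fun i k => ?_, fun k hk => ?_⟩
    · change σ.symm _ = solutionField.pd P L lam i (σ.symm k)
      rw [RingEquiv.symm_apply_eq, h1, RingEquiv.apply_symm_apply]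
    · change σ.symm k = k
      rw [RingEquiv.symm_apply_eq, h2 k hk]

end EllipticPotential

end

end GenLame

namespace GenLame

noncomputable section

/-! ### Holomorphic functions of several variables -/

section SeveralVariables

variable {n : ℕ}

/-! Off the singular locus the system is holonomic. Commutation with `L = -Δ + u` forces the
coefficients of every `Lᵢ` to be holomorphic wherever `u` is (`extendsAt_coeff`), and finiteness of
the polynomial ring over the symbols expresses all derivatives of some order `N` of a solution by
lower ones (`exists_monomial_eq_sum`, `reduces_mixedPd_of_eq_sum`). Hence all solution germs near a
regular point extend to one common ball and are determined by finitely many derivatives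
(`exists_extendsOn`).

Near a generic point of a singular hyperplane put `α(x) - p - qτ = exp w`. Solutions become
functions of `w` on a half plane, depending on parameters, and the monodromy is the translation `w ↦
w + 2πi` acting on a finite-dimensional space. The Fourier coefficients of an eigenfunction satisfy
a recursion with indicial polynomial `(s + m)(s - m - 1)`. Cauchy estimates show that there are no
modes below `-m` (`eq_zero_of_recursion`), so the singularity is regular with integer exponents and
`1` is the only eigenvalue. A Jordan block would produce a logarithm. It is excluded since
quasi-invariance removes the odd Taylor coefficients of the regular part of `u` below order `2m +
1`: the exponents `-m` and `m + 1` have an odd difference and so do not interact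
(`Chart.Wave.eq_zero_of_log`). Thus the local monodromy is trivial (`Chart.monodromy_eq_one`), and
the lowest mode gives the local form (`Chart.exists_local_form`).

Multiplied by suitable powers of the equations of the hyperplanes, a solution becomes holomorphic at
generic points of `Sing`. The remaining set, where hyperplanes intersect, has codimension two and is
crossed by a Hartogs argument (`exists_extendsOn_isRegularized`). Continuation in convex balls then
makes every solution single-valued on `V ∖ Sing` and meromorphic on `V` (`exists_global`). Therefore
continuation along a loop in `T ∖ Sing` is translation by the period that joins the ends of its
lift, and the monodromy group is a homomorphic image of the abelian group of periods
(`exists_monodromyRep`).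

An element of the differential Galois group acts linearly on the global solutions
(`exists_galoisMap`). By Cramer's rule every endomorphism of the solution space which commutes with
all translations is a differential operator with elliptic coefficients (`exists_elliptic_operator`),
so it commutes with the Galois group. Translations are such endomorphisms because periods commute.
Consequently Galois maps commute with translations, are themselves such endomorphisms, and commute
with each other (`Dgal_comm`). -/

lemma norm_single_le (i : Fin n) (t : ℂ) : ‖(Pi.single i t : Vec n)‖ = ‖t‖ :=
  Pi.norm_single (G := fun _ : Fin n => ℂ) t

lemma hasDerivAt_line {f : Vec n → ℂ} {x v : Vec n} {t : ℂ}
    (hf : DifferentiableAt ℂ f (x + t • v)) :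
    HasDerivAt (fun s : ℂ => f (x + s • v)) (fderiv ℂ f (x + t • v) v) t := by
  have h1 : HasDerivAt (fun s : ℂ => x + s • v) v t := by
    simpa using ((hasDerivAt_id t).smul_const v).const_add x
  exact hf.hasFDerivAt.comp_hasDerivAt t h1

lemma pd_eq_deriv {f : Vec n → ℂ} {x : Vec n} (i : Fin n) (hf : DifferentiableAt ℂ f x) :
    pd i f x = deriv (fun s : ℂ => f (x + s • Pi.single i 1)) 0 := by
  have := hasDerivAt_line (f := f) (x := x) (v := Pi.single i 1) (t := 0) (by simpa using hf)
  simpa [pd] using this.deriv.symm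

lemma fderiv_apply_eq_sum (f : Vec n → ℂ) (x v : Vec n) :
    fderiv ℂ f x v = ∑ i, v i * pd i f x := by
  conv_lhs => rw [pi_eq_sum_univ' v]
  simp [pd, map_sum]

lemma fderiv_eq_sum_proj (f : Vec n → ℂ) (x : Vec n) :
    fderiv ℂ f x = ∑ i, pd i f x • (ContinuousLinearMap.proj i : Vec n →L[ℂ] ℂ) := by
  ext1 v
  rw [fderiv_apply_eq_sum]
  simp [mul_comm]

lemma add_smul_single_mem_ball {x y : Vec n} {r δ : ℝ} (hy : y ∈ Metric.ball x (r - δ))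
    (i : Fin n) {t : ℂ} (ht : ‖t‖ ≤ δ) : y + t • Pi.single i 1 ∈ Metric.ball x r := by
  rw [Metric.mem_ball, dist_eq_norm] at *
  have h1 : ‖t • (Pi.single i 1 : Vec n)‖ ≤ δ := by rw [norm_smul, norm_single_le]; simpa using ht
  calc ‖y + t • Pi.single i 1 - x‖ = ‖(y - x) + t • Pi.single i 1‖ := by congr 1; abel
    _ ≤ _ := norm_add_le _ _
    _ < r := by linarith

lemma norm_pd_le {f : Vec n → ℂ} {x y : Vec n} {r δ M : ℝ} (hδ : 0 < δ)
    (hf : DifferentiableOn ℂ f (Metric.ball x r)) (hM : ∀ z ∈ Metric.ball x r, ‖f z‖ ≤ M)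
    (hy : y ∈ Metric.ball x (r - δ)) (i : Fin n) : ‖pd i f y‖ ≤ M / δ := by
  have hmem : ∀ t : ℂ, ‖t‖ ≤ δ → y + t • Pi.single i 1 ∈ Metric.ball x r :=
    fun t ht => add_smul_single_mem_ball hy i ht
  have hd : ∀ t : ℂ, ‖t‖ ≤ δ → DifferentiableAt ℂ f (y + t • Pi.single i 1) :=
    fun t ht => hf.differentiableAt (Metric.isOpen_ball.mem_nhds (hmem t ht))
  rw [pd_eq_deriv i (by simpa using hd 0 (by simpa using hδ.le))]
  refine Complex.norm_deriv_le_of_forall_mem_sphere_norm_le hδ ?_ ?_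
  · refine DifferentiableOn.diffContOnCl fun t ht => ?_
    rw [closure_ball _ hδ.ne', mem_closedBall_zero_iff] at ht
    exact (hasDerivAt_line (hd t ht)).differentiableAt.differentiableWithinAt
  · intro t ht
    rw [mem_sphere_zero_iff_norm] at ht
    exact hM _ (hmem t ht.le)

lemma norm_fderiv_le_of_bound {f : Vec n → ℂ} {x y : Vec n} {r δ M : ℝ} (hδ : 0 < δ)
    (hf : DifferentiableOn ℂ f (Metric.ball x r)) (hM : ∀ z ∈ Metric.ball x r, ‖f z‖ ≤ M)
    (hy : y ∈ Metric.ball x (r - δ)) : ‖fderiv ℂ f y‖ ≤ n * (M / δ) := by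
  rw [fderiv_eq_sum_proj]
  refine (norm_sum_le _ _).trans ?_
  have : ∀ i : Fin n, ‖pd i f y • (ContinuousLinearMap.proj i : Vec n →L[ℂ] ℂ)‖ ≤ M / δ := by
    intro i
    have h1 : ‖(ContinuousLinearMap.proj i : Vec n →L[ℂ] ℂ)‖ ≤ 1 :=
      ContinuousLinearMap.opNorm_le_bound _ zero_le_one fun v => by
        simpa using norm_le_pi_norm v i
    rw [norm_smul]
    have h2 := norm_pd_le hδ hf hM hy i
    calc _ ≤ ‖pd i f y‖ * 1 := by gcongr
      _ ≤ _ := by simpa using h2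
  calc _ ≤ ∑ _i : Fin n, M / δ := Finset.sum_le_sum fun i _ => this i
    _ = _ := by simp

lemma exists_bound_of_continuousOn {a b : ℝ} {U : Set (Vec n)} (hU : IsOpen U)
    {g : ℝ → Vec n → ℂ}
    (hc : ContinuousOn (Function.uncurry g) (Set.Icc a b ×ˢ U)) {x : Vec n} (hx : x ∈ U) :
    ∃ r > 0, ∃ M, Metric.ball x r ⊆ U ∧ ∀ θ ∈ Set.Icc a b, ∀ y ∈ Metric.ball x r, ‖g θ y‖ ≤ M := by
  obtain ⟨r, hr, hb⟩ := Metric.nhds_basis_closedBall.mem_iff.1 (hU.mem_nhds hx)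
  have hK : IsCompact (Set.Icc a b ×ˢ Metric.closedBall x r) :=
    isCompact_Icc.prod (isCompact_closedBall x r)
  obtain ⟨M, hM⟩ := hK.exists_bound_of_continuousOn (hc.mono (Set.prod_mono le_rfl hb))
  exact ⟨r, hr, M, Metric.ball_subset_closedBall.trans hb, fun θ hθ y hy =>
    hM (θ, y) ⟨hθ, Metric.ball_subset_closedBall hy⟩⟩

/-- Differentiation under the integral sign for functions which are holomorphic in a parameter. -/
lemma hasFDerivAt_intervalIntegral {a b : ℝ} (hab : a ≤ b) {U : Set (Vec n)} (hU : IsOpen U)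
    {g : ℝ → Vec n → ℂ}
    (hc : ContinuousOn (Function.uncurry g) (Set.Icc a b ×ˢ U))
    (hd : ∀ θ ∈ Set.Icc a b, DifferentiableOn ℂ (g θ) U) {x : Vec n} (hx : x ∈ U) :
    IntervalIntegrable (fun θ => fderiv ℂ (g θ) x) MeasureTheory.volume a b ∧
    HasFDerivAt (fun y => ∫ θ in a..b, g θ y) (∫ θ in a..b, fderiv ℂ (g θ) x) x := by
  obtain ⟨r, hr, M, hrU, hM⟩ := exists_bound_of_continuousOn hU hc hx
  have hI : Set.uIoc a b ⊆ Set.Icc a b := by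
    rw [Set.uIoc_of_le hab]; exact Set.Ioc_subset_Icc_self
  have hcont : ∀ y ∈ U, ContinuousOn (fun θ => g θ y) (Set.Icc a b) := fun y hy =>
    hc.comp (f := fun θ : ℝ => (θ, y)) (by fun_prop) fun θ hθ => ⟨hθ, hy⟩
  have hmeas : ∀ y ∈ U, MeasureTheory.AEStronglyMeasurable (fun θ => g θ y)
      (MeasureTheory.volume.restrict (Set.uIoc a b)) := fun y hy =>
    ((hcont y hy).mono hI).aestronglyMeasurable measurableSet_uIoc
  have hx0 : Metric.ball x (r - r / 2) ∈ 𝓝 x := Metric.ball_mem_nhds _ (by linarith)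
  -- Continuity in `θ` is assumed for `g` only. The derivative is measurable in `θ` as a pointwise
  -- limit of difference quotients with steps `r / 2 / (k + 1)`, which keep the points inside the
  -- ball.
  have hpdm : ∀ i : Fin n, MeasureTheory.AEStronglyMeasurable (fun θ => pd i (g θ) x)
      (MeasureTheory.volume.restrict (Set.uIoc a b)) := by
    intro i
    refine aestronglyMeasurable_of_tendsto_ae atTop
      (f := fun (k : ℕ) θ => ((((r / 2 / ((k : ℝ) + 1) : ℝ) : ℂ))⁻¹ •
        (g θ (x + ((r / 2 / ((k : ℝ) + 1) : ℝ) : ℂ) • Pi.single i 1) - g θ x))) (fun k => ?_) ?_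
    · refine ((hmeas _ (hrU ?_)).sub (hmeas _ hx)).const_smul
        (((r / 2 / ((k : ℝ) + 1) : ℝ) : ℂ))⁻¹
      refine add_smul_single_mem_ball (δ := r / 2) (Metric.mem_ball_self (by linarith)) i ?_
      rw [Complex.norm_real, Real.norm_of_nonneg (by positivity)]
      refine div_le_self (by linarith) ?_
      have : (0 : ℝ) ≤ k := k.cast_nonneg
      linarith
    · refine (MeasureTheory.ae_restrict_iff' measurableSet_uIoc).2 (MeasureTheory.ae_of_all _ fun θ hθ => ?_)
      have h1 := hasDerivAt_line (f := g θ) (x := x) (v := Pi.single i 1) (t := 0)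
        (by simpa using (hd θ (hI hθ)).differentiableAt (hU.mem_nhds hx))
      have h2 := h1.tendsto_slope_zero
      have h3 : Tendsto (fun k : ℕ => ((r / 2 / ((k : ℝ) + 1) : ℝ) : ℂ)) atTop (𝓝[≠] 0) := by
        rw [tendsto_nhdsWithin_iff]
        constructor
        · have h4 : Tendsto (fun k : ℕ => (r / 2 / ((k : ℝ) + 1) : ℝ)) atTop (𝓝 0) := by
            have := (tendsto_one_div_add_atTop_nhds_zero_nat (𝕜 := ℝ)).const_mul (r / 2)
            simpa [div_eq_mul_inv] using this
          have := (Complex.continuous_ofReal.tendsto 0).comp h4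
          rwa [Complex.ofReal_zero] at this
        · refine Eventually.of_forall fun k => ?_
          simp only [Set.mem_compl_iff, Set.mem_singleton_iff, Complex.ofReal_eq_zero]
          positivity
      have h5 := h2.comp h3
      simpa [pd, Function.comp_def] using h5
  have hfm : MeasureTheory.AEStronglyMeasurable (fun θ => fderiv ℂ (g θ) x)
      (MeasureTheory.volume.restrict (Set.uIoc a b)) := by
    simp_rw [fderiv_eq_sum_proj]
    exact Finset.aestronglyMeasurable_fun_sum _ fun i _ => (hpdm i).smul_const _
  have hbd : ∀ θ ∈ Set.uIoc a b, ∀ y ∈ Metric.ball x (r - r / 2),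
      ‖fderiv ℂ (g θ) y‖ ≤ n * (M / (r / 2)) := fun θ hθ y hy =>
    norm_fderiv_le_of_bound (by linarith) ((hd θ (hI hθ)).mono hrU) (hM θ (hI hθ)) hy
  constructor
  · refine (intervalIntegrable_const (c := (n * (M / (r / 2)) : ℝ))).mono_fun hfm ?_
    refine (MeasureTheory.ae_restrict_iff' measurableSet_uIoc).2 (MeasureTheory.ae_of_all _ fun θ hθ => ?_)
    exact (hbd θ hθ x (Metric.mem_ball_self (by linarith))).trans (le_abs_self _)
  · refine intervalIntegral.hasFDerivAt_integral_of_dominated_of_fderiv_le (𝕜 := ℂ)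
      (F := fun y θ => g θ y) (F' := fun y θ => fderiv ℂ (g θ) y)
      (bound := fun _ => n * (M / (r / 2))) hx0 ?_ ?_ hfm ?_ ?_ ?_
    · filter_upwards [hU.mem_nhds hx] with y hy using hmeas y hy
    · exact (hcont x hx).intervalIntegrable_of_Icc hab
    · exact MeasureTheory.ae_of_all _ fun θ hθ y hy => hbd θ hθ y hy
    · exact intervalIntegrable_const
    · refine MeasureTheory.ae_of_all _ fun θ hθ y hy => ?_
      refine ((hd θ (hI hθ)).differentiableAt (hU.mem_nhds (hrU ?_))).hasFDerivAt
      exact Metric.ball_subset_ball (by linarith) hy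

lemma differentiableOn_intervalIntegral {a b : ℝ} (hab : a ≤ b) {U : Set (Vec n)} (hU : IsOpen U)
    {g : ℝ → Vec n → ℂ}
    (hc : ContinuousOn (Function.uncurry g) (Set.Icc a b ×ˢ U))
    (hd : ∀ θ ∈ Set.Icc a b, DifferentiableOn ℂ (g θ) U) :
    DifferentiableOn ℂ (fun y => ∫ θ in a..b, g θ y) U := fun _ hx =>
  (hasFDerivAt_intervalIntegral hab hU hc hd hx).2.differentiableAt.differentiableWithinAt

lemma pd_intervalIntegral {a b : ℝ} (hab : a ≤ b) {U : Set (Vec n)} (hU : IsOpen U)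
    {g : ℝ → Vec n → ℂ}
    (hc : ContinuousOn (Function.uncurry g) (Set.Icc a b ×ˢ U))
    (hd : ∀ θ ∈ Set.Icc a b, DifferentiableOn ℂ (g θ) U) {x : Vec n} (hx : x ∈ U) (i : Fin n) :
    pd i (fun y => ∫ θ in a..b, g θ y) x = ∫ θ in a..b, pd i (g θ) x := by
  obtain ⟨h1, h2⟩ := hasFDerivAt_intervalIntegral hab hU hc hd hx
  rw [pd, h2.fderiv]
  exact ContinuousLinearMap.intervalIntegral_apply h1 _

/-- Cauchy's formula on a circle of radius `r / 2` in the `i`-th direction writes the derivative as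
an integral of values of `f`, and this integral may be differentiated with respect to the centre. -/
lemma differentiableOn_pd {f : Vec n → ℂ} {U : Set (Vec n)} (hU : IsOpen U)
    (hf : DifferentiableOn ℂ f U) (i : Fin n) : DifferentiableOn ℂ (pd i f) U := by
  intro x hx
  obtain ⟨r, hr, hrU⟩ := Metric.isOpen_iff.1 hU x hx
  have hr2 : 0 < r / 2 := by linarith
  set B := Metric.ball x (r - r / 2) with hB
  have hmem : ∀ y ∈ B, ∀ t : ℂ, ‖t‖ ≤ r / 2 → y + t • Pi.single i 1 ∈ U :=
    fun y hy t ht => hrU (add_smul_single_mem_ball hy i ht)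
  have hcirc : ∀ θ : ℝ, ‖circleMap 0 (r / 2) θ‖ ≤ r / 2 := fun θ => by
    simp [abs_of_pos hr2]
  let g : ℝ → Vec n → ℂ := fun θ y => deriv (circleMap 0 (r / 2)) θ *
    ((1 / (circleMap 0 (r / 2) θ) ^ 2) * f (y + circleMap 0 (r / 2) θ • Pi.single i 1))
  have hne : ∀ θ : ℝ, circleMap 0 (r / 2) θ ≠ 0 := fun θ => circleMap_ne_center hr2.ne'
  have key : ∀ y ∈ B, pd i f y = (2 * Real.pi * Complex.I)⁻¹ * ∫ θ in (0 : ℝ)..2 * Real.pi, g θ y := by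
    intro y hy
    have hd : ∀ t : ℂ, ‖t‖ ≤ r / 2 → DifferentiableAt ℂ f (y + t • Pi.single i 1) :=
      fun t ht => hf.differentiableAt (hU.mem_nhds (hmem y hy t ht))
    rw [pd_eq_deriv i (by simpa using hd 0 (by simpa using hr2.le))]
    have hdc : DiffContOnCl ℂ (fun s : ℂ => f (y + s • Pi.single i 1)) (Metric.ball 0 (r / 2)) := by
      refine DifferentiableOn.diffContOnCl fun t ht => ?_
      rw [closure_ball _ hr2.ne', mem_closedBall_zero_iff] at ht
      exact (hasDerivAt_line (hd t ht)).differentiableAt.differentiableWithinAt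
    have := hdc.deriv_eq_smul_circleIntegral hr2
    rw [eq_inv_mul_iff_mul_eq₀ (by simp [Real.pi_ne_zero]), ← smul_eq_mul, ← this, circleIntegral]
    simp [g, smul_eq_mul]
  have hcont : ContinuousOn (Function.uncurry g) (Set.Icc 0 (2 * Real.pi) ×ˢ B) := by
    have h1 : ContinuousOn (fun p : ℝ × Vec n => f (p.2 + circleMap 0 (r / 2) p.1 • Pi.single i 1))
        (Set.Icc 0 (2 * Real.pi) ×ˢ B) := by
      refine hf.continuousOn.comp (Continuous.continuousOn ?_) fun p hp =>
        hmem p.2 hp.2 _ (hcirc p.1)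
      have := continuous_circleMap (0 : ℂ) (r / 2)
      fun_prop
    have h2 : Continuous (fun p : ℝ × Vec n => deriv (circleMap 0 (r / 2)) p.1 *
        (1 / (circleMap 0 (r / 2) p.1) ^ 2)) := by
      simp only [deriv_circleMap]
      have := continuous_circleMap (0 : ℂ) (r / 2)
      refine Continuous.mul (by fun_prop) (Continuous.div continuous_const (by fun_prop)
        fun p => pow_ne_zero _ (hne _))
    refine (h2.continuousOn.mul h1).congr fun p _ => ?_
    simp [g, Function.uncurry, mul_assoc]
  have hdiff : ∀ θ ∈ Set.Icc 0 (2 * Real.pi), DifferentiableOn ℂ (g θ) B := by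
    intro θ _
    have h1 : DifferentiableOn ℂ (fun y => f (y + circleMap 0 (r / 2) θ • Pi.single i 1)) B :=
      hf.comp (by fun_prop) fun y hy => hmem y hy _ (hcirc θ)
    exact (h1.const_mul _).const_mul _
  have hxB : x ∈ B := Metric.mem_ball_self (by linarith)
  have := (differentiableOn_intervalIntegral Real.two_pi_pos.le Metric.isOpen_ball hcont
    hdiff).const_mul ((2 * Real.pi * Complex.I)⁻¹)
  have h4 := (this.congr key).differentiableAt (Metric.isOpen_ball.mem_nhds hxB)
  exact h4.differentiableWithinAt

/-- Iterated partial derivatives along a list of directions. -/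
def pdList (l : List (Fin n)) (f : Vec n → ℂ) : Vec n → ℂ := l.foldr pd f

@[simp] lemma pdList_nil (f : Vec n → ℂ) : pdList [] f = f := rfl

@[simp] lemma pdList_cons (i : Fin n) (l : List (Fin n)) (f : Vec n → ℂ) :
    pdList (i :: l) f = pd i (pdList l f) := rfl

lemma differentiableOn_pdList {f : Vec n → ℂ} {U : Set (Vec n)} (hU : IsOpen U)
    (hf : DifferentiableOn ℂ f U) (l : List (Fin n)) : DifferentiableOn ℂ (pdList l f) U := by
  induction l with
  | nil => exact hf
  | cons i l ih => exact differentiableOn_pd hU ih i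

/-- Each differentiation costs a collar of width `δ` and a factor `1 / δ`, by the one-variable
Cauchy estimate. -/
lemma norm_pdList_le {f : Vec n → ℂ} {x : Vec n} {r δ M : ℝ} (hδ : 0 < δ)
    (hf : DifferentiableOn ℂ f (Metric.ball x r)) (hM : ∀ z ∈ Metric.ball x r, ‖f z‖ ≤ M)
    (l : List (Fin n)) : ∀ y ∈ Metric.ball x (r - l.length * δ), ‖pdList l f y‖ ≤ M / δ ^ l.length := by
  induction l with
  | nil => intro y hy; simpa using hM y (by simpa using hy)
  | cons i l ih =>
    intro y hy
    have hsub : Metric.ball x (r - l.length * δ) ⊆ Metric.ball x r :=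
      Metric.ball_subset_ball (by nlinarith [(Nat.cast_nonneg l.length : (0 : ℝ) ≤ _)])
    have := norm_pd_le hδ ((differentiableOn_pdList Metric.isOpen_ball hf l).mono hsub) ih
      (y := y) (by convert hy using 2; push_cast [List.length_cons]; ring) i
    rw [pdList_cons, List.length_cons, pow_succ, ← div_div]
    exact this

/-- The formal Taylor series of `f` at `x`. -/
def taylorFMS (f : Vec n → ℂ) (x : Vec n) : FormalMultilinearSeries ℂ (Vec n) ℂ := fun k =>
  ∑ i : Fin k → Fin n, ((k.factorial : ℂ)⁻¹ * pdList (List.ofFn i) f x) •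
    (ContinuousMultilinearMap.mkPiAlgebra ℂ (Fin k) ℂ).compContinuousLinearMap
      fun j => (ContinuousLinearMap.proj (i j) : Vec n →L[ℂ] ℂ)

lemma taylorFMS_apply (f : Vec n → ℂ) (x : Vec n) (k : ℕ) (v : Vec n) :
    taylorFMS f x k (fun _ => v) = (k.factorial : ℂ)⁻¹ *
      ∑ i : Fin k → Fin n, (∏ j, v (i j)) * pdList (List.ofFn i) f x := by
  simp only [taylorFMS, sum_apply, smul_apply,
    ContinuousMultilinearMap.compContinuousLinearMap_apply, ContinuousMultilinearMap.mkPiAlgebra_apply,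
    ContinuousLinearMap.proj_apply, smul_eq_mul, Finset.mul_sum]
  exact Finset.sum_congr rfl fun i _ => by ring

/-- There are `n ^ k` tuples of directions, and the factorial admitted in the hypothesis is
cancelled by the `1 / k!` of the Taylor series. -/
lemma norm_taylorFMS_le {f : Vec n → ℂ} {x : Vec n} {M K : ℝ}
    (h : ∀ l : List (Fin n), ‖pdList l f x‖ ≤ M * K ^ l.length * l.length.factorial) (k : ℕ) :
    ‖taylorFMS f x k‖ ≤ M * (n * K) ^ k := by
  have hproj : ∀ i : Fin n, ‖(ContinuousLinearMap.proj i : Vec n →L[ℂ] ℂ)‖ ≤ 1 := fun i =>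
    ContinuousLinearMap.opNorm_le_bound _ zero_le_one fun v => by simpa using norm_le_pi_norm v i
  have hterm : ∀ i : Fin k → Fin n, ‖((k.factorial : ℂ)⁻¹ * pdList (List.ofFn i) f x) •
      (ContinuousMultilinearMap.mkPiAlgebra ℂ (Fin k) ℂ).compContinuousLinearMap
      fun j => (ContinuousLinearMap.proj (i j) : Vec n →L[ℂ] ℂ)‖ ≤ M * K ^ k := by
    intro i
    have h1 := h (List.ofFn i)
    rw [List.length_ofFn] at h1
    have h2 : ‖(ContinuousMultilinearMap.mkPiAlgebra ℂ (Fin k) ℂ).compContinuousLinearMap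
      fun j => (ContinuousLinearMap.proj (i j) : Vec n →L[ℂ] ℂ)‖ ≤ 1 := by
      refine (ContinuousMultilinearMap.norm_compContinuousLinearMap_le _ _).trans ?_
      have h4 : ∏ j, ‖(ContinuousLinearMap.proj (i j) : Vec n →L[ℂ] ℂ)‖ ≤ 1 :=
        Finset.prod_le_one (fun _ _ => norm_nonneg _) fun j _ => hproj _
      simpa using h4
    have hk : (0 : ℝ) < k.factorial := by exact_mod_cast k.factorial_pos
    rw [norm_smul, norm_mul, norm_inv, Complex.norm_natCast]
    calc _ ≤ (k.factorial : ℝ)⁻¹ * ‖pdList (List.ofFn i) f x‖ * 1 := by gcongr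
      _ ≤ (k.factorial : ℝ)⁻¹ * (M * K ^ k * k.factorial) := by rw [mul_one]; gcongr
      _ = M * K ^ k := by field_simp
  calc ‖taylorFMS f x k‖ ≤ ∑ _i : Fin k → Fin n, M * K ^ k :=
        (norm_sum_le _ _).trans (Finset.sum_le_sum fun i _ => hterm i)
    _ = _ := by simp; ring

/-- The bridge between the Taylor series on a complex line and the one in `n` variables. The sum
runs over ordered tuples of directions, so no symmetry of mixed derivatives is needed. -/
lemma iteratedDeriv_line {f : Vec n → ℂ} {U : Set (Vec n)} (hU : IsOpen U)
    (hf : DifferentiableOn ℂ f U) (x v : Vec n) (k : ℕ) : ∀ t : ℂ, x + t • v ∈ U →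
    iteratedDeriv k (fun s : ℂ => f (x + s • v)) t =
      ∑ i : Fin k → Fin n, (∏ j, v (i j)) * pdList (List.ofFn i) f (x + t • v) := by
  induction k with
  | zero => intro t _; simp
  | succ k ih =>
    intro t ht
    have hev : ∀ᶠ s in 𝓝 t, x + s • v ∈ U := by
      have hc : Continuous fun s : ℂ => x + s • v := by fun_prop
      exact hc.continuousAt.eventually (hU.mem_nhds ht)
    rw [iteratedDeriv_succ, Filter.EventuallyEq.deriv_eq (hev.mono ih)]
    have hd : ∀ i : Fin k → Fin n, HasDerivAt
        (fun s : ℂ => (∏ j, v (i j)) * pdList (List.ofFn i) f (x + s • v))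
        ((∏ j, v (i j)) * fderiv ℂ (pdList (List.ofFn i) f) (x + t • v) v) t := fun i =>
      (hasDerivAt_line ((differentiableOn_pdList hU hf _).differentiableAt
        (hU.mem_nhds ht))).const_mul _
    have h2 := (HasDerivAt.fun_sum fun i (_ : i ∈ Finset.univ) => hd i).deriv
    rw [h2]
    simp only [fderiv_apply_eq_sum, Finset.mul_sum]
    rw [Finset.sum_comm, ← Fintype.sum_prod_type']
    refine Fintype.sum_equiv (Fin.consEquiv fun _ => Fin n) _ _ fun p => ?_
    simp [Fin.consEquiv, Fin.prod_univ_succ, List.ofFn_succ]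
    ring

/-- Restriction to the complex line through `x` in the direction `v` reduces this to the
one-variable Taylor expansion, evaluated at `t = 1`. -/
lemma hasSum_taylorFMS {f : Vec n → ℂ} {x : Vec n} {r : ℝ}
    (hf : DifferentiableOn ℂ f (Metric.ball x r)) {v : Vec n} (hv : ‖v‖ < r) :
    HasSum (fun k => taylorFMS f x k fun _ => v) (f (x + v)) := by
  have hr : 0 < r := (norm_nonneg v).trans_lt hv
  -- The restriction to the line must be holomorphic on a disc of radius larger than `1`. For `v =
  -- 0` the quotient `r / ‖v‖` is useless and any `ρ > 1` will do.
  obtain ⟨ρ, hρ, hρv⟩ : ∃ ρ : ℝ, 1 < ρ ∧ ρ * ‖v‖ < r := by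
    rcases eq_or_lt_of_le (norm_nonneg v) with h | h
    · exact ⟨2, by norm_num, by rw [← h]; simpa using hr⟩
    · refine ⟨(1 + r / ‖v‖) / 2, ?_, ?_⟩
      · have : 1 < r / ‖v‖ := (one_lt_div h).2 hv
        linarith
      · rw [show (1 + r / ‖v‖) / 2 * ‖v‖ = (‖v‖ + r) / 2 by field_simp]
        linarith
  have hmem : ∀ t ∈ Metric.ball (0 : ℂ) ρ, x + t • v ∈ Metric.ball x r := by
    intro t ht
    rw [mem_ball_zero_iff] at ht
    rw [Metric.mem_ball, dist_eq_norm, add_sub_cancel_left, norm_smul]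
    exact lt_of_le_of_lt (by gcongr) hρv
  have hd : DifferentiableOn ℂ (fun s : ℂ => f (x + s • v)) (Metric.ball 0 ρ) := fun t ht =>
    (hasDerivAt_line (hf.differentiableAt
      (Metric.isOpen_ball.mem_nhds (hmem t ht)))).differentiableAt.differentiableWithinAt
  have h1 := Complex.hasSum_taylorSeries_on_ball hd (z := 1) (by simpa using hρ)
  simp only [sub_zero, one_pow, one_smul] at h1
  refine h1.congr_fun fun k => ?_
  rw [taylorFMS_apply, iteratedDeriv_line Metric.isOpen_ball hf x v k 0
    (hmem 0 (Metric.mem_ball_self (by linarith)))]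
  simp

/-- The factor `n + 1` turns the bound `(n K) ^ k` into `(n / (n + 1)) ^ k ≤ 1` and keeps the
denominator non-zero for `n = 0`. -/
lemma le_radius_taylorFMS {f : Vec n → ℂ} {x : Vec n} {M K : ℝ} (hK : 0 < K)
    (h : ∀ l : List (Fin n), ‖pdList l f x‖ ≤ M * K ^ l.length * l.length.factorial) :
    ENNReal.ofReal (1 / ((n + 1) * K)) ≤ (taylorFMS f x).radius := by
  have hM : 0 ≤ M := by
    have := (norm_nonneg _).trans (h [])
    simpa using this
  have h0 : 0 ≤ 1 / ((n + 1) * K) := by positivity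
  rw [ENNReal.ofReal]
  refine (taylorFMS f x).le_radius_of_bound M fun k => ?_
  rw [Real.coe_toNNReal _ h0]
  calc _ ≤ (M * (n * K) ^ k) * (1 / ((n + 1) * K)) ^ k := by
        gcongr; exact norm_taylorFMS_le h k
    _ = M * (n / (n + 1)) ^ k := by
        rw [mul_assoc, ← mul_pow]; congr 2; field_simp
    _ ≤ M * 1 := by
        gcongr
        exact pow_le_one₀ (by positivity) ((div_le_one (by positivity)).2 (by linarith))
    _ = M := mul_one M

lemma pdList_bound_of_bound {f : Vec n → ℂ} {x : Vec n} {r M : ℝ} (hr : 0 < r)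
    (hf : DifferentiableOn ℂ f (Metric.ball x r)) (hM : ∀ z ∈ Metric.ball x r, ‖f z‖ ≤ M)
    (l : List (Fin n)) :
    ‖pdList l f x‖ ≤ M * (2 * Real.exp 1 / r) ^ l.length * l.length.factorial := by
  have hM0 : 0 ≤ M := (norm_nonneg _).trans (hM x (Metric.mem_ball_self hr))
  rcases Nat.eq_zero_or_pos l.length with h0 | h0
  · rw [h0, List.length_eq_zero_iff.1 h0]
    simpa using hM x (Metric.mem_ball_self hr)
  set k := l.length with hk
  have hk0 : (0 : ℝ) < k := by exact_mod_cast h0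
  -- For `k` derivatives the collars of width `r / (2 k)` use up half of the radius. The resulting
  -- `k ^ k` is absorbed by `e ^ k * k!`.
  have h1 := norm_pdList_le (δ := r / (2 * k)) (by positivity) hf hM l x (by
    refine Metric.mem_ball_self ?_
    rw [← hk]; field_simp; linarith)
  rw [← hk] at h1
  refine h1.trans ?_
  have h2 : (k : ℝ) ^ k ≤ Real.exp 1 ^ k * k.factorial := by
    have := Real.pow_div_factorial_le_exp (k : ℝ) hk0.le k
    rw [div_le_iff₀ (by positivity)] at this
    rwa [← Real.exp_nat_mul, mul_one]
  calc M / (r / (2 * k)) ^ k = M * (2 / r) ^ k * k ^ k := by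
        rw [div_pow, mul_pow, div_pow]; field_simp
    _ ≤ M * (2 / r) ^ k * (Real.exp 1 ^ k * k.factorial) := by gcongr
    _ = _ := by rw [show 2 * Real.exp 1 / r = (2 / r) * Real.exp 1 by ring, mul_pow]; ring

/-- Osgood's lemma. -/
theorem analyticOnNhd_of_differentiableOn {f : Vec n → ℂ} {U : Set (Vec n)} (hU : IsOpen U)
    (hf : DifferentiableOn ℂ f U) : AnalyticOnNhd ℂ f U := by
  intro x hx
  obtain ⟨r, hr, M, hrU, hM⟩ := exists_bound_of_continuousOn (a := 0) (b := 0) hU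
    (g := fun _ => f) (hf.continuousOn.comp (by fun_prop) fun p hp => hp.2) hx
  have hM' := hM 0 (by simp)
  have hrad := le_radius_taylorFMS (K := 2 * Real.exp 1 / r) (by positivity)
    (pdList_bound_of_bound hr (hf.mono hrU) hM')
  set s := min r (1 / ((n + 1) * (2 * Real.exp 1 / r))) with hs
  have hs0 : 0 < s := by positivity
  refine ⟨taylorFMS f x, ENNReal.ofReal s, ?_⟩
  refine ⟨(ENNReal.ofReal_le_ofReal (min_le_right _ _)).trans hrad, by simpa using hs0, ?_⟩
  intro v hv
  refine hasSum_taylorFMS (hf.mono hrU) ?_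
  rw [Metric.eball_ofReal, mem_ball_zero_iff] at hv
  exact hv.trans_le (min_le_left _ _)

/-- A holomorphic germ whose Taylor coefficients satisfy Cauchy estimates extends to a ball. -/
theorem exists_analyticOnNhd_ball {f : Vec n → ℂ} {x : Vec n} (hf : AnalyticAt ℂ f x) {M K : ℝ}
    (hK : 0 < K)
    (h : ∀ l : List (Fin n), ‖pdList l f x‖ ≤ M * K ^ l.length * l.length.factorial) :
    ∃ F : Vec n → ℂ, AnalyticOnNhd ℂ F (Metric.ball x (1 / ((n + 1) * K))) ∧ F =ᶠ[𝓝 x] f := by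
  set p := taylorFMS f x with hp
  have hR : 0 < 1 / ((n + 1) * K) := by positivity
  have hrad := le_radius_taylorFMS hK h
  have hpos : 0 < p.radius := lt_of_lt_of_le (by simpa using hR) hrad
  have h1 := (p.hasFPowerSeriesOnBall hpos).comp_sub x
  rw [zero_add] at h1
  refine ⟨fun z => p.sum (z - x), fun y hy => h1.analyticAt_of_mem ?_, ?_⟩
  · refine lt_of_lt_of_le ?_ hrad
    rw [edist_dist]
    exact (ENNReal.ofReal_lt_ofReal_iff hR).2 hy
  · obtain ⟨r, hr, hb⟩ := Metric.eventually_nhds_iff_ball.1 hf.eventually_analyticAt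
    have hd : DifferentiableOn ℂ f (Metric.ball x r) := fun y hy =>
      (hb y hy).differentiableAt.differentiableWithinAt
    have hr' : 0 < min r (1 / ((n + 1) * K)) := lt_min hr hR
    filter_upwards [Metric.ball_mem_nhds x hr'] with y hy
    rw [Metric.mem_ball, dist_eq_norm] at hy
    have h2 := hasSum_taylorFMS hd (v := y - x) (hy.trans_le (min_le_left _ _))
    rw [add_sub_cancel] at h2
    have h3 : HasSum (fun k => p k fun _ => y - x) (p.sum (y - x)) := by
      refine p.hasSum (lt_of_lt_of_le ?_ hrad)
      rw [edist_zero_right, ← ofReal_norm]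
      exact (ENNReal.ofReal_lt_ofReal_iff hR).2 (hy.trans_le (min_le_right _ _))
    exact h3.unique h2

theorem analyticOnNhd_intervalIntegral {a b : ℝ} (hab : a ≤ b) {U : Set (Vec n)} (hU : IsOpen U)
    {g : ℝ → Vec n → ℂ}
    (hc : ContinuousOn (Function.uncurry g) (Set.Icc a b ×ˢ U))
    (hd : ∀ θ ∈ Set.Icc a b, DifferentiableOn ℂ (g θ) U) :
    AnalyticOnNhd ℂ (fun y => ∫ θ in a..b, g θ y) U :=
  analyticOnNhd_of_differentiableOn hU (differentiableOn_intervalIntegral hab hU hc hd)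

end SeveralVariables

/-! ### Continuation of germs in convex domains -/

section Continuation

variable {E : Type*} [NormedAddCommGroup E] [NormedSpace ℂ E]

/-- A local class of germs of analytic functions. -/
structure IsGermClass (S : (E → ℂ) → E → Prop) : Prop where
  congr : ∀ f g x, f =ᶠ[𝓝 x] g → S f x → S g x
  analytic : ∀ f x, S f x → AnalyticAt ℂ f x

/-- Every germ of the class at a point of `B` extends to `B`. -/
def ExtendsOn (S : (E → ℂ) → E → Prop) (B : Set E) : Prop :=
  ∀ y ∈ B, ∀ f, S f y → ∃ F : E → ℂ, (∀ z ∈ B, S F z) ∧ F =ᶠ[𝓝 y] f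

variable {S : (E → ℂ) → E → Prop}

lemma IsGermClass.eqOn (hS : IsGermClass S) {B : Set E} (hB : IsPreconnected B) {f g : E → ℂ}
    (hf : ∀ z ∈ B, S f z) (hg : ∀ z ∈ B, S g z) {y : E} (hy : y ∈ B) (h : f =ᶠ[𝓝 y] g) :
    Set.EqOn f g B :=
  AnalyticOnNhd.eqOn_of_preconnected_of_eventuallyEq (fun z hz => hS.analytic _ _ (hf z hz))
    (fun z hz => hS.analytic _ _ (hg z hz)) hB hy h

lemma ExtendsOn.mono {M : Type*} [NormedAddCommGroup M] {S : (M → ℂ) → M → Prop} {B B' : Set M}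
    (h : ExtendsOn S B) (hBB : B' ⊆ B) : ExtendsOn S B' := fun y hy f hf => by
  obtain ⟨F, h1, h2⟩ := h y (hBB hy) f hf
  exact ⟨F, fun z hz => h1 z (hBB hz), h2⟩

/-- Two sections on open sets which agree on the intersection glue. -/
lemma IsGermClass.glue (hS : IsGermClass S) {A B : Set E} (hA : IsOpen A) (hB : IsOpen B)
    {f g : E → ℂ} (hf : ∀ z ∈ A, S f z) (hg : ∀ z ∈ B, S g z) (h : Set.EqOn f g (A ∩ B)) :
    ∃ F : E → ℂ, (∀ z ∈ A ∪ B, S F z) ∧ Set.EqOn F f A := by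
  classical
  refine ⟨A.piecewise f g, ?_, Set.piecewise_eqOn A f g⟩
  rintro z (hz | hz)
  · refine hS.congr f _ z ?_ (hf z hz)
    filter_upwards [hA.mem_nhds hz] with y hy
    rw [Set.piecewise_eq_of_mem _ _ _ hy]
  · refine hS.congr g _ z ?_ (hg z hz)
    filter_upwards [hB.mem_nhds hz] with y hy
    by_cases hyA : y ∈ A
    · rw [Set.piecewise_eq_of_mem _ _ _ hyA, h ⟨hyA, hy⟩]
    · rw [Set.piecewise_eq_of_notMem _ _ _ hyA]

lemma convex_thickening_line (q x : E) (t δ : ℝ) :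
    Convex ℝ (Metric.thickening δ (AffineMap.lineMap (k := ℝ) q x '' Set.Icc (0 : ℝ) t)) :=
  ((convex_Icc (0 : ℝ) t).affine_image (AffineMap.lineMap (k := ℝ) q x)).thickening δ

/-- Continuation of a germ to a neighbourhood of a segment. -/
lemma IsGermClass.exists_thickening (hS : IsGermClass S) {q x : E}
    (hadm : ∀ p ∈ AffineMap.lineMap (k := ℝ) q x '' Set.Icc (0 : ℝ) 1,
      ∃ r > 0, ExtendsOn S (Metric.ball p r)) {f : E → ℂ} (hf : S f q) :
    ∃ δ > 0, ∃ F : E → ℂ,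
      (∀ z ∈ Metric.thickening δ (AffineMap.lineMap (k := ℝ) q x '' Set.Icc (0 : ℝ) 1), S F z) ∧
      F =ᶠ[𝓝 q] f := by
  set c : ℝ → E := ⇑(AffineMap.lineMap (k := ℝ) q x) with hc
  have hcont : Continuous c := AffineMap.lineMap_continuous
  have hcomp : IsCompact (c '' Set.Icc (0 : ℝ) 1) := isCompact_Icc.image hcont
  choose! r hr hext using hadm
  -- A Lebesgue number of the segment gives balls of one radius `δ₀` around all its points to which
  -- germs extend.
  obtain ⟨δ₀, hδ₀, hleb⟩ := lebesgue_number_lemma_of_metric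
    (c := fun p : c '' Set.Icc (0 : ℝ) 1 => Metric.ball (p : E) (r p)) hcomp
    (fun _ => Metric.isOpen_ball)
    (fun p hp => Set.mem_iUnion.2 ⟨⟨p, hp⟩, Metric.mem_ball_self (hr p hp)⟩)
  have hball : ∀ s ∈ Set.Icc (0 : ℝ) 1, ExtendsOn S (Metric.ball (c s) δ₀) := by
    intro s hs
    obtain ⟨p, hp⟩ := hleb (c s) ⟨s, hs, rfl⟩
    exact (hext p p.2).mono hp
  set δ := δ₀ / 2 with hδ
  have hδpos : 0 < δ := by positivity
  obtain ⟨N, hN⟩ := exists_nat_gt (dist q x / δ)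
  have hN0 : (0 : ℝ) < N := lt_of_le_of_lt (by positivity) hN
  have hq0 : c 0 = q := by simp [hc]
  -- Induction over `N` equal pieces of the segment, each of length at most `δ₀ / 2`. The tube
  -- covered so far and the next ball are convex, so their intersection is connected and the two
  -- extensions agree on it.
  have key : ∀ k : ℕ, k ≤ N → ∃ F : E → ℂ,
      (∀ z ∈ Metric.thickening δ (c '' Set.Icc (0 : ℝ) (k / N)), S F z) ∧ F =ᶠ[𝓝 q] f := by
    intro k
    induction k with
    | zero =>
      intro _
      obtain ⟨F, h1, h2⟩ := hball 0 (by simp) q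
        (by rw [hq0]; exact Metric.mem_ball_self hδ₀) f hf
      refine ⟨F, fun z hz => h1 z ?_, h2⟩
      simp only [Nat.cast_zero, zero_div, Set.Icc_self, Set.image_singleton,
        Metric.thickening_singleton] at hz
      exact Metric.ball_subset_ball (by linarith) hz
    | succ k ih =>
      intro hk
      obtain ⟨F, h1, h2⟩ := ih (by omega)
      have hkN : (k : ℝ) / N ∈ Set.Icc (0 : ℝ) 1 :=
        ⟨by positivity, (div_le_one hN0).2 (by exact_mod_cast (by omega : k ≤ N))⟩
      have hkin : c (k / N) ∈ Metric.thickening δ (c '' Set.Icc (0 : ℝ) (k / N)) :=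
        Metric.self_subset_thickening hδpos _ ⟨k / N, ⟨hkN.1, le_rfl⟩, rfl⟩
      obtain ⟨G, h3, h4⟩ := hball (k / N) hkN (c (k / N)) (Metric.mem_ball_self hδ₀) F
        (h1 _ hkin)
      have hconv := (convex_thickening_line q x (k / N) δ).inter (convex_ball (c (k / N)) δ₀)
      have heq := hS.eqOn hconv.isPreconnected (fun z hz => h1 z hz.1) (fun z hz => h3 z hz.2)
        ⟨hkin, Metric.mem_ball_self hδ₀⟩ h4.symm
      obtain ⟨H, h5, h6⟩ := hS.glue Metric.isOpen_thickening Metric.isOpen_ball h1 h3 heq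
      refine ⟨H, fun z hz => h5 z ?_, ?_⟩
      · obtain ⟨_, ⟨s, hs, rfl⟩, hzs⟩ := Metric.mem_thickening_iff.1 hz
        rcases le_total s (k / N) with hsk | hsk
        · exact Or.inl (Metric.mem_thickening_iff.2 ⟨_, ⟨s, ⟨hs.1, hsk⟩, rfl⟩, hzs⟩)
        · right
          have h7 : dist (c s) (c (k / N)) ≤ δ := by
            rw [hc, dist_lineMap_lineMap, Real.dist_eq, abs_of_nonneg (by linarith)]
            have h8 : s - k / N ≤ 1 / N := by
              have := hs.2
              push_cast at this
              rw [add_div] at this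
              linarith
            calc (s - k / N) * dist q x ≤ 1 / N * dist q x := by gcongr
              _ ≤ δ := by
                rw [div_lt_iff₀ hδpos] at hN
                rw [one_div, inv_mul_le_iff₀ hN0]
                linarith
          rw [Metric.mem_ball]
          calc dist z (c (k / N)) ≤ dist z (c s) + dist (c s) (c (k / N)) := dist_triangle _ _ _
            _ < δ + δ := by linarith
            _ = δ₀ := by rw [hδ]; ring
      · refine EventuallyEq.trans ?_ h2
        have hqin : q ∈ Metric.thickening δ (c '' Set.Icc (0 : ℝ) (k / N)) :=
          Metric.self_subset_thickening hδpos _ ⟨0, ⟨le_rfl, hkN.1⟩, hq0⟩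
        filter_upwards [Metric.isOpen_thickening.mem_nhds hqin] with y hy using h6 hy
  obtain ⟨F, h1, h2⟩ := key N le_rfl
  rw [div_self hN0.ne'] at h1
  exact ⟨δ, hδpos, F, h1, h2⟩

/-- The monodromy theorem for convex domains. -/
theorem IsGermClass.extendsOn_convex (hS : IsGermClass S) {U : Set E} (hUo : IsOpen U)
    (hUc : Convex ℝ U) (hadm : ∀ p ∈ U, ∃ r > 0, ExtendsOn S (Metric.ball p r)) :
    ExtendsOn S U := by
  intro q hq f hf
  have h1 : ∀ x ∈ U, ∃ δ > 0, ∃ F : E → ℂ,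
      (∀ z ∈ Metric.thickening δ (AffineMap.lineMap (k := ℝ) q x '' Set.Icc (0 : ℝ) 1), S F z) ∧
      F =ᶠ[𝓝 q] f := fun x hx => hS.exists_thickening (fun p hp => hadm p (by
    obtain ⟨s, hs, rfl⟩ := hp
    exact hUc.lineMap_mem hq hx hs)) hf
  choose! δ hδ F hF hFq using h1
  have hmem : ∀ x ∈ U, ∀ s ∈ Set.Icc (0 : ℝ) 1, AffineMap.lineMap (k := ℝ) q x s ∈
      Metric.thickening (δ x) (AffineMap.lineMap (k := ℝ) q x '' Set.Icc (0 : ℝ) 1) := fun x hx s hs =>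
    Metric.self_subset_thickening (hδ x hx) _ ⟨s, hs, rfl⟩
  have h0 : ∀ x ∈ U, q ∈ Metric.thickening (δ x)
      (AffineMap.lineMap (k := ℝ) q x '' Set.Icc (0 : ℝ) 1) := fun x hx => by
    simpa using hmem x hx 0 (by simp)
  have hx1 : ∀ x ∈ U, x ∈ Metric.thickening (δ x)
      (AffineMap.lineMap (k := ℝ) q x '' Set.Icc (0 : ℝ) 1) := fun x hx => by
    simpa using hmem x hx 1 (by simp)
  -- The value at `y` is taken from the continuation along the segment from `q` to `y`. Tubes around
  -- two segments starting at `q` meet in a convex set containing `q`, so the continuation along the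
  -- segment to `x` has the same values near `x`.
  have key : ∀ x ∈ U, (fun y => F y y) =ᶠ[𝓝 x] F x := by
    intro x hx
    filter_upwards [hUo.mem_nhds hx, Metric.isOpen_thickening.mem_nhds (hx1 x hx)] with y hy hyx
    have hconv := (convex_thickening_line q x 1 (δ x)).inter (convex_thickening_line q y 1 (δ y))
    exact (hS.eqOn hconv.isPreconnected (fun z hz => hF x hx z hz.1) (fun z hz => hF y hy z hz.2)
      ⟨h0 x hx, h0 y hy⟩ ((hFq x hx).trans (hFq y hy).symm) ⟨hyx, hx1 y hy⟩).symm
  exact ⟨fun y => F y y, fun z hz => hS.congr _ _ z (key z hz).symm (hF z hz z (hx1 z hz)),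
    (key q hq).trans (hFq q hq)⟩

end Continuation

/-! ### Calculus of partial derivatives -/

section Calculus

variable {n : ℕ}

lemma pd_add {f g : Vec n → ℂ} {x : Vec n} (i : Fin n) (hf : AnalyticAt ℂ f x)
    (hg : AnalyticAt ℂ g x) : pd i (fun y => f y + g y) x = pd i f x + pd i g x := by
  simp [pd, fderiv_fun_add hf.differentiableAt hg.differentiableAt]

lemma pd_mul {f g : Vec n → ℂ} {x : Vec n} (i : Fin n) (hf : AnalyticAt ℂ f x)
    (hg : AnalyticAt ℂ g x) : pd i (fun y => f y * g y) x = pd i f x * g x + f x * pd i g x := by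
  simp [pd, fderiv_fun_mul hf.differentiableAt hg.differentiableAt]
  ring

lemma pd_const (i : Fin n) (c : ℂ) : pd i (fun _ : Vec n => c) = fun _ => 0 := by
  funext x; simp [pd]

lemma analyticAt_const_mul {f : Vec n → ℂ} {x : Vec n} (c : ℂ) (hf : AnalyticAt ℂ f x) :
    AnalyticAt ℂ (fun y => c * f y) x := analyticAt_const.mul hf

lemma pd_const_mul {f : Vec n → ℂ} {x : Vec n} (i : Fin n) (c : ℂ) (hf : AnalyticAt ℂ f x) :
    pd i (fun y => c * f y) x = c * pd i f x := by
  rw [pd_mul i analyticAt_const hf, pd_const]; ring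

lemma pd_sum {ι : Type*} (s : Finset ι) {f : ι → Vec n → ℂ} {x : Vec n} (i : Fin n)
    (hf : ∀ j ∈ s, AnalyticAt ℂ (f j) x) :
    pd i (fun y => ∑ j ∈ s, f j y) x = ∑ j ∈ s, pd i (f j) x := by
  unfold pd
  rw [fderiv_fun_sum fun j hj => (hf j hj).differentiableAt]
  simp

lemma pd_comm {f : Vec n → ℂ} {x : Vec n} (i j : Fin n) (hf : AnalyticAt ℂ f x) :
    pd i (pd j f) x = pd j (pd i f) x := by
  have h : ∀ a b : Fin n, pd a (pd b f) x =
      fderiv ℂ (fderiv ℂ f) x (Pi.single a 1) (Pi.single b 1) := by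
    intro a b
    have h1 := (ContinuousLinearMap.apply ℂ ℂ (Pi.single b 1 : Vec n)).hasFDerivAt.comp x
      hf.fderiv.differentiableAt.hasFDerivAt
    have h2 : pd b f = (ContinuousLinearMap.apply ℂ ℂ (Pi.single b 1 : Vec n)) ∘ fderiv ℂ f := rfl
    rw [h2, pd, h1.fderiv]
    rfl
  rw [h, h]
  refine second_derivative_symmetric_of_eventually (𝕜 := ℂ) (f := f) (f' := fderiv ℂ f) ?_
    hf.fderiv.differentiableAt.hasFDerivAt _ _
  filter_upwards [hf.eventually_analyticAt] with y hy using hy.differentiableAt.hasFDerivAt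

lemma pd_comm_eventually {f : Vec n → ℂ} {x : Vec n} (i j : Fin n) (hf : AnalyticAt ℂ f x) :
    pd i (pd j f) =ᶠ[𝓝 x] pd j (pd i f) := by
  filter_upwards [hf.eventually_analyticAt] with y hy using pd_comm i j hy

lemma goodOp_iterate_pd (i : Fin n) (x : Vec n) (m : ℕ) : GoodOp x (fun f => (pd i)^[m] f) := by
  induction m with
  | zero => exact goodOp_id x
  | succ m ih =>
    simp only [Function.iterate_succ']
    exact (goodOp_pd i x).comp ih

lemma iterate_pd_comm (i j : Fin n) (m : ℕ) {f : Vec n → ℂ} {x : Vec n}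
    (hf : AnalyticAt ℂ f x) : (pd j)^[m] (pd i f) =ᶠ[𝓝 x] pd i ((pd j)^[m] f) := by
  induction m with
  | zero => rfl
  | succ m ih =>
    rw [Function.iterate_succ_apply', Function.iterate_succ_apply']
    exact (pd_congr j ih).trans (pd_comm_eventually j i ((goodOp_iterate_pd j x m).analytic f hf))

lemma goodOp_foldr (l : List (Fin n)) (k : Fin n →₀ ℕ) (x : Vec n) :
    GoodOp x (fun f => l.foldr (fun i g => (pd i)^[k i] g) f) := by
  induction l with
  | nil => exact goodOp_id x
  | cons i l ih => exact (goodOp_iterate_pd i x (k i)).comp ih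

lemma foldr_congr_of_notMem (l : List (Fin n)) (k : Fin n →₀ ℕ) (i : Fin n) (hi : i ∉ l)
    (f : Vec n → ℂ) :
    l.foldr (fun j g => (pd j)^[(k + Finsupp.single i 1 : Fin n →₀ ℕ) j] g) f =
      l.foldr (fun j g => (pd j)^[k j] g) f := by
  induction l with
  | nil => rfl
  | cons j l ih =>
    simp only [List.mem_cons, not_or] at hi
    simp only [List.foldr_cons]
    rw [ih hi.2]
    simp [hi.1]

/-- `∂^{k + eᵢ} = ∂ᵢ ∂^k` on holomorphic germs. -/
lemma mixedPd_add_single (k : Fin n →₀ ℕ) (i : Fin n) {f : Vec n → ℂ} {x : Vec n}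
    (hf : AnalyticAt ℂ f x) :
    mixedPd (k + Finsupp.single i 1) f =ᶠ[𝓝 x] pd i (mixedPd k f) := by
  unfold mixedPd
  have hnd := List.nodup_finRange n
  have hi := List.mem_finRange i
  generalize List.finRange n = l at hnd hi
  induction l with
  | nil => simp at hi
  | cons j l ih =>
    rw [List.nodup_cons] at hnd
    simp only [List.foldr_cons]
    by_cases hij : i = j
    · subst hij
      rw [foldr_congr_of_notMem l k i hnd.1]
      simp only [Finsupp.add_apply, Finsupp.single_eq_same]
      rw [Function.iterate_succ_apply']
    · have hil : i ∈ l := by simpa [hij] using hi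
      have h1 := ih hnd.2 hil
      have h2 : (k + Finsupp.single i 1 : Fin n →₀ ℕ) j = k j := by
        simp [hij]
      rw [h2]
      exact ((goodOp_iterate_pd j x (k j)).congr _ _ h1).trans
        (iterate_pd_comm i j _ ((goodOp_foldr l k x).analytic f hf))

@[simp] lemma mixedPd_zero (f : Vec n → ℂ) : mixedPd 0 f = f := by
  unfold mixedPd
  induction List.finRange n with
  | nil => rfl
  | cons j l ih => simp

lemma mixedPd_single (i : Fin n) (m : ℕ) (f : Vec n → ℂ) :
    mixedPd (Finsupp.single i m) f = (pd i)^[m] f := by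
  unfold mixedPd
  have hnd := List.nodup_finRange n
  have key : ∀ l : List (Fin n), l.Nodup →
      l.foldr (fun j g => (pd j)^[(Finsupp.single i m : Fin n →₀ ℕ) j] g) f =
        if i ∈ l then (pd i)^[m] f else f := by
    intro l
    induction l with
    | nil => simp
    | cons j l ih =>
      intro hl
      rw [List.nodup_cons] at hl
      rw [List.foldr_cons, ih hl.2]
      by_cases hij : i = j
      · subst hij
        simp [hl.1]
      · simp [hij]
  rw [key _ hnd, if_pos (List.mem_finRange i)]

/-- The list of directions of the multi-index `k`. -/
def multiList (k : Fin n →₀ ℕ) : List (Fin n) :=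
  (List.finRange n).flatMap fun i => List.replicate (k i) i

lemma mixedPd_eq_pdList (k : Fin n →₀ ℕ) (f : Vec n → ℂ) :
    mixedPd k f = pdList (multiList k) f := by
  unfold mixedPd multiList
  induction List.finRange n with
  | nil => rfl
  | cons i l ih =>
    rw [List.foldr_cons, ih, List.flatMap_cons]
    generalize List.flatMap (fun i => List.replicate (k i) i) l = l'
    induction k i with
    | zero => rfl
    | succ m ihm => rw [Function.iterate_succ_apply', ihm]; rfl

lemma length_multiList (k : Fin n →₀ ℕ) : (multiList k).length = k.degree := by
  simp only [multiList, List.length_flatMap, List.length_replicate]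
  rw [Finsupp.degree_eq_sum, ← List.ofFn_eq_map, List.sum_ofFn]

lemma prod_multiList (k : Fin n →₀ ℕ) (ξ : Vec n) :
    ((multiList k).map ξ).prod = ∏ i, ξ i ^ k i := by
  rw [multiList, ← List.prod_ofFn, List.ofFn_eq_map]
  induction List.finRange n with
  | nil => rfl
  | cons i l ih => simp [ih]

lemma analyticAt_mixedPd (k : Fin n →₀ ℕ) {f : Vec n → ℂ} {x : Vec n} (hf : AnalyticAt ℂ f x) :
    AnalyticAt ℂ (mixedPd k f) x := (goodOp_mixedPd k x).analytic f hf

lemma pd_congr_at {f g : Vec n → ℂ} {x : Vec n} (i : Fin n) (h : f =ᶠ[𝓝 x] g) :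
    pd i f x = pd i g x := (pd_congr i h).eq_of_nhds

lemma mixedPd_congr (k : Fin n →₀ ℕ) {f g : Vec n → ℂ} {x : Vec n} (h : f =ᶠ[𝓝 x] g) :
    mixedPd k f =ᶠ[𝓝 x] mixedPd k g := (goodOp_mixedPd k x).congr f g h

lemma DiffOp.apply_congr (D : DiffOp n) {f g : Vec n → ℂ} {x : Vec n} (h : f =ᶠ[𝓝 x] g) :
    D.apply f =ᶠ[𝓝 x] D.apply g := by
  have h1 : ∀ᶠ y in 𝓝 x, ∀ k ∈ D.support, mixedPd k f y = mixedPd k g y := by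
    rw [Filter.eventually_all_finset]
    exact fun k _ => mixedPd_congr k h
  filter_upwards [h1] with y hy
  exact Finset.sum_congr rfl fun k hk => by simp only [hy k hk]

lemma DiffOp.apply_eq_sum (D : DiffOp n) {s : Finset (Fin n →₀ ℕ)} (hs : D.support ⊆ s)
    (f : Vec n → ℂ) (x : Vec n) : D.apply f x = ∑ k ∈ s, D k x * mixedPd k f x :=
  Finsupp.sum_of_support_subset D hs _ fun k _ => by simp

lemma DiffOp.apply_add (D E : DiffOp n) (f : Vec n → ℂ) (x : Vec n) :
    (D + E).apply f x = D.apply f x + E.apply f x :=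
  Finsupp.sum_add_index' (fun k => by simp) fun k a b => by simp [add_mul]

lemma DiffOp.apply_single (k : Fin n →₀ ℕ) (c : Vec n → ℂ) (f : Vec n → ℂ) (x : Vec n) :
    DiffOp.apply (Finsupp.single k c) f x = c x * mixedPd k f x :=
  Finsupp.sum_single_index (by simp)

lemma DiffOp.apply_sub (D E : DiffOp n) (f : Vec n → ℂ) (x : Vec n) :
    (D - E).apply f x = D.apply f x - E.apply f x :=
  Finsupp.sum_sub_index fun k a b => by simp [sub_mul]

lemma DiffOp.apply_finset_sum {ι : Type*} (s : Finset ι) (D : ι → DiffOp n) (f : Vec n → ℂ)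
    (x : Vec n) : (∑ i ∈ s, D i).apply f x = ∑ i ∈ s, (D i).apply f x := by
  classical
  induction s using Finset.induction_on with
  | empty => rfl
  | insert a s ha ih => rw [Finset.sum_insert ha, Finset.sum_insert ha, DiffOp.apply_add, ih]

lemma schrodinger_apply (P : EllipticPotential n) (f : Vec n → ℂ) (x : Vec n) :
    P.schrodinger.apply f x = P.u x * f x - ∑ j, pd j (pd j f) x := by
  rw [EllipticPotential.schrodinger, DiffOp.apply_sub, DiffOp.apply_single, mixedPd_zero,
    DiffOp.apply_finset_sum]
  congr 1
  refine Finset.sum_congr rfl fun j _ => ?_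
  rw [DiffOp.apply_single, mixedPd_single]
  simp

lemma analyticAt_apply {D : DiffOp n} {x : Vec n} (hD : D.RegularAt x) {f : Vec n → ℂ}
    (hf : AnalyticAt ℂ f x) : AnalyticAt ℂ (D.apply f) x := by
  have : D.apply f = fun y => ∑ k ∈ D.support, D k y * mixedPd k f y := rfl
  rw [this]
  exact Finset.analyticAt_fun_sum _ fun k _ => (hD k).mul (analyticAt_mixedPd k hf)

/-- The derivatives of `u(x) e^{s (ξ, x)}` are polynomial in `s`; these are the coefficients. -/
def leibniz (ξ : Vec n) (u : Vec n → ℂ) : List (Fin n) → ℕ → Vec n → ℂ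
  | [], 0 => u
  | [], _ + 1 => 0
  | i :: l, 0 => pd i (leibniz ξ u l 0)
  | i :: l, j + 1 => fun x => pd i (leibniz ξ u l (j + 1)) x + ξ i * leibniz ξ u l j x

lemma analyticAt_leibniz (ξ : Vec n) {u : Vec n → ℂ} {x : Vec n} (hu : AnalyticAt ℂ u x)
    (l : List (Fin n)) : ∀ j, AnalyticAt ℂ (leibniz ξ u l j) x := by
  induction l with
  | nil =>
    intro j
    cases j with
    | zero => exact hu
    | succ j => exact analyticAt_const
  | cons i l ih =>
    intro j
    cases j with
    | zero => exact analyticAt_pd i (ih 0)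
    | succ j => exact (analyticAt_pd i (ih (j + 1))).add (analyticAt_const.mul (ih j))

lemma leibniz_eq_zero (ξ : Vec n) (u : Vec n → ℂ) (l : List (Fin n)) :
    ∀ j, l.length < j → leibniz ξ u l j = 0 := by
  induction l with
  | nil =>
    intro j hj
    cases j with
    | zero => simp at hj
    | succ j => rfl
  | cons i l ih =>
    intro j hj
    cases j with
    | zero => simp at hj
    | succ j =>
      rw [List.length_cons] at hj
      funext x
      simp only [leibniz]
      rw [ih (j + 1) (by omega), ih j (by omega)]
      simp [pd]

lemma leibniz_length (ξ : Vec n) (u : Vec n → ℂ) (l : List (Fin n)) :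
    leibniz ξ u l l.length = fun x => (l.map ξ).prod * u x := by
  induction l with
  | nil => simp [leibniz]
  | cons i l ih =>
    funext x
    simp only [leibniz, List.length_cons]
    rw [ih, leibniz_eq_zero ξ u l (l.length + 1) (by omega)]
    simp [pd]
    ring

lemma pd_exp (s : ℂ) (ξ : Vec n) (i : Fin n) (x : Vec n) :
    pd i (fun y => Complex.exp (s * (ξ ⬝ᵥ y))) x = s * ξ i * Complex.exp (s * (ξ ⬝ᵥ x)) := by
  have h1 : HasFDerivAt (fun y : Vec n => ξ ⬝ᵥ y)
      (∑ j, ξ j • (ContinuousLinearMap.proj j : Vec n →L[ℂ] ℂ)) x := by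
    unfold dotProduct
    exact HasFDerivAt.fun_sum fun j _ =>
      (ContinuousLinearMap.proj (R := ℂ) (φ := fun _ : Fin n => ℂ) j).hasFDerivAt.const_mul (ξ j)
  have h2 := ((h1.const_mul s).cexp).fderiv
  rw [pd, h2]
  simp [Pi.single_apply]
  ring

lemma analyticAt_dot (ξ x : Vec n) : AnalyticAt ℂ (fun y : Vec n => ξ ⬝ᵥ y) x := by
  unfold dotProduct
  exact Finset.analyticAt_fun_sum _ fun i _ =>
    analyticAt_const.mul ((ContinuousLinearMap.proj (R := ℂ) i).analyticAt x)

lemma analyticAt_exp (s : ℂ) (ξ x : Vec n) :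
    AnalyticAt ℂ (fun y : Vec n => Complex.exp (s * (ξ ⬝ᵥ y))) x :=
  (analyticAt_const.mul (analyticAt_dot ξ x)).cexp

/-- The bound `N` may be any number above the length, since the further coefficients vanish. This
allows a common `N` for all terms of an operator. -/
lemma pdList_mul_exp (ξ : Vec n) {u : Vec n → ℂ} {x : Vec n} (s : ℂ) (hu : AnalyticAt ℂ u x)
    (l : List (Fin n)) (N : ℕ) (hN : l.length < N) :
    pdList l (fun y => u y * Complex.exp (s * (ξ ⬝ᵥ y))) =ᶠ[𝓝 x]
      fun y => (∑ j ∈ Finset.range N, s ^ j * leibniz ξ u l j y) * Complex.exp (s * (ξ ⬝ᵥ y)) := by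
  induction l generalizing N with
  | nil =>
    refine Eventually.of_forall fun y => ?_
    obtain ⟨N, rfl⟩ : ∃ M, N = M + 1 := ⟨N - 1, by simp at hN; omega⟩
    simp [Finset.sum_range_succ', leibniz]
  | cons i l ih =>
    rw [List.length_cons] at hN
    obtain ⟨N, rfl⟩ : ∃ M, N = M + 1 := ⟨N - 1, by omega⟩
    have h1 := pd_congr i (ih (N + 1) (by omega))
    rw [pdList_cons]
    refine h1.trans ?_
    filter_upwards [hu.eventually_analyticAt] with y hy
    have ha : ∀ j, AnalyticAt ℂ (leibniz ξ u l j) y := analyticAt_leibniz ξ hy l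
    have hs : ∀ j ∈ Finset.range (N + 1), AnalyticAt ℂ (fun y => s ^ j * leibniz ξ u l j y) y :=
      fun j _ => analyticAt_const.mul (ha j)
    rw [pd_mul i (Finset.analyticAt_fun_sum _ hs) (analyticAt_exp s ξ y), pd_sum _ i hs, pd_exp]
    have h2 : ∑ j ∈ Finset.range (N + 1), s ^ j * leibniz ξ u l j y =
        ∑ j ∈ Finset.range N, s ^ j * leibniz ξ u l j y := by
      rw [Finset.sum_range_succ, leibniz_eq_zero ξ u l N (by omega)]
      simp
    rw [h2, ← mul_assoc, ← add_mul]
    congr 1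
    rw [Finset.sum_congr rfl fun j _ => pd_const_mul i (s ^ j) (ha j), Finset.sum_range_succ',
      Finset.sum_range_succ' (n := N), Finset.sum_mul, add_right_comm, ← Finset.sum_add_distrib]
    congr 1
    refine Finset.sum_congr rfl fun j _ => ?_
    simp only [leibniz]
    ring

lemma pdList_exp (ξ : Vec n) (s : ℂ) (l : List (Fin n)) :
    pdList l (fun y => Complex.exp (s * (ξ ⬝ᵥ y))) =
      fun y => s ^ l.length * (l.map ξ).prod * Complex.exp (s * (ξ ⬝ᵥ y)) := by
  induction l with
  | nil => simp
  | cons i l ih =>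
    funext y
    rw [pdList_cons, ih, pd_const_mul i _ (analyticAt_exp s ξ y), pd_exp]
    simp [pow_succ]
    ring

end Calculus

/-! ### Regularity of the commuting operators off the singular locus -/

section Regularity

variable {n : ℕ}

/-- The monomial `ξ^k`. -/
def monom (ξ : Vec n) (k : Fin n →₀ ℕ) : ℂ := ∏ i, ξ i ^ k i

lemma mixedPd_exp (ξ : Vec n) (s : ℂ) (k : Fin n →₀ ℕ) :
    mixedPd k (fun y => Complex.exp (s * (ξ ⬝ᵥ y))) =
      fun y => s ^ k.degree * monom ξ k * Complex.exp (s * (ξ ⬝ᵥ y)) := by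
  rw [mixedPd_eq_pdList, pdList_exp, length_multiList, prod_multiList]
  rfl

lemma analyticAt_schrodinger (P : EllipticPotential n) {x : Vec n} (hu : AnalyticAt ℂ P.u x) :
    P.schrodinger.RegularAt x := by
  intro k
  have h1 : ∀ (j : Fin n →₀ ℕ) (c : Vec n → ℂ), AnalyticAt ℂ c x →
      AnalyticAt ℂ ((Finsupp.single j c : DiffOp n) k) x := by
    intro j c hc
    rw [Finsupp.single_apply]
    split_ifs
    · exact hc
    · exact analyticAt_const
  have h2 : P.schrodinger k = (Finsupp.single 0 P.u : DiffOp n) k -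
      ∑ j : Fin n, (Finsupp.single (Finsupp.single j 2) 1 : DiffOp n) k := by
    rw [EllipticPotential.schrodinger, Finsupp.sub_apply, Finsupp.finsetSum_apply]
  rw [h2]
  exact (h1 0 _ hu).sub (Finset.analyticAt_sum _ fun j _ => h1 _ 1 analyticAt_const)

lemma schrodinger_mul_exp (P : EllipticPotential n) {σ : Vec n → ℂ} {x : Vec n}
    (hσ : AnalyticAt ℂ σ x) (s : ℂ) (ξ : Vec n) :
    P.schrodinger.apply (fun y => σ y * Complex.exp (s * (ξ ⬝ᵥ y))) x =
      (P.u x * σ x - ∑ j, (pd j (pd j σ) x + 2 * s * ξ j * pd j σ x + s ^ 2 * ξ j ^ 2 * σ x)) *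
        Complex.exp (s * (ξ ⬝ᵥ x)) := by
  have h1 : ∀ (j : Fin n) (y : Vec n), AnalyticAt ℂ σ y →
      pd j (fun y => σ y * Complex.exp (s * (ξ ⬝ᵥ y))) y =
        (pd j σ y + s * ξ j * σ y) * Complex.exp (s * (ξ ⬝ᵥ y)) := by
    intro j y hy
    rw [pd_mul j hy (analyticAt_exp s ξ y), pd_exp]
    ring
  have h2 : ∀ j : Fin n, pd j (pd j (fun y => σ y * Complex.exp (s * (ξ ⬝ᵥ y)))) x =
      (pd j (pd j σ) x + 2 * s * ξ j * pd j σ x + s ^ 2 * ξ j ^ 2 * σ x) *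
        Complex.exp (s * (ξ ⬝ᵥ x)) := by
    intro j
    rw [pd_congr_at j (hσ.eventually_analyticAt.mono fun y hy => h1 j y hy),
      pd_mul j ((analyticAt_pd j hσ).fun_add (analyticAt_const_mul _ hσ)) (analyticAt_exp s ξ x), pd_exp,
      pd_add j (analyticAt_pd j hσ) (analyticAt_const_mul _ hσ), pd_const_mul j _ hσ]
    ring
  rw [schrodinger_apply, Finset.sum_congr rfl fun j _ => h2 j, ← Finset.sum_mul]
  ring

/-- Both products of `L` and `D` are applied to the plane wave `exp (s (ξ, x))`. The operator `D`
multiplies it by its full symbol at `s ξ`, the terms with `s² (ξ, ξ)` cancel, and what remains is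
polynomial in `s`. -/
lemma commutator_polynomial (P : EllipticPotential n) {D : DiffOp n}
    (hc : P.schrodinger.Commutes D) {x : Vec n} (hD : D.RegularAt x) (hu : AnalyticAt ℂ P.u x)
    (ξ : Vec n) {N : ℕ} (hN : ∀ k ∈ D.support, k.degree < N) (s : ℂ) :
    (∑ k ∈ D.support, s ^ k.degree * (monom ξ k * ∑ j, pd j (pd j (D k)) x)) +
      s * (∑ k ∈ D.support, s ^ k.degree * (2 * monom ξ k * fderiv ℂ (D k) x ξ)) =
    (∑ k ∈ D.support, s ^ k.degree * (P.u x * D k x * monom ξ k)) -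
      ∑ k ∈ D.support, D k x * ∑ j ∈ Finset.range N, s ^ j * leibniz ξ P.u (multiList k) j x := by
  set e : Vec n → ℂ := fun y => Complex.exp (s * (ξ ⬝ᵥ y)) with he
  have hea : ∀ y, AnalyticAt ℂ e y := analyticAt_exp s ξ
  set σ : Vec n → ℂ := fun y => ∑ k ∈ D.support, s ^ k.degree * monom ξ k * D k y with hσdef
  have hDe : D.apply e = fun y => σ y * e y := by
    funext y
    rw [D.apply_eq_sum le_rfl, hσdef]
    simp only [Finset.sum_mul]
    refine Finset.sum_congr rfl fun k _ => ?_
    rw [mixedPd_exp]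
    ring
  have hσ : AnalyticAt ℂ σ x := Finset.analyticAt_fun_sum _ fun k _ => analyticAt_const.mul (hD k)
  have hσ1 : ∀ y, D.RegularAt y → ∀ j, pd j σ y =
      ∑ k ∈ D.support, s ^ k.degree * monom ξ k * pd j (D k) y := by
    intro y hy j
    rw [pd_sum _ j fun k _ => analyticAt_const_mul _ (hy k)]
    exact Finset.sum_congr rfl fun k _ => pd_const_mul j _ (hy k)
  have hreg : ∀ᶠ y in 𝓝 x, D.RegularAt y := by
    have h1 : ∀ᶠ y in 𝓝 x, ∀ k ∈ D.support, AnalyticAt ℂ (D k) y := by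
      rw [Filter.eventually_all_finset]
      exact fun k _ => (hD k).eventually_analyticAt
    filter_upwards [h1] with y hy k
    by_cases hk : k ∈ D.support
    · exact hy k hk
    · rw [Finsupp.notMem_support_iff.1 hk]; exact analyticAt_const
  have hσ2 : ∀ j, pd j (pd j σ) x =
      ∑ k ∈ D.support, s ^ k.degree * monom ξ k * pd j (pd j (D k)) x := by
    intro j
    rw [pd_congr_at j (hreg.mono fun y hy => hσ1 y hy j),
      pd_sum _ j fun k _ => analyticAt_const_mul _ (analyticAt_pd j (hD k))]
    exact Finset.sum_congr rfl fun k _ => pd_const_mul j _ (analyticAt_pd j (hD k))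
  have hLe : P.schrodinger.apply e = (fun y => P.u y * e y) +
      ((-(s ^ 2 * ∑ j, ξ j ^ 2)) • e) := by
    funext y
    have h1 := schrodinger_mul_exp P (σ := fun _ => 1) (x := y) analyticAt_const s ξ
    simp only [one_mul, pd_const, mul_one] at h1
    rw [he, h1, Pi.add_apply, Pi.smul_apply, smul_eq_mul]
    simp only [mul_zero, zero_add, add_zero, Finset.mul_sum]
    ring
  have hcom := hc x (analyticAt_schrodinger P hu) hD e (hea x)
  have hue : AnalyticAt ℂ (fun y => P.u y * e y) x := hu.mul (hea x)
  rw [hDe, schrodinger_mul_exp P hσ, hLe,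
    (apply_add_eventually D hue ((hea x).const_smul)).self_of_nhds,
    (apply_smul_eventually D _ (hea x)).self_of_nhds, hDe, D.apply_eq_sum le_rfl] at hcom
  have hlb : ∀ k ∈ D.support, mixedPd k (fun y => P.u y * e y) x =
      (∑ j ∈ Finset.range N, s ^ j * leibniz ξ P.u (multiList k) j x) * e x := by
    intro k hk
    rw [mixedPd_eq_pdList]
    exact (pdList_mul_exp ξ s hu (multiList k) N
      (by rw [length_multiList]; exact hN k hk)).eq_of_nhds
  have hlb' : ∑ k ∈ D.support, D k x * mixedPd k (fun y => P.u y * e y) x = ∑ k ∈ D.support,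
      D k x * ((∑ j ∈ Finset.range N, s ^ j * leibniz ξ P.u (multiList k) j x) * e x) :=
    Finset.sum_congr rfl fun k hk => by rw [hlb k hk]
  rw [hlb'] at hcom
  have he0 : e x ≠ 0 := Complex.exp_ne_zero _
  have hcom2 : (P.u x * σ x - ∑ j, (pd j (pd j σ) x + 2 * s * ξ j * pd j σ x +
      s ^ 2 * ξ j ^ 2 * σ x)) = (∑ k ∈ D.support, D k x *
        ∑ j ∈ Finset.range N, s ^ j * leibniz ξ P.u (multiList k) j x) -
        s ^ 2 * (∑ j, ξ j ^ 2) * σ x := by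
    apply mul_right_cancel₀ he0
    rw [hcom, sub_mul, Finset.sum_mul]
    simp only [mul_assoc]
    ring
  rw [Finset.sum_add_distrib, Finset.sum_add_distrib] at hcom2
  have h5 : ∑ j, s ^ 2 * ξ j ^ 2 * σ x = s ^ 2 * (∑ j, ξ j ^ 2) * σ x := by
    rw [← Finset.sum_mul, ← Finset.mul_sum]
  have h6 : ∑ j, pd j (pd j σ) x =
      ∑ k ∈ D.support, s ^ k.degree * (monom ξ k * ∑ j, pd j (pd j (D k)) x) := by
    rw [Finset.sum_congr rfl fun j _ => hσ2 j, Finset.sum_comm]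
    refine Finset.sum_congr rfl fun k _ => ?_
    rw [Finset.mul_sum, Finset.mul_sum]
    exact Finset.sum_congr rfl fun j _ => by ring
  have h7 : ∑ j, 2 * s * ξ j * pd j σ x =
      s * (∑ k ∈ D.support, s ^ k.degree * (2 * monom ξ k * fderiv ℂ (D k) x ξ)) := by
    simp only [fderiv_apply_eq_sum, hσ1 x hD, Finset.mul_sum]
    rw [Finset.sum_comm]
    exact Finset.sum_congr rfl fun k _ => Finset.sum_congr rfl fun j _ => by ring
  have h8 : P.u x * σ x = ∑ k ∈ D.support, s ^ k.degree * (P.u x * D k x * monom ξ k) := by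
    rw [hσdef, Finset.mul_sum]
    exact Finset.sum_congr rfl fun k _ => by ring
  rw [h5, h6, h7, h8] at hcom2
  linear_combination -hcom2

/-- The coefficient of `s ^ (m + 1)` in `commutator_polynomial`. It computes the derivative along
`ξ` of the order-`m` part of the symbol from the coefficients of higher order, which makes a
descending induction on the order possible. -/
lemma commutator_coeff (P : EllipticPotential n) {D : DiffOp n}
    (hc : P.schrodinger.Commutes D) {x : Vec n} (hD : D.RegularAt x) (hu : AnalyticAt ℂ P.u x)
    (ξ : Vec n) (m : ℕ) :
    2 * ∑ k ∈ D.support with k.degree = m, monom ξ k * fderiv ℂ (D k) x ξ =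
      -(∑ k ∈ D.support with k.degree = m + 1, monom ξ k * ∑ j, pd j (pd j (D k)) x) -
      ∑ k ∈ D.support with m + 1 < k.degree, D k x * leibniz ξ P.u (multiList k) (m + 1) x := by
  classical
  obtain ⟨N, hN, hmN⟩ : ∃ N, (∀ k ∈ D.support, k.degree < N) ∧ m + 1 < N := by
    refine ⟨D.support.sup (fun k => k.degree) + m + 2, fun k hk => ?_, by omega⟩
    have := Finset.le_sup (f := fun k : Fin n →₀ ℕ => k.degree) hk
    omega
  have hpoly : (∑ k ∈ D.support, Polynomial.C (monom ξ k * ∑ j, pd j (pd j (D k)) x) *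
        Polynomial.X ^ k.degree) +
      (∑ k ∈ D.support, Polynomial.C (2 * monom ξ k * fderiv ℂ (D k) x ξ) *
        Polynomial.X ^ (k.degree + 1)) =
      (∑ k ∈ D.support, Polynomial.C (P.u x * D k x * monom ξ k) * Polynomial.X ^ k.degree) -
      ∑ k ∈ D.support, ∑ j ∈ Finset.range N,
        Polynomial.C (D k x * leibniz ξ P.u (multiList k) j x) * Polynomial.X ^ j := by
    refine Polynomial.funext fun s => ?_
    have := commutator_polynomial P hc hD hu ξ hN s
    simp only [Polynomial.eval_add, Polynomial.eval_sub, Polynomial.eval_finsetSum,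
      Polynomial.eval_mul, Polynomial.eval_C, Polynomial.eval_pow, Polynomial.eval_X]
    rw [Finset.mul_sum] at this
    convert this using 2
    · exact Finset.sum_congr rfl fun k _ => by ring
    · exact Finset.sum_congr rfl fun k _ => by ring
    · exact Finset.sum_congr rfl fun k _ => by ring
    · refine Finset.sum_congr rfl fun k _ => ?_
      rw [Finset.mul_sum]
      exact Finset.sum_congr rfl fun j _ => by ring
  have h := congrArg (fun p => Polynomial.coeff p (m + 1)) hpoly
  simp only [Polynomial.coeff_add, Polynomial.coeff_sub, Polynomial.finsetSum_coeff,
    Polynomial.coeff_C_mul_X_pow, add_left_inj] at h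
  -- The top Leibniz coefficient is `ξ ^ k u`. Hence the terms with `|k| = m + 1` cancel against
  -- those of `u D`, and only orders above `m + 1` contribute through derivatives of `u`.
  have h1 : ∀ k ∈ D.support, (∑ j ∈ Finset.range N, if m + 1 = j then
      D k x * leibniz ξ P.u (multiList k) j x else 0) =
      (if m + 1 = k.degree then P.u x * D k x * monom ξ k else 0) +
      if m + 1 < k.degree then D k x * leibniz ξ P.u (multiList k) (m + 1) x else 0 := by
    intro k _
    rw [Finset.sum_ite_eq, if_pos (Finset.mem_range.2 hmN)]
    rcases lt_trichotomy (m + 1) k.degree with h2 | h2 | h2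
    · rw [if_neg h2.ne, if_pos h2, zero_add]
    · rw [if_pos h2, if_neg (by omega), h2, ← length_multiList, leibniz_length, prod_multiList, monom]
      ring
    · rw [if_neg h2.ne', if_neg (by omega), leibniz_eq_zero _ _ _ _ (by rwa [length_multiList])]
      simp
  rw [Finset.sum_congr rfl h1, Finset.sum_add_distrib] at h
  simp only [Finset.sum_filter, eq_comm (b := m), eq_comm (b := m + 1)]
  rw [Finset.mul_sum]
  have h3 : ∑ k ∈ D.support, 2 * (if m = k.degree then monom ξ k * fderiv ℂ (D k) x ξ else 0) =
      ∑ k ∈ D.support, if m = k.degree then 2 * monom ξ k * fderiv ℂ (D k) x ξ else 0 :=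
    Finset.sum_congr rfl fun k _ => by split_ifs <;> ring
  rw [h3]
  linear_combination h

end Regularity

/-! ### Removal of poles by integration in transversal directions -/

section Extension

variable {n : ℕ}

/-- Meromorphic functions with holomorphic derivative in a direction transversal to the polar
divisor are holomorphic. -/
lemma exists_analyticAt_of_fderiv_apply {G h F : Vec n → ℂ} {p ξ : Vec n} (hG : AnalyticAt ℂ G p)
    (hh : AnalyticAt ℂ h p) (hF : AnalyticAt ℂ F p) (hξ : ¬ ∀ᶠ t : ℂ in 𝓝 0, h (p + t • ξ) = 0)
    (hd : ∀ᶠ x in 𝓝 p, h x ≠ 0 → fderiv ℂ (fun y => G y / h y) x ξ = F x) :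
    ∃ C : Vec n → ℂ, AnalyticAt ℂ C p ∧ ∀ᶠ x in 𝓝 p, h x ≠ 0 → G x / h x = C x := by
  obtain ⟨r₀, hr₀, hb⟩ := Metric.eventually_nhds_iff_ball.1 (hG.eventually_analyticAt.and
    (hh.eventually_analyticAt.and (hF.eventually_analyticAt.and hd)))
  have hline : ∀ x : Vec n, Continuous fun t : ℂ => x + t • ξ := fun x => by fun_prop
  have hh0 : AnalyticAt ℂ (fun t : ℂ => h (p + t • ξ)) 0 := by
    refine AnalyticAt.fun_comp (g := h) (by simpa using hh) ?_
    fun_prop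
  have hne := (hh0.eventually_eq_zero_or_eventually_ne_zero).resolve_left hξ
  obtain ⟨r₁, hr₁, hb₁⟩ := Metric.eventually_nhds_iff_ball.1 (eventually_nhdsWithin_iff.1 hne)
  obtain ⟨r, hr, hrr₁, hrξ⟩ : ∃ r > 0, r < r₁ ∧ 2 * r * ‖ξ‖ < r₀ / 2 := by
    refine ⟨min (r₁ / 2) (r₀ / (8 * (‖ξ‖ + 1))), by positivity,
      (min_le_left _ _).trans_lt (by linarith), ?_⟩
    calc 2 * min (r₁ / 2) (r₀ / (8 * (‖ξ‖ + 1))) * ‖ξ‖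
        ≤ 2 * (r₀ / (8 * (‖ξ‖ + 1))) * (‖ξ‖ + 1) := by
          gcongr
          · exact min_le_right _ _
          · linarith
      _ = r₀ / 4 := by field_simp; norm_num
      _ < r₀ / 2 := by linarith
  have hball : ∀ x ∈ Metric.ball p (r₀ / 2), ∀ t ∈ Metric.ball (0 : ℂ) (2 * r),
      x + t • ξ ∈ Metric.ball p r₀ := by
    intro x hx t ht
    rw [mem_ball_zero_iff] at ht
    rw [Metric.mem_ball, dist_eq_norm] at *
    calc ‖x + t • ξ - p‖ = ‖(x - p) + t • ξ‖ := by congr 1; abel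
      _ ≤ ‖x - p‖ + ‖t‖ * ‖ξ‖ := by rw [← norm_smul]; exact norm_add_le _ _
      _ < r₀ / 2 + r₀ / 2 := by
        have : ‖t‖ * ‖ξ‖ ≤ 2 * r * ‖ξ‖ := by gcongr
        linarith
      _ = r₀ := by ring
  have hsph : ∀ t ∈ Metric.sphere (0 : ℂ) r, t ∈ Metric.ball (0 : ℂ) (2 * r) := by
    intro t ht
    rw [mem_sphere_zero_iff_norm] at ht
    rw [mem_ball_zero_iff, ht]; linarith
  -- On the line through `p` the function `h` has no zeros for `0 < ‖t‖ < r₁`. By compactness of the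
  -- circle of radius `r < r₁`, it has none on the corresponding circles around points near `p`.
  have hcpt : ∀ᶠ x in 𝓝 p, ∀ t ∈ Metric.sphere (0 : ℂ) r, h (x + t • ξ) ≠ 0 := by
    refine (isCompact_sphere (0 : ℂ) r).eventually_forall_of_forall_eventually fun t ht => ?_
    have h1 : ContinuousAt (fun z : Vec n × ℂ => h (z.1 + z.2 • ξ)) (p, t) := by
      refine ContinuousAt.comp (g := h)
        (hb _ (hball p (Metric.mem_ball_self (by linarith)) t (hsph t ht))).2.1.continuousAt ?_
      fun_prop
    refine h1.eventually_ne ?_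
    have h2 := ht
    rw [mem_sphere_zero_iff_norm] at h2
    exact hb₁ t (by rw [mem_ball_zero_iff, h2]; exact hrr₁)
      (by rintro rfl; simp at h2; exact hr.ne h2)
  obtain ⟨δ, hδ, hbδ⟩ := Metric.eventually_nhds_iff_ball.1
    (hcpt.and (Metric.ball_mem_nhds p (half_pos hr₀)))
  set c : Vec n → ℂ := fun y => G y / h y with hc
  have hcirc : ∀ θ : ℝ, circleMap 0 r θ ∈ Metric.sphere (0 : ℂ) r := fun θ =>
    circleMap_mem_sphere 0 hr.le θ
  have han : AnalyticOnNhd ℂ (fun x => ∫ θ in (0 : ℝ)..2 * Real.pi, c (x + circleMap 0 r θ • ξ))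
      (Metric.ball p δ) := by
    have hca : ∀ x ∈ Metric.ball p δ, ∀ θ : ℝ, AnalyticAt ℂ c (x + circleMap 0 r θ • ξ) := by
      intro x hx θ
      have h1 := hb _ (hball x (hbδ x hx).2 _ (hsph _ (hcirc θ)))
      exact h1.1.div h1.2.1 ((hbδ x hx).1 _ (hcirc θ))
    refine analyticOnNhd_intervalIntegral Real.two_pi_pos.le Metric.isOpen_ball ?_ ?_
    · intro z hz
      refine ContinuousAt.continuousWithinAt ?_
      refine ContinuousAt.comp (g := c) (hca z.2 hz.2 z.1).continuousAt ?_
      have := continuous_circleMap (0 : ℂ) r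
      fun_prop
    · intro θ _ x hx
      refine DifferentiableAt.differentiableWithinAt ?_
      exact (hca x hx θ).differentiableAt.comp (𝕜 := ℂ) (f := fun x => x + circleMap 0 r θ • ξ) x
        (by fun_prop)
  -- The extension is the mean of `G / h` over these circles. If `h x ≠ 0`, then on the circle
  -- around `x` the quotient equals a primitive `Φ` of `F` plus a constant, and the mean value
  -- property returns `G x / h x`.
  refine ⟨fun x => (2 * Real.pi : ℝ)⁻¹ • ∫ θ in (0 : ℝ)..2 * Real.pi, c (x + circleMap 0 r θ • ξ),
    (han p (Metric.mem_ball_self hδ)).fun_const_smul, ?_⟩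
  filter_upwards [Metric.ball_mem_nhds p hδ] with x hx hx0
  have hb2 : ∀ t ∈ Metric.ball (0 : ℂ) (2 * r), AnalyticAt ℂ G (x + t • ξ) ∧
      AnalyticAt ℂ h (x + t • ξ) ∧ AnalyticAt ℂ F (x + t • ξ) ∧
      (h (x + t • ξ) ≠ 0 → fderiv ℂ c (x + t • ξ) ξ = F (x + t • ξ)) := fun t ht =>
    hb _ (hball x (hbδ x hx).2 t ht)
  have hFd : DifferentiableOn ℂ (fun t : ℂ => F (x + t • ξ)) (Metric.ball 0 (2 * r)) := fun t ht =>
    (hasDerivAt_line (hb2 t ht).2.2.1.differentiableAt).differentiableAt.differentiableWithinAt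
  obtain ⟨Φ, hΦ⟩ := hFd.isExactOn_ball
  have h0m : (0 : ℂ) ∈ Metric.ball (0 : ℂ) (2 * r) := Metric.mem_ball_self (by linarith)
  have hΦd : DifferentiableOn ℂ Φ (Metric.ball 0 (2 * r)) := fun t ht =>
    (hΦ t ht).differentiableAt.differentiableWithinAt
  have hΦa := hΦd.analyticOnNhd Metric.isOpen_ball
  set g : ℂ → ℂ := fun t => G (x + t • ξ) with hg
  set η : ℂ → ℂ := fun t => h (x + t • ξ) with hη
  have hlin : ∀ t : ℂ, AnalyticAt ℂ (fun t : ℂ => x + t • ξ) t := fun t => by fun_prop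
  have hga : AnalyticOnNhd ℂ g (Metric.ball 0 (2 * r)) := fun t ht =>
    AnalyticAt.fun_comp (g := G) (hb2 t ht).1 (hlin t)
  have hηa : AnalyticOnNhd ℂ η (Metric.ball 0 (2 * r)) := fun t ht =>
    AnalyticAt.fun_comp (g := h) (hb2 t ht).2.1 (hlin t)
  have hη0 : η 0 ≠ 0 := by simpa [hη] using hx0
  set k : ℂ := g 0 / η 0 - Φ 0 with hk
  -- near `0` the function `g / η - Φ` has zero derivative
  have hnear : (fun t => g t - Φ t * η t) =ᶠ[𝓝 0] fun t => k * η t := by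
    have hev : ∀ᶠ t in 𝓝 (0 : ℂ), η t ≠ 0 ∧ t ∈ Metric.ball (0 : ℂ) (2 * r) :=
      ((hηa 0 h0m).continuousAt.eventually_ne hη0).and (Metric.isOpen_ball.mem_nhds h0m)
    obtain ⟨ε, hε, hbε⟩ := Metric.eventually_nhds_iff_ball.1 hev
    have hder : ∀ t ∈ Metric.ball (0 : ℂ) ε, HasDerivAt (fun t => g t / η t - Φ t) 0 t := by
      intro t ht
      obtain ⟨h1, h2⟩ := hbε t ht
      have h3 := hasDerivAt_line (f := c) (x := x) (v := ξ) (t := t)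
        ((hb2 t h2).1.div (hb2 t h2).2.1 h1).differentiableAt
      rw [(hb2 t h2).2.2.2 h1] at h3
      have h5 := h3.sub (hΦ t h2)
      rw [sub_self] at h5
      exact h5
    filter_upwards [Metric.ball_mem_nhds (0 : ℂ) hε] with t ht
    have h4 := (convex_ball (0 : ℂ) ε).is_const_of_fderivWithin_eq_zero (𝕜 := ℂ)
      (f := fun t => g t / η t - Φ t)
      (fun s hs => (hder s hs).differentiableAt.differentiableWithinAt)
      (fun s hs => by
        rw [fderivWithin_of_isOpen Metric.isOpen_ball hs]
        ext
        simp [(hder s hs).hasFDerivAt.fderiv]) ht (Metric.mem_ball_self hε)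
    have h5 := (hbε t ht).1
    rw [hk, ← h4]
    field_simp
  have hall := AnalyticOnNhd.eqOn_of_preconnected_of_eventuallyEq
    (hga.sub (hΦa.mul hηa)) (analyticOnNhd_const.mul hηa)
    (convex_ball (0 : ℂ) (2 * r)).isPreconnected h0m hnear
  have hcval : ∀ θ : ℝ, c (x + circleMap 0 r θ • ξ) = Φ (circleMap 0 r θ) + k := by
    intro θ
    have h1 := hall (hsph _ (hcirc θ))
    have h2 : η (circleMap 0 r θ) ≠ 0 := (hbδ x hx).1 _ (hcirc θ)
    simp only [Pi.sub_apply] at h1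
    change g (circleMap 0 r θ) / η (circleMap 0 r θ) = _
    rw [div_eq_iff h2]
    linear_combination h1
  have hav : Real.circleAverage (fun t => Φ t + k) 0 r = Φ 0 + k := by
    refine DiffContOnCl.circleAverage ?_
    rw [abs_of_pos hr]
    refine DifferentiableOn.diffContOnCl ?_
    rw [closure_ball _ hr.ne']
    exact (hΦd.add_const k).mono (Metric.closedBall_subset_ball (by linarith))
  rw [Real.circleAverage_def] at hav
  simp only [hcval]
  rw [hav, hk]
  simp [hg, hη]

/-- The evaluations of monomials at the points of an open set span. -/
lemma span_monom_eq_top (s : Finset (Fin n →₀ ℕ)) {O : Set (Vec n)} (hO : IsOpen O)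
    (hne : O.Nonempty) :
    Submodule.span ℂ ((fun ξ : Vec n => fun k : s => monom ξ k) '' O) = ⊤ := by
  by_contra hcon
  obtain ⟨f, hf0, hf⟩ := Submodule.exists_le_ker_of_lt_top _ (lt_top_iff_ne_top.2 hcon)
  obtain ⟨ξ₀, hξ₀⟩ := hne
  obtain ⟨r, hr, hrO⟩ := Metric.isOpen_iff.1 hO ξ₀ hξ₀
  set a : s → ℂ := fun k => f (Pi.single k 1) with ha
  have hfa : ∀ w : s → ℂ, f w = ∑ k, a k * w k := by
    intro w
    conv_lhs => rw [pi_eq_sum_univ' w]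
    simp [map_sum, ha, mul_comm]
  set p : MvPolynomial (Fin n) ℂ := ∑ k : s, MvPolynomial.monomial k.1 (a k) with hp
  have hev : ∀ ξ : Vec n, MvPolynomial.eval ξ p = ∑ k : s, a k * monom ξ k := by
    intro ξ
    simp [hp, MvPolynomial.eval_monomial, Finsupp.prod_fintype, monom]
  -- A functional that kills all evaluations is a polynomial which vanishes on a polydisc, and such
  -- a polynomial is zero.
  have hp0 : p = 0 := by
    refine MvPolynomial.funext_set (fun i => Metric.ball (ξ₀ i) r) (fun i => ?_) fun ξ hξ => ?_
    · exact infinite_of_mem_nhds (ξ₀ i) (Metric.ball_mem_nhds _ hr)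
    · rw [hev, map_zero, ← hfa fun k : s => monom ξ k]
      refine LinearMap.mem_ker.1 (hf (Submodule.subset_span ⟨ξ, hrO ?_, rfl⟩))
      rw [← ball_pi _ hr] at hξ
      exact hξ
  refine hf0 (LinearMap.ext fun w => ?_)
  rw [hfa]
  have hak : ∀ k, a k = 0 := by
    intro k
    have h1 : MvPolynomial.coeff k.1 p = a k := by
      rw [hp, MvPolynomial.coeff_sum]
      simp only [MvPolynomial.coeff_monomial]
      rw [Finset.sum_eq_single k]
      · simp
      · intro b _ hb
        rw [if_neg fun h => hb (Subtype.ext h)]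
      · simp
    rw [← h1, hp0, MvPolynomial.coeff_zero]
  simp [hak]

/-- Any small `ξ` with `h (p + ξ) ≠ 0` will do: if `h` vanished on the line near `t = 0`, the
identity theorem would give zero at `t = 1` as well. -/
lemma isOpen_transversal {h : Vec n → ℂ} {p : Vec n} (hh : AnalyticAt ℂ h p)
    (h0 : ¬ ∀ᶠ x in 𝓝 p, h x = 0) :
    ∃ O : Set (Vec n), IsOpen O ∧ O.Nonempty ∧
      ∀ ξ ∈ O, ¬ ∀ᶠ t : ℂ in 𝓝 0, h (p + t • ξ) = 0 := by
  obtain ⟨r, hr, hb⟩ := Metric.eventually_nhds_iff_ball.1 hh.eventually_analyticAt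
  have hcont : ContinuousOn h (Metric.ball p r) := fun x hx =>
    (hb x hx).continuousAt.continuousWithinAt
  have hO1 : IsOpen (Metric.ball p r ∩ {x | h x ≠ 0}) :=
    hcont.isOpen_inter_preimage Metric.isOpen_ball isOpen_ne
  refine ⟨(fun ξ => p + ξ) ⁻¹' (Metric.ball p r ∩ {x | h x ≠ 0}),
    hO1.preimage (by fun_prop), ?_, ?_⟩
  · by_contra hcon
    refine h0 ?_
    filter_upwards [Metric.ball_mem_nhds p hr] with x hx
    by_contra hx0
    exact hcon ⟨x - p, by simpa using hx, by simpa using hx0⟩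
  · rintro ξ ⟨hξ, hξ0⟩ hz
    set S : Set ℂ := (fun t : ℂ => p + t • ξ) ⁻¹' Metric.ball p r with hS
    have hSc : Convex ℝ S := by
      intro a ha b hb' s t hs ht hst
      have := (convex_ball p r) ha hb' hs ht hst
      simp only [hS, Set.mem_preimage] at this ⊢
      convert this using 1
      have h2 : p = (s + t) • p := by rw [hst, one_smul]
      conv_lhs => rw [h2]
      simp only [add_smul, smul_add, smul_assoc]
      abel
    have han : AnalyticOnNhd ℂ (fun t : ℂ => h (p + t • ξ)) S := fun t ht =>
      AnalyticAt.fun_comp (g := h) (hb _ ht) (by fun_prop)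
    have := han.eqOn_zero_of_preconnected_of_eventuallyEq_zero hSc.isPreconnected
      (z₀ := 0) (by simpa [hS] using hr) hz (x := 1) (by simpa [hS] using hξ)
    exact hξ0 (by simpa using this)

end Extension

/-! ### Holomorphy of the coefficients of operators commuting with `L` -/

section Regularity

variable {n : ℕ}

/-- Off the zero set of `h` the function `c` agrees near `p` with a holomorphic function. -/
def ExtendsAt (h : Vec n → ℂ) (p : Vec n) (c : Vec n → ℂ) : Prop :=
  ∃ g : Vec n → ℂ, AnalyticAt ℂ g p ∧ ∀ᶠ x in 𝓝 p, h x ≠ 0 → c x = g x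

lemma ExtendsAt.add {h : Vec n → ℂ} {p : Vec n} {c d : Vec n → ℂ} (hc : ExtendsAt h p c)
    (hd : ExtendsAt h p d) : ExtendsAt h p fun x => c x + d x := by
  obtain ⟨g, hg, hcg⟩ := hc
  obtain ⟨k, hk, hdk⟩ := hd
  refine ⟨fun x => g x + k x, hg.add hk, ?_⟩
  filter_upwards [hcg, hdk] with x h1 h2 hx
  rw [h1 hx, h2 hx]

lemma ExtendsAt.mul {h : Vec n → ℂ} {p : Vec n} {c d : Vec n → ℂ} (hc : ExtendsAt h p c)
    (hd : ExtendsAt h p d) : ExtendsAt h p fun x => c x * d x := by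
  obtain ⟨g, hg, hcg⟩ := hc
  obtain ⟨k, hk, hdk⟩ := hd
  refine ⟨fun x => g x * k x, hg.mul hk, ?_⟩
  filter_upwards [hcg, hdk] with x h1 h2 hx
  rw [h1 hx, h2 hx]

lemma extendsAt_of_analyticAt {h : Vec n → ℂ} {p : Vec n} {c : Vec n → ℂ}
    (hc : AnalyticAt ℂ c p) : ExtendsAt h p c := ⟨c, hc, Eventually.of_forall fun _ _ => rfl⟩

lemma ExtendsAt.const_mul {h : Vec n → ℂ} {p : Vec n} {c : Vec n → ℂ} (a : ℂ)
    (hc : ExtendsAt h p c) : ExtendsAt h p fun x => a * c x :=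
  (extendsAt_of_analyticAt analyticAt_const).mul hc

lemma ExtendsAt.sum {ι : Type*} {h : Vec n → ℂ} {p : Vec n} {c : ι → Vec n → ℂ} (s : Finset ι)
    (hc : ∀ i ∈ s, ExtendsAt h p (c i)) : ExtendsAt h p fun x => ∑ i ∈ s, c i x := by
  classical
  induction s using Finset.induction_on with
  | empty => simpa using extendsAt_of_analyticAt analyticAt_const
  | insert a s ha ih =>
    simp only [Finset.sum_insert ha]
    exact (hc a (Finset.mem_insert_self a s)).add
      (ih fun i hi => hc i (Finset.mem_insert_of_mem hi))

lemma ExtendsAt.congr {h : Vec n → ℂ} {p : Vec n} {c d : Vec n → ℂ} (hc : ExtendsAt h p c)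
    (hcd : ∀ᶠ x in 𝓝 p, h x ≠ 0 → d x = c x) : ExtendsAt h p d := by
  obtain ⟨g, hg, hcg⟩ := hc
  refine ⟨g, hg, ?_⟩
  filter_upwards [hcg, hcd] with x h1 h2 hx
  rw [h2 hx, h1 hx]

lemma eventually_eventually_ne {h : Vec n → ℂ} {p : Vec n} (hh : AnalyticAt ℂ h p)
    {Q : Vec n → Prop} (hQ : ∀ᶠ x in 𝓝 p, h x ≠ 0 → Q x) :
    ∀ᶠ x in 𝓝 p, h x ≠ 0 → ∀ᶠ y in 𝓝 x, Q y := by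
  filter_upwards [hQ.eventually_nhds, hh.eventually_analyticAt] with x h1 h2 hx
  filter_upwards [h1, h2.continuousAt.eventually_ne hx] with y h3 h4 using h3 h4

lemma ExtendsAt.pd {h : Vec n → ℂ} {p : Vec n} {c : Vec n → ℂ} (hh : AnalyticAt ℂ h p)
    (hc : ExtendsAt h p c) (i : Fin n) : ExtendsAt h p (pd i c) := by
  obtain ⟨g, hg, hcg⟩ := hc
  refine ⟨GenLame.pd i g, analyticAt_pd i hg, ?_⟩
  filter_upwards [eventually_eventually_ne hh hcg] with x h1 hx
  exact pd_congr_at i (h1 hx)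

/-- A differential operator with meromorphic coefficients which commutes with a Schrödinger
operator has holomorphic coefficients wherever the potential is holomorphic. -/
lemma extendsAt_coeff (P : EllipticPotential n) {D : DiffOp n} (hc : P.schrodinger.Commutes D)
    {p : Vec n} (hu : AnalyticAt ℂ P.u p) {h : Vec n → ℂ} (hh : AnalyticAt ℂ h p)
    (h0 : ¬ ∀ᶠ x in 𝓝 p, h x = 0)
    (hD : ∀ k, ∃ G : Vec n → ℂ, AnalyticAt ℂ G p ∧ ∀ᶠ x in 𝓝 p, h x ≠ 0 → D k x = G x / h x) :
    ∀ k, ExtendsAt h p (D k) := by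
  obtain ⟨O, hO, hOne, hOt⟩ := isOpen_transversal hh h0
  choose G hG hDG using hD
  have hreg : ∀ᶠ x in 𝓝 p, h x ≠ 0 → D.RegularAt x ∧
      ∀ k ∈ D.support, D k =ᶠ[𝓝 x] fun y => G k y / h y := by
    have h1 : ∀ᶠ x in 𝓝 p, ∀ k ∈ D.support, h x ≠ 0 → D k x = G k x / h x :=
      (Filter.eventually_all_finset _).2 fun k _ => hDG k
    have h2 : ∀ᶠ x in 𝓝 p, ∀ k ∈ D.support, AnalyticAt ℂ (G k) x :=
      (Filter.eventually_all_finset _).2 fun k _ => (hG k).eventually_analyticAt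
    have h3 : ∀ᶠ x in 𝓝 p, h x ≠ 0 → ∀ k ∈ D.support, D k x = G k x / h x := by
      filter_upwards [h1] with x hx hx0 k hk using hx k hk hx0
    filter_upwards [eventually_eventually_ne hh h3, h2, hh.eventually_analyticAt]
      with x h4 h5 h6 hx
    have h7 : ∀ k ∈ D.support, D k =ᶠ[𝓝 x] fun y => G k y / h y := fun k hk => by
      filter_upwards [h4 hx] with y hy using hy k hk
    refine ⟨fun k => ?_, h7⟩
    by_cases hk : k ∈ D.support
    · exact ((h5 k hk).div h6 hx).congr (h7 k hk).symm
    · rw [Finsupp.notMem_support_iff.1 hk]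
      exact analyticAt_const
  have hzero : ∀ k ∉ D.support, ExtendsAt h p (D k) := fun k hk => by
    rw [Finsupp.notMem_support_iff.1 hk]
    exact extendsAt_of_analyticAt analyticAt_const
  -- Descending induction on the order `m`. The number `N` counts the steps down from above the
  -- order of `D`, where all coefficients vanish.
  have main : ∀ N m : ℕ, (D.support.sup fun k => k.degree) < N + m →
      ∀ k, m ≤ k.degree → ExtendsAt h p (D k) := by
    intro N
    induction N with
    | zero =>
      intro m hm k hk
      refine hzero k fun hks => ?_
      have := Finset.le_sup (f := fun k : Fin n →₀ ℕ => k.degree) hks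
      omega
    | succ N ih =>
      intro m hm
      have ihm := ih (m + 1) (by omega)
      set s := D.support.filter fun k => k.degree = m with hs
      -- The combinations `∑ ξ ^ k D_k` with transversal `ξ` span all combinations of the
      -- coefficients of order `m`. For these special ones `commutator_coeff` supplies a holomorphic
      -- derivative along `ξ`, so their poles can be removed.
      have hspan : ∀ w : s → ℂ, ExtendsAt h p fun x => ∑ k : s, w k * D k x := by
        intro w
        have hw : w ∈ Submodule.span ℂ ((fun ξ : Vec n => fun k : s => monom ξ k) '' O) := by
          rw [span_monom_eq_top s hO hOne]; trivial
        induction hw using Submodule.span_induction with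
        | zero => simpa using extendsAt_of_analyticAt analyticAt_const
        | add a b _ _ ha hb =>
          refine (ha.add hb).congr (Eventually.of_forall fun x _ => ?_)
          rw [← Finset.sum_add_distrib]
          exact Finset.sum_congr rfl fun k _ => by rw [Pi.add_apply, add_mul]
        | smul a b _ hb =>
          refine (hb.const_mul a).congr (Eventually.of_forall fun x _ => ?_)
          rw [Finset.mul_sum]
          exact Finset.sum_congr rfl fun k _ => by rw [Pi.smul_apply, smul_eq_mul, mul_assoc]
        | mem w hw =>
          obtain ⟨ξ, hξ, rfl⟩ := hw
          set F : Vec n → ℂ := fun x =>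
            2⁻¹ * ((-1) * (∑ k ∈ D.support with k.degree = m + 1,
                monom ξ k * ∑ j, GenLame.pd j (GenLame.pd j (D k)) x) +
              (-1) * ∑ k ∈ D.support with m + 1 < k.degree,
                D k x * leibniz ξ P.u (multiList k) (m + 1) x) with hF
          have hFe : ExtendsAt h p F := by
            refine ((ExtendsAt.sum _ fun k hk => (ExtendsAt.sum _ fun j _ => ?_).const_mul _).const_mul
              _ |>.add ((ExtendsAt.sum _ fun k hk => ?_).const_mul _)).const_mul _
            · exact ((ihm k (Finset.mem_filter.1 hk).2.ge).pd hh j).pd hh j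
            · exact (ihm k (Finset.mem_filter.1 hk).2.le).mul
                (extendsAt_of_analyticAt (analyticAt_leibniz ξ hu _ _))
          obtain ⟨F', hF', hFF⟩ := hFe
          set Gξ : Vec n → ℂ := fun x => ∑ k : s, monom ξ k * G k x with hGξ
          have hGa : AnalyticAt ℂ Gξ p :=
            Finset.analyticAt_fun_sum _ fun k _ => analyticAt_const.mul (hG k)
          have heq : ∀ x, (∀ k ∈ D.support, D k x = G k x / h x) →
              ∑ k : s, monom ξ k * D k x = Gξ x / h x := by
            intro x hx
            rw [hGξ, Finset.sum_div]
            refine Finset.sum_congr rfl fun k _ => ?_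
            rw [hx k (Finset.mem_filter.1 k.2).1, mul_div_assoc]
          obtain ⟨C, hC, hCe⟩ := exists_analyticAt_of_fderiv_apply hGa hh hF' (hOt ξ hξ) (by
            filter_upwards [hreg, hFF, hu.eventually_analyticAt] with x h1 h2 h3 hx
            obtain ⟨h4, h5⟩ := h1 hx
            rw [← h2 hx]
            have h6 : (fun y => Gξ y / h y) =ᶠ[𝓝 x] fun y => ∑ k : s, monom ξ k * D k y := by
              have h7 : ∀ᶠ y in 𝓝 x, ∀ k ∈ D.support, D k y = G k y / h y :=
                (Filter.eventually_all_finset _).2 h5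
              filter_upwards [h7] with y hy using (heq y hy).symm
            rw [h6.fderiv_eq, fderiv_fun_sum (A := fun (k : s) y => monom ξ k.1 * D k.1 y) fun k _ =>
              (analyticAt_const_mul (monom ξ k.1) (h4 k.1)).differentiableAt]
            have h8 := commutator_coeff P hc h4 h3 ξ m
            have h9 : (∑ k : s, fderiv ℂ (fun y => monom ξ k * D k y) x) ξ =
                ∑ k ∈ D.support with k.degree = m, monom ξ k * fderiv ℂ (D k) x ξ := by
              rw [← hs, ← Finset.sum_coe_sort s]
              simp only [FunLike.coe_sum, Finset.sum_apply]
              refine Finset.sum_congr rfl fun k _ => ?_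
              rw [fderiv_const_mul (h4 k).differentiableAt]
              rfl
            rw [h9]
            simp only [hF]
            linear_combination h8 / 2)
          refine ⟨C, hC, ?_⟩
          filter_upwards [hCe, hreg] with x h1 h2 hx
          rw [← h1 hx]
          exact heq x fun k hk => ((h2 hx).2 k hk).eq_of_nhds
      intro k hk
      rcases hk.lt_or_eq with h1 | h1
      · exact ihm k h1
      · by_cases hks : k ∈ D.support
        · have hks' : k ∈ s := Finset.mem_filter.2 ⟨hks, h1.symm⟩
          refine (hspan (Pi.single ⟨k, hks'⟩ 1)).congr (Eventually.of_forall fun x _ => ?_)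
          rw [Finset.sum_eq_single (⟨k, hks'⟩ : s)]
          · simp
          · intro b _ hb
            simp [hb]
          · simp
        · exact hzero k hks
  intro k
  exact main ((D.support.sup fun k => k.degree) + 1) 0 (by omega) k (Nat.zero_le _)

end Regularity

/-! ### An equivalent system with holomorphic coefficients -/

section Potential

variable {n : ℕ} (P : EllipticPotential n)

lemma notMem_lattice_of_notMem_sing {x : Vec n} (hx : x ∉ P.sing) {α : AffineFun n}
    (hα : α ∈ P.A) : α.1 ⬝ᵥ x + α.2 ∉ (periodPair P.τ P.im_pos).lattice := by
  intro h
  obtain ⟨a, b, hab⟩ := PeriodPair.mem_lattice.1 h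
  refine hx ⟨α, hα, a, b, ?_⟩
  simp only [periodPair] at hab
  simp only [hyperplane, shifted, Set.mem_ofPred_eq, ← hab]
  ring

lemma analyticAt_affine (α : AffineFun n) (x : Vec n) :
    AnalyticAt ℂ (fun y : Vec n => α.1 ⬝ᵥ y + α.2) x := (analyticAt_dot α.1 x).add analyticAt_const

lemma analyticAt_u {x : Vec n} (hx : x ∉ P.sing) : AnalyticAt ℂ P.u x := by
  unfold EllipticPotential.u
  refine Finset.analyticAt_fun_sum _ fun α hα => analyticAt_const.mul ?_
  refine AnalyticAt.fun_comp (g := (periodPair P.τ P.im_pos).weierstrassP) ?_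
    (analyticAt_affine α x)
  exact (periodPair P.τ P.im_pos).analyticOnNhd_weierstrassP _
    (notMem_lattice_of_notMem_sing P hx hα)

/-- Used to pass from identities off the zero set of `h` to identities at all nearby points. -/
lemma frequently_of_not_eventually_zero {h : Vec n → ℂ} {p : Vec n} (hh : AnalyticAt ℂ h p)
    (h0 : ¬ ∀ᶠ x in 𝓝 p, h x = 0) : ∀ᶠ x in 𝓝 p, ∃ᶠ y in 𝓝 x, h y ≠ 0 := by
  obtain ⟨r, hr, hb⟩ := Metric.eventually_nhds_iff_ball.1 hh.eventually_analyticAt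
  filter_upwards [Metric.ball_mem_nhds p hr] with x hx hx0
  refine h0 ?_
  have h1 : h =ᶠ[𝓝 x] 0 := by
    filter_upwards [hx0] with y hy using not_not.1 hy
  have := AnalyticOnNhd.eqOn_zero_of_preconnected_of_eventuallyEq_zero (fun z hz => hb z hz)
    (convex_ball p r).isPreconnected hx h1
  filter_upwards [Metric.ball_mem_nhds p hr] with y hy using this hy

/-- The ring of holomorphic germs is a domain. -/
lemma not_eventually_prod_eq_zero {ι : Type*} (s : Finset ι) {h : ι → Vec n → ℂ} {p : Vec n}
    (hh : ∀ i ∈ s, AnalyticAt ℂ (h i) p) (h0 : ∀ i ∈ s, ¬ ∀ᶠ x in 𝓝 p, h i x = 0) :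
    ¬ ∀ᶠ x in 𝓝 p, ∏ i ∈ s, h i x = 0 := by
  classical
  induction s using Finset.induction_on with
  | empty => simpa [Filter.eventually_false_iff_eq_bot] using (inferInstance : (𝓝 p).NeBot).ne
  | insert a s ha ih =>
    intro hz
    have h1 := ih (fun i hi => hh i (Finset.mem_insert_of_mem hi))
      fun i hi => h0 i (Finset.mem_insert_of_mem hi)
    have h2 : AnalyticAt ℂ (fun x => ∏ i ∈ s, h i x) p :=
      Finset.analyticAt_fun_prod _ fun i hi => hh i (Finset.mem_insert_of_mem hi)
    have h3 : AnGerm.of (h a) (hh a (Finset.mem_insert_self a s)) * AnGerm.of _ h2 = 0 := by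
      refine Subtype.ext (Germ.coe_eq.2 ?_)
      filter_upwards [hz] with x hx
      rwa [Finset.prod_insert ha] at hx
    rcases mul_eq_zero.1 h3 with h4 | h4
    · exact h0 a (Finset.mem_insert_self a s) (Germ.coe_eq.1 (congrArg Subtype.val h4))
    · exact h1 (Germ.coe_eq.1 (congrArg Subtype.val h4))

/-- The system `Lᵢ ψ = λᵢ ψ` is, near each point off the singular locus, equivalent to a system
with holomorphic coefficients. -/
lemma exists_regular_system [NeZero n] {L : Fin n → DiffOp n} (hL : P.StronglyIntegrable L)
    (lam : Fin n → ℂ) {s : Fin n → MvPolynomial (Fin n) ℂ} {d : Fin n → ℕ}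
    (hs : ∀ i, (L i).HasHighestSymbol (s i) (d i)) {p : Vec n} (hp : p ∉ P.sing) :
    ∃ r > 0, ∃ D : Fin n → DiffOp n,
      (∀ i k, AnalyticOnNhd ℂ (D i k) (Metric.ball p r)) ∧
      (∀ i, (D i).HasHighestSymbol (s i) (d i)) ∧
      (∀ y ∈ Metric.ball p r, ∀ ψ : Vec n → ℂ, IsSol L lam ψ y ↔
        AnalyticAt ℂ ψ y ∧ ∀ᶠ x in 𝓝 y, ∀ i, (D i).apply ψ x = lam i * ψ x) ∧
      ∃ h : Vec n → ℂ, AnalyticAt ℂ h p ∧ (¬ ∀ᶠ x in 𝓝 p, h x = 0) ∧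
        ∀ i k, ∀ᶠ x in 𝓝 p, h x ≠ 0 → L i k x = D i k x := by
  classical
  choose g h hg hh h0 hgh using fun (i : Fin n) (k : Fin n →₀ ℕ) => hL.meromorphic i k p
  set S : Finset (Fin n × (Fin n →₀ ℕ)) :=
    Finset.univ.biUnion fun i => (L i).support.image fun k => (i, k) with hS
  have hmem : ∀ i, ∀ k ∈ (L i).support, (i, k) ∈ S := fun i k hk =>
    Finset.mem_biUnion.2 ⟨i, Finset.mem_univ i, Finset.mem_image_of_mem _ hk⟩
  -- A common denominator for all non-zero coefficients of all the operators.
  set H : Vec n → ℂ := fun x => ∏ j ∈ S, h j.1 j.2 x with hH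
  have hHa : AnalyticAt ℂ H p := Finset.analyticAt_fun_prod _ fun j _ => hh j.1 j.2
  have hH0 : ¬ ∀ᶠ x in 𝓝 p, H x = 0 :=
    not_eventually_prod_eq_zero S (fun j _ => hh j.1 j.2) fun j _ => h0 j.1 j.2
  have hext : ∀ i k, ExtendsAt H p (L i k) := by
    intro i
    refine extendsAt_coeff P (by rw [← hL.first]; exact hL.commutes 0 i) (analyticAt_u P hp) hHa
      hH0 fun k => ?_
    by_cases hk : k ∈ (L i).support
    · refine ⟨fun x => g i k x * ∏ j ∈ S.erase (i, k), h j.1 j.2 x,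
        (hg i k).mul (Finset.analyticAt_fun_prod _ fun j _ => hh j.1 j.2), ?_⟩
      filter_upwards [hgh i k] with x hx hx0
      have h1 : H x = h i k x * ∏ j ∈ S.erase (i, k), h j.1 j.2 x :=
        (Finset.mul_prod_erase S (fun j => h j.1 j.2 x) (hmem i k hk)).symm
      rw [h1] at hx0 ⊢
      rw [hx (left_ne_zero_of_mul hx0), mul_div_mul_right _ _ (right_ne_zero_of_mul hx0)]
    · refine ⟨fun _ => 0, analyticAt_const, Eventually.of_forall fun x _ => ?_⟩
      rw [Finsupp.notMem_support_iff.1 hk]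
      simp
  choose C hC hCe using hext
  -- In degree `d i` the coefficient is the symbol itself, so that the highest symbol is correct at
  -- every point and not only where `H ≠ 0`.
  set c : Fin n → (Fin n →₀ ℕ) → Vec n → ℂ := fun i k =>
    if k.degree = d i then fun _ => (s i).coeff k else if k ∈ (L i).support then C i k else 0 with hc
  have hcz : ∀ i k, k ∉ (L i).support → c i k = 0 := by
    intro i k hk
    simp only [hc]
    split_ifs with h1
    · rw [← (hs i).2.2 k h1, Finsupp.notMem_support_iff.1 hk]
    · rfl
  have hce : ∀ i k, AnalyticAt ℂ (c i k) p ∧ ∀ᶠ x in 𝓝 p, H x ≠ 0 → L i k x = c i k x := by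
    intro i k
    simp only [hc]
    split_ifs with h1 h2
    · refine ⟨analyticAt_const, Eventually.of_forall fun x _ => ?_⟩
      rw [(hs i).2.2 k h1]
    · exact ⟨hC i k, hCe i k⟩
    · refine ⟨analyticAt_const, Eventually.of_forall fun x _ => ?_⟩
      rw [Finsupp.notMem_support_iff.1 h2]
  have hev : ∀ᶠ x in 𝓝 p, ∀ j ∈ S, AnalyticAt ℂ (c j.1 j.2) x ∧
      (H x ≠ 0 → L j.1 j.2 x = c j.1 j.2 x) :=
    (Filter.eventually_all_finset _).2 fun j _ =>
      (hce j.1 j.2).1.eventually_analyticAt.and (hce j.1 j.2).2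
  obtain ⟨r, hr, hb⟩ := Metric.eventually_nhds_iff_ball.1
    (hev.and (hHa.eventually_analyticAt.and (frequently_of_not_eventually_zero hHa hH0)))
  set D : Fin n → DiffOp n := fun i => Finsupp.onFinset (L i).support (c i) (fun k hk => by
    by_contra hk'
    exact hk (hcz i k hk')) with hD
  have hDk : ∀ i k, D i k = c i k := fun i k => rfl
  have hDsup : ∀ i, (D i).support ⊆ (L i).support := fun i => Finsupp.support_onFinset_subset
  have hDan : ∀ i k, AnalyticOnNhd ℂ (D i k) (Metric.ball p r) := by
    intro i k x hx
    by_cases hk : k ∈ (L i).support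
    · exact ((hb x hx).1 (i, k) (hmem i k hk)).1
    · rw [hDk, hcz i k hk]
      exact analyticAt_const
  refine ⟨r, hr, D, hDan, fun i => ⟨(hs i).1, fun k hk => ?_, fun k hk => ?_⟩,
    fun y hy ψ => ?_, H, hHa, hH0, fun i k => (hce i k).2⟩
  · rw [hDk]
    exact hcz i k (Finsupp.notMem_support_iff.2 ((hs i).2.1 k hk))
  · rw [hDk]
    simp only [hc, if_pos hk]
  · have hHne : ∀ x ∈ Metric.ball p r, H x ≠ 0 → ∀ i k, L i k =ᶠ[𝓝 x] D i k := by
      intro x hx hx0 i k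
      by_cases hk : k ∈ (L i).support
      · filter_upwards [Metric.isOpen_ball.mem_nhds hx,
          (hb x hx).2.1.continuousAt.eventually_ne hx0] with z hz hz0
        exact ((hb z hz).1 (i, k) (hmem i k hk)).2 hz0
      · rw [hDk, hcz i k hk, Finsupp.notMem_support_iff.1 hk]
    have hap : ∀ i x, (∀ k, L i k x = D i k x) → (L i).apply ψ x = (D i).apply ψ x := by
      intro i x hx
      rw [DiffOp.apply_eq_sum (L i) (Finset.Subset.refl _), DiffOp.apply_eq_sum (D i) (hDsup i)]
      exact Finset.sum_congr rfl fun k _ => by rw [hx k]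
    -- The values of `L i k` on `H = 0` carry no information. Both directions use that the two
    -- operators agree on the dense set `H ≠ 0` and give continuous results at the points where the
    -- equations are required.
    refine and_congr_right fun hψ => ⟨fun hsol => ?_, fun hsol => ?_⟩
    · filter_upwards [hsol.eventually_nhds, hψ.eventually_analyticAt,
        Metric.isOpen_ball.mem_nhds hy] with x h1 h2 h3 i
      by_contra hcon
      have h4 : AnalyticAt ℂ ((D i).apply ψ) x := analyticAt_apply (fun k => hDan i k x h3) h2
      have h5 : ∀ᶠ z in 𝓝 x, (D i).apply ψ z - lam i * ψ z ≠ 0 :=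
        (h4.sub (analyticAt_const.mul h2)).continuousAt.eventually_ne (sub_ne_zero.2 hcon)
      obtain ⟨z, hz0, hz1, hz2, hz3⟩ := ((hb x h3).2.2.and_eventually
        (h1.and (h5.and (Metric.isOpen_ball.mem_nhds h3)))).exists
      refine hz2 ?_
      have h6 := hHne z hz3 hz0 i
      rw [← hap i z fun k => (h6 k).eq_of_nhds, hz1 i fun k => (hDan i k z hz3).congr (h6 k).symm,
        sub_self]
    · filter_upwards [hsol, hψ.eventually_analyticAt, Metric.isOpen_ball.mem_nhds hy]
        with x h1 h2 h3 i hreg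
      rw [← h1 i]
      by_contra hcon
      have h4 : AnalyticAt ℂ ((D i).apply ψ) x := analyticAt_apply (fun k => hDan i k x h3) h2
      have h5 : ∀ᶠ z in 𝓝 x, (L i).apply ψ z - (D i).apply ψ z ≠ 0 :=
        ((analyticAt_apply hreg h2).sub h4).continuousAt.eventually_ne (sub_ne_zero.2 hcon)
      obtain ⟨z, hz0, hz2, hz3⟩ := ((hb x h3).2.2.and_eventually
        (h5.and (Metric.isOpen_ball.mem_nhds h3))).exists
      refine hz2 ?_
      rw [hap i z fun k => (hHne z hz3 hz0 i k).eq_of_nhds, sub_self]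

end Potential

/-! ### Consequences of finiteness over the symbols -/

section Algebra

variable {n : ℕ}

/-- Multiplication by `s` raises all degrees by `d`, so only the component of `q` of degree `N - d`
contributes. The conditional sum also covers `N < d`, where there is no such component. -/
lemma homogeneousComponent_mul_of_isHomogeneous (q s : MvPolynomial (Fin n) ℂ) {d : ℕ}
    (hs : s.IsHomogeneous d) (N : ℕ) :
    ∃ q' : MvPolynomial (Fin n) ℂ, MvPolynomial.homogeneousComponent N (q * s) = q' * s ∧
      ∀ k ∈ q'.support, k.degree + d = N := by
  refine ⟨∑ e ∈ Finset.range (q.totalDegree + 1),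
    if e + d = N then MvPolynomial.homogeneousComponent e q else 0, ?_, fun k hk => ?_⟩
  · conv_lhs => rw [← MvPolynomial.sum_homogeneousComponent q]
    rw [Finset.sum_mul, map_sum, Finset.sum_mul]
    refine Finset.sum_congr rfl fun e _ => ?_
    rw [MvPolynomial.homogeneousComponent_of_mem
      ((MvPolynomial.homogeneousComponent_isHomogeneous e q).mul hs)]
    by_cases h : e + d = N
    · rw [if_pos h, if_pos h.symm]
    · rw [if_neg h, if_neg (Ne.symm h), zero_mul]
  · rw [MvPolynomial.mem_support_iff, MvPolynomial.coeff_sum] at hk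
    obtain ⟨e, -, he⟩ := Finset.exists_ne_zero_of_sum_ne_zero hk
    split_ifs at he with h
    · rw [MvPolynomial.coeff_homogeneousComponent] at he
      split_ifs at he with h'
      · rw [h', h]
      · exact absurd rfl he
    · simp at he

/-- If the polynomial ring is finite over the algebra generated by homogeneous polynomials, then
all monomials of some degree are in the ideal generated by these polynomials. -/
lemma exists_monomial_eq_sum {s : Fin n → MvPolynomial (Fin n) ℂ} {d : Fin n → ℕ}
    (hs : ∀ i, (s i).IsHomogeneous (d i))
    (hfin : Module.Finite (Algebra.adjoin ℂ (Set.range s)) (MvPolynomial (Fin n) ℂ)) :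
    ∃ R : ℕ, ∀ b : Fin n →₀ ℕ, b.degree = R + 1 → ∃ q : Fin n → MvPolynomial (Fin n) ℂ,
      MvPolynomial.monomial b 1 = ∑ i, q i * s i ∧ ∀ i, ∀ k ∈ (q i).support, k.degree + d i = R + 1 := by
  obtain ⟨T, hT⟩ := hfin.fg_top
  set I := Ideal.span (Set.range s) with hI
  set R := T.sup MvPolynomial.totalDegree with hR
  -- Modulo the ideal generated by the symbols, the algebra which they generate reduces to the
  -- constants.
  have hadj : ∀ a ∈ Algebra.adjoin ℂ (Set.range s), ∃ c : ℂ, a - MvPolynomial.C c ∈ I := by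
    intro a ha
    induction ha using Algebra.adjoin_induction with
    | mem x hx => exact ⟨0, by simpa using Ideal.subset_span hx⟩
    | algebraMap c => exact ⟨c, by simp [MvPolynomial.algebraMap_eq]⟩
    | add x y _ _ hx hy =>
      obtain ⟨c, hc⟩ := hx
      obtain ⟨c', hc'⟩ := hy
      refine ⟨c + c', ?_⟩
      convert I.add_mem hc hc' using 1
      rw [map_add]; ring
    | mul x y _ _ hx hy =>
      obtain ⟨c, hc⟩ := hx
      obtain ⟨c', hc'⟩ := hy
      refine ⟨c * c', ?_⟩
      convert I.add_mem (I.mul_mem_left x hc') (I.mul_mem_right (MvPolynomial.C c') hc) using 1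
      rw [map_mul]; ring
  -- Hence every polynomial is congruent modulo `I` to a complex combination of the module
  -- generators, whose degrees are at most `R`.
  have hall : ∀ f : MvPolynomial (Fin n) ℂ, ∃ g ∈ I, (f - g).totalDegree ≤ R := by
    intro f
    have hf : f ∈ Submodule.span (Algebra.adjoin ℂ (Set.range s)) (T : Set (MvPolynomial (Fin n) ℂ)) := by
      rw [hT]; trivial
    induction hf using Submodule.span_induction with
    | mem x hx => exact ⟨0, I.zero_mem, by
        rw [sub_zero]; exact Finset.le_sup (f := MvPolynomial.totalDegree) hx⟩
    | zero => exact ⟨0, I.zero_mem, by simp⟩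
    | add x y _ _ hx hy =>
      obtain ⟨g, hg, h1⟩ := hx
      obtain ⟨g', hg', h2⟩ := hy
      refine ⟨g + g', I.add_mem hg hg', ?_⟩
      rw [add_sub_add_comm]
      exact (MvPolynomial.totalDegree_add _ _).trans (max_le h1 h2)
    | smul a x _ hx =>
      obtain ⟨g, hg, h1⟩ := hx
      obtain ⟨c, hc⟩ := hadj a.1 a.2
      refine ⟨(a.1 - MvPolynomial.C c) * x + MvPolynomial.C c * g,
        I.add_mem (I.mul_mem_right _ hc) (I.mul_mem_left _ hg), ?_⟩
      have h2 : a • x - ((a.1 - MvPolynomial.C c) * x + MvPolynomial.C c * g) =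
          MvPolynomial.C c * (x - g) := by
        rw [Subalgebra.smul_def, smul_eq_mul]; ring
      rw [h2]
      refine (MvPolynomial.totalDegree_mul _ _).trans ?_
      rwa [MvPolynomial.totalDegree_C, zero_add]
  refine ⟨R, fun b hb => ?_⟩
  obtain ⟨g, hg, hd⟩ := hall (MvPolynomial.monomial b 1)
  obtain ⟨c, hc⟩ := Ideal.mem_span_range_iff_exists_fun.1 hg
  choose q hq hqd using fun i => homogeneousComponent_mul_of_isHomogeneous (c i) (s i) (hs i) (R + 1)
  refine ⟨q, ?_, hqd⟩
  -- The degree `R + 1` lies just above the degree of the remainder, so passing to the component of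
  -- this degree removes the remainder.
  have h1 : MvPolynomial.homogeneousComponent (R + 1)
      (MvPolynomial.monomial b (1 : ℂ)) = MvPolynomial.monomial b 1 :=
    MvPolynomial.homogeneousComponent_eq_self (MvPolynomial.isHomogeneous_monomial 1 hb)
  have h2 : MvPolynomial.homogeneousComponent (R + 1) (MvPolynomial.monomial b (1 : ℂ) - g) = 0 :=
    MvPolynomial.homogeneousComponent_eq_zero (R + 1) _ (by omega)
  rw [map_sub, h1, sub_eq_zero] at h2
  rw [h2, ← hc, map_sum]
  exact Finset.sum_congr rfl fun i _ => hq i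

/-- A symbol of degree `0` would be a constant, and constants are algebraic. -/
lemma pos_of_isHomogeneous_of_algebraicIndependent {s : Fin n → MvPolynomial (Fin n) ℂ}
    (hs : AlgebraicIndependent ℂ s) {i : Fin n} {d : ℕ} (hd : (s i).IsHomogeneous d) : 0 < d := by
  rcases Nat.eq_zero_or_pos d with rfl | h
  · have h1 := (MvPolynomial.totalDegree_zero_iff_isHomogeneous (p := s i)).2 hd
    have h2 := MvPolynomial.totalDegree_eq_zero_iff_eq_C.1 h1
    refine absurd ?_ (hs.transcendental i)
    rw [h2]
    exact isAlgebraic_algebraMap _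
  · exact h

end Algebra

/-! ### Reduction of derivatives of solutions to lower order -/

section Representation

variable {n : ℕ}

/-- The multi-indices of degree less than `N`. -/
def degLT (n N : ℕ) : Finset (Fin n →₀ ℕ) := (Finsupp.finite_of_degree_lt (σ := Fin n) N).toFinset

@[simp] lemma mem_degLT {N : ℕ} {k : Fin n →₀ ℕ} : k ∈ degLT n N ↔ k.degree < N := by
  simp [degLT]

/-- On the solutions in `B` the operator `T` agrees with a combination of the derivatives `∂ᵏ`,
`k ∈ s`, with holomorphic coefficients. -/
def Reduces (B : Set (Vec n)) (S : (Vec n → ℂ) → Vec n → Prop) (s : Finset (Fin n →₀ ℕ))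
    (T : (Vec n → ℂ) → Vec n → ℂ) : Prop :=
  ∃ a : (Fin n →₀ ℕ) → Vec n → ℂ, (∀ k, AnalyticOnNhd ℂ (a k) B) ∧
    ∀ y ∈ B, ∀ ψ, S ψ y → T ψ =ᶠ[𝓝 y] fun x => ∑ k ∈ s, a k x * mixedPd k ψ x

variable {B : Set (Vec n)} {S : (Vec n → ℂ) → Vec n → Prop} {s t : Finset (Fin n →₀ ℕ)}
  {T T' : (Vec n → ℂ) → Vec n → ℂ}

lemma Reduces.congr (h : Reduces B S s T)
    (hT : ∀ y ∈ B, ∀ ψ, S ψ y → T' ψ =ᶠ[𝓝 y] T ψ) : Reduces B S s T' := by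
  obtain ⟨a, ha, h⟩ := h
  exact ⟨a, ha, fun y hy ψ hψ => (hT y hy ψ hψ).trans (h y hy ψ hψ)⟩

lemma reduces_zero : Reduces B S s fun _ _ => 0 :=
  ⟨0, fun _ _ _ => analyticAt_const, fun _ _ _ _ => Eventually.of_forall fun _ => by simp⟩

lemma Reduces.add (h : Reduces B S s T) (h' : Reduces B S s T') :
    Reduces B S s fun ψ x => T ψ x + T' ψ x := by
  obtain ⟨a, ha, h⟩ := h
  obtain ⟨a', ha', h'⟩ := h'
  refine ⟨fun k x => a k x + a' k x, fun k x hx => (ha k x hx).add (ha' k x hx),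
    fun y hy ψ hψ => ?_⟩
  filter_upwards [h y hy ψ hψ, h' y hy ψ hψ] with x h1 h2
  rw [h1, h2, ← Finset.sum_add_distrib]
  exact Finset.sum_congr rfl fun k _ => by ring

lemma Reduces.mul (h : Reduces B S s T) {c : Vec n → ℂ} (hc : AnalyticOnNhd ℂ c B) :
    Reduces B S s fun ψ x => c x * T ψ x := by
  obtain ⟨a, ha, h⟩ := h
  refine ⟨fun k x => c x * a k x, fun k x hx => (hc x hx).mul (ha k x hx),
    fun y hy ψ hψ => ?_⟩
  filter_upwards [h y hy ψ hψ] with x h1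
  rw [h1, Finset.mul_sum]
  exact Finset.sum_congr rfl fun k _ => by ring

lemma Reduces.sum {ι : Type*} (J : Finset ι) {T : ι → (Vec n → ℂ) → Vec n → ℂ}
    (h : ∀ j ∈ J, Reduces B S s (T j)) : Reduces B S s fun ψ x => ∑ j ∈ J, T j ψ x := by
  classical
  induction J using Finset.induction_on with
  | empty => simpa using reduces_zero
  | insert j J hj ih =>
    simp only [Finset.sum_insert hj]
    exact (h j (Finset.mem_insert_self j J)).add (ih fun i hi => h i (Finset.mem_insert_of_mem hi))

lemma reduces_mixedPd {k : Fin n →₀ ℕ} (hk : k ∈ s) : Reduces B S s (mixedPd k) := by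
  classical
  refine ⟨fun k' _ => if k' = k then 1 else 0, fun _ _ _ => analyticAt_const,
    fun y _ ψ _ => Eventually.of_forall fun x => ?_⟩
  simp [hk]

lemma Reduces.pd (hS : ∀ ψ y, S ψ y → AnalyticAt ℂ ψ y) (h : Reduces B S s T) (hst : s ⊆ t)
    (i : Fin n) (ht : ∀ k ∈ s, Reduces B S t (mixedPd (k + Finsupp.single i 1))) :
    Reduces B S t fun ψ => pd i (T ψ) := by
  obtain ⟨a, ha, h⟩ := h
  have h1 : Reduces B S t fun ψ x => ∑ k ∈ s, (GenLame.pd i (a k) x * mixedPd k ψ x +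
      a k x * mixedPd (k + Finsupp.single i 1) ψ x) :=
    Reduces.sum s fun k hk => ((reduces_mixedPd (hst hk)).mul
      fun x hx => analyticAt_pd i (ha k x hx)).add ((ht k hk).mul (ha k))
  refine h1.congr fun y hy ψ hψ => ?_
  have h2 := hS ψ y hψ
  have h3 : ∀ᶠ x in 𝓝 y, ∀ k ∈ s, AnalyticAt ℂ (a k) x ∧
      mixedPd (k + Finsupp.single i 1) ψ x = GenLame.pd i (mixedPd k ψ) x :=
    (Filter.eventually_all_finset _).2 fun k _ =>
      (ha k y hy).eventually_analyticAt.and (mixedPd_add_single k i h2)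
  filter_upwards [(h y hy ψ hψ).eventually_nhds, h3, h2.eventually_analyticAt] with x h4 h5 h6
  rw [pd_congr_at i h4, pd_sum s i fun k hk => (h5 k hk).1.fun_mul (analyticAt_mixedPd k h6)]
  refine Finset.sum_congr rfl fun k hk => ?_
  rw [pd_mul i (h5 k hk).1 (analyticAt_mixedPd k h6), (h5 k hk).2]

/-- The action of a polynomial in `∂₁, …, ∂ₙ`. -/
def symbolApply (Q : MvPolynomial (Fin n) ℂ) (f : Vec n → ℂ) (x : Vec n) : ℂ :=
  (MvPolynomial.basisMonomials (Fin n) ℂ).constr ℂ (fun k => mixedPd k f x) Q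

lemma symbolApply_monomial (k : Fin n →₀ ℕ) (c : ℂ) (f : Vec n → ℂ) (x : Vec n) :
    symbolApply (MvPolynomial.monomial k c) f x = c * mixedPd k f x := by
  have h1 : MvPolynomial.monomial k c = c • MvPolynomial.basisMonomials (Fin n) ℂ k := by
    rw [MvPolynomial.coe_basisMonomials, MvPolynomial.smul_monomial, smul_eq_mul, mul_one]
  rw [symbolApply, h1, map_smul, Module.Basis.constr_basis, smul_eq_mul]

lemma symbolApply_sum {ι : Type*} (J : Finset ι) (Q : ι → MvPolynomial (Fin n) ℂ) (f : Vec n → ℂ)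
    (x : Vec n) : symbolApply (∑ j ∈ J, Q j) f x = ∑ j ∈ J, symbolApply (Q j) f x := map_sum _ _ _

lemma symbolApply_C_mul (c : ℂ) (Q : MvPolynomial (Fin n) ℂ) (f : Vec n → ℂ) (x : Vec n) :
    symbolApply (MvPolynomial.C c * Q) f x = c * symbolApply Q f x := by
  rw [← MvPolynomial.smul_eq_C_mul]
  exact map_smul _ _ _

lemma symbolApply_eq_sum (Q : MvPolynomial (Fin n) ℂ) {J : Finset (Fin n →₀ ℕ)}
    (hJ : Q.support ⊆ J) (f : Vec n → ℂ) (x : Vec n) :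
    symbolApply Q f x = ∑ k ∈ J, Q.coeff k * mixedPd k f x := by
  conv_lhs => rw [← MvPolynomial.support_sum_monomial_coeff Q]
  rw [symbolApply_sum, Finset.sum_congr rfl fun k _ => symbolApply_monomial k _ f x]
  exact Finset.sum_subset hJ fun k _ hk => by
    rw [MvPolynomial.notMem_support_iff.1 hk, zero_mul]

lemma symbolApply_mul_X (Q : MvPolynomial (Fin n) ℂ) (i : Fin n) {f : Vec n → ℂ} {x : Vec n}
    (hf : AnalyticAt ℂ f x) :
    symbolApply (Q * MvPolynomial.X i) f =ᶠ[𝓝 x] pd i (symbolApply Q f) := by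
  have h3 : ∀ᶠ x in 𝓝 x, ∀ k ∈ Q.support,
      mixedPd (k + Finsupp.single i 1) f x = GenLame.pd i (mixedPd k f) x :=
    (Filter.eventually_all_finset _).2 fun k _ => mixedPd_add_single k i hf
  filter_upwards [h3, hf.eventually_analyticAt] with y h4 h5
  have h6 : symbolApply Q f = fun y => ∑ k ∈ Q.support, Q.coeff k * mixedPd k f y :=
    funext fun y => symbolApply_eq_sum Q (Finset.Subset.refl _) f y
  rw [h6, pd_sum _ i fun k _ => analyticAt_const_mul (Q.coeff k) (analyticAt_mixedPd k h5)]
  conv_lhs => rw [← MvPolynomial.support_sum_monomial_coeff Q]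
  rw [Finset.sum_mul, symbolApply_sum]
  refine Finset.sum_congr rfl fun k hk => ?_
  rw [pd_const_mul i _ (analyticAt_mixedPd k h5), ← h4 k hk, MvPolynomial.X,
    MvPolynomial.monomial_mul, mul_one, symbolApply_monomial]

/-- The equation `D ψ = λ ψ` is solved for its part of top order. Positivity of `d` makes room for
the term `λ ψ` among the derivatives of order below `d`. -/
lemma reduces_symbol {D : DiffOp n} {Q : MvPolynomial (Fin n) ℂ} {d : ℕ}
    (hD : D.HasHighestSymbol Q d) (hd : 0 < d) (hDB : ∀ k, AnalyticOnNhd ℂ (D k) B) (lam : ℂ)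
    (hsol : ∀ y ∈ B, ∀ ψ, S ψ y → ∀ᶠ x in 𝓝 y, D.apply ψ x = lam * ψ x) :
    Reduces B S (degLT n d) (symbolApply Q) := by
  classical
  have h1 : Reduces B S (degLT n d) fun ψ x => lam * mixedPd 0 ψ x +
      ∑ k ∈ D.support with k.degree < d, -1 * (D k x * mixedPd k ψ x) :=
    ((reduces_mixedPd (by simpa using hd)).mul analyticOnNhd_const).add
      (Reduces.sum _ fun k hk => ((reduces_mixedPd (by simpa using (Finset.mem_filter.1 hk).2)).mul
        (hDB k)).mul analyticOnNhd_const)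
  refine h1.congr fun y hy ψ hψ => ?_
  filter_upwards [hsol y hy ψ hψ] with x hx
  rw [mixedPd_zero, ← hx, DiffOp.apply_eq_sum D (Finset.subset_union_left (s₂ := Q.support)),
    symbolApply_eq_sum Q (Finset.subset_union_right (s₁ := D.support)), ← Finset.mul_sum,
    neg_one_mul, ← sub_eq_add_neg, eq_sub_iff_add_eq, Finset.sum_filter,
    Finset.sum_subset (Finset.subset_union_left (s₁ := D.support) (s₂ := Q.support)), ← Finset.sum_add_distrib]
  · refine Finset.sum_congr rfl fun k _ => ?_
    rcases lt_trichotomy k.degree d with h2 | h2 | h2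
    · rw [if_pos h2, hD.1.coeff_eq_zero h2.ne]
      ring
    · rw [if_neg (by omega), hD.2.2 k h2]
      ring
    · rw [if_neg (by omega), hD.1.coeff_eq_zero h2.ne', hD.2.1 k h2]
      simp
  · intro k _ hk
    rw [Finsupp.notMem_support_iff.1 hk]
    simp

lemma exists_eq_add_single {k : Fin n →₀ ℕ} (hk : k.degree ≠ 0) :
    ∃ k' i, k = k' + Finsupp.single i 1 := by
  have : k ≠ 0 := by rintro rfl; simp at hk
  obtain ⟨i, hi⟩ := Finsupp.ne_iff.1 this
  refine ⟨k - Finsupp.single i 1, i, (tsub_add_cancel_of_le ?_).symm⟩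
  rw [Finsupp.single_le_iff]
  exact Nat.one_le_iff_ne_zero.2 hi

/-- Each further derivative raises the order of the reduction by one, through the product rule in
`Reduces.pd`. -/
lemma reduces_monomial_mul (hS : ∀ ψ y, S ψ y → AnalyticAt ℂ ψ y) {Q : MvPolynomial (Fin n) ℂ}
    {d : ℕ} (h : Reduces B S (degLT n d) (symbolApply Q)) :
    ∀ (m : ℕ) (k : Fin n →₀ ℕ), k.degree = m →
      Reduces B S (degLT n (m + d)) (symbolApply (MvPolynomial.monomial k 1 * Q)) := by
  intro m
  induction m with
  | zero =>
    intro k hk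
    rw [Finsupp.degree_eq_zero_iff] at hk
    subst hk
    simpa using h
  | succ m ih =>
    intro k hk
    obtain ⟨k', i, rfl⟩ := exists_eq_add_single (k := k) (by omega)
    have hk' : k'.degree = m := by simpa using hk
    refine ((ih k' hk').pd hS (t := degLT n (m + 1 + d)) (fun a ha => ?_) i fun a ha => ?_).congr
      fun y hy ψ hψ => ?_
    · rw [mem_degLT] at *; omega
    · refine reduces_mixedPd ?_
      rw [mem_degLT] at *
      simp; omega
    · have h1 : MvPolynomial.monomial (k' + Finsupp.single i 1) (1 : ℂ) * Q =
          (MvPolynomial.monomial k' 1 * Q) * MvPolynomial.X i := by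
        rw [mul_right_comm, MvPolynomial.X, MvPolynomial.monomial_mul, mul_one]
      rw [h1]
      exact symbolApply_mul_X _ i (hS ψ y hψ)

/-- The decomposition of the monomial turns `∂ᵇ ψ` into a combination of derivatives of the
functions `Qᵢ(∂) ψ`. These reduce to orders below `dᵢ`, and since all degrees add up to `N`, only
orders below `N` remain. -/
lemma reduces_mixedPd_of_eq_sum (hS : ∀ ψ y, S ψ y → AnalyticAt ℂ ψ y)
    {Q : Fin n → MvPolynomial (Fin n) ℂ} {d : Fin n → ℕ}
    (h : ∀ i, Reduces B S (degLT n (d i)) (symbolApply (Q i))) {b : Fin n →₀ ℕ} {N : ℕ}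
    {q : Fin n → MvPolynomial (Fin n) ℂ} (hb : MvPolynomial.monomial b 1 = ∑ i, q i * Q i)
    (hq : ∀ i, ∀ k ∈ (q i).support, k.degree + d i = N) :
    Reduces B S (degLT n N) (mixedPd b) := by
  have h1 : Reduces B S (degLT n N) fun ψ x => ∑ i, ∑ k ∈ (q i).support,
      (q i).coeff k * symbolApply (MvPolynomial.monomial k 1 * Q i) ψ x := by
    refine Reduces.sum _ fun i _ => Reduces.sum _ fun k hk => Reduces.mul ?_ analyticOnNhd_const
    rw [← hq i k hk]
    exact reduces_monomial_mul hS (h i) _ k rfl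
  refine h1.congr fun y hy ψ hψ => Eventually.of_forall fun x => ?_
  have h2 : mixedPd b ψ x = symbolApply (MvPolynomial.monomial b 1) ψ x := by
    rw [symbolApply_monomial, one_mul]
  simp only [h2]
  rw [hb, symbolApply_sum]
  refine Finset.sum_congr rfl fun i _ => ?_
  conv_lhs => rw [← MvPolynomial.support_sum_monomial_coeff (q i)]
  rw [Finset.sum_mul, symbolApply_sum]
  refine Finset.sum_congr rfl fun k _ => ?_
  rw [← symbolApply_C_mul, ← mul_assoc, MvPolynomial.C_mul_monomial, mul_one]

end Representation

/-! ### Extension of solutions to balls of uniform size -/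

section Extension

variable {n : ℕ} {p : Vec n} {r : ℝ} {S : (Vec n → ℂ) → Vec n → Prop} {N : ℕ}

/-- Derivatives of all orders of solutions of a system which is closed at order `N` are combinations
of the derivatives of order less than `N`, with explicit bounds of the coefficients. -/
lemma exists_pdList_coeff (hr : 0 < r) (hS : ∀ ψ y, S ψ y → AnalyticAt ℂ ψ y)
    (hred : ∀ b : Fin n →₀ ℕ, b.degree = N →
      Reduces (Metric.ball p r) S (degLT n N) (mixedPd b)) (hN : 0 < N) :
    ∃ ρ > 0, ρ ≤ r ∧ ∃ C : ℝ, 0 ≤ C ∧ ∀ l : List (Fin n), ∃ Z : (Fin n →₀ ℕ) → Vec n → ℂ,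
      (∀ k, AnalyticOnNhd ℂ (Z k) (Metric.ball p ρ)) ∧
      (∀ y ∈ Metric.ball p ρ, ∀ ψ, S ψ y →
        pdList l ψ =ᶠ[𝓝 y] fun x => ∑ k ∈ degLT n N, Z k x * mixedPd k ψ x) ∧
      ∀ δ > 0, ∀ k ∈ degLT n N, ∀ y ∈ Metric.ball p (ρ - l.length * δ),
        ‖Z k y‖ ≤ (1 / δ + C) ^ l.length := by
  classical
  -- The derivatives of order below `N` satisfy a linear system of first order, whose matrices
  -- become `A` below.
  have hconn : ∀ (j : Fin n) (k : Fin n →₀ ℕ), k.degree < N →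
      Reduces (Metric.ball p r) S (degLT n N) (mixedPd (k + Finsupp.single j 1)) := by
    intro j k hk
    rcases Nat.lt_or_ge (k + Finsupp.single j 1).degree N with h | h
    · exact reduces_mixedPd (mem_degLT.2 h)
    · refine hred _ (le_antisymm ?_ h)
      simp; omega
  have hconn' : ∀ (j : Fin n) (k : degLT n N), ∃ a : (Fin n →₀ ℕ) → Vec n → ℂ,
      (∀ k', AnalyticOnNhd ℂ (a k') (Metric.ball p r)) ∧ ∀ y ∈ Metric.ball p r, ∀ ψ, S ψ y →
        mixedPd (k.1 + Finsupp.single j 1) ψ =ᶠ[𝓝 y]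
          fun x => ∑ k' ∈ degLT n N, a k' x * mixedPd k' ψ x :=
    fun j k => hconn j k.1 (mem_degLT.1 k.2)
  choose A hAa hA using hconn'
  set G : Vec n → (Fin n × degLT n N × degLT n N → ℂ) := fun y i => A i.1 i.2.1 i.2.2 y with hG
  have hpr : p ∈ Metric.ball p r := Metric.mem_ball_self hr
  have hGc : ContinuousAt G p :=
    continuousAt_pi.2 fun i => (hAa i.1 i.2.1 i.2.2 p hpr).continuousAt
  obtain ⟨ρ₀, hρ₀, hb⟩ := Metric.eventually_nhds_iff_ball.1
    (hGc.norm.eventually_lt continuousAt_const (lt_add_one ‖G p‖))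
  set M₀ := ‖G p‖ + 1 with hM₀
  have hM₀0 : 0 ≤ M₀ := by positivity
  set ρ := min ρ₀ r with hρ
  have hρpos : 0 < ρ := lt_min hρ₀ hr
  have hsub : Metric.ball p ρ ⊆ Metric.ball p r := Metric.ball_subset_ball (min_le_right _ _)
  have hAb : ∀ j (k k' : degLT n N), ∀ y ∈ Metric.ball p ρ, ‖A j k k' y‖ ≤ M₀ :=
    fun j k k' y hy => (norm_le_pi_norm (G y) (j, k, k')).trans
      (hb y (Metric.ball_subset_ball (min_le_left _ _) hy)).le
  refine ⟨ρ, hρpos, min_le_right _ _, (degLT n N).card * M₀, by positivity, fun l => ?_⟩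
  induction l with
  | nil =>
    refine ⟨fun k _ => if k = 0 then 1 else 0, fun _ _ _ => analyticAt_const,
      fun y _ ψ _ => Eventually.of_forall fun x => ?_, fun δ _ k _ y _ => ?_⟩
    · simp [hN]
    · simp only [List.length_nil, pow_zero]
      split_ifs <;> simp
  | cons j l ih =>
    obtain ⟨Z, hZa, hZ, hZb⟩ := ih
    -- By the product rule, one more derivative replaces the row `Z` by `∂ⱼ Z + Z Aⱼ`. The first
    -- term costs a factor `1 / δ` and a collar of width `δ`, the second at most the factor `C`, the
    -- number of indices times `M₀`. This explains the bound `(1 / δ + C) ^ l.length`.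
    refine ⟨fun k' x => pd j (Z k') x + ∑ k : degLT n N, Z k x * A j k k' x, fun k' x hx =>
      (analyticAt_pd j (hZa k' x hx)).add (Finset.analyticAt_fun_sum _ fun k _ =>
        (hZa k x hx).mul (hAa j k k' x (hsub hx))), fun y hy ψ hψ => ?_, fun δ hδ k' hk' y hy => ?_⟩
    · have h2 := hS ψ y hψ
      have h3 : ∀ᶠ x in 𝓝 y, ∀ k : degLT n N, AnalyticAt ℂ (Z k) x ∧
          mixedPd (k.1 + Finsupp.single j 1) ψ x = pd j (mixedPd k ψ) x ∧
          mixedPd (k.1 + Finsupp.single j 1) ψ x =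
            ∑ k' ∈ degLT n N, A j k k' x * mixedPd k' ψ x :=
        Filter.eventually_all.2 fun k => (hZa k y hy).eventually_analyticAt.and
          ((mixedPd_add_single k.1 j h2).and (hA j k y (hsub hy) ψ hψ))
      filter_upwards [(hZ y hy ψ hψ).eventually_nhds, h3, h2.eventually_analyticAt] with x h4 h5 h6
      rw [pdList_cons, pd_congr_at j h4, pd_sum _ j fun k hk =>
        (h5 ⟨k, hk⟩).1.fun_mul (analyticAt_mixedPd k h6)]
      simp only [add_mul, Finset.sum_add_distrib]
      have h7 : ∀ k ∈ degLT n N, pd j (fun y => Z k y * mixedPd k ψ y) x =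
          pd j (Z k) x * mixedPd k ψ x + Z k x * pd j (mixedPd k ψ) x := fun k hk =>
        pd_mul j (h5 ⟨k, hk⟩).1 (analyticAt_mixedPd k h6)
      rw [Finset.sum_congr rfl h7, Finset.sum_add_distrib]
      congr 1
      simp only [Finset.sum_mul]
      rw [Finset.sum_comm, ← Finset.sum_coe_sort (degLT n N)]
      refine Finset.sum_congr rfl fun k _ => ?_
      rw [← (h5 k).2.1, (h5 k).2.2, Finset.mul_sum]
      exact Finset.sum_congr rfl fun k' _ => by ring
    · set M := (1 / δ + (degLT n N).card * M₀) ^ l.length with hM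
      have hM0 : 0 ≤ M := by positivity
      have hle : ρ - (l.length + 1) * δ ≤ ρ - l.length * δ := by linarith
      have hle' : ρ - l.length * δ ≤ ρ := by
        have : 0 ≤ (l.length : ℝ) * δ := by positivity
        linarith
      rw [List.length_cons, Nat.cast_add_one] at hy
      have h1 : ‖pd j (Z k') y‖ ≤ M / δ := by
        refine norm_pd_le hδ (r := ρ - l.length * δ) (x := p) (fun x hx =>
          (hZa k' x (Metric.ball_subset_ball hle' hx)).differentiableAt.differentiableWithinAt)
          (hZb δ hδ k' hk') ?_ j
        convert hy using 2; ring
      have hy1 := Metric.ball_subset_ball hle hy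
      have hy2 := Metric.ball_subset_ball hle' hy1
      have h2 : ‖∑ k : degLT n N, Z k y * A j k k' y‖ ≤ (degLT n N).card * (M * M₀) := by
        refine (norm_sum_le _ _).trans ?_
        refine (Finset.sum_le_card_nsmul _ _ (M * M₀) fun k _ => ?_).trans (by simp)
        rw [norm_mul]
        exact mul_le_mul (hZb δ hδ k k.2 y hy1) (hAb j k ⟨k', hk'⟩ y hy2) (norm_nonneg _) hM0
      refine (norm_add_le _ _).trans ((add_le_add h1 h2).trans (le_of_eq ?_))
      rw [List.length_cons, pow_succ, ← hM]
      ring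

lemma add_pow_le_exp_mul_factorial {a b : ℝ} (ha : 0 ≤ a) (hb : 0 ≤ b) {m : ℕ} (hm : 0 < m) :
    (a * m + b) ^ m ≤ ((a + b) * Real.exp 1) ^ m * m.factorial := by
  have hm1 : (1 : ℝ) ≤ m := by exact_mod_cast hm
  have h2 : (m : ℝ) ^ m ≤ Real.exp 1 ^ m * m.factorial := by
    have := Real.pow_div_factorial_le_exp (m : ℝ) (by positivity) m
    rw [div_le_iff₀ (by positivity)] at this
    rwa [← Real.exp_nat_mul, mul_one]
  calc (a * m + b) ^ m ≤ ((a + b) * m) ^ m := by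
        gcongr
        nlinarith
    _ = (a + b) ^ m * m ^ m := mul_pow _ _ _
    _ ≤ (a + b) ^ m * (Real.exp 1 ^ m * m.factorial) := by gcongr
    _ = _ := by rw [mul_pow]; ring

/-- Solutions of a system which is closed at order `N` extend to a ball of uniform size and are
determined by their derivatives of order less than `N`. -/
lemma exists_ball_extension (hr : 0 < r) (hS : ∀ ψ y, S ψ y → AnalyticAt ℂ ψ y)
    (hred : ∀ b : Fin n →₀ ℕ, b.degree = N →
      Reduces (Metric.ball p r) S (degLT n N) (mixedPd b)) (hN : 0 < N) :
    (∃ ε > 0, ε ≤ r ∧ ∀ y ∈ Metric.ball p ε, ∀ ψ, S ψ y →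
      ∃ F : Vec n → ℂ, AnalyticOnNhd ℂ F (Metric.ball p ε) ∧ F =ᶠ[𝓝 y] ψ) ∧
    ∀ ψ, S ψ p → (∀ k ∈ degLT n N, mixedPd k ψ p = 0) → ψ =ᶠ[𝓝 p] 0 := by
  obtain ⟨ρ, hρ, hρr, C, hC, hZ⟩ := exists_pdList_coeff hr hS hred hN
  refine ⟨?_, fun ψ hψ h0 => ?_⟩
  -- For lists of length `j > 0` the collar width will be `δ = ρ / (2 j)`. The coefficients are then
  -- bounded by `(2 j / ρ + C) ^ j`, which is at most `K ^ j * j!`.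
  · set K : ℝ := (2 / ρ + C) * Real.exp 1 with hK
    have hK0 : 0 < K := by positivity
    -- Half of the radius of convergence, so that the ball of convergence around any `y` in the ball
    -- of radius `ε` contains this ball.
    set ε := min (ρ / 2) (1 / ((n + 1) * K) / 2) with hε
    have hε0 : 0 < ε := by positivity
    refine ⟨ε, hε0, (min_le_left _ _).trans (by linarith), fun y hy ψ hψ => ?_⟩
    have hyρ : y ∈ Metric.ball p (ρ / 2) := Metric.ball_subset_ball (min_le_left _ _) hy
    have hyρ' : y ∈ Metric.ball p ρ := Metric.ball_subset_ball (by linarith) hyρ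
    set M := ∑ k ∈ degLT n N, ‖mixedPd k ψ y‖ with hM
    obtain ⟨F, hF, hFψ⟩ := exists_analyticOnNhd_ball (hS ψ y hψ) (M := M) hK0 (fun l => by
      obtain ⟨Z, -, hZ2, hZ3⟩ := hZ l
      have hZb : ∀ k ∈ degLT n N, ‖Z k y‖ ≤ K ^ l.length * l.length.factorial := by
        intro k hk
        rcases Nat.eq_zero_or_pos l.length with h0 | h0
        · have := hZ3 1 one_pos k hk y (by simpa [h0] using hyρ')
          simpa [h0] using this
        · have hl0 : (0 : ℝ) < l.length := by exact_mod_cast h0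
          have := hZ3 (ρ / (2 * l.length)) (by positivity) k hk y (by
            convert hyρ using 2
            field_simp
            ring)
          refine this.trans (le_trans (le_of_eq ?_)
            (add_pow_le_exp_mul_factorial (a := 2 / ρ) (by positivity) hC h0))
          congr 2
          field_simp
      rw [(hZ2 y hyρ' ψ hψ).eq_of_nhds, hM, Finset.sum_mul, Finset.sum_mul]
      refine (norm_sum_le _ _).trans (Finset.sum_le_sum fun k hk => ?_)
      rw [norm_mul, mul_comm, mul_assoc]
      exact mul_le_mul_of_nonneg_left (hZb k hk) (norm_nonneg _))
    refine ⟨F, hF.mono (Metric.ball_subset_ball' ?_), hFψ⟩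
    rw [Metric.mem_ball, dist_comm] at hy
    have := min_le_right (ρ / 2) (1 / ((n + 1) * K) / 2)
    linarith
  · obtain ⟨R, hR, hb⟩ := Metric.eventually_nhds_iff_ball.1 (hS ψ p hψ).eventually_analyticAt
    filter_upwards [Metric.ball_mem_nhds p hR] with x hx
    have hl : ∀ l : List (Fin n), pdList l ψ p = 0 := by
      intro l
      obtain ⟨Z, -, hZ2, -⟩ := hZ l
      rw [(hZ2 p (Metric.mem_ball_self hρ) ψ hψ).eq_of_nhds]
      exact Finset.sum_eq_zero fun k hk => by rw [h0 k hk, mul_zero]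
    have h1 := hasSum_taylorFMS (f := ψ) (x := p) (r := R) (v := x - p)
      (fun y hy => (hb y hy).differentiableAt.differentiableWithinAt)
      (by rwa [← dist_eq_norm])
    simp only [taylorFMS_apply, hl, mul_zero, Finset.sum_const_zero, add_sub_cancel] at h1
    exact h1.unique hasSum_zero

end Extension

/-! ### Solution germs at regular points -/

section Solutions

variable {n : ℕ} (P : EllipticPotential n)

lemma isGermClass_isSol (L : Fin n → DiffOp n) (lam : Fin n → ℂ) :
    IsGermClass (IsSol L lam) where
  congr f g x h hf := by
    refine ⟨hf.1.congr h, ?_⟩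
    filter_upwards [hf.2, h.eventually_nhds] with y h1 h2 i hi
    rw [← (DiffOp.apply_congr (L i) h2).eq_of_nhds, h1 i hi, h2.self_of_nhds]
  analytic f x h := h.1

/-- Solutions of a strongly integrable system extend, near each regular point, to a ball of uniform
size, and they are determined by finitely many derivatives. -/
theorem exists_extendsOn [NeZero n] {L : Fin n → DiffOp n} (hL : P.StronglyIntegrable L)
    (lam : Fin n → ℂ) : ∃ N : ℕ, ∀ p ∉ P.sing,
      (∃ ε > 0, ExtendsOn (IsSol L lam) (Metric.ball p ε)) ∧
      ∀ ψ, IsSol L lam ψ p → (∀ k ∈ degLT n N, mixedPd k ψ p = 0) → ψ =ᶠ[𝓝 p] 0 := by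
  obtain ⟨s, d, hs, hind, hfin⟩ := hL.symbols
  obtain ⟨R, hR⟩ := exists_monomial_eq_sum (fun i => (hs i).1) hfin
  -- The number `R` depends on the symbols only, so one order serves all points.
  refine ⟨R + 1, fun p hp => ?_⟩
  obtain ⟨r, hr, D, hDa, hDs, hD, -⟩ := exists_regular_system P hL lam hs hp
  set S : (Vec n → ℂ) → Vec n → Prop := fun ψ y => y ∈ Metric.ball p r ∧ IsSol L lam ψ y with hS
  have hred : ∀ b : Fin n →₀ ℕ, b.degree = R + 1 →
      Reduces (Metric.ball p r) S (degLT n (R + 1)) (mixedPd b) := by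
    intro b hb
    obtain ⟨q, hq, hqd⟩ := hR b hb
    refine reduces_mixedPd_of_eq_sum (fun ψ y h => h.2.1) (fun i => ?_) hq hqd
    refine reduces_symbol (hDs i)
      (pos_of_isHomogeneous_of_algebraicIndependent hind (hs i).1) (hDa i) (lam i)
      fun y hy ψ hψ => ?_
    filter_upwards [((hD y hy ψ).1 hψ.2).2] with x hx using hx i
  obtain ⟨⟨ε, hε, hεr, hext⟩, huniq⟩ :=
    exists_ball_extension hr (fun ψ y (h : S ψ y) => h.2.1) hred (Nat.succ_pos R)
  refine ⟨⟨ε, hε, fun y hy ψ hψ => ?_⟩, fun ψ hψ => huniq ψ ⟨Metric.mem_ball_self hr, hψ⟩⟩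
  have hsub := Metric.ball_subset_ball (x := p) hεr
  obtain ⟨F, hF, hFψ⟩ := hext y hy ψ ⟨hsub hy, hψ⟩
  refine ⟨F, fun z hz => (hD z (hsub hz) F).2 ⟨hF z hz, ?_⟩, hFψ⟩
  have hFy := ((hD y (hsub hy) F).1 ((isGermClass_isSol L lam).congr ψ F y hFψ.symm hψ)).2
  have hall : ∀ i, Set.EqOn (fun x => (D i).apply F x - lam i * F x) 0 (Metric.ball p ε) := by
    intro i
    refine AnalyticOnNhd.eqOn_zero_of_preconnected_of_eventuallyEq_zero (fun x hx =>
      (analyticAt_apply (fun k => hDa i k x (hsub hx)) (hF x hx)).sub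
        (analyticAt_const.mul (hF x hx))) (convex_ball p ε).isPreconnected hy ?_
    filter_upwards [hFy] with x hx
    simp [hx i]
  filter_upwards [Metric.isOpen_ball.mem_nhds hz] with x hx i
  exact sub_eq_zero.1 (hall i hx)

lemma isClosed_sing : IsClosed P.sing := by
  have h : P.sing = ⋃ α ∈ P.A, (fun x : Vec n => α.1 ⬝ᵥ x + α.2) ⁻¹'
      ((periodPair P.τ P.im_pos).lattice : Set ℂ) := by
    ext x
    simp only [EllipticPotential.sing, hyperplane, shifted, Set.mem_ofPred_eq, Set.mem_iUnion,
      Set.mem_preimage, SetLike.mem_coe, PeriodPair.mem_lattice, periodPair, exists_prop]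
    refine exists_congr fun α => and_congr_right fun _ => exists_congr fun p =>
      exists_congr fun q => ?_
    constructor <;> intro h <;> linear_combination -h
  rw [h]
  refine isClosed_biUnion_finset fun α _ => IsClosed.preimage ?_ ?_
  · exact continuous_iff_continuousAt.2 fun x => (analyticAt_affine α x).continuousAt
  · exact (periodPair P.τ P.im_pos).isClosed_lattice

end Solutions

/-! ### A recursion which forces its solutions to vanish -/

section Laplacian

variable {n : ℕ}

/-- The Laplacian `∑ⱼ ∂ⱼ²`. -/
def lap (f : Vec n → ℂ) (x : Vec n) : ℂ := ∑ j, pd j (pd j f) x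

lemma norm_lap_le {f : Vec n → ℂ} {x y : Vec n} {r δ M : ℝ} (hδ : 0 < δ)
    (hf : DifferentiableOn ℂ f (Metric.ball x r)) (hM : ∀ z ∈ Metric.ball x r, ‖f z‖ ≤ M)
    (hy : y ∈ Metric.ball x (r - 2 * δ)) : ‖lap f y‖ ≤ n * (M / δ ^ 2) := by
  refine (norm_sum_le _ _).trans ((Finset.sum_le_card_nsmul _ _ (M / δ ^ 2) fun j _ => ?_).trans
    (by simp))
  have := norm_pdList_le hδ hf hM [j, j] y (by simpa using hy)
  simpa using this

lemma lap_congr {f g : Vec n → ℂ} {x : Vec n} (h : f =ᶠ[𝓝 x] g) : lap f x = lap g x :=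
  Finset.sum_congr rfl fun j _ => pd_congr_at j (pd_congr j h)

lemma lap_zero_of_eventually {f : Vec n → ℂ} {x : Vec n} (h : ∀ᶠ y in 𝓝 x, f y = 0) :
    lap f x = 0 := by
  rw [lap_congr (g := fun _ => 0) h]
  simp [lap, pd_const]

/-- Solutions of a recursion `Q_t C_t = -Δ C_{t+2} + ∑ᵢ vᵢ C_{t+2+i}` with quadratically growing
`Q_t` and bounds `O(ρ^t)` for small `ρ` vanish. -/
lemma eq_zero_of_recursion {x₀ : Vec n} {r ρ κ V r₁ M : ℝ} (hr : 0 < r) (hκ : 0 < κ) (hρ : 0 < ρ)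
    (hr₁ : 2 * ρ ≤ r₁) (hV : 0 ≤ V) {C : ℕ → Vec n → ℂ} {Q : ℕ → ℂ} {v : ℕ → Vec n → ℂ}
    (hC : ∀ t, DifferentiableOn ℂ (C t) (Metric.ball x₀ r))
    (hM : ∀ t, ∀ y ∈ Metric.ball x₀ r, ‖C t y‖ ≤ M * ρ ^ t)
    (hQ : ∀ t : ℕ, κ * (1 + t) ^ 2 ≤ ‖Q t‖)
    (hv : ∀ i, ∀ y ∈ Metric.ball x₀ r, ‖v i y‖ ≤ V * (1 / r₁) ^ i)
    (hrec : ∀ t, ∀ y ∈ Metric.ball x₀ r,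
      HasSum (fun i => v i y * C (t + 2 + i) y) (Q t * C t y + lap (C (t + 2)) y))
    (hsmall : ρ ^ 2 * ((16 * n / r ^ 2 + 2 * V) / κ) * Real.exp 1 ^ 2 < 1) :
    ∀ t, ∀ y ∈ Metric.ball x₀ (r / 2), C t y = 0 := by
  have hr₁0 : 0 < r₁ := by linarith
  set D := (16 * n / r ^ 2 + 2 * V) / κ with hD
  have hD0 : 0 ≤ D := by positivity
  have hM0 : 0 ≤ M := by
    have := hM 0 x₀ (Metric.mem_ball_self hr)
    simp only [pow_zero, mul_one] at this
    exact (norm_nonneg _).trans this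
  -- For fixed `k` the recursion is used `s ≤ k` times, each time on a ball smaller by `r / (2 k)`.
  -- One use gains `1 / (1 + t) ^ 2` from the division by `Q t` and `ρ ^ 2` from the shift of the
  -- index, and loses `k ^ 2` through the Cauchy estimate of the Laplacian.
  have hmain : ∀ k : ℕ, 0 < k → ∀ s : ℕ, s ≤ k → ∀ t, ∀ y ∈ Metric.ball x₀ (r - s * (r / (2 * k))),
      ‖C t y‖ ≤ M * ρ ^ t * ∏ i ∈ Finset.range s, (ρ ^ 2 * k ^ 2 * D / (1 + t + i) ^ 2) := by
    intro k hk s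
    have hk0 : (1 : ℝ) ≤ k := by exact_mod_cast hk
    set δ := r / (2 * k) with hδ
    have hδ0 : 0 < δ := by positivity
    induction s with
    | zero => intro _ t y hy; simpa using hM t y (by simpa using hy)
    | succ s ih =>
      intro hsk t y hy
      have ih := ih (by omega)
      set β : ℕ → ℝ := fun t => ∏ i ∈ Finset.range s, (ρ ^ 2 * k ^ 2 * D / (1 + t + i) ^ 2) with hβ
      have hβ0 : ∀ t, 0 ≤ β t := fun t => Finset.prod_nonneg fun i _ => by positivity
      have hβanti : ∀ t t', t ≤ t' → β t' ≤ β t := fun t t' htt =>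
        Finset.prod_le_prod (fun i _ => by positivity) fun i _ => by gcongr
      have hsδ : (0 : ℝ) ≤ s * δ := by positivity
      have hyb : y ∈ Metric.ball x₀ (r - s * δ - 2 * (δ / 2)) := by
        convert hy using 2; push_cast; ring
      have hys : y ∈ Metric.ball x₀ (r - s * δ) := Metric.ball_subset_ball (by linarith) hyb
      have hsub : Metric.ball x₀ (r - s * δ) ⊆ Metric.ball x₀ r :=
        Metric.ball_subset_ball (by linarith)
      have hlap : ‖lap (C (t + 2)) y‖ ≤ n * (M * ρ ^ (t + 2) * β (t + 2) / (δ / 2) ^ 2) :=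
        norm_lap_le (by positivity) ((hC _).mono hsub) (fun z hz => ih (t + 2) z hz) hyb
      have hsum := hrec t y (hsub hys)
      -- The condition `2 ρ ≤ r₁` makes the series geometric with ratio at most `1 / 2`.
      have hterm : ∀ i, ‖v i y * C (t + 2 + i) y‖ ≤
          V * (M * ρ ^ (t + 2) * β (t + 2)) * (1 / 2) ^ i := by
        intro i
        rw [norm_mul]
        calc ‖v i y‖ * ‖C (t + 2 + i) y‖
            ≤ (V * (1 / r₁) ^ i) * (M * ρ ^ (t + 2 + i) * β (t + 2 + i)) :=
              mul_le_mul (hv i y (hsub hys)) (ih _ y hys) (norm_nonneg _) (by positivity)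
          _ ≤ (V * (1 / r₁) ^ i) * (M * ρ ^ (t + 2 + i) * β (t + 2)) := by
              gcongr
              exact hβanti _ _ (by omega)
          _ = V * (M * ρ ^ (t + 2) * β (t + 2)) * (ρ / r₁) ^ i := by
              rw [pow_add ρ (t + 2) i, div_pow, div_pow, one_pow]; ring
          _ ≤ V * (M * ρ ^ (t + 2) * β (t + 2)) * (1 / 2) ^ i := by
              have : ρ / r₁ ≤ 1 / 2 := by
                rw [div_le_div_iff₀ hr₁0 two_pos]; linarith
              have h2 := hβ0 (t + 2)
              gcongr
      have hb1 : ‖Q t * C t y + lap (C (t + 2)) y‖ ≤ 2 * (V * (M * ρ ^ (t + 2) * β (t + 2))) := by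
        rw [← hsum.tsum_eq]
        have := tsum_of_norm_bounded (hasSum_geometric_two.mul_left
          (V * (M * ρ ^ (t + 2) * β (t + 2)))) hterm
        linarith
      have hb2 : ‖Q t‖ * ‖C t y‖ ≤ κ * (M * ρ ^ t * (ρ ^ 2 * k ^ 2 * D * β (t + 2))) := by
        rw [← norm_mul]
        have h3 : Q t * C t y = (Q t * C t y + lap (C (t + 2)) y) - lap (C (t + 2)) y := by ring
        rw [h3]
        refine (norm_sub_le _ _).trans ((add_le_add hb1 hlap).trans ?_)
        set X := M * ρ ^ (t + 2) * β (t + 2) with hX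
        have hX0 : 0 ≤ X := by have := hβ0 (t + 2); positivity
        have h4 : κ * (M * ρ ^ t * (ρ ^ 2 * k ^ 2 * D * β (t + 2))) =
            k ^ 2 * (16 * n / r ^ 2 + 2 * V) * X := by
          rw [hX, hD, pow_add]; field_simp
        have h5 : n * (X / (δ / 2) ^ 2) = k ^ 2 * (16 * n / r ^ 2) * X := by
          rw [hδ]; field_simp; ring
        rw [h4, h5]
        have h6 : (1 : ℝ) ≤ (k : ℝ) ^ 2 := one_le_pow₀ hk0
        have h7 : 0 ≤ 2 * V * X := by positivity
        nlinarith
      have hQt := hQ t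
      have ht0 : (0 : ℝ) < (1 + t) ^ 2 := by positivity
      have hb3 : (1 + (t : ℝ)) ^ 2 * ‖C t y‖ ≤ M * ρ ^ t * (ρ ^ 2 * k ^ 2 * D * β (t + 2)) := by
        have h8 : κ * ((1 + (t : ℝ)) ^ 2 * ‖C t y‖) ≤
            κ * (M * ρ ^ t * (ρ ^ 2 * k ^ 2 * D * β (t + 2))) := by
          refine le_trans ?_ hb2
          rw [← mul_assoc]
          exact mul_le_mul_of_nonneg_right hQt (norm_nonneg _)
        exact le_of_mul_le_mul_left h8 hκ
      rw [mul_comm, ← le_div_iff₀ ht0] at hb3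
      refine hb3.trans ?_
      rw [Finset.prod_range_succ']
      have h9 : ∏ i ∈ Finset.range s, (ρ ^ 2 * k ^ 2 * D / (1 + t + (i + 1 : ℕ)) ^ 2) = β (t + 1) := by
        refine Finset.prod_congr rfl fun i _ => ?_
        push_cast; ring
      rw [h9]
      have h10 := hβanti (t + 1) (t + 2) (by omega)
      calc M * ρ ^ t * (ρ ^ 2 * k ^ 2 * D * β (t + 2)) / (1 + t) ^ 2
          ≤ M * ρ ^ t * (ρ ^ 2 * k ^ 2 * D * β (t + 1)) / (1 + t) ^ 2 := by gcongr
        _ = _ := by push_cast; ring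
  intro t y hy
  -- For `s = k` the product is at most `(ρ ^ 2 k ^ 2 D) ^ k / (k!) ^ 2 ≤ (ρ ^ 2 D e ^ 2) ^ k`,
  -- which tends to zero by the smallness hypothesis.
  have hlim : Tendsto (fun k : ℕ => M * ρ ^ t * (ρ ^ 2 * D * Real.exp 1 ^ 2) ^ (k + 1)) atTop
      (𝓝 0) := by
    have := ((tendsto_pow_atTop_nhds_zero_of_lt_one (by positivity) hsmall).comp
      (tendsto_add_atTop_nat 1)).const_mul (M * ρ ^ t)
    simpa using this
  have hle : ∀ k : ℕ, ‖C t y‖ ≤ M * ρ ^ t * (ρ ^ 2 * D * Real.exp 1 ^ 2) ^ (k + 1) := by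
    intro k
    set K := k + 1 with hK
    have hKpos : (0 : ℝ) < K := by positivity
    refine (hmain K (by omega) K le_rfl t y ?_).trans ?_
    · convert hy using 2; field_simp; ring
    · gcongr
      have h1 : ∏ i ∈ Finset.range K, (ρ ^ 2 * K ^ 2 * D / (1 + t + i) ^ 2) ≤
          ∏ i ∈ Finset.range K, (ρ ^ 2 * K ^ 2 * D / ((i : ℝ) + 1) ^ 2) := by
        refine Finset.prod_le_prod (fun i _ => by positivity) fun i _ => ?_
        have : (0 : ℝ) ≤ t := by positivity
        have h2 : (i : ℝ) + 1 ≤ 1 + t + i := by linarith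
        gcongr
      refine h1.trans ?_
      rw [Finset.prod_div_distrib, Finset.prod_const, Finset.card_range, Finset.prod_pow]
      have h3 : ∏ i ∈ Finset.range K, ((i : ℝ) + 1) = K.factorial := by
        rw [← Finset.prod_range_add_one_eq_factorial]; push_cast; rfl
      rw [h3, div_le_iff₀ (by positivity)]
      have h4 : (K : ℝ) ^ K ≤ Real.exp 1 ^ K * K.factorial := by
        have := Real.pow_div_factorial_le_exp (K : ℝ) (by positivity) K
        rw [div_le_iff₀ (by positivity)] at this
        rwa [← Real.exp_nat_mul, mul_one]
      calc (ρ ^ 2 * (K : ℝ) ^ 2 * D) ^ K = (ρ ^ 2 * D) ^ K * ((K : ℝ) ^ K) ^ 2 := by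
            rw [mul_pow, mul_pow, mul_pow, ← pow_mul, ← pow_mul, ← pow_mul, mul_comm K 2]; ring
        _ ≤ (ρ ^ 2 * D) ^ K * (Real.exp 1 ^ K * K.factorial) ^ 2 := by gcongr
        _ = _ := by rw [mul_pow (ρ ^ 2 * D), mul_pow (Real.exp 1 ^ K), ← pow_mul, ← pow_mul,
              mul_comm K 2]; ring
  exact norm_le_zero_iff.1 (ge_of_tendsto' hlim hle)

end Laplacian

/-! ### Fourier coefficients on vertical lines -/

section Modes

open Complex

/-- The coefficient of `exp (s w)` in the Fourier expansion on the line `Re w = a` of a function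
`f(w)` which is multiplied by `exp (2πis)` under the translation by `2πi`. -/
def mode (a : ℝ) (s : ℂ) (f : ℂ → ℂ) : ℂ :=
  ∫ θ in (0 : ℝ)..2 * Real.pi, exp (-(s * (a + θ * I))) * f (a + θ * I)

lemma norm_exp_line (a θ : ℝ) (j : ℤ) : ‖exp (j * (a + θ * I))‖ = Real.exp a ^ j := by
  rw [norm_exp, ← Real.rpow_intCast, ← Real.exp_mul]
  congr 1
  simp [mul_comm]

lemma continuous_line (a : ℝ) : Continuous fun θ : ℝ => (a + θ * I : ℂ) := by fun_prop

/-- The Fourier coefficients of a product with a power series in `exp (± w)`. -/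
lemma hasSum_mode_mul {a : ℝ} {f v : ℂ → ℂ} (hf : Continuous fun θ : ℝ => f (a + θ * I)) (s : ℂ)
    {α : ℕ → ℂ} (σ : ℤ)
    (hv : ∀ θ : ℝ, HasSum (fun i : ℕ => α i * exp ((σ * i : ℤ) * (a + θ * I))) (v (a + θ * I)))
    (hs : Summable fun i : ℕ => ‖α i‖ * Real.exp a ^ (σ * i)) :
    HasSum (fun i : ℕ => α i * mode a (s - (σ * i : ℤ)) f) (mode a s fun w => v w * f w) := by
  have hc : Continuous fun θ : ℝ => exp (-(s * (a + θ * I))) * f (a + θ * I) :=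
    (by fun_prop : Continuous fun θ : ℝ => exp (-(s * (a + θ * I)))).mul hf
  obtain ⟨D, hD⟩ := (isCompact_Icc (a := (0 : ℝ)) (b := 2 * Real.pi)).exists_bound_of_continuousOn
    hc.continuousOn
  have h1 := intervalIntegral.hasSum_integral_of_dominated_convergence (μ := MeasureTheory.volume)
    (a := 0) (b := 2 * Real.pi)
    (F := fun (i : ℕ) (θ : ℝ) => (α i * exp ((σ * i : ℤ) * (a + θ * I))) *
      (exp (-(s * (a + θ * I))) * f (a + θ * I)))
    (f := fun θ => v (a + θ * I) * (exp (-(s * (a + θ * I))) * f (a + θ * I)))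
    (fun i _ => ‖α i‖ * Real.exp a ^ (σ * i) * D) (fun i => ?_) (fun i => ?_) ?_ ?_ ?_
  · have h2 : (fun i : ℕ => α i * mode a (s - (σ * i : ℤ)) f) = fun i : ℕ =>
        ∫ θ in (0 : ℝ)..2 * Real.pi, (α i * exp ((σ * i : ℤ) * (a + θ * I))) *
          (exp (-(s * (a + θ * I))) * f (a + θ * I)) := by
      funext i
      rw [mode, ← intervalIntegral.integral_const_mul]
      congr 1
      funext θ
      rw [sub_mul, neg_sub, sub_eq_add_neg, exp_add]
      ring
    have h3 : mode a s (fun w => v w * f w) = ∫ θ in (0 : ℝ)..2 * Real.pi,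
        v (a + θ * I) * (exp (-(s * (a + θ * I))) * f (a + θ * I)) := by
      unfold mode
      congr 1
      funext θ
      ring
    rw [h2, h3]
    exact h1
  · refine Continuous.aestronglyMeasurable ?_
    exact (by fun_prop : Continuous fun θ : ℝ => α i * exp ((σ * i : ℤ) * (a + θ * I))).mul hc
  · refine Eventually.of_forall fun θ hθ => ?_
    rw [Set.uIoc_of_le Real.two_pi_pos.le] at hθ
    rw [norm_mul, norm_mul, norm_exp_line]
    exact mul_le_mul_of_nonneg_left (hD θ (Set.Ioc_subset_Icc_self hθ)) (by positivity)
  · exact Eventually.of_forall fun θ _ => hs.mul_right D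
  · exact intervalIntegrable_const
  · exact Eventually.of_forall fun θ _ => (hv θ).mul_right _

variable {b : ℝ} {f : ℂ → ℂ} {s : ℂ}

lemma continuous_line_of_differentiableOn {a : ℝ} (hf : DifferentiableOn ℂ f {w | w.re < b})
    (hab : a < b) : Continuous fun θ : ℝ => f (a + θ * I) := by
  refine continuous_iff_continuousAt.2 fun θ => ?_
  have h1 : (a + θ * I : ℂ) ∈ {w : ℂ | w.re < b} := by simpa using hab
  have h2 := (hf.differentiableAt ((isOpen_lt continuous_re continuous_const).mem_nhds h1)).continuousAt
  exact ContinuousAt.comp (f := fun θ : ℝ => (a + θ * I : ℂ)) h2 (continuous_line a).continuousAt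

lemma exp_mul_periodic (hper : ∀ w : ℂ, w.re < b → f (w + 2 * Real.pi * I) =
    exp (2 * Real.pi * I * s) * f w) {w : ℂ} (hw : w.re < b) :
    exp (-(s * (w + 2 * Real.pi * I))) * f (w + 2 * Real.pi * I) = exp (-(s * w)) * f w := by
  rw [hper w hw, ← mul_assoc, ← exp_add]
  congr 2
  ring

/-- Integration by parts. The boundary terms cancel because multiplication by `exp (-(s w))` turns
`f` into a function with period `2πi`. -/
lemma mode_deriv {a : ℝ} (hf : DifferentiableOn ℂ f {w | w.re < b}) (hab : a < b)
    (hper : ∀ w : ℂ, w.re < b → f (w + 2 * Real.pi * I) = exp (2 * Real.pi * I * s) * f w) :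
    mode a s (deriv f) = s * mode a s f := by
  have hO : IsOpen {w : ℂ | w.re < b} := isOpen_lt continuous_re continuous_const
  have hmem : ∀ θ : ℝ, (a + θ * I : ℂ) ∈ {w : ℂ | w.re < b} := fun θ => by simpa using hab
  have hf' : DifferentiableOn ℂ (deriv f) {w | w.re < b} := hf.deriv hO
  have hc1 := continuous_line_of_differentiableOn hf hab
  have hc2 := continuous_line_of_differentiableOn hf' hab
  have hce : Continuous fun θ : ℝ => exp (-(s * (a + θ * I))) := by fun_prop
  have hder : ∀ θ : ℝ, HasDerivAt (fun θ : ℝ => exp (-(s * (a + θ * I))) * f (a + θ * I))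
      (I * (exp (-(s * (a + θ * I))) * deriv f (a + θ * I) -
        s * (exp (-(s * (a + θ * I))) * f (a + θ * I)))) θ := by
    intro θ
    have h1 : HasDerivAt (fun θ : ℝ => (a + θ * I : ℂ)) I θ := by
      simpa using ((hasDerivAt_id θ).ofReal_comp.mul_const I).const_add (a : ℂ)
    have h2 : HasDerivAt (fun w => exp (-(s * w)) * f w)
        (exp (-(s * (a + θ * I))) * (-s) * f (a + θ * I) +
          exp (-(s * (a + θ * I))) * deriv f (a + θ * I)) (a + θ * I) := by
      have h3 : HasDerivAt (fun w : ℂ => -(s * w)) (-s) (a + θ * I : ℂ) := by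
        simpa using ((hasDerivAt_id (a + θ * I : ℂ)).const_mul s).fun_neg
      exact h3.cexp.mul (hf.differentiableAt (hO.mem_nhds (hmem θ))).hasDerivAt
    refine (h2.scomp θ h1).congr_deriv ?_
    rw [smul_eq_mul]; ring
  have h1 := intervalIntegral.integral_eq_sub_of_hasDerivAt (a := 0) (b := 2 * Real.pi)
    (fun θ _ => hder θ) (Continuous.intervalIntegrable
      (continuous_const.mul ((hce.mul hc2).sub (continuous_const.mul (hce.mul hc1)))) _ _)
  have h2 : exp (-(s * (a + (2 * Real.pi : ℝ) * I))) * f (a + (2 * Real.pi : ℝ) * I) =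
      exp (-(s * (a + (0 : ℝ) * I))) * f (a + (0 : ℝ) * I) := by
    have := exp_mul_periodic hper (hmem 0)
    push_cast at this ⊢
    simpa using this
  rw [h2, sub_self, intervalIntegral.integral_const_mul, intervalIntegral.integral_sub
    ((hce.fun_mul hc2).intervalIntegrable _ _)
    ((continuous_const.fun_mul (hce.fun_mul hc1)).intervalIntegrable _ _),
    intervalIntegral.integral_const_mul, mul_eq_zero] at h1
  exact sub_eq_zero.1 (h1.resolve_left I_ne_zero)

/-- Cauchy's theorem for a rectangle of height `2π`, whose horizontal sides cancel by periodicity.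
-/
lemma mode_eq_mode {a a' : ℝ} (hf : DifferentiableOn ℂ f {w | w.re < b}) (hab : a < b)
    (hab' : a' < b)
    (hper : ∀ w : ℂ, w.re < b → f (w + 2 * Real.pi * I) = exp (2 * Real.pi * I * s) * f w) :
    mode a s f = mode a' s f := by
  have h1 := integral_boundary_rect_eq_zero_of_differentiableOn
    (fun w => exp (-(s * w)) * f w) (a : ℂ) (a' + (2 * Real.pi : ℝ) * I) (by
      refine DifferentiableOn.mul (by fun_prop) (hf.mono fun w hw => ?_)
      have h2 := (mem_reProdIm.1 hw).1
      simp only [ofReal_re, add_re, mul_re, I_re, mul_zero, ofReal_im, I_im, sub_self, add_zero,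
        mul_one] at h2
      exact (Set.mem_uIcc.1 h2).elim (fun h => h.2.trans_lt hab') fun h => h.2.trans_lt hab)
  simp only [ofReal_re, add_re, mul_re, I_re, mul_zero, ofReal_im, I_im, sub_self, add_zero,
    mul_one, add_im, mul_im, zero_add] at h1
  have h3 : ∀ x ∈ Set.uIcc a a', (fun w => exp (-(s * w)) * f w) (x + ((2 * Real.pi : ℝ) : ℂ) * I) =
      (fun w => exp (-(s * w)) * f w) (x + ((0 : ℝ) : ℂ) * I) := by
    intro x hx
    have hx' : (x : ℂ).re < b := by
      simpa using (Set.mem_uIcc.1 hx).elim (fun h => h.2.trans_lt hab') fun h => h.2.trans_lt hab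
    have := exp_mul_periodic hper hx'
    push_cast at this ⊢
    simpa using this
  rw [intervalIntegral.integral_congr h3, sub_self, zero_add, ← smul_sub, smul_eq_mul] at h1
  exact (sub_eq_zero.1 ((mul_eq_zero.1 h1).resolve_left I_ne_zero)).symm

/-- Fourier expansion on a vertical line. -/
lemma hasSum_mode {a : ℝ} {f : ℂ → ℂ} (hf : Continuous fun θ : ℝ => f (a + θ * I))
    (hper : ∀ θ : ℝ, f (a + (θ + 2 * Real.pi : ℝ) * I) = f (a + θ * I))
    (hs : Summable fun j : ℤ => ‖mode a j f‖ * Real.exp a ^ j) (θ : ℝ) :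
    HasSum (fun j : ℤ => (2 * Real.pi : ℂ)⁻¹ * mode a j f * exp (j * (a + θ * I)))
      (f (a + θ * I)) := by
  have : Fact (0 < 2 * Real.pi) := ⟨Real.two_pi_pos⟩
  have hp : Function.Periodic (fun θ : ℝ => f (a + θ * I)) (2 * Real.pi) := hper
  set F : C(AddCircle (2 * Real.pi), ℂ) := ⟨hp.lift, continuous_coinduced_dom.2 hf⟩ with hF
  have hpi : (Real.pi : ℂ) ≠ 0 := by exact_mod_cast Real.pi_ne_zero
  have hcoef : ∀ j : ℤ, fourierCoeff F j = (2 * Real.pi : ℂ)⁻¹ * mode a j f * exp (j * a) := by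
    intro j
    rw [fourierCoeff_eq_intervalIntegral F j 0, zero_add, mode, mul_assoc,
      ← intervalIntegral.integral_mul_const, one_div, real_smul]
    push_cast
    congr 1
    refine intervalIntegral.integral_congr fun x _ => ?_
    simp only [fourier_coe_apply, smul_eq_mul]
    change _ * f (a + x * I) = _
    rw [mul_right_comm (exp (-(j * (a + x * I)))), ← exp_add]
    congr 2
    push_cast
    field_simp
    ring
  have hsum : Summable (fourierCoeff F) := by
    refine Summable.of_norm ?_
    refine (hs.mul_left ‖(2 * Real.pi : ℂ)⁻¹‖).congr fun j => ?_
    rw [hcoef, norm_mul, norm_mul, mul_assoc]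
    congr 2
    simpa using (norm_exp_line a 0 j).symm
  have h1 := has_pointwise_sum_fourier_series_of_summable hsum (θ : AddCircle (2 * Real.pi))
  have h2 : (fun j : ℤ => (2 * Real.pi : ℂ)⁻¹ * mode a j f * exp (j * (a + θ * I))) =
      fun j => fourierCoeff F j • fourier j (θ : AddCircle (2 * Real.pi)) := by
    funext j
    rw [hcoef, fourier_coe_apply, smul_eq_mul, mul_assoc _ (exp _), ← exp_add]
    congr 2
    push_cast
    field_simp
  rw [h2]
  exact h1

/-- A function on a half plane with vanishing Fourier coefficients is zero. -/
lemma eq_zero_of_mode_eq_zero {a : ℝ} {f : ℂ → ℂ} {μ : ℂ}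
    (hf : Continuous fun θ : ℝ => f (a + θ * I))
    (hper : ∀ θ : ℝ, f (a + (θ + 2 * Real.pi : ℝ) * I) = exp (2 * Real.pi * I * μ) * f (a + θ * I))
    (h0 : ∀ j : ℤ, mode a (μ + j) f = 0) (θ : ℝ) : f (a + θ * I) = 0 := by
  have h1 : ∀ j : ℤ, mode a j (fun w => exp (-(μ * w)) * f w) = 0 := by
    intro j
    rw [← h0 j]
    unfold mode
    congr 1
    funext θ
    rw [← mul_assoc, ← exp_add]
    congr 2
    ring
  have h2 := hasSum_mode (a := a) (f := fun w => exp (-(μ * w)) * f w)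
    ((by fun_prop : Continuous fun θ : ℝ => exp (-(μ * (a + θ * I)))).mul hf) (fun θ => by
      rw [hper, ← mul_assoc, ← exp_add]
      congr 2
      push_cast
      ring) (by simp [h1]) θ
  simp only [h1, mul_zero, zero_mul] at h2
  exact (mul_eq_zero.1 (h2.unique hasSum_zero)).resolve_left (exp_ne_zero _)

lemma norm_mode_le {a : ℝ} {f : ℂ → ℂ} {μ : ℂ} {M : ℝ}
    (hM : ∀ θ ∈ Set.Icc (0 : ℝ) (2 * Real.pi), ‖exp (-(μ * (a + θ * I))) * f (a + θ * I)‖ ≤ M)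
    (j : ℤ) : ‖mode a (μ + j) f‖ ≤ 2 * Real.pi * M * (Real.exp a ^ j)⁻¹ := by
  have h1 := intervalIntegral.norm_integral_le_of_norm_le_const (a := 0) (b := 2 * Real.pi)
    (f := fun θ : ℝ => exp (-((μ + j) * (a + θ * I))) * f (a + θ * I))
    (C := M * (Real.exp a ^ j)⁻¹) (fun θ hθ => by
      rw [Set.uIoc_of_le Real.two_pi_pos.le] at hθ
      have h2 := hM θ (Set.Ioc_subset_Icc_self hθ)
      rw [add_mul, neg_add, exp_add, mul_right_comm, norm_mul]
      refine mul_le_mul h2 (le_of_eq ?_) (norm_nonneg _) ((norm_nonneg _).trans h2)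
      rw [exp_neg, norm_inv, norm_exp_line])
  rw [sub_zero, abs_of_pos Real.two_pi_pos] at h1
  refine h1.trans (le_of_eq ?_)
  ring

/-- Cauchy's formula for periodic functions on a half plane without negative Fourier modes. -/
lemma eq_integral_of_mode_eq_zero {a : ℝ} (hf : DifferentiableOn ℂ f {w | w.re < b}) (hab : a < b)
    (hper : ∀ w : ℂ, w.re < b → f (w + 2 * Real.pi * I) = f w)
    (h0 : ∀ j : ℤ, j < 0 → mode a j f = 0) {w : ℂ} (hw : w.re < a) :
    f w = (2 * Real.pi : ℂ)⁻¹ *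
      mode a 0 (fun s => exp s / (exp s - exp w) * f s) := by
  have hper' : ∀ j : ℤ, ∀ w : ℂ, w.re < b →
      f (w + 2 * Real.pi * I) = exp (2 * Real.pi * I * j) * f w := by
    intro j w hw
    rw [hper w hw, mul_comm _ (j : ℂ), exp_int_mul_two_pi_mul_I, one_mul]
  set a' := w.re with ha'
  have hab' : a' < b := hw.trans hab
  have hmode : ∀ j : ℤ, mode a' j f = mode a j f := fun j =>
    mode_eq_mode hf hab' hab (hper' j)
  have hcont := continuous_line_of_differentiableOn hf hab
  obtain ⟨M, hM⟩ := (isCompact_Icc (a := (0 : ℝ)) (b := 2 * Real.pi)).exists_bound_of_continuousOn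
    hcont.continuousOn
  have hM' : ∀ j : ℤ, ‖mode a j f‖ ≤ 2 * Real.pi * M * (Real.exp a ^ j)⁻¹ := by
    intro j
    simpa using norm_mode_le (a := a) (f := f) (μ := 0) (by simpa using hM) j
  set q := Real.exp a' / Real.exp a with hq
  have hq1 : q < 1 := by
    rw [hq, div_lt_one (Real.exp_pos a)]
    exact Real.exp_lt_exp.2 hw
  have hsN : Summable fun k : ℕ => ‖mode a (k : ℤ) f‖ * Real.exp a' ^ (k : ℤ) := by
    refine Summable.of_nonneg_of_le (fun k => by positivity) (fun k => ?_)
      ((summable_geometric_of_lt_one (by positivity) hq1).mul_left (2 * Real.pi * M))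
    calc ‖mode a (k : ℤ) f‖ * Real.exp a' ^ (k : ℤ)
        ≤ 2 * Real.pi * M * (Real.exp a ^ (k : ℤ))⁻¹ * Real.exp a' ^ (k : ℤ) := by
          gcongr
          exact hM' k
      _ = 2 * Real.pi * M * q ^ k := by
          rw [hq, div_pow, zpow_natCast, zpow_natCast]; ring
  have hneg : ∀ j : ℤ, j ∉ Set.range ((↑) : ℕ → ℤ) → mode a j f = 0 := by
    intro j hj
    refine h0 j (not_le.1 fun h => hj ⟨j.toNat, Int.toNat_of_nonneg h⟩)
  have hs : Summable fun j : ℤ => ‖mode a' j f‖ * Real.exp a' ^ j := by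
    refine (Function.Injective.summable_iff (g := ((↑) : ℕ → ℤ)) Nat.cast_injective
      fun j hj => ?_).1 ?_
    · rw [hmode, hneg j hj]; simp
    · simpa [Function.comp_def, hmode] using hsN
  have h1 := hasSum_mode (continuous_line_of_differentiableOn hf hab') (fun θ => by
    have := hper (a' + θ * I) (by simpa using hab')
    rw [← this]
    congr 1
    push_cast
    ring) hs w.im
  have hwre : (a' + w.im * I : ℂ) = w := re_add_im w
  rw [hwre, ← Function.Injective.hasSum_iff (g := ((↑) : ℕ → ℤ)) Nat.cast_injective
    (fun j hj => by rw [hmode, hneg j hj]; simp)] at h1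
  -- On the line `Re s = a` the kernel is the geometric series in `exp (w - s)`. Integrated against
  -- `f` term by term, it reproduces the Fourier series of `f` at `w`, since the negative modes are
  -- absent.
  have h2 := hasSum_mode_mul (a := a) (f := f) (v := fun s => exp s / (exp s - exp w)) hcont 0
    (α := fun k => exp (k * w)) (-1) (fun θ => by
      have h3 : ‖exp (w - (a + θ * I))‖ < 1 := by
        rw [norm_exp, Real.exp_lt_one_iff]
        simpa using hw
      have h4 := hasSum_geometric_of_norm_lt_one h3
      have h5 : (1 - exp (w - (a + θ * I)))⁻¹ =
          exp (a + θ * I) / (exp (a + θ * I) - exp w) := by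
        rw [exp_sub]
        have : exp (a + θ * I) ≠ 0 := exp_ne_zero _
        field_simp
      rw [← h5]
      have h6 : (fun k : ℕ => exp (k * w) * exp ((-1 * k : ℤ) * (a + θ * I))) =
          fun k : ℕ => exp (w - (a + θ * I)) ^ k := by
        funext k
        rw [← exp_add, ← exp_nat_mul]
        congr 1
        push_cast
        ring
      rw [h6]
      exact h4) (by
      refine (summable_geometric_of_lt_one (by positivity) hq1).congr fun k => ?_
      have h6 : ‖exp (k * w)‖ = Real.exp a' ^ k := by rw [exp_nat_mul, norm_pow, norm_exp]
      rw [h6, hq, div_pow, neg_one_mul, zpow_neg, zpow_natCast]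
      ring)
  refine HasSum.unique h1 ?_
  have h7 := h2.mul_left (2 * Real.pi : ℂ)⁻¹
  have h8 : ((fun j : ℤ => (2 * Real.pi : ℂ)⁻¹ * mode a' j f * exp (j * w)) ∘ ((↑) : ℕ → ℤ)) =
      fun k : ℕ => (2 * Real.pi : ℂ)⁻¹ * (exp (k * w) * mode a (0 - (-1 * k : ℤ)) f) := by
    funext k
    have h9 : (0 - ((-1 * k : ℤ) : ℂ)) = ((k : ℤ) : ℂ) := by push_cast; ring
    simp only [Function.comp_apply]
    rw [h9, hmode]
    push_cast
    ring
  rw [h8]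
  exact h7

end Modes

/-! ### Exponential coordinates around a hyperplane -/

section Wrap

open Complex

variable {n : ℕ} (a : Vec n) (c : ℂ)

/-- The affine function with gradient `a` and constant term `c`. -/
def aff (x : Vec n) : ℂ := a ⬝ᵥ x + c

/-- The vector orthogonal to the hyperplanes `aff a c = const` on which `(a, ·)` is `1`. -/
def normalVec : Vec n := (a ⬝ᵥ a)⁻¹ • a

/-- The point of the line through `y` orthogonal to the hyperplane `aff a c = 0` where `aff a c`
has the value `t`. -/
def slide (t : ℂ) (y : Vec n) : Vec n := y + (t - aff a c y) • normalVec a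

/-- `wrap (w, y) = slide (exp w) y`. -/
def wrap (z : ℂ × Vec n) : Vec n := slide a c (exp z.1) z.2

variable {a c}

lemma dotProduct_normalVec (ha : a ⬝ᵥ a ≠ 0) : a ⬝ᵥ normalVec a = 1 := by
  rw [normalVec, dotProduct_smul, smul_eq_mul, inv_mul_cancel₀ ha]

lemma aff_add_smul (ha : a ⬝ᵥ a ≠ 0) (x : Vec n) (t : ℂ) :
    aff a c (x + t • normalVec a) = aff a c x + t := by
  rw [aff, dotProduct_add, dotProduct_smul, dotProduct_normalVec ha, aff, smul_eq_mul]
  ring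

lemma aff_slide (ha : a ⬝ᵥ a ≠ 0) (t : ℂ) (y : Vec n) : aff a c (slide a c t y) = t := by
  rw [slide, aff_add_smul ha]; ring

lemma slide_aff (y : Vec n) : slide a c (aff a c y) y = y := by simp [slide]

lemma wrap_of_exp_eq {w : ℂ} {y : Vec n} (h : exp w = aff a c y) : wrap a c (w, y) = y := by
  rw [wrap, h, slide_aff]

lemma wrap_add_two_pi (w : ℂ) (y : Vec n) :
    wrap a c (w + 2 * Real.pi * I, y) = wrap a c (w, y) := by
  simp [wrap, exp_add, exp_two_pi_mul_I]

lemma analyticAt_aff (a : Vec n) (c : ℂ) (x : Vec n) : AnalyticAt ℂ (aff a c) x :=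
  (analyticAt_dot a x).add analyticAt_const

lemma continuous_aff (a : Vec n) (c : ℂ) : Continuous (aff a c) :=
  continuous_iff_continuousAt.2 fun x => (analyticAt_aff a c x).continuousAt

lemma continuous_slide (a : Vec n) (c : ℂ) :
    Continuous fun z : ℂ × Vec n => slide a c z.1 z.2 := by
  have := continuous_aff a c
  unfold slide
  fun_prop

lemma analyticAt_wrap (a : Vec n) (c : ℂ) (z : ℂ × Vec n) : AnalyticAt ℂ (wrap a c) z := by
  have h1 : AnalyticAt ℂ (fun z : ℂ × Vec n => aff a c z.2) z :=
    AnalyticAt.fun_comp (g := aff a c) (analyticAt_aff a c z.2) analyticAt_snd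
  have h2 : AnalyticAt ℂ (fun z : ℂ × Vec n => exp z.1) z := analyticAt_fst.cexp
  exact analyticAt_snd.add ((h2.sub h1).smul analyticAt_const)

end Wrap

/-! ### Charts and the role of quasi-invariance -/

section Chart

open Complex

variable {n : ℕ}

/-- Coordinates near a generic point `x₀` of the hyperplane `aff a c = 0` in which the singular part
of the potential is `m (m + 1) (a, a) / t²`, and constants which control the expansion of the
regular part. -/
structure Chart (u : Vec n → ℂ) (sing : Set (Vec n)) (a : Vec n) (c lam : ℂ) (m : ℕ)
    (x₀ : Vec n) where
  (r t b r₁ V : ℝ)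
  coeff : ℕ → Vec n → ℂ
  reg : ℂ × Vec n → ℂ
  r_pos : 0 < r
  t_lt : t < b
  notMem : ∀ z : ℂ × Vec n, z.1.re < b → z.2 ∈ Metric.ball x₀ r → wrap a c z ∉ sing
  pot : ∀ z : ℂ × Vec n, z.1.re < b → z.2 ∈ Metric.ball x₀ r →
    u (wrap a c z) - lam = m * (m + 1) * (a ⬝ᵥ a) / exp z.1 ^ 2 + reg z
  hasSum : ∀ z : ℂ × Vec n, z.1.re < b → z.2 ∈ Metric.ball x₀ r →
    HasSum (fun i : ℕ => coeff i z.2 * exp (i * z.1)) (reg z)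
  bound : ∀ i, ∀ y ∈ Metric.ball x₀ r, ‖coeff i y‖ ≤ V * (1 / r₁) ^ i
  V_nonneg : 0 ≤ V
  two_mul_le : 2 * Real.exp t ≤ r₁
  small : Real.exp t ^ 2 * ((16 * n / (r / 2) ^ 2 + 2 * V) / ‖a ⬝ᵥ a‖) * Real.exp 1 ^ 2 < 1
  odd : ∀ i, Odd i → i < 2 * m + 1 → ∀ y ∈ Metric.ball x₀ r, coeff i y = 0

/-- In `f t - f (-t)` the even Taylor coefficients cancel and the odd ones double. -/
lemma iteratedDeriv_eq_zero_of_odd {f g : ℂ → ℂ} {N : ℕ} (hf : AnalyticAt ℂ f 0)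
    (hg : AnalyticAt ℂ g 0) (h : ∀ᶠ t in 𝓝 (0 : ℂ), f t - f (-t) = t ^ N * g t) {i : ℕ}
    (hi : Odd i) (hiN : i < N) : iteratedDeriv i f 0 = 0 := by
  have hneg : AnalyticAt ℂ (fun t => f (-t)) 0 :=
    AnalyticAt.fun_comp (g := f) (by simpa using hf) (by fun_prop)
  have hs : AnalyticAt ℂ (fun t => f t - f (-t)) 0 := hf.sub hneg
  have h1 : (N : ℕ∞) ≤ analyticOrderAt (fun t => f t - f (-t)) 0 := by
    rw [natCast_le_analyticOrderAt hs]
    exact ⟨g, hg, by simpa using h⟩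
  have h2 := (natCast_le_analyticOrderAt_iff_iteratedDeriv_eq_zero hs).1 h1 i hiN
  rw [iteratedDeriv_fun_sub hf.contDiffAt hneg.contDiffAt, iteratedDeriv_comp_neg, neg_zero,
    hi.neg_one_pow, neg_one_smul, sub_neg_eq_add, ← two_mul] at h2
  simpa using h2

/-- On each normal line the reflection is `t ↦ -t` and the polar part of `u` is even.
Quasi-invariance is therefore a condition on the regular part alone, and it kills the odd Taylor
coefficients of order less than `2 m + 1`. -/
lemma exists_chart {u : Vec n → ℂ} {sing : Set (Vec n)} {a : Vec n} {c lam : ℂ} {m : ℕ}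
    {x₀ : Vec n} (ha : a ⬝ᵥ a ≠ 0) (hx₀ : aff a c x₀ = 0) {v g : Vec n → ℂ}
    (hv : AnalyticAt ℂ v x₀) (hg : AnalyticAt ℂ g x₀)
    (hu : ∀ᶠ x in 𝓝 x₀, aff a c x ≠ 0 →
      x ∉ sing ∧ u x = m * (m + 1) * (a ⬝ᵥ a) / aff a c x ^ 2 + v x)
    (hq : ∀ᶠ x in 𝓝 x₀, u x - u (x - (2 * aff a c x / (a ⬝ᵥ a)) • a) =
      aff a c x ^ (2 * m + 1) * g x) : Nonempty (Chart u sing a c lam m x₀) := by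
  set V : ℝ := ‖v x₀ - lam‖ + 1 with hV
  have hVb : ∀ᶠ x in 𝓝 x₀, ‖v x - lam‖ < V :=
    (hv.continuousAt.sub continuousAt_const).norm.eventually_lt continuousAt_const (lt_add_one _)
  have hall := hv.eventually_analyticAt.and (hg.eventually_analyticAt.and (hVb.and (hu.and hq)))
  have hcs : ContinuousAt (fun z : ℂ × Vec n => slide a c z.1 z.2) (0, x₀) :=
    (continuous_slide a c).continuousAt
  have h0 : slide a c 0 x₀ = x₀ := by rw [← hx₀, slide_aff]
  have hall' := hcs.tendsto.eventually (by simpa only [h0] using hall)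
  obtain ⟨δ, hδ, hb⟩ := Metric.eventually_nhds_iff_ball.1 hall'
  have hmem : ∀ t : ℂ, ‖t‖ < δ → ∀ y ∈ Metric.ball x₀ δ, (t, y) ∈ Metric.ball ((0 : ℂ), x₀) δ := by
    intro t ht y hy
    rw [← ball_prod_same]
    exact ⟨by simpa using ht, hy⟩
  set f : Vec n → ℂ → ℂ := fun y t => v (slide a c t y) - lam with hf
  have hsl : ∀ (y : Vec n) (t : ℂ), AnalyticAt ℂ (fun t => slide a c t y) t := by
    intro y t
    unfold slide
    fun_prop
  have hfa : ∀ y ∈ Metric.ball x₀ δ, ∀ t ∈ Metric.ball (0 : ℂ) δ, AnalyticAt ℂ (f y) t := by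
    intro y hy t ht
    exact (AnalyticAt.fun_comp (g := v) (f := fun t => slide a c t y)
      (hb _ (hmem t (by simpa using ht) y hy)).1 (hsl y t)).sub analyticAt_const
  -- Cauchy estimates on the circle of radius `r₁` give the field `bound`, and `b = log r₁` keeps
  -- `exp w` inside it. The number `ρ = exp t` is taken small enough for `two_mul_le` and `small`.
  set r₁ := δ / 2 with hr₁
  have hr₁0 : 0 < r₁ := half_pos hδ
  set X := ((16 * n / (δ / 2) ^ 2 + 2 * V) / ‖a ⬝ᵥ a‖) * Real.exp 1 ^ 2 with hX
  have hX0 : 0 ≤ X := by positivity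
  set ρ := min (r₁ / 4) (1 / (X + 1)) with hρ
  have hρ0 : 0 < ρ := by positivity
  have hsub : ∀ z : ℂ × Vec n, z.1.re < Real.log r₁ → ‖exp z.1‖ < r₁ := by
    intro z hz
    rw [norm_exp, ← Real.lt_log_iff_exp_lt hr₁0]
    exact hz
  refine ⟨⟨δ, Real.log ρ, Real.log r₁, r₁, V,
    fun i y => (i.factorial : ℂ)⁻¹ * iteratedDeriv i (f y) 0, fun z => f z.2 (exp z.1), hδ,
    Real.log_lt_log hρ0 ((min_le_left _ _).trans_lt (by linarith)), fun z hz hy => ?_,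
    fun z hz hy => ?_, fun z hz hy => ?_, fun i y hy => ?_, by positivity, ?_, ?_,
    fun i hi hiN y hy => ?_⟩⟩
  · have h1 := (hb _ (hmem _ ((hsub z hz).trans (by linarith)) _ hy)).2.2.2.1
    simp only [aff_slide ha] at h1
    exact (h1 (exp_ne_zero _)).1
  · have h1 := (hb _ (hmem _ ((hsub z hz).trans (by linarith)) _ hy)).2.2.2.1
    simp only [aff_slide ha] at h1
    have h2 := (h1 (exp_ne_zero _)).2
    simp only [hf]
    rw [wrap, h2]
    ring
  · have h1 := hasSum_taylorSeries_on_ball (f := f z.2) (c := 0) (r := δ) (z := exp z.1)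
      (fun t ht => (hfa _ hy t ht).differentiableAt.differentiableWithinAt)
      (by simpa using (hsub z hz).trans (by linarith))
    have h2 : (fun i : ℕ => (i.factorial : ℂ)⁻¹ * iteratedDeriv i (f z.2) 0 * exp (i * z.1)) =
        fun i : ℕ => (i.factorial : ℂ)⁻¹ • (exp z.1 - 0) ^ i • iteratedDeriv i (f z.2) 0 := by
      funext i
      rw [exp_nat_mul, sub_zero, smul_eq_mul, smul_eq_mul]
      ring
    rw [h2]
    exact h1
  · have h1 := norm_iteratedDeriv_le_of_forall_mem_sphere_norm_le (f := f y) (c := 0) (R := r₁)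
      (C := V) i hr₁0 (DifferentiableOn.diffContOnCl (by
        rw [closure_ball _ hr₁0.ne']
        intro t ht
        refine (hfa y hy t ?_).differentiableAt.differentiableWithinAt
        exact Metric.closedBall_subset_ball (by linarith) ht)) (fun t ht => by
        have h2 : ‖t‖ = r₁ := by simpa using ht
        exact (hb _ (hmem t (by rw [h2]; linarith) y hy)).2.2.1.le)
    rw [norm_mul, norm_inv, _root_.norm_natCast]
    rw [← div_eq_inv_mul, div_le_iff₀ (by positivity)]
    refine h1.trans (le_of_eq ?_)
    rw [one_div, inv_pow]
    ring
  · rw [Real.exp_log hρ0]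
    have := min_le_left (r₁ / 4) (1 / (X + 1))
    linarith
  · rw [Real.exp_log hρ0]
    have h1 : ρ ≤ 1 / (X + 1) := min_le_right _ _
    have h2 : ρ * (X + 1) ≤ 1 := by rwa [le_div_iff₀ (by positivity)] at h1
    have h3 : ρ ≤ 1 := h1.trans (by rw [div_le_one (by positivity)]; linarith)
    rw [mul_assoc, ← hX]
    nlinarith
  · rw [iteratedDeriv_eq_zero_of_odd (f := f y) (g := fun t => g (slide a c t y))
      (N := 2 * m + 1) (hfa y hy 0 (Metric.mem_ball_self hδ)) ?_ ?_ hi hiN, mul_zero]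
    · exact AnalyticAt.fun_comp (g := g) (f := fun t => slide a c t y)
        (hb _ (hmem 0 (by simpa using hδ) y hy)).2.1 (hsl y 0)
    · filter_upwards [Metric.ball_mem_nhds (0 : ℂ) hδ] with t ht
      have ht' : ‖t‖ < δ := by simpa using ht
      rcases eq_or_ne t 0 with rfl | ht0
      · simp
      · have h1 := (hb _ (hmem t ht' y hy)).2.2.2
        have h2 := (hb _ (hmem (-t) (by simpa using ht') y hy)).2.2.2.1
        simp only [aff_slide ha] at h1 h2
        have h3 : slide a c t y - (2 * t / (a ⬝ᵥ a)) • a = slide a c (-t) y := by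
          rw [slide, slide, normalVec, smul_smul, smul_smul, add_sub_assoc, ← sub_smul]
          congr 2
          field_simp
          ring
        rw [h3, (h1.1 ht0).2, (h2 (neg_ne_zero.2 ht0)).2] at h1
        rw [← h1.2]
        simp only [hf]
        rw [neg_sq]
        ring

end Chart

/-! ### The potential near a generic point -/

section Generic

variable {n : ℕ} (P : EllipticPotential n)

lemma shifted_eq_aff (τ : ℂ) (α : AffineFun n) (p q : ℤ) :
    shifted τ α p q = aff α.1 (α.2 - p - q * τ) := by
  funext x
  simp only [shifted, aff]
  ring

/-- The regular part of the potential near a generic point of a singular hyperplane. -/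
lemma exists_regular_part {α : AffineFun n} (hα : α ∈ P.A) {p q : ℤ} {x₀ : Vec n}
    (hx₀ : P.IsGenericPoint α p q x₀) :
    (∀ᶠ x in 𝓝 x₀, x ∈ P.sing → x ∈ hyperplane P.τ α p q) ∧
    ∃ v : Vec n → ℂ, AnalyticAt ℂ v x₀ ∧ ∀ x,
      P.u x = P.m α * (P.m α + 1) * (α.1 ⬝ᵥ α.1) / shifted P.τ α p q x ^ 2 + v x := by
  classical
  set Λ := periodPair P.τ P.im_pos with hΛ
  set l₀ : ℂ := p + q * P.τ with hl₀
  have hl₀m : l₀ ∈ Λ.lattice := PeriodPair.mem_lattice.2 ⟨p, q, by simp [hΛ, hl₀, periodPair]⟩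
  have hs : ∀ x, shifted P.τ α p q x = α.1 ⬝ᵥ x + α.2 - l₀ := fun x => by
    simp only [shifted, hl₀]; ring
  have h0 : α.1 ⬝ᵥ x₀ + α.2 = l₀ := by
    have h1 := hx₀.1
    rw [hyperplane, Set.mem_ofPred_eq, hs] at h1
    exact sub_eq_zero.1 h1
  have hmem : ∀ β : AffineFun n, ∀ x, β.1 ⬝ᵥ x + β.2 ∈ Λ.lattice ↔
      ∃ p' q' : ℤ, x ∈ hyperplane P.τ β p' q' := by
    intro β x
    rw [PeriodPair.mem_lattice]
    refine exists_congr fun p' => exists_congr fun q' => ?_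
    simp only [hΛ, periodPair, hyperplane, shifted, Set.mem_ofPred_eq]
    constructor <;> intro h <;> linear_combination -h
  have hoth : ∀ β ∈ P.A, β ≠ α → β.1 ⬝ᵥ x₀ + β.2 ∉ Λ.lattice := by
    intro β hβ hne h
    obtain ⟨p', q', h'⟩ := (hmem β x₀).1 h
    exact hne (hx₀.2 β hβ p' q' h').1
  have hcont : ∀ β : AffineFun n, Continuous fun x : Vec n => β.1 ⬝ᵥ x + β.2 := fun β =>
    continuous_iff_continuousAt.2 fun x => (analyticAt_affine β x).continuousAt
  refine ⟨?_, ?_⟩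
  · have h1 : ∀ᶠ x in 𝓝 x₀, ∀ β ∈ P.A, β ≠ α → β.1 ⬝ᵥ x + β.2 ∉ Λ.lattice := by
      refine (Filter.eventually_all_finset _).2 fun β hβ => ?_
      by_cases hne : β = α
      · exact Eventually.of_forall fun x h => absurd hne h
      · filter_upwards [(hcont β).continuousAt.eventually
          (Λ.isClosed_lattice.isOpen_compl.mem_nhds (hoth β hβ hne))] with x hx _ using hx
    have h2 : ∀ᶠ x in 𝓝 x₀, α.1 ⬝ᵥ x + α.2 ∉ (Λ.lattice : Set ℂ) \ {l₀} := by
      refine (hcont α).continuousAt.eventually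
        ((Λ.isClosed_of_subset_lattice Set.sdiff_subset).isOpen_compl.mem_nhds ?_)
      simp [h0]
    filter_upwards [h1, h2] with x hx hx' ⟨β, hβ, p', q', h3⟩
    have h4 := (hmem β x).2 ⟨p', q', h3⟩
    by_cases hne : β = α
    · subst hne
      by_contra hcon
      refine hx' ⟨h4, fun h5 => hcon ?_⟩
      rw [hyperplane, Set.mem_ofPred_eq, hs, sub_eq_zero]
      exact h5
    · exact absurd h4 (hx β hβ hne)
  -- Only the summand of the pole `l₀` is separated from the Weierstrass function. It is `1 / (z -
  -- l₀) ^ 2 - 1 / l₀ ^ 2`, and for `l₀ = 0` the convention `1 / 0 = 0` makes this the correct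
  -- summand.
  · refine ⟨fun x => (P.m α * (P.m α + 1) * (α.1 ⬝ᵥ α.1)) *
        (Λ.weierstrassPExcept l₀ (α.1 ⬝ᵥ x + α.2) - 1 / l₀ ^ 2) +
      ∑ β ∈ P.A.erase α, (P.m β * (P.m β + 1) * (β.1 ⬝ᵥ β.1)) *
        Λ.weierstrassP (β.1 ⬝ᵥ x + β.2), ?_, fun x => ?_⟩
    · refine (analyticAt_const.mul (AnalyticAt.sub ?_ analyticAt_const)).add
        (Finset.analyticAt_fun_sum _ fun β hβ => analyticAt_const.mul ?_)
      · refine AnalyticAt.fun_comp (g := Λ.weierstrassPExcept l₀) ?_ (analyticAt_affine α x₀)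
        refine Λ.analyticOnNhd_weierstrassPExcept l₀ _ ?_
        rw [h0]
        simp
      · refine AnalyticAt.fun_comp (g := Λ.weierstrassP) ?_ (analyticAt_affine β x₀)
        exact Λ.analyticOnNhd_weierstrassP _
          (hoth β (Finset.mem_of_mem_erase hβ) (Finset.ne_of_mem_erase hβ))
    · have h1 := Λ.weierstrassPExcept_add ⟨l₀, hl₀m⟩ (α.1 ⬝ᵥ x + α.2)
      simp only at h1
      rw [EllipticPotential.u, ← Finset.add_sum_erase _ _ hα, ← hΛ, ← h1, hs]
      ring

lemma exists_chart_of_isGenericPoint (hP : P.QuasiInvariant) (lam : ℂ) {α : AffineFun n}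
    (hα : α ∈ P.A) {p q : ℤ} {x₀ : Vec n} (hx₀ : P.IsGenericPoint α p q x₀) :
    Nonempty (Chart P.u P.sing α.1 (α.2 - p - q * P.τ) lam (P.m α) x₀) := by
  obtain ⟨h1, v, hv, hu⟩ := exists_regular_part P hα hx₀
  obtain ⟨g, hg, hq⟩ := hP α hα p q x₀ hx₀
  have h0 := hx₀.1
  simp only [hyperplane, Set.mem_ofPred_eq, reflection, shifted_eq_aff] at h0 h1 hu hq
  refine exists_chart (P.nonisotropic α hα) h0 hv hg ?_ hq
  filter_upwards [h1] with x hx hx0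
  exact ⟨fun h => hx0 (hx h), hu x⟩

end Generic

/-! ### The eigenvalue equation in exponential coordinates -/

section ChainRule

open Complex

variable {n : ℕ} {a : Vec n} {c : ℂ}

/-- The derivative in the direction `v`. -/
def dirD (v : Vec n) (f : Vec n → ℂ) (x : Vec n) : ℂ := fderiv ℂ f x v

lemma analyticAt_dirD (v : Vec n) {f : Vec n → ℂ} {x : Vec n} (hf : AnalyticAt ℂ f x) :
    AnalyticAt ℂ (dirD v f) x :=
  ((ContinuousLinearMap.apply ℂ ℂ v).analyticAt _).comp hf.fderiv

lemma dirD_pd (v : Vec n) {f : Vec n → ℂ} {x : Vec n} (hf : AnalyticAt ℂ f x) (i : Fin n) :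
    dirD v (pd i f) x = pd i (dirD v f) x := by
  have h1 : dirD v f = fun x => ∑ j, v j * pd j f x := funext fun x => fderiv_apply_eq_sum f x v
  rw [h1, pd_sum _ i fun j _ => analyticAt_const_mul (v j) (analyticAt_pd j hf), dirD,
    fderiv_apply_eq_sum]
  refine Finset.sum_congr rfl fun j _ => ?_
  rw [pd_const_mul i _ (analyticAt_pd j hf), pd_comm i j hf]

lemma sum_mul_pd (ha : a ⬝ᵥ a ≠ 0) (f : Vec n → ℂ) (x : Vec n) :
    ∑ i, a i * pd i f x = (a ⬝ᵥ a) * dirD (normalVec a) f x := by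
  rw [← fderiv_apply_eq_sum, dirD, ← smul_eq_mul, ← map_smul, normalVec, smul_smul,
    mul_inv_cancel₀ ha, one_smul]

lemma hasFDerivAt_slide (a : Vec n) (c t : ℂ) (y : Vec n) :
    HasFDerivAt (slide a c t) (ContinuousLinearMap.id ℂ (Vec n) -
      (∑ j, a j • (ContinuousLinearMap.proj j : Vec n →L[ℂ] ℂ)).smulRight (normalVec a)) y := by
  have h1 : HasFDerivAt (aff a c) (∑ j, a j • (ContinuousLinearMap.proj j : Vec n →L[ℂ] ℂ)) y := by
    unfold aff dotProduct
    exact (HasFDerivAt.fun_sum fun j _ => (ContinuousLinearMap.proj (R := ℂ)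
      (φ := fun _ : Fin n => ℂ) j).hasFDerivAt.const_mul (a j)).add_const c
  have h2 := (hasFDerivAt_id y).add ((h1.const_sub t).smul_const (normalVec a))
  refine h2.congr_fderiv ?_
  ext
  simp [sub_eq_add_neg]

lemma pd_comp_slide {f : Vec n → ℂ} {t : ℂ} {y : Vec n} (hf : AnalyticAt ℂ f (slide a c t y))
    (i : Fin n) : pd i (fun y => f (slide a c t y)) y =
      pd i f (slide a c t y) - a i * dirD (normalVec a) f (slide a c t y) := by
  have h1 := hf.differentiableAt.hasFDerivAt.comp y (hasFDerivAt_slide a c t y)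
  have h2 : fderiv ℂ (fun y => f (slide a c t y)) y = _ := h1.fderiv
  rw [pd, h2]
  simp [pd, dirD, Pi.single_apply]

/-- The map `slide a c t` projects to the hyperplane `aff a c = t` along its normal, so the
composite is constant along normals and its Laplacian lacks the second normal derivative. -/
lemma lap_comp_slide (ha : a ⬝ᵥ a ≠ 0) {f : Vec n → ℂ} {t : ℂ} {y : Vec n}
    (hf : AnalyticAt ℂ f (slide a c t y)) :
    lap (fun y => f (slide a c t y)) y = lap f (slide a c t y) -
      (a ⬝ᵥ a) * dirD (normalVec a) (dirD (normalVec a) f) (slide a c t y) := by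
  have hcont : ContinuousAt (slide a c t) y := (hasFDerivAt_slide a c t y).continuousAt
  have hsl : AnalyticAt ℂ (slide a c t) y := by
    have := analyticAt_aff a c y
    unfold slide
    exact analyticAt_id.add ((analyticAt_const.sub this).smul analyticAt_const)
  have hν := analyticAt_dirD (normalVec a) hf
  have h1 : ∀ i, pd i (pd i fun y => f (slide a c t y)) y =
      pd i (pd i f) (slide a c t y) - 2 * (a i * pd i (dirD (normalVec a) f) (slide a c t y)) +
        a i * a i * dirD (normalVec a) (dirD (normalVec a) f) (slide a c t y) := by
    intro i
    have h2 : pd i (fun y => f (slide a c t y)) =ᶠ[𝓝 y] fun y => pd i f (slide a c t y) +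
        -(a i) * dirD (normalVec a) f (slide a c t y) := by
      filter_upwards [hcont.eventually hf.eventually_analyticAt] with z hz
      rw [pd_comp_slide hz]
      ring
    have h3 : AnalyticAt ℂ (fun y => pd i f (slide a c t y)) y :=
      AnalyticAt.fun_comp (g := pd i f) (analyticAt_pd i hf) hsl
    have h4 : AnalyticAt ℂ (fun y => dirD (normalVec a) f (slide a c t y)) y :=
      AnalyticAt.fun_comp (g := dirD (normalVec a) f) hν hsl
    rw [pd_congr_at i h2, pd_add i h3 (analyticAt_const_mul _ h4), pd_const_mul i _ h4,
      pd_comp_slide (analyticAt_pd i hf), pd_comp_slide hν, dirD_pd _ hf]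
    ring
  rw [lap, Finset.sum_congr rfl fun i _ => h1 i, Finset.sum_add_distrib, Finset.sum_sub_distrib,
    ← Finset.mul_sum, sum_mul_pd ha, ← Finset.sum_mul, lap]
  have h5 : ∑ i, a i * a i = a ⬝ᵥ a := rfl
  rw [h5]
  ring

lemma hasDerivAt_comp_wrap {f : Vec n → ℂ} {w : ℂ} {y : Vec n}
    (hf : AnalyticAt ℂ f (wrap a c (w, y))) :
    HasDerivAt (fun w => f (wrap a c (w, y)))
      (exp w * dirD (normalVec a) f (wrap a c (w, y))) w := by
  have h1 : HasDerivAt (fun w => wrap a c (w, y)) (exp w • normalVec a) w := by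
    have h0 : HasDerivAt (fun w => y + (exp w - aff a c y) • normalVec a) (exp w • normalVec a) w :=
      (((hasDerivAt_exp w).sub_const _).smul_const _).const_add y
    exact h0
  have h2 := hf.differentiableAt.hasFDerivAt.comp_hasDerivAt w h1
  rw [map_smul] at h2
  exact h2

/-- The derivative in the first variable. -/
def dw (Ψ : ℂ × Vec n → ℂ) (z : ℂ × Vec n) : ℂ := deriv (fun w => Ψ (w, z.2)) z.1

/-- The partial derivatives in the second variable. -/
def pdY (j : Fin n) (Ψ : ℂ × Vec n → ℂ) (z : ℂ × Vec n) : ℂ := pd j (fun y => Ψ (z.1, y)) z.2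

/-- The Laplacian in the second variable. -/
def lapY (Ψ : ℂ × Vec n → ℂ) (z : ℂ × Vec n) : ℂ := lap (fun y => Ψ (z.1, y)) z.2

/-- The differential equation in the coordinates given by `wrap`. -/
lemma wrap_equation (ha : a ⬝ᵥ a ≠ 0) {f : Vec n → ℂ} {Ψ : ℂ × Vec n → ℂ} {z : ℂ × Vec n}
    (hf : AnalyticAt ℂ f (wrap a c z)) (hΨ : Ψ =ᶠ[𝓝 z] fun z => f (wrap a c z)) :
    (a ⬝ᵥ a) * (dw (dw Ψ) z - dw Ψ z) = exp z.1 ^ 2 * (lap f (wrap a c z) - lapY Ψ z) := by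
  obtain ⟨w, y⟩ := z
  have hcw : ContinuousAt (fun w : ℂ => ((w, y) : ℂ × Vec n)) w := by fun_prop
  have hcy : ContinuousAt (fun y : Vec n => ((w, y) : ℂ × Vec n)) y := by fun_prop
  have hw : ∀ᶠ w' in 𝓝 w, AnalyticAt ℂ f (wrap a c (w', y)) ∧
      (fun w => Ψ (w, y)) =ᶠ[𝓝 w'] fun w => f (wrap a c (w, y)) := by
    have h1 : ∀ᶠ w' in 𝓝 w, Ψ (w', y) = f (wrap a c (w', y)) := hcw.eventually hΨ
    refine Filter.Eventually.and ?_ h1.eventually_nhds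
    exact hcw.eventually ((analyticAt_wrap a c (w, y)).continuousAt.eventually
      hf.eventually_analyticAt)
  have hν := analyticAt_dirD (normalVec a) hf
  have hd : ∀ᶠ w' in 𝓝 w, dw Ψ (w', y) = exp w' * dirD (normalVec a) f (wrap a c (w', y)) := by
    filter_upwards [hw] with w' h1
    exact h1.2.deriv_eq.trans (hasDerivAt_comp_wrap h1.1).deriv
  -- With `t = exp w` the derivative `dw` is `t ∂_t`, so `dw² - dw` is `t² ∂_t²`. This supplies the
  -- normal part of the Laplacian which is missing in `lapY`.
  have hdd : dw (dw Ψ) (w, y) = exp w * dirD (normalVec a) f (wrap a c (w, y)) +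
      exp w * (exp w * dirD (normalVec a) (dirD (normalVec a) f) (wrap a c (w, y))) := by
    have h1 : (fun w' => dw Ψ (w', y)) =ᶠ[𝓝 w]
        fun w' => exp w' * dirD (normalVec a) f (wrap a c (w', y)) := hd
    exact h1.deriv_eq.trans ((hasDerivAt_exp w).fun_mul (hasDerivAt_comp_wrap hν)).deriv
  have hl : lapY Ψ (w, y) = lap f (wrap a c (w, y)) -
      (a ⬝ᵥ a) * dirD (normalVec a) (dirD (normalVec a) f) (wrap a c (w, y)) := by
    have h1 : (fun y' => Ψ (w, y')) =ᶠ[𝓝 y] fun y' => f (slide a c (exp w) y') := hcy.eventually hΨ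
    exact (lap_congr h1).trans (lap_comp_slide ha hf)
  rw [hdd, hd.self_of_nhds, hl]
  ring

lemma analyticAt_pdY {Ψ : ℂ × Vec n → ℂ} {z : ℂ × Vec n} (hΨ : AnalyticAt ℂ Ψ z) (j : Fin n) :
    AnalyticAt ℂ (pdY j Ψ) z := by
  have h1 : AnalyticAt ℂ (fun z => fderiv ℂ Ψ z (0, Pi.single j 1)) z :=
    ((ContinuousLinearMap.apply ℂ ℂ ((0, Pi.single j 1) : ℂ × Vec n)).analyticAt _).comp hΨ.fderiv
  refine h1.congr ?_
  filter_upwards [hΨ.eventually_analyticAt] with x hx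
  have h2 : HasFDerivAt (fun y : Vec n => ((x.1, y) : ℂ × Vec n))
      (ContinuousLinearMap.inr ℂ ℂ (Vec n)) x.2 := hasFDerivAt_prodMk_right x.1 x.2
  have h3 : HasFDerivAt (fun y => Ψ (x.1, y)) _ x.2 :=
    HasFDerivAt.comp (g := Ψ) x.2 hx.differentiableAt.hasFDerivAt h2
  rw [pdY, pd, h3.fderiv]
  simp

lemma analyticAt_lapY {Ψ : ℂ × Vec n → ℂ} {z : ℂ × Vec n} (hΨ : AnalyticAt ℂ Ψ z) :
    AnalyticAt ℂ (lapY Ψ) z :=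
  show AnalyticAt ℂ (fun z => ∑ j, pdY j (pdY j Ψ) z) z from
    Finset.analyticAt_fun_sum _ fun j _ => analyticAt_pdY (analyticAt_pdY hΨ j) j

end ChainRule

/-! ### Fourier coefficients as holomorphic functions of the parameters -/

section ModeCalculus

open Complex

variable {n : ℕ} {t b r : ℝ} {x₀ : Vec n} {Ψ : ℂ × Vec n → ℂ}

/-- The domain of the coordinates given by `wrap`. -/
def wrapDom (b : ℝ) (x₀ : Vec n) (r : ℝ) : Set (ℂ × Vec n) :=
  {z | z.1.re < b ∧ z.2 ∈ Metric.ball x₀ r}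

lemma isOpen_wrapDom : IsOpen (wrapDom b x₀ r) := by
  have h1 : IsOpen {z : ℂ × Vec n | z.1.re < b} :=
    isOpen_lt (continuous_re.comp continuous_fst) continuous_const
  have h2 : IsOpen {z : ℂ × Vec n | z.2 ∈ Metric.ball x₀ r} :=
    Metric.isOpen_ball.preimage continuous_snd
  exact h1.inter h2

lemma convex_wrapDom : Convex ℝ (wrapDom b x₀ r) := by
  have h1 : Convex ℝ {z : ℂ | z.re < b} := convex_halfSpace_re_lt b
  exact h1.prod (convex_ball x₀ r)

lemma analyticAt_fst_slice (hΨ : AnalyticOnNhd ℂ Ψ (wrapDom b x₀ r)) {y : Vec n}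
    (hy : y ∈ Metric.ball x₀ r) : AnalyticOnNhd ℂ (fun w => Ψ (w, y)) {w | w.re < b} :=
  fun w hw => AnalyticAt.fun_comp (g := Ψ) (f := fun w => (w, y)) (hΨ (w, y) ⟨hw, hy⟩) (by fun_prop)

lemma continuous_mode_integrand (hΨ : AnalyticOnNhd ℂ Ψ (wrapDom b x₀ r)) (ht : t < b) (s : ℂ) :
    ContinuousOn (Function.uncurry fun (θ : ℝ) (y : Vec n) =>
      exp (-(s * (t + θ * I))) * Ψ (t + θ * I, y)) (Set.univ ×ˢ Metric.ball x₀ r) := by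
  intro z hz
  refine ContinuousAt.continuousWithinAt ?_
  have h1 : ContinuousAt (fun z : ℝ × Vec n => exp (-(s * (t + z.1 * I)))) z := by fun_prop
  have h3 : ContinuousAt (fun z : ℝ × Vec n => ((t + z.1 * I : ℂ), z.2)) z := by fun_prop
  have h2 : ContinuousAt (fun z : ℝ × Vec n => Ψ (t + z.1 * I, z.2)) z :=
    ContinuousAt.comp (g := Ψ) (f := fun z : ℝ × Vec n => ((t + z.1 * I : ℂ), z.2))
      (hΨ (t + z.1 * I, z.2) ⟨by simpa using ht, hz.2⟩).continuousAt h3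
  exact h1.mul h2

lemma differentiableOn_mode_integrand (hΨ : AnalyticOnNhd ℂ Ψ (wrapDom b x₀ r)) (ht : t < b)
    (s : ℂ) (θ : ℝ) : DifferentiableOn ℂ (fun y : Vec n =>
      exp (-(s * (t + θ * I))) * Ψ (t + θ * I, y)) (Metric.ball x₀ r) := by
  intro y hy
  have h1 : AnalyticAt ℂ (fun y => Ψ (t + θ * I, y)) y :=
    AnalyticAt.fun_comp (g := Ψ) (f := fun y => ((t + θ * I : ℂ), y))
      (hΨ (t + θ * I, y) ⟨by simpa using ht, hy⟩) (by fun_prop)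
  exact (analyticAt_const_mul _ h1).differentiableAt.differentiableWithinAt

lemma analyticOnNhd_mode (hΨ : AnalyticOnNhd ℂ Ψ (wrapDom b x₀ r)) (ht : t < b) (s : ℂ) :
    AnalyticOnNhd ℂ (fun y => mode t s fun w => Ψ (w, y)) (Metric.ball x₀ r) :=
  analyticOnNhd_intervalIntegral Real.two_pi_pos.le Metric.isOpen_ball
    ((continuous_mode_integrand hΨ ht s).mono (Set.prod_mono_left (Set.subset_univ _)))
    fun θ _ => differentiableOn_mode_integrand hΨ ht s θ

lemma pd_mode (hΨ : AnalyticOnNhd ℂ Ψ (wrapDom b x₀ r)) (ht : t < b) (s : ℂ) {y : Vec n}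
    (hy : y ∈ Metric.ball x₀ r) (j : Fin n) :
    pd j (fun y => mode t s fun w => Ψ (w, y)) y = mode t s fun w => pdY j Ψ (w, y) := by
  have h1 := pd_intervalIntegral (a := 0) (b := 2 * Real.pi) Real.two_pi_pos.le Metric.isOpen_ball
    ((continuous_mode_integrand hΨ ht s).mono (Set.prod_mono_left (Set.subset_univ _)))
    (fun θ _ => differentiableOn_mode_integrand hΨ ht s θ) hy j
  refine h1.trans ?_
  unfold mode
  congr 1
  funext θ
  refine pd_const_mul j _ ?_
  exact AnalyticAt.fun_comp (g := Ψ) (f := fun y => ((t + θ * I : ℂ), y))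
    (hΨ (t + θ * I, y) ⟨by simpa using ht, hy⟩) (by fun_prop)

lemma continuous_slice_line (hΨ : AnalyticOnNhd ℂ Ψ (wrapDom b x₀ r)) (ht : t < b) {y : Vec n}
    (hy : y ∈ Metric.ball x₀ r) : Continuous fun θ : ℝ => Ψ (t + θ * I, y) :=
  continuous_line_of_differentiableOn (f := fun w => Ψ (w, y))
    (analyticAt_fst_slice hΨ hy).differentiableOn ht

lemma intervalIntegrable_mode {f : ℂ → ℂ} (hf : Continuous fun θ : ℝ => f (t + θ * I)) (s : ℂ) :
    IntervalIntegrable (fun θ : ℝ => exp (-(s * (t + θ * I))) * f (t + θ * I))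
      MeasureTheory.volume 0 (2 * Real.pi) :=
  Continuous.intervalIntegrable
    ((by fun_prop : Continuous fun θ : ℝ => exp (-(s * (t + θ * I)))).mul hf) _ _

lemma mode_add {f g : ℂ → ℂ} (hf : Continuous fun θ : ℝ => f (t + θ * I))
    (hg : Continuous fun θ : ℝ => g (t + θ * I)) (s : ℂ) :
    mode t s (fun w => f w + g w) = mode t s f + mode t s g := by
  unfold mode
  rw [← intervalIntegral.integral_add (intervalIntegrable_mode hf s) (intervalIntegrable_mode hg s)]
  congr 1
  funext θ
  ring

lemma mode_sub {f g : ℂ → ℂ} (hf : Continuous fun θ : ℝ => f (t + θ * I))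
    (hg : Continuous fun θ : ℝ => g (t + θ * I)) (s : ℂ) :
    mode t s (fun w => f w - g w) = mode t s f - mode t s g := by
  unfold mode
  rw [← intervalIntegral.integral_sub (intervalIntegrable_mode hf s) (intervalIntegrable_mode hg s)]
  congr 1
  funext θ
  ring

lemma mode_const_mul (f : ℂ → ℂ) (k s : ℂ) :
    mode t s (fun w => k * f w) = k * mode t s f := by
  simp only [mode, mul_left_comm _ k]
  exact intervalIntegral.integral_const_mul _ _

lemma mode_exp_mul (f : ℂ → ℂ) (s : ℂ) :
    mode t s (fun w => exp w ^ 2 * f w) = mode t (s - 2) f := by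
  unfold mode
  congr 1
  funext θ
  rw [← mul_assoc, ← exp_nat_mul, ← exp_add]
  congr 2
  push_cast
  ring

lemma mode_congr {f g : ℂ → ℂ} (h : ∀ θ : ℝ, f (t + θ * I) = g (t + θ * I)) (s : ℂ) :
    mode t s f = mode t s g := by
  simp only [mode, h]

lemma lap_mode (hΨ : AnalyticOnNhd ℂ Ψ (wrapDom b x₀ r)) (ht : t < b) (s : ℂ) {y : Vec n}
    (hy : y ∈ Metric.ball x₀ r) :
    lap (fun y => mode t s fun w => Ψ (w, y)) y = mode t s fun w => lapY Ψ (w, y) := by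
  have h1 : ∀ j, pd j (pd j fun y => mode t s fun w => Ψ (w, y)) y =
      mode t s fun w => pdY j (pdY j Ψ) (w, y) := by
    intro j
    have h2 : pd j (fun y => mode t s fun w => Ψ (w, y)) =ᶠ[𝓝 y]
        fun y => mode t s fun w => pdY j Ψ (w, y) := by
      filter_upwards [Metric.isOpen_ball.mem_nhds hy] with z hz using pd_mode hΨ ht s hz j
    rw [pd_congr_at j h2, pd_mode (fun z hz => analyticAt_pdY (hΨ z hz) j) ht s hy]
  rw [lap, Finset.sum_congr rfl fun j _ => h1 j]
  have h3 : ∀ w, lapY Ψ (w, y) = ∑ j, pdY j (pdY j Ψ) (w, y) := fun w => rfl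
  simp only [mode, h3, Finset.mul_sum]
  rw [intervalIntegral.integral_finsetSum]
  intro j _
  exact intervalIntegrable_mode (f := fun w => pdY j (pdY j Ψ) (w, y)) (continuous_slice_line
    (fun z hz => analyticAt_pdY (analyticAt_pdY (hΨ z hz) j) j) ht hy) s

lemma deriv_add_two_pi {f : ℂ → ℂ} {k : ℂ}
    (hper : ∀ w : ℂ, w.re < b → f (w + 2 * Real.pi * I) = k * f w) {w : ℂ} (hw : w.re < b) :
    deriv f (w + 2 * Real.pi * I) = k * deriv f w := by
  rw [← deriv_comp_add_const, ← deriv_const_mul_field]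
  refine Filter.EventuallyEq.deriv_eq ?_
  filter_upwards [(isOpen_lt continuous_re continuous_const).mem_nhds hw] with v hv using hper v hv

end ModeCalculus

/-! ### Exponents and the absence of logarithms -/

section Modes

open Complex

variable {n : ℕ} {u : Vec n → ℂ} {sing : Set (Vec n)} {a : Vec n} {c lam : ℂ} {m : ℕ} {x₀ : Vec n}

/-- The domain of the coordinates of a chart. -/
def Chart.dom (C : Chart u sing a c lam m x₀) : Set (ℂ × Vec n) := wrapDom C.b x₀ C.r

/-- The Fourier coefficients in the first variable. -/
def Chart.coef (C : Chart u sing a c lam m x₀) (μ : ℂ) (Ψ : ℂ × Vec n → ℂ) (j : ℤ) (y : Vec n) : ℂ :=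
  mode C.t (μ + j) fun w => Ψ (w, y)

/-- Quasi-periodic solutions of the (inhomogeneous) eigenvalue equation in the coordinates of a
chart. -/
structure Chart.Wave (C : Chart u sing a c lam m x₀) (μ : ℂ) (H Ψ : ℂ × Vec n → ℂ) : Prop where
  analytic : AnalyticOnNhd ℂ Ψ C.dom
  quasiperiodic : ∀ z ∈ C.dom, Ψ (z.1 + 2 * Real.pi * I, z.2) = exp (2 * Real.pi * I * μ) * Ψ z
  equation : ∀ z ∈ C.dom, (a ⬝ᵥ a) * (dw (dw Ψ) z - dw Ψ z - m * (m + 1) * Ψ z) =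
    exp z.1 ^ 2 * (C.reg z * Ψ z - lapY Ψ z) + H z
  continuous : ∀ y ∈ Metric.ball x₀ C.r, Continuous fun θ : ℝ => H (C.t + θ * I, y)

variable {C : Chart u sing a c lam m x₀} {μ : ℂ} {H Ψ : ℂ × Vec n → ℂ}

lemma Chart.line_mem (C : Chart u sing a c lam m x₀) {y : Vec n} (hy : y ∈ Metric.ball x₀ C.r)
    (θ : ℝ) : ((C.t + θ * I : ℂ), y) ∈ C.dom :=
  ⟨by simpa using C.t_lt, hy⟩

lemma exp_mul_add_int (μ : ℂ) (j : ℤ) :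
    exp (2 * Real.pi * I * (μ + j)) = exp (2 * Real.pi * I * μ) := by
  rw [mul_add, exp_add, mul_comm _ (j : ℂ), exp_int_mul_two_pi_mul_I, mul_one]

lemma Chart.Wave.slice (hΨ : C.Wave μ H Ψ) {y : Vec n} (hy : y ∈ Metric.ball x₀ C.r) :
    DifferentiableOn ℂ (fun w => Ψ (w, y)) {w | w.re < C.b} :=
  (analyticAt_fst_slice hΨ.analytic hy).differentiableOn

lemma Chart.Wave.slice_periodic (hΨ : C.Wave μ H Ψ) {y : Vec n} (hy : y ∈ Metric.ball x₀ C.r) (j : ℤ)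
    (w : ℂ) (hw : w.re < C.b) :
    Ψ (w + 2 * Real.pi * I, y) = exp (2 * Real.pi * I * (μ + j)) * Ψ (w, y) := by
  rw [exp_mul_add_int]
  exact hΨ.quasiperiodic (w, y) ⟨hw, hy⟩

lemma Chart.Wave.analyticOnNhd_coef (hΨ : C.Wave μ H Ψ) (j : ℤ) :
    AnalyticOnNhd ℂ (C.coef μ Ψ j) (Metric.ball x₀ C.r) :=
  analyticOnNhd_mode hΨ.analytic C.t_lt (μ + j)

lemma Chart.Wave.mode_dw (hΨ : C.Wave μ H Ψ) {y : Vec n} (hy : y ∈ Metric.ball x₀ C.r) (j : ℤ) :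
    mode C.t (μ + j) (fun w => dw Ψ (w, y)) = (μ + j) * C.coef μ Ψ j y :=
  mode_deriv (hΨ.slice hy) C.t_lt (hΨ.slice_periodic hy j)

lemma Chart.Wave.mode_dw_dw (hΨ : C.Wave μ H Ψ) {y : Vec n} (hy : y ∈ Metric.ball x₀ C.r) (j : ℤ) :
    mode C.t (μ + j) (fun w => dw (dw Ψ) (w, y)) = (μ + j) ^ 2 * C.coef μ Ψ j y := by
  have h1 := mode_deriv ((hΨ.slice hy).deriv (isOpen_lt continuous_re continuous_const)) C.t_lt
    fun w hw => deriv_add_two_pi (hΨ.slice_periodic hy j) hw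
  refine h1.trans ?_
  rw [sq, mul_assoc]
  exact congrArg _ (hΨ.mode_dw hy j)

lemma Chart.hasSum_mode_reg_mul (C : Chart u sing a c lam m x₀) {y : Vec n}
    (hy : y ∈ Metric.ball x₀ C.r) (hΨ : AnalyticOnNhd ℂ Ψ C.dom) (s : ℂ) :
    HasSum (fun i : ℕ => C.coeff i y * mode C.t (s - i) fun w => Ψ (w, y))
      (mode C.t s fun w => C.reg (w, y) * Ψ (w, y)) := by
  have h0 : 0 < C.r₁ := (by positivity : 0 < 2 * Real.exp C.t).trans_le C.two_mul_le
  have h1 := hasSum_mode_mul (f := fun w => Ψ (w, y)) (v := fun w => C.reg (w, y)) (α := fun i => C.coeff i y)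
    (continuous_slice_line hΨ C.t_lt hy) s 1 (fun θ => by
      have := C.hasSum _ (C.line_mem hy θ).1 (C.line_mem hy θ).2
      simpa using this) (by
      refine Summable.of_nonneg_of_le (fun i => by positivity) (fun i => ?_)
        ((summable_geometric_of_lt_one (r := 1 / 2) (by norm_num) (by norm_num)).mul_left C.V)
      rw [one_mul, zpow_natCast]
      refine (mul_le_mul_of_nonneg_right (C.bound i y hy) (by positivity)).trans ?_
      rw [mul_assoc, ← mul_pow]
      refine mul_le_mul_of_nonneg_left (pow_le_pow_left₀ (by positivity) ?_ i) C.V_nonneg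
      rw [one_div, ← div_eq_inv_mul, div_le_iff₀ h0]
      linarith [C.two_mul_le])
  simpa using h1

/-- The recursion for the Fourier coefficients. -/
lemma Chart.Wave.hasSum_coef (hΨ : C.Wave μ H Ψ) {y : Vec n} (hy : y ∈ Metric.ball x₀ C.r) (j : ℤ) :
    HasSum (fun i : ℕ => C.coeff i y * C.coef μ Ψ (j - 2 - i) y)
      ((a ⬝ᵥ a) * ((μ + j) ^ 2 - (μ + j) - m * (m + 1)) * C.coef μ Ψ j y +
        lap (C.coef μ Ψ (j - 2)) y - C.coef μ H j y) := by
  have hO : IsOpen {w : ℂ | w.re < C.b} := isOpen_lt continuous_re continuous_const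
  have c0 := continuous_line_of_differentiableOn (hΨ.slice hy) C.t_lt
  have c1 : Continuous fun θ : ℝ => dw Ψ (C.t + θ * I, y) :=
    continuous_line_of_differentiableOn ((hΨ.slice hy).deriv hO) C.t_lt
  have c2 : Continuous fun θ : ℝ => dw (dw Ψ) (C.t + θ * I, y) :=
    continuous_line_of_differentiableOn (((hΨ.slice hy).deriv hO).deriv hO) C.t_lt
  have c3 : Continuous fun θ : ℝ => lapY Ψ (C.t + θ * I, y) :=
    continuous_slice_line (fun z hz => analyticAt_lapY (hΨ.analytic z hz)) C.t_lt hy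
  have cH := hΨ.continuous y hy
  have c4 : Continuous fun θ : ℝ => exp (C.t + θ * I) ^ 2 * lapY Ψ (C.t + θ * I, y) :=
    (by fun_prop : Continuous fun θ : ℝ => exp (C.t + θ * I) ^ 2).mul c3
  have h1 := C.hasSum_mode_reg_mul hy hΨ.analytic (μ + j - 2)
  -- Multiplication by `exp w ^ 2` shifts modes by two, which is why the regular part of the
  -- potential and the Laplacian enter with index `j - 2`.
  have h2 : mode C.t (μ + j - 2) (fun w => C.reg (w, y) * Ψ (w, y)) =
      mode C.t (μ + j) fun w => (a ⬝ᵥ a) * (dw (dw Ψ) (w, y) - dw Ψ (w, y) -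
        m * (m + 1) * Ψ (w, y)) + exp w ^ 2 * lapY Ψ (w, y) - H (w, y) := by
    rw [← mode_exp_mul]
    refine mode_congr (fun θ => ?_) _
    have := hΨ.equation _ (C.line_mem hy θ)
    simp only at this
    linear_combination -this
  have c5 : Continuous fun θ : ℝ => m * (m + 1) * Ψ (C.t + θ * I, y) := continuous_const.mul c0
  have c6 : Continuous fun θ : ℝ => (a ⬝ᵥ a) * (dw (dw Ψ) (C.t + θ * I, y) -
    dw Ψ (C.t + θ * I, y) - m * (m + 1) * Ψ (C.t + θ * I, y)) :=
    continuous_const.mul ((c2.sub c1).sub c5)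
  rw [h2, mode_sub (f := fun w => (a ⬝ᵥ a) * (dw (dw Ψ) (w, y) - dw Ψ (w, y) -
        m * (m + 1) * Ψ (w, y)) + exp w ^ 2 * lapY Ψ (w, y)) (g := fun w => H (w, y)) (c6.add c4) cH,
    mode_add (f := fun w => (a ⬝ᵥ a) * (dw (dw Ψ) (w, y) - dw Ψ (w, y) - m * (m + 1) * Ψ (w, y)))
      (g := fun w => exp w ^ 2 * lapY Ψ (w, y)) c6 c4, mode_const_mul,
    mode_sub (f := fun w => dw (dw Ψ) (w, y) - dw Ψ (w, y)) (g := fun w => m * (m + 1) * Ψ (w, y))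
      (c2.sub c1) c5, mode_sub (f := fun w => dw (dw Ψ) (w, y)) (g := fun w => dw Ψ (w, y)) c2 c1,
    mode_const_mul,
    hΨ.mode_dw hy, hΨ.mode_dw_dw hy, mode_exp_mul, ← lap_mode hΨ.analytic C.t_lt _ hy] at h1
  have e1 : ∀ i : ℕ, μ + j - 2 - i = μ + ((j - 2 - i : ℤ) : ℂ) := fun i => by push_cast; ring
  have e2 : μ + j - 2 = μ + ((j - 2 : ℤ) : ℂ) := by push_cast; ring
  simp only [e1] at h1
  rw [e2] at h1
  refine Eq.mp ?_ h1
  congr 1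
  unfold Chart.coef
  ring

/-- The lowest non-zero coefficients satisfy the indicial equation. -/
lemma Chart.Wave.indicial (hΨ : C.Wave μ H Ψ) {j : ℤ}
    (h0 : ∀ k, k ≤ j - 2 → ∀ y ∈ Metric.ball x₀ C.r, C.coef μ Ψ k y = 0) {y : Vec n}
    (hy : y ∈ Metric.ball x₀ C.r) :
    (a ⬝ᵥ a) * ((μ + j) ^ 2 - (μ + j) - m * (m + 1)) * C.coef μ Ψ j y = C.coef μ H j y := by
  have h1 := hΨ.hasSum_coef hy j
  have h2 : (fun i : ℕ => C.coeff i y * C.coef μ Ψ (j - 2 - i) y) = fun _ => 0 := by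
    funext i
    rw [h0 _ (by omega) y hy, mul_zero]
  rw [h2, lap_zero_of_eventually] at h1
  · linear_combination -(hasSum_zero.unique h1)
  · filter_upwards [Metric.isOpen_ball.mem_nhds hy] with z hz using h0 _ le_rfl z hz

lemma indicial_factor (s : ℂ) (m : ℕ) : s ^ 2 - s - m * (m + 1) = (s + m) * (s - m - 1) := by ring

/-- Excludes essential singularities. Read towards decreasing indices `-m - 2 - t`, the recursion
for the modes is the one of `eq_zero_of_recursion`, and the bound `O(ρ ^ t)` comes from the integral
on the line `Re w = C.t`. -/
lemma Chart.Wave.coef_eq_zero_of_le (ha : a ⬝ᵥ a ≠ 0) (hμ : μ.re ≤ 1 / 2) (hΨ : C.Wave μ H Ψ)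
    (hH : ∀ j : ℤ, j < -m → ∀ y ∈ Metric.ball x₀ C.r, C.coef μ H j y = 0) (N : ℕ) {y : Vec n}
    (hy : y ∈ Metric.ball x₀ C.r) : C.coef μ Ψ (-m - 2 - N) y = 0 := by
  have hr2 : 0 < C.r / 2 := half_pos C.r_pos
  have hsub : Metric.ball x₀ (C.r / 2) ⊆ Metric.ball x₀ C.r := Metric.ball_subset_ball (by linarith)
  have hsub' : Metric.closedBall x₀ (C.r / 2) ⊆ Metric.ball x₀ C.r :=
    Metric.closedBall_subset_ball (by linarith [C.r_pos])
  obtain ⟨M, hM⟩ := (isCompact_Icc (a := (0 : ℝ)) (b := 2 * Real.pi)).prod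
    (isCompact_closedBall x₀ (C.r / 2)) |>.exists_bound_of_continuousOn
    ((continuous_mode_integrand hΨ.analytic C.t_lt μ).mono
      (Set.prod_mono (Set.subset_univ _) hsub'))
  set ρ := Real.exp C.t with hρ
  have hρ0 : 0 < ρ := Real.exp_pos _
  have hre : ∀ t : ℕ, (μ + ((-m - 2 - t : ℤ) : ℂ)).re = μ.re - m - 2 - t := fun t => by
    simp; ring
  have key := eq_zero_of_recursion (x₀ := x₀) (r := C.r / 2) (ρ := ρ) (κ := ‖a ⬝ᵥ a‖)
    (M := 2 * Real.pi * M * ρ ^ (m + 2)) hr2 (norm_pos_iff.2 ha) hρ0 C.two_mul_le C.V_nonneg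
    (C := fun t => C.coef μ Ψ (-m - 2 - t))
    (Q := fun t => (a ⬝ᵥ a) * ((μ + ((-m - 2 - t : ℤ) : ℂ)) ^ 2 - (μ + ((-m - 2 - t : ℤ) : ℂ)) -
      m * (m + 1))) (v := C.coeff)
    (fun t => ((hΨ.analyticOnNhd_coef _).differentiableOn).mono hsub) ?_ ?_
    (fun i y hy => C.bound i y (hsub hy)) ?_ C.small
  · refine (hΨ.analyticOnNhd_coef (-m - 2 - N)).eqOn_zero_of_preconnected_of_eventuallyEq_zero
      (convex_ball x₀ C.r).isPreconnected (Metric.mem_ball_self C.r_pos) ?_ hy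
    filter_upwards [Metric.ball_mem_nhds x₀ (half_pos hr2)] with z hz using key N z hz
  · intro t y hy
    have h1 := norm_mode_le (a := C.t) (f := fun w => Ψ (w, y)) (μ := μ) (M := M)
      (fun θ hθ => hM (θ, y) ⟨hθ, Metric.ball_subset_closedBall hy⟩) (-m - 2 - t)
    refine h1.trans (le_of_eq ?_)
    have h2 : (-m - 2 - t : ℤ) = -((m + 2 + t : ℕ) : ℤ) := by push_cast; ring
    rw [h2, zpow_neg, inv_inv, zpow_natCast, pow_add _ (m + 2), ← hρ]
    ring
  -- At the exponent `μ - m - 2 - t` both factors of the indicial polynomial have modulus at least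
  -- `1 + t`. Here `Re μ ≤ 1 / 2` is used.
  · intro t
    rw [norm_mul, indicial_factor, norm_mul, sq]
    refine mul_le_mul_of_nonneg_left (mul_le_mul ?_ ?_ (by positivity) (norm_nonneg _))
      (norm_nonneg _)
    · refine le_trans ?_ (abs_re_le_norm _)
      rw [add_re, hre, natCast_re, abs_of_nonpos] <;> linarith [(Nat.cast_nonneg t : (0 : ℝ) ≤ t)]
    · refine le_trans ?_ (abs_re_le_norm _)
      rw [sub_re, sub_re, hre, natCast_re, one_re, abs_of_nonpos] <;>
      linarith [(Nat.cast_nonneg t : (0 : ℝ) ≤ t), (Nat.cast_nonneg m : (0 : ℝ) ≤ m)]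
  · intro t y hy
    have h1 := hΨ.hasSum_coef (hsub hy) (-m - 2 - t)
    rw [hH _ (by omega) y (hsub hy), sub_zero] at h1
    have e1 : ∀ i : ℕ, (-m - 2 - t - 2 - i : ℤ) = -m - 2 - (t + 2 + i : ℕ) := fun i => by
      push_cast; ring
    have e2 : (-m - 2 - t - 2 : ℤ) = -m - 2 - (t + 2 : ℕ) := by push_cast; ring
    simp only [e1] at h1
    rw [e2] at h1
    exact h1

/-- The coefficients with index less than `-m` vanish. -/
lemma Chart.Wave.coef_eq_zero (ha : a ⬝ᵥ a ≠ 0) (hμ : μ.re ≤ 1 / 2) (hΨ : C.Wave μ H Ψ)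
    (hH : ∀ j : ℤ, j < -m → ∀ y ∈ Metric.ball x₀ C.r, C.coef μ H j y = 0) {j : ℤ} (hj : j < -m) :
    ∀ y ∈ Metric.ball x₀ C.r, C.coef μ Ψ j y = 0 := by
  intro y hy
  have h1 : ∀ k : ℤ, k ≤ -m - 2 → ∀ y ∈ Metric.ball x₀ C.r, C.coef μ Ψ k y = 0 := by
    intro k hk y hy
    have h2 := hΨ.coef_eq_zero_of_le ha hμ hH (-m - 2 - k).toNat hy
    rwa [Int.toNat_of_nonneg (by omega), sub_sub_cancel] at h2
  rcases (by omega : j ≤ -m - 2 ∨ j = -m - 1) with h | rfl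
  · exact h1 j h y hy
  -- Only the index `-m - 1` remains. Since `Re μ ≤ 1 / 2`, the exponent `μ - m - 1` is neither of
  -- the indicial roots `-m` and `m + 1`.
  · have h3 := hΨ.indicial (j := -m - 1) (fun k hk => h1 k (by omega)) hy
    rw [hH _ hj y hy, indicial_factor] at h3
    refine (mul_eq_zero.1 h3).resolve_left (mul_ne_zero ha (mul_ne_zero ?_ ?_))
    · intro h
      have := congrArg re h
      simp at this
      linarith
    · intro h
      have := congrArg re h
      simp at this
      linarith [(Nat.cast_nonneg m : (0 : ℝ) ≤ m)]

/-- A solution all of whose Fourier coefficients vanish is zero. -/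
lemma Chart.Wave.eq_zero (hΨ : C.Wave μ H Ψ)
    (h0 : ∀ j, ∀ y ∈ Metric.ball x₀ C.r, C.coef μ Ψ j y = 0) : ∀ z ∈ C.dom, Ψ z = 0 := by
  rintro ⟨w, y⟩ ⟨hw, hy⟩
  have h1 : ∀ θ : ℝ, Ψ (C.t + θ * I, y) = 0 := by
    refine eq_zero_of_mode_eq_zero (f := fun w => Ψ (w, y)) (μ := μ)
      (continuous_slice_line hΨ.analytic C.t_lt hy) (fun θ => ?_) fun j => h0 j y hy
    have := hΨ.quasiperiodic _ (C.line_mem hy θ)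
    rw [← this]
    simp only
    congr 2
    push_cast
    ring
  refine (analyticAt_fst_slice hΨ.analytic hy).eqOn_zero_of_preconnected_of_frequently_eq_zero
    (convex_halfSpace_re_lt C.b).isPreconnected (z₀ := (C.t : ℂ)) (by simpa using C.t_lt) ?_ hw
  have h2 : Tendsto (fun θ : ℝ => (C.t + θ * I : ℂ)) (𝓝[≠] 0) (𝓝[≠] (C.t : ℂ)) := by
    refine tendsto_nhdsWithin_iff.2 ⟨?_, ?_⟩
    · have : Continuous fun θ : ℝ => (C.t + θ * I : ℂ) := by fun_prop
      refine (this.tendsto' 0 _ (by simp)).mono_left nhdsWithin_le_nhds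
    · filter_upwards [self_mem_nhdsWithin] with θ hθ
      simpa using hθ
  exact h2.frequently (Eventually.frequently (Eventually.of_forall h1))

/-- There are no solutions with non-integer exponents. -/
lemma Chart.Wave.eq_zero_of_ne_int (ha : a ⬝ᵥ a ≠ 0) (hμ : μ.re ≤ 1 / 2) (hμ' : ∀ k : ℤ, μ ≠ k)
    (hΨ : C.Wave μ 0 Ψ) : ∀ z ∈ C.dom, Ψ z = 0 := by
  have hH : ∀ j y, C.coef μ 0 j y = 0 := fun j y => by simp [Chart.coef, mode]
  -- For non-integral `μ` no exponent `μ + j` is an indicial root, so the vanishing of the modes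
  -- below `-m` propagates upwards.
  have h1 : ∀ N : ℕ, ∀ j : ℤ, j < -m + N → ∀ y ∈ Metric.ball x₀ C.r, C.coef μ Ψ j y = 0 := by
    intro N
    induction N with
    | zero => exact fun j hj => hΨ.coef_eq_zero ha hμ (fun j _ y _ => hH j y) (by simpa using hj)
    | succ N ih =>
      intro j hj y hy
      have h3 := hΨ.indicial (j := j) (fun k hk => ih k (by push_cast at hj; omega)) hy
      rw [hH, indicial_factor] at h3
      refine (mul_eq_zero.1 h3).resolve_left (mul_ne_zero ha (mul_ne_zero ?_ ?_))
      · intro h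
        refine hμ' (-j - m) ?_
        push_cast
        linear_combination h
      · intro h
        refine hμ' (-j + m + 1) ?_
        push_cast
        linear_combination h
  refine hΨ.eq_zero fun j => h1 (j + m + 1).toNat j ?_
  have := Int.self_le_toNat (j + m + 1)
  omega

/-- There are no logarithms: if a solution is periodic up to a multiple of `w Φ`, with `Φ` a periodic
solution, then `Φ = 0`. -/
lemma Chart.Wave.eq_zero_of_log (ha : a ⬝ᵥ a ≠ 0) {Φ : ℂ × Vec n → ℂ} {k : ℂ} (hk : k ≠ 0)
    (hΦ : C.Wave 0 0 Φ) (hΨ : C.Wave 0 (fun z => k * (2 * dw Φ z - Φ z)) Ψ) :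
    ∀ z ∈ C.dom, Φ z = 0 := by
  have h0 : ∀ j y, C.coef 0 0 j y = 0 := fun j y => by simp [Chart.coef, mode]
  have hre : (0 : ℂ).re ≤ 1 / 2 := by norm_num
  -- The factor `2 j - 1` never vanishes. So at an indicial root where lower modes of `Ψ` do not
  -- contribute, the equation for `Ψ` forces the mode of `Φ` to be zero.
  have hH : ∀ j, ∀ y ∈ Metric.ball x₀ C.r, C.coef 0 (fun z => k * (2 * dw Φ z - Φ z)) j y =
      k * (2 * j - 1) * C.coef 0 Φ j y := by
    intro j y hy
    have c0 := continuous_line_of_differentiableOn (hΦ.slice hy) C.t_lt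
    have c1 : Continuous fun θ : ℝ => dw Φ (C.t + θ * I, y) :=
      continuous_line_of_differentiableOn
        ((hΦ.slice hy).deriv (isOpen_lt continuous_re continuous_const)) C.t_lt
    have c2 : Continuous fun θ : ℝ => 2 * dw Φ (C.t + θ * I, y) := continuous_const.mul c1
    rw [Chart.coef, mode_const_mul, mode_sub (f := fun w => 2 * dw Φ (w, y))
      (g := fun w => Φ (w, y)) c2 c0, mode_const_mul,
      hΦ.mode_dw hy, ← Chart.coef]
    ring
  have hΦ0 : ∀ j : ℤ, j < -m → ∀ y ∈ Metric.ball x₀ C.r, C.coef 0 Φ j y = 0 := fun j hj =>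
    hΦ.coef_eq_zero ha hre (fun j _ y _ => h0 j y) hj
  have hΨ0 : ∀ j : ℤ, j < -m → ∀ y ∈ Metric.ball x₀ C.r, C.coef 0 Ψ j y = 0 := fun j hj =>
    hΨ.coef_eq_zero ha hre (fun j hj y hy => by rw [hH j y hy, hΦ0 j hj y hy, mul_zero]) hj
  have hstep : ∀ j : ℤ, ((0 : ℂ) + j) ^ 2 - (0 + j) - m * (m + 1) = ((j + m) * (j - m - 1) : ℤ) := by
    intro j
    push_cast
    ring
  have hodd : ∀ j : ℤ, k * (2 * j - 1) ≠ 0 := fun j => mul_ne_zero hk (by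
    intro h
    have : ((2 * j - 1 : ℤ) : ℂ) = 0 := by push_cast; exact h
    have := Int.cast_eq_zero.1 this
    omega)
  -- This applies at `j = -m`. The homogeneous equation for `Φ` then removes its modes up to `j =
  -- m`, where the indicial polynomial is not zero.
  have hup : ∀ N : ℕ, N ≤ 2 * m + 1 → ∀ j : ℤ, j < -m + N →
      ∀ y ∈ Metric.ball x₀ C.r, C.coef 0 Φ j y = 0 := by
    intro N
    induction N with
    | zero => exact fun _ j hj => hΦ0 j (by simpa using hj)
    | succ N ih =>
      intro hN j hj y hy
      by_cases hjN : j < -m + N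
      · exact ih (by omega) j hjN y hy
      have hj' : j = -m + N := by push_cast at hj; omega
      rcases Nat.eq_zero_or_pos N with rfl | hN0
      · have h3 := hΨ.indicial (j := j) (fun k hk => hΨ0 k (by push_cast at hj'; omega)) hy
        rw [hH j y hy, hstep, hj'] at h3
        simp only [Nat.cast_zero, add_zero, neg_add_cancel, zero_mul, Int.cast_zero, mul_zero] at h3
        rw [hj', Nat.cast_zero, add_zero]
        exact (mul_eq_zero.1 h3.symm).resolve_left (hodd _)
      · have h3 := hΦ.indicial (j := j) (fun k hk => ih (by omega) k (by omega)) hy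
        rw [h0, hstep] at h3
        refine (mul_eq_zero.1 h3).resolve_left (mul_ne_zero ha ?_)
        rw [Int.cast_ne_zero]
        exact mul_ne_zero (by omega) (by omega)
  have hmid : ∀ j : ℤ, j < m + 1 → ∀ y ∈ Metric.ball x₀ C.r, C.coef 0 Φ j y = 0 := fun j hj =>
    hup (2 * m + 1) le_rfl j (by push_cast; omega)
  -- The modes of `Ψ` with `j + m` odd decouple up to `j = m + 1`. Odd `i < 2 m + 1` have zero
  -- coefficient by quasi-invariance, larger odd `i` lead to indices below `-m`, and even `i`
  -- preserve the parity.
  have hsum : ∀ j : ℤ, j ≤ m + 1 → Odd (j + m) → (∀ k : ℤ, k ≤ j - 2 → Odd (k + m) →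
      ∀ y ∈ Metric.ball x₀ C.r, C.coef 0 Ψ k y = 0) → ∀ y ∈ Metric.ball x₀ C.r,
      (a ⬝ᵥ a) * (((j + m) * (j - m - 1) : ℤ) : ℂ) * C.coef 0 Ψ j y =
        k * (2 * j - 1) * C.coef 0 Φ j y := by
    intro j hj hjo hk y hy
    have h1 := hΨ.hasSum_coef hy j
    have h2 : (fun i : ℕ => C.coeff i y * C.coef 0 Ψ (j - 2 - i) y) = fun _ => 0 := by
      funext i
      rcases Nat.even_or_odd i with hi | hi
      · rw [hk _ (by omega) _ y hy, mul_zero]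
        have : (j - 2 - i + m : ℤ) = (j + m) - (2 + i) := by ring
        rw [this]
        exact hjo.sub_even (even_two.add ((Int.even_coe_nat i).2 hi))
      · by_cases him : i < 2 * m + 1
        · rw [C.odd i hi him y hy, zero_mul]
        · rw [hΨ0 _ (by omega) y hy, mul_zero]
    rw [h2, lap_zero_of_eventually, hstep, hH j y hy] at h1
    · linear_combination -(hasSum_zero.unique h1)
    · filter_upwards [Metric.isOpen_ball.mem_nhds hy] with z hz
      refine hk _ le_rfl ?_ z hz
      have : (j - 2 + m : ℤ) = (j + m) - 2 := by ring
      rw [this]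
      exact hjo.sub_even even_two
  have hpar : ∀ N : ℕ, N ≤ 2 * m + 1 → ∀ j : ℤ, j < -m + N → Odd (j + m) →
      ∀ y ∈ Metric.ball x₀ C.r, C.coef 0 Ψ j y = 0 := by
    intro N
    induction N with
    | zero => exact fun _ j hj _ => hΨ0 j (by simpa using hj)
    | succ N ih =>
      intro hN j hj hjo y hy
      by_cases hjN : j < -m + N
      · exact ih (by omega) j hjN hjo y hy
      have h3 := hsum j (by omega) hjo (fun k hk => ih (by omega) k (by omega)) y hy
      rw [hmid j (by omega) y hy, mul_zero] at h3
      refine (mul_eq_zero.1 h3).resolve_left (mul_ne_zero ha ?_)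
      rw [Int.cast_ne_zero]
      refine mul_ne_zero (fun h => ?_) (by omega)
      rw [h] at hjo
      exact absurd hjo (by decide)
  -- The index `m + 1` has the parity just treated, because `2 m + 1` is odd, and it is an indicial
  -- root. So this mode of `Φ` vanishes too, and no possible leading exponent of `Φ` is left.
  have htop : ∀ y ∈ Metric.ball x₀ C.r, C.coef 0 Φ (m + 1) y = 0 := by
    intro y hy
    have h3 := hsum (m + 1) le_rfl ⟨m, by ring⟩
      (fun k hk => hpar (2 * m + 1) le_rfl k (by push_cast; omega)) y hy
    have e : ((m + 1 : ℤ) + m) * ((m + 1 : ℤ) - m - 1) = 0 := by ring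
    rw [e, Int.cast_zero, mul_zero, zero_mul] at h3
    exact (mul_eq_zero.1 h3.symm).resolve_left (hodd _)
  have hall : ∀ N : ℕ, ∀ j : ℤ, j < m + 2 + N → ∀ y ∈ Metric.ball x₀ C.r, C.coef 0 Φ j y = 0 := by
    intro N
    induction N with
    | zero =>
      intro j hj
      rcases (by push_cast at hj; omega : j < m + 1 ∨ j = m + 1) with h | rfl
      · exact hmid j h
      · exact htop
    | succ N ih =>
      intro j hj y hy
      by_cases hjN : j < m + 2 + N
      · exact ih j hjN y hy
      have h3 := hΦ.indicial (j := j) (fun k hk => ih k (by omega)) hy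
      rw [h0, hstep] at h3
      refine (mul_eq_zero.1 h3).resolve_left (mul_ne_zero ha ?_)
      rw [Int.cast_ne_zero]
      exact mul_ne_zero (by omega) (by omega)
  refine hΦ.eq_zero fun j => hall j.toNat j ?_
  have := Int.self_le_toNat j
  omega

end Modes

/-- A linear operator on a finite-dimensional space without Jordan blocks of size two for the
eigenvalue `1` and without other eigenvalues is the identity. -/
lemma end_eq_one {V : Type*} [AddCommGroup V] [Module ℂ V] [FiniteDimensional ℂ V]
    (T : Module.End ℂ V) (h1 : ∀ κ : ℂ, κ ≠ 1 → ∀ v, T v = κ • v → v = 0)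
    (h2 : ∀ v, (T - 1) ((T - 1) v) = 0 → (T - 1) v = 0) : T = 1 := by
  have key : ∀ κ : ℂ, T.maxGenEigenspace κ ≤ LinearMap.ker (T - 1) := by
    intro κ v hv
    obtain ⟨k, hk⟩ := (Module.End.mem_maxGenEigenspace _ _ _).1 hv
    rw [LinearMap.mem_ker]
    by_cases hκ : κ = 1
    · subst hκ
      rw [one_smul] at hk
      induction k generalizing v with
      | zero => simp at hk; simp [hk]
      | succ k ih =>
        rw [pow_succ, Module.End.mul_apply] at hk
        refine h2 v (ih ((Module.End.mem_maxGenEigenspace _ _ _).2 ⟨k, ?_⟩) hk)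
        rwa [one_smul]
    · have h3 : v = 0 := by
        clear hv
        induction k generalizing v with
        | zero => simpa using hk
        | succ k ih =>
          rw [pow_succ, Module.End.mul_apply] at hk
          refine h1 κ hκ v ?_
          have := ih hk
          simpa [sub_eq_zero] using this
      rw [h3, map_zero]
  have h3 : (⊤ : Submodule ℂ V) ≤ LinearMap.ker (T - 1) := by
    rw [← Module.End.iSup_maxGenEigenspace_eq_top T]
    exact iSup_le key
  refine sub_eq_zero.1 (LinearMap.ext fun v => ?_)
  exact h3 (Submodule.mem_top (x := v))

lemma lap_add {n : ℕ} {f g : Vec n → ℂ} {x : Vec n} (hf : AnalyticAt ℂ f x)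
    (hg : AnalyticAt ℂ g x) : lap (fun y => f y + g y) x = lap f x + lap g x := by
  simp only [lap]
  rw [← Finset.sum_add_distrib]
  refine Finset.sum_congr rfl fun j _ => ?_
  rw [← pd_add j (analyticAt_pd j hf) (analyticAt_pd j hg)]
  refine pd_congr_at j ?_
  filter_upwards [hf.eventually_analyticAt, hg.eventually_analyticAt] with y h1 h2 using
    pd_add j h1 h2

lemma lap_const_mul {n : ℕ} {f : Vec n → ℂ} {x : Vec n} (k : ℂ) (hf : AnalyticAt ℂ f x) :
    lap (fun y => k * f y) x = k * lap f x := by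
  simp only [lap]
  rw [Finset.mul_sum]
  refine Finset.sum_congr rfl fun j _ => ?_
  rw [← pd_const_mul j k (analyticAt_pd j hf)]
  refine pd_congr_at j ?_
  filter_upwards [hf.eventually_analyticAt] with y h1 using pd_const_mul j k h1

/-! ### Pull-backs of solutions under `wrap` -/

section PullBack

open Complex

variable {n : ℕ} {L : Fin n → DiffOp n} {lam : Fin n → ℂ} {a : Vec n} {c : ℂ}

/-- The germs which are pull-backs of germs of solutions under `wrap`. -/
def IsPullBack (L : Fin n → DiffOp n) (lam : Fin n → ℂ) (a : Vec n) (c : ℂ) (Ψ : ℂ × Vec n → ℂ)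
    (z : ℂ × Vec n) : Prop :=
  ∃ ψ, IsSol L lam ψ (wrap a c z) ∧ Ψ =ᶠ[𝓝 z] fun z => ψ (wrap a c z)

lemma isGermClass_isPullBack : IsGermClass (IsPullBack L lam a c) where
  congr f g z h := by
    rintro ⟨ψ, h1, h2⟩
    exact ⟨ψ, h1, h.symm.trans h2⟩
  analytic f z := by
    rintro ⟨ψ, h1, h2⟩
    exact (AnalyticAt.fun_comp (g := ψ) h1.1 (analyticAt_wrap a c z)).congr h2.symm

lemma IsPullBack.add {Ψ Φ : ℂ × Vec n → ℂ} {z : ℂ × Vec n} (h : IsPullBack L lam a c Ψ z)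
    (h' : IsPullBack L lam a c Φ z) : IsPullBack L lam a c (Ψ + Φ) z := by
  obtain ⟨ψ, h1, h2⟩ := h
  obtain ⟨φ, h3, h4⟩ := h'
  exact ⟨ψ + φ, h1.add h3, h2.add h4⟩

lemma IsPullBack.smul {Ψ : ℂ × Vec n → ℂ} {z : ℂ × Vec n} (k : ℂ) (h : IsPullBack L lam a c Ψ z) :
    IsPullBack L lam a c (k • Ψ) z := by
  obtain ⟨ψ, h1, h2⟩ := h
  exact ⟨k • ψ, h1.smul k, h2.fun_const_smul k⟩

/-- The translation by the period of the exponential function. -/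
def turn (z : ℂ × Vec n) : ℂ × Vec n := (z.1 + 2 * Real.pi * I, z.2)

lemma continuous_turn : Continuous (turn (n := n)) := by unfold turn; fun_prop

lemma wrap_turn (z : ℂ × Vec n) : wrap a c (turn z) = wrap a c z := wrap_add_two_pi z.1 z.2

lemma IsPullBack.turn {Ψ : ℂ × Vec n → ℂ} {z : ℂ × Vec n}
    (h : IsPullBack L lam a c Ψ (GenLame.turn z)) :
    IsPullBack L lam a c (fun z => Ψ (GenLame.turn z)) z := by
  obtain ⟨ψ, h1, h2⟩ := h
  rw [wrap_turn] at h1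
  refine ⟨ψ, h1, ?_⟩
  filter_upwards [continuous_turn.continuousAt.eventually h2] with y hy
  rw [hy, wrap_turn]

lemma turn_mem_wrapDom {b r : ℝ} {x₀ : Vec n} {z : ℂ × Vec n} :
    turn z ∈ wrapDom b x₀ r ↔ z ∈ wrapDom b x₀ r := by
  simp [wrapDom, turn]

/-- The local inverse of `wrap`. -/
def lift (a : Vec n) (c : ℂ) (w₁ : ℂ) (x : Vec n) : ℂ × Vec n :=
  (w₁ + log (aff a c x / exp w₁), x)

variable {w₁ : ℂ} {x₁ : Vec n}

lemma analyticAt_lift (h : exp w₁ = aff a c x₁) : AnalyticAt ℂ (lift a c w₁) x₁ := by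
  have h1 : AnalyticAt ℂ (fun x => aff a c x / exp w₁) x₁ :=
    (analyticAt_aff a c x₁).div analyticAt_const (exp_ne_zero _)
  have h2 : AnalyticAt ℂ (fun x => log (aff a c x / exp w₁)) x₁ := h1.clog (by
    rw [← h, div_self (exp_ne_zero _)]
    exact one_mem_slitPlane)
  exact (analyticAt_const.add h2).prod analyticAt_id

lemma lift_self (h : exp w₁ = aff a c x₁) : lift a c w₁ x₁ = (w₁, x₁) := by
  rw [lift, ← h, div_self (exp_ne_zero _), log_one, add_zero]

lemma wrap_lift (h : exp w₁ = aff a c x₁) : ∀ᶠ x in 𝓝 x₁, wrap a c (lift a c w₁ x) = x := by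
  have h1 : aff a c x₁ ≠ 0 := by rw [← h]; exact exp_ne_zero _
  filter_upwards [(continuous_aff a c).continuousAt.eventually_ne h1] with x hx
  refine wrap_of_exp_eq ?_
  rw [exp_add, exp_log (div_ne_zero hx (exp_ne_zero _)), mul_div_cancel₀ _ (exp_ne_zero _)]

lemma IsPullBack.eventuallyEq_comp_lift (h : exp w₁ = aff a c x₁) {Ψ : ℂ × Vec n → ℂ} {ψ : Vec n → ℂ}
    (hΨ : Ψ =ᶠ[𝓝 (w₁, x₁)] fun z => ψ (wrap a c z)) : (fun x => Ψ (lift a c w₁ x)) =ᶠ[𝓝 x₁] ψ := by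
  have h1 : Tendsto (lift a c w₁) (𝓝 x₁) (𝓝 (w₁, x₁)) := by
    rw [← lift_self h]
    exact (analyticAt_lift h).continuousAt
  filter_upwards [h1.eventually hΨ, wrap_lift h] with x h2 h3
  rw [h2, h3]

lemma IsPullBack.isSol_comp_lift (h : exp w₁ = aff a c x₁) {Ψ : ℂ × Vec n → ℂ}
    (hΨ : IsPullBack L lam a c Ψ (w₁, x₁)) : IsSol L lam (fun x => Ψ (lift a c w₁ x)) x₁ := by
  obtain ⟨ψ, h1, h2⟩ := hΨ
  rw [wrap_of_exp_eq h] at h1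
  exact (isGermClass_isSol L lam).congr _ _ _ (IsPullBack.eventuallyEq_comp_lift h h2).symm h1

end PullBack

/-! ### Triviality of the local monodromy -/

section Monodromy

open Complex

variable {n : ℕ} [NeZero n] {P : EllipticPotential n} {L : Fin n → DiffOp n} {lam : Fin n → ℂ}
  {a : Vec n} {c : ℂ} {m : ℕ} {x₀ : Vec n}

lemma IsSol.lap_eq (hL : P.StronglyIntegrable L) {ψ : Vec n → ℂ} {x : Vec n} (hx : x ∉ P.sing)
    (hψ : IsSol L lam ψ x) : lap ψ x = (P.u x - lam 0) * ψ x := by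
  have h1 := hψ.2.self_of_nhds 0
  rw [hL.first] at h1
  have h2 := h1 (analyticAt_schrodinger P (analyticAt_u P hx))
  rw [schrodinger_apply] at h2
  rw [lap]
  linear_combination -h2

variable {C : Chart P.u P.sing a c (lam 0) m x₀} {Ψ : ℂ × Vec n → ℂ}

/-- The domain is convex and is mapped off the singular locus, so the monodromy theorem for convex
domains applies to pull-backs of solutions. -/
lemma Chart.extendsOn (C : Chart P.u P.sing a c (lam 0) m x₀) (hL : P.StronglyIntegrable L) :
    ExtendsOn (IsPullBack L lam a c) C.dom := by
  obtain ⟨N, hN⟩ := exists_extendsOn P hL lam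
  refine isGermClass_isPullBack.extendsOn_convex isOpen_wrapDom convex_wrapDom fun z hz => ?_
  obtain ⟨⟨ε, hε, hext⟩, -⟩ := hN _ (C.notMem z hz.1 hz.2)
  obtain ⟨r, hr, hrε⟩ := Metric.mem_nhds_iff.1
    ((analyticAt_wrap a c z).continuousAt.preimage_mem_nhds (Metric.ball_mem_nhds _ hε))
  refine ⟨r, hr, ?_⟩
  rintro y hy Φ ⟨ψ, h1, h2⟩
  obtain ⟨F, hF, hFψ⟩ := hext _ (hrε hy) ψ h1
  refine ⟨fun z => F (wrap a c z), fun z hz => ⟨F, hF _ (hrε hz), EventuallyEq.rfl⟩, ?_⟩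
  refine EventuallyEq.trans ?_ h2.symm
  exact (analyticAt_wrap a c y).continuousAt.eventually hFψ

lemma IsPullBack.equation (ha : a ⬝ᵥ a ≠ 0) (hL : P.StronglyIntegrable L) {z : ℂ × Vec n}
    (hz : z ∈ C.dom) (hΨ : IsPullBack L lam a c Ψ z) :
    (a ⬝ᵥ a) * (dw (dw Ψ) z - dw Ψ z - m * (m + 1) * Ψ z) =
      exp z.1 ^ 2 * (C.reg z * Ψ z - lapY Ψ z) := by
  obtain ⟨ψ, h1, h2⟩ := hΨ
  have h3 := wrap_equation ha h1.1 h2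
  rw [h1.lap_eq hL (C.notMem z hz.1 hz.2), C.pot z hz.1 hz.2] at h3
  have h4 : exp z.1 ≠ 0 := exp_ne_zero _
  have h5 := h2.self_of_nhds
  simp only at h5
  rw [← h5] at h3
  have h6 : exp z.1 ^ 2 * (m * (m + 1) * (a ⬝ᵥ a) / exp z.1 ^ 2) = m * (m + 1) * (a ⬝ᵥ a) := by
    field_simp
  linear_combination h3 + Ψ z * h6

/-- Sections over the domain of a chart, extended by zero. -/
def Chart.sections (C : Chart P.u P.sing a c (lam 0) m x₀) (L : Fin n → DiffOp n) :
    Submodule ℂ (ℂ × Vec n → ℂ) where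
  carrier := {Ψ | (∀ z ∈ C.dom, IsPullBack L lam a c Ψ z) ∧ ∀ z ∉ C.dom, Ψ z = 0}
  zero_mem' := ⟨fun z _ => ⟨0, IsSol.zero L lam _, EventuallyEq.rfl⟩, fun _ _ => rfl⟩
  add_mem' h h' := ⟨fun z hz => (h.1 z hz).add (h'.1 z hz), fun z hz => by
    rw [Pi.add_apply, h.2 z hz, h'.2 z hz, add_zero]⟩
  smul_mem' k Ψ h := ⟨fun z hz => (h.1 z hz).smul k, fun z hz => by
    rw [Pi.smul_apply, h.2 z hz, smul_zero]⟩

lemma Chart.exists_base (C : Chart P.u P.sing a c (lam 0) m x₀) (ha : a ⬝ᵥ a ≠ 0)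
    (hx₀ : aff a c x₀ = 0) : ∃ (w : ℂ) (x : Vec n), exp w = aff a c x ∧ (w, x) ∈ C.dom := by
  have h1 : Tendsto (fun s : ℝ => slide a c (exp s) x₀) atBot (𝓝 x₀) := by
    have h2 : Tendsto (fun s : ℝ => exp s) atBot (𝓝 0) :=
      Complex.tendsto_exp_comap_re_atBot.comp (tendsto_comap_iff.2
        (show Tendsto (fun s : ℝ => s) atBot atBot from tendsto_id))
    have h3 : Tendsto (fun t : ℂ => slide a c t x₀) (𝓝 0) (𝓝 x₀) :=
      ((continuous_slide a c).comp (by fun_prop : Continuous fun t : ℂ => (t, x₀))).tendsto' 0 _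
        (by rw [← hx₀]; exact slide_aff x₀)
    exact h3.comp h2
  obtain ⟨s, hs, hsb⟩ := ((h1.eventually (Metric.ball_mem_nhds x₀ C.r_pos)).and
    (eventually_lt_atBot C.b)).exists
  exact ⟨s, _, (aff_slide ha _ _).symm, by simpa using hsb, hs⟩

lemma Chart.eq_zero_of_eventually {z₁ : ℂ × Vec n} (hz₁ : z₁ ∈ C.dom)
    (hΨ : ∀ z ∈ C.dom, IsPullBack L lam a c Ψ z) (h : Ψ =ᶠ[𝓝 z₁] 0) : ∀ z ∈ C.dom, Ψ z = 0 :=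
  (isGermClass_isPullBack (L := L) (lam := lam) (a := a) (c := c)).eqOn
    convex_wrapDom.isPreconnected hΨ (fun _ _ => ⟨0, IsSol.zero L lam _, EventuallyEq.rfl⟩) hz₁ h

/-- Finitely many derivatives at one base point determine a section. Finite dimension is what allows
the monodromy to be studied through its generalized eigenspaces. -/
lemma Chart.finiteDimensional_sections (C : Chart P.u P.sing a c (lam 0) m x₀) (ha : a ⬝ᵥ a ≠ 0)
    (hx₀ : aff a c x₀ = 0) (hL : P.StronglyIntegrable L) : FiniteDimensional ℂ (C.sections L) := by
  obtain ⟨N, hN⟩ := exists_extendsOn P hL lam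
  obtain ⟨w₁, x₁, h, hd⟩ := C.exists_base ha hx₀
  have hx₁ : x₁ ∉ P.sing := by
    have := C.notMem _ hd.1 hd.2
    rwa [wrap_of_exp_eq h] at this
  have han : ∀ Ψ : C.sections L, AnalyticAt ℂ (fun x => Ψ.1 (lift a c w₁ x)) x₁ := fun Ψ =>
    ((Ψ.2.1 _ hd).isSol_comp_lift h).1
  let E : C.sections L →ₗ[ℂ] (degLT n N → ℂ) :=
    { toFun := fun Ψ k => mixedPd k.1 (fun x => Ψ.1 (lift a c w₁ x)) x₁
      map_add' := fun Ψ Φ => funext fun k =>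
        ((goodOp_mixedPd k.1 x₁).add _ _ (han Ψ) (han Φ)).eq_of_nhds
      map_smul' := fun s Ψ => funext fun k =>
        ((goodOp_mixedPd k.1 x₁).smul s _ (han Ψ)).eq_of_nhds }
  refine FiniteDimensional.of_injective E ?_
  rw [← LinearMap.ker_eq_bot, LinearMap.ker_eq_bot']
  intro Ψ hΨ
  obtain ⟨ψ, h1, h2⟩ := Ψ.2.1 _ hd
  have h3 := IsPullBack.eventuallyEq_comp_lift h h2
  rw [wrap_of_exp_eq h] at h1
  have h4 := (hN x₁ hx₁).2 ψ h1 fun k hk => by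
    rw [← (mixedPd_congr k h3).eq_of_nhds]
    exact congrFun hΨ ⟨k, hk⟩
  have h5 : Tendsto (wrap a c) (𝓝 (w₁, x₁)) (𝓝 x₁) := by
    have := (analyticAt_wrap a c (w₁, x₁)).continuousAt
    rwa [ContinuousAt, wrap_of_exp_eq h] at this
  have h6 := Chart.eq_zero_of_eventually hd Ψ.2.1 (h2.trans (h5.eventually h4))
  refine Subtype.ext (funext fun z => ?_)
  by_cases hz : z ∈ C.dom
  · exact h6 z hz
  · exact Ψ.2.2 z hz

/-- The monodromy operator. -/
def Chart.monodromy (C : Chart P.u P.sing a c (lam 0) m x₀) (L : Fin n → DiffOp n) :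
    Module.End ℂ (C.sections L) where
  toFun Ψ := ⟨fun z => Ψ.1 (turn z), fun _ hz => IsPullBack.turn (Ψ.2.1 _ (turn_mem_wrapDom.2 hz)),
    fun _ hz => Ψ.2.2 _ fun h => hz (turn_mem_wrapDom.1 h)⟩
  map_add' := fun _ _ => rfl
  map_smul' := fun _ _ => rfl

lemma Chart.wave_of_eigenvector (ha : a ⬝ᵥ a ≠ 0) (hL : P.StronglyIntegrable L) {μ : ℂ}
    (hΨ : ∀ z ∈ C.dom, IsPullBack L lam a c Ψ z)
    (hper : ∀ z ∈ C.dom, Ψ (turn z) = exp (2 * Real.pi * I * μ) * Ψ z) : C.Wave μ 0 Ψ where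
  analytic z hz := isGermClass_isPullBack.analytic _ _ (hΨ z hz)
  quasiperiodic := hper
  equation z hz := by rw [Pi.zero_apply, add_zero, (hΨ z hz).equation ha hL hz]
  continuous _ _ := continuous_const

/-- If the translation sends `Ψ` to `Ψ + Φ` and fixes `Φ`, subtracting `w Φ / (2πi)` from `Ψ`
restores periodicity. The inhomogeneity consists of the terms in which a derivative falls on the
factor `w`. -/
lemma Chart.wave_of_log (ha : a ⬝ᵥ a ≠ 0) (hL : P.StronglyIntegrable L) {Φ : ℂ × Vec n → ℂ}
    (hΨ : ∀ z ∈ C.dom, IsPullBack L lam a c Ψ z) (hΦ : ∀ z ∈ C.dom, IsPullBack L lam a c Φ z)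
    (hΨΦ : ∀ z ∈ C.dom, Ψ (turn z) = Ψ z + Φ z) (hΦΦ : ∀ z ∈ C.dom, Φ (turn z) = Φ z) :
    C.Wave 0 (fun z => (-(a ⬝ᵥ a) / (2 * Real.pi * I)) * (2 * dw Φ z - Φ z))
      (fun z => Ψ z + -(2 * Real.pi * I)⁻¹ * (z.1 * Φ z)) := by
  set k : ℂ := -(2 * Real.pi * I)⁻¹ with hk
  have hΨa : AnalyticOnNhd ℂ Ψ C.dom := fun z hz =>
    isGermClass_isPullBack.analytic _ _ (hΨ z hz)
  have hΦa : AnalyticOnNhd ℂ Φ C.dom := fun z hz =>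
    isGermClass_isPullBack.analytic _ _ (hΦ z hz)
  have hO : IsOpen {w : ℂ | w.re < C.b} := isOpen_lt continuous_re continuous_const
  have hpi : (2 * Real.pi * I : ℂ) ≠ 0 := two_pi_I_ne_zero
  refine ⟨fun z hz => (hΨa z hz).add (analyticAt_const.mul (analyticAt_fst.mul (hΦa z hz))),
    fun z hz => ?_, ?_, fun y hy => ?_⟩
  · have h1 := hΨΦ z hz
    have h2 := hΦΦ z hz
    simp only [turn] at h1 h2
    simp only [mul_zero, exp_zero, one_mul]
    rw [h1, h2, hk]
    field_simp
    ring
  · rintro ⟨w, y⟩ hz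
    have hs : ∀ w : ℂ, w.re < C.b → AnalyticAt ℂ (fun w => Ψ (w, y)) w := fun w hw =>
      analyticAt_fst_slice hΨa hz.2 w hw
    have hs' : ∀ w : ℂ, w.re < C.b → AnalyticAt ℂ (fun w => Φ (w, y)) w := fun w hw =>
      analyticAt_fst_slice hΦa hz.2 w hw
    have h1 : ∀ w : ℂ, w.re < C.b → dw (fun z => Ψ z + k * (z.1 * Φ z)) (w, y) =
        dw Ψ (w, y) + k * (1 * Φ (w, y) + w * dw Φ (w, y)) := fun w hw =>
      ((hs w hw).differentiableAt.hasDerivAt.fun_add (((hasDerivAt_id w).fun_mul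
        (hs' w hw).differentiableAt.hasDerivAt).const_mul k)).deriv
    have h2 : dw (dw fun z => Ψ z + k * (z.1 * Φ z)) (w, y) =
        dw (dw Ψ) (w, y) + k * (1 * dw Φ (w, y) + (1 * dw Φ (w, y) + w * dw (dw Φ) (w, y))) := by
      have h3 : (fun w => dw (fun z => Ψ z + k * (z.1 * Φ z)) (w, y)) =ᶠ[𝓝 w]
          fun w => dw Ψ (w, y) + k * (1 * Φ (w, y) + w * dw Φ (w, y)) := by
        filter_upwards [hO.mem_nhds hz.1] with v hv using h1 v hv
      refine h3.deriv_eq.trans ?_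
      exact ((hs w hz.1).deriv.differentiableAt.hasDerivAt.fun_add
        ((((hs' w hz.1).differentiableAt.hasDerivAt.const_mul 1).fun_add ((hasDerivAt_id w).fun_mul
          (hs' w hz.1).deriv.differentiableAt.hasDerivAt)).const_mul k)).deriv
    have hy1 : AnalyticAt ℂ (fun y => Ψ (w, y)) y :=
      AnalyticAt.fun_comp (g := Ψ) (f := fun y => (w, y)) (hΨa (w, y) hz) (by fun_prop)
    have hy2 : AnalyticAt ℂ (fun y => Φ (w, y)) y :=
      AnalyticAt.fun_comp (g := Φ) (f := fun y => (w, y)) (hΦa (w, y) hz) (by fun_prop)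
    have h4 : lapY (fun z => Ψ z + k * (z.1 * Φ z)) (w, y) =
        lapY Ψ (w, y) + k * (w * lapY Φ (w, y)) := by
      refine (lap_add hy1 (analyticAt_const_mul k (analyticAt_const_mul w hy2))).trans ?_
      rw [lap_const_mul k (analyticAt_const_mul w hy2), lap_const_mul w hy2]
      rfl
    have h5 := (hΨ _ hz).equation ha hL hz
    have h6 := (hΦ _ hz).equation ha hL hz
    have h7 : -(a ⬝ᵥ a) / (2 * Real.pi * I) = k * (a ⬝ᵥ a) := by rw [hk]; field_simp
    rw [h1 w hz.1, h2, h4, h7]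
    simp only at h5 h6 ⊢
    linear_combination h5 + k * w * h6
  · have h1 := continuous_line_of_differentiableOn (f := fun w => Φ (w, y))
      (analyticAt_fst_slice hΦa hy).differentiableOn C.t_lt
    have h2 : Continuous fun θ : ℝ => dw Φ (C.t + θ * I, y) :=
      continuous_line_of_differentiableOn
        ((analyticAt_fst_slice hΦa hy).differentiableOn.deriv hO) C.t_lt
    exact continuous_const.mul ((continuous_const.mul h2).sub h1)

lemma Chart.monodromy_eq_one (C : Chart P.u P.sing a c (lam 0) m x₀) (ha : a ⬝ᵥ a ≠ 0)
    (hx₀ : aff a c x₀ = 0) (hL : P.StronglyIntegrable L) : C.monodromy L = 1 := by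
  have := C.finiteDimensional_sections ha hx₀ hL
  have hpi : (2 * Real.pi * I : ℂ) ≠ 0 := two_pi_I_ne_zero
  have hzero : ∀ Ψ : C.sections L, (∀ z ∈ C.dom, Ψ.1 z = 0) → Ψ = 0 := fun Ψ h =>
    Subtype.ext (funext fun z => (em (z ∈ C.dom)).elim (h z) (Ψ.2.2 z))
  refine end_eq_one _ (fun κ hκ Ψ hΨ => ?_) fun Ψ hΨ => ?_
  · have h1 : ∀ z, Ψ.1 (turn z) = κ * Ψ.1 z := fun z => congrFun (congrArg Subtype.val hΨ) z
    refine hzero Ψ ?_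
    -- The eigenvalue `0` cannot occur because the translation is invertible. It is treated apart
    -- since it has no logarithm.
    by_cases hκ0 : κ = 0
    · intro z hz
      have h2 := h1 (z.1 - 2 * Real.pi * I, z.2)
      rw [hκ0, zero_mul] at h2
      simpa [turn] using h2
    -- The principal logarithm gives `Re μ = arg κ / (2π) ≤ 1 / 2`, and `κ ≠ 1` makes `μ`
    -- non-integral.
    · refine Chart.Wave.eq_zero_of_ne_int (μ := log κ / (2 * Real.pi * I)) ha ?_ ?_
        (Chart.wave_of_eigenvector ha hL Ψ.2.1 fun z _ => ?_)
      · have h2 : (log κ / (2 * Real.pi * I)).re = arg κ / (2 * Real.pi) := by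
          have h3 : log κ / (2 * Real.pi * I) = -I * log κ / ((2 * Real.pi : ℝ) : ℂ) := by
            push_cast
            field_simp
            rw [I_sq]
            ring
          rw [h3, div_ofReal_re]
          simp [log_im]
        rw [h2, div_le_div_iff₀ Real.two_pi_pos two_pos]
        linarith [arg_le_pi κ]
      · intro k hk
        refine hκ ?_
        rw [div_eq_iff hpi] at hk
        rw [← exp_log hκ0, hk, exp_int_mul_two_pi_mul_I]
      · rw [mul_div_cancel₀ _ hpi, exp_log hκ0]
        exact h1 z
  · set Φ := (C.monodromy L - 1) Ψ with hΦ
    have h1 : ∀ z, Ψ.1 (turn z) = Ψ.1 z + Φ.1 z := fun z => by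
      have : Φ.1 z = Ψ.1 (turn z) - Ψ.1 z := rfl
      rw [this]; ring
    have h2 : ∀ z, Φ.1 (turn z) = Φ.1 z := fun z =>
      sub_eq_zero.1 (congrFun (congrArg Subtype.val hΨ) z)
    refine hzero Φ (Chart.Wave.eq_zero_of_log ha (k := -(a ⬝ᵥ a) / (2 * Real.pi * I))
      (div_ne_zero (neg_ne_zero.2 ha) hpi)
      (Chart.wave_of_eigenvector ha hL Φ.2.1 fun z _ => ?_)
      (Chart.wave_of_log ha hL Ψ.2.1 Φ.2.1 (fun z _ => h1 z) fun z _ => h2 z))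
    rw [mul_zero, exp_zero, one_mul]
    exact h2 z

/-- Sections over the domain of a chart are periodic. -/
lemma Chart.periodic (ha : a ⬝ᵥ a ≠ 0) (hx₀ : aff a c x₀ = 0) (hL : P.StronglyIntegrable L)
    (hΨ : ∀ z ∈ C.dom, IsPullBack L lam a c Ψ z) {z : ℂ × Vec n} (hz : z ∈ C.dom) :
    Ψ (turn z) = Ψ z := by
  classical
  have h1 : C.dom.indicator Ψ ∈ C.sections L := by
    refine ⟨fun z hz => isGermClass_isPullBack.congr Ψ _ z ?_ (hΨ z hz), fun z hz =>
      Set.indicator_of_notMem hz Ψ⟩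
    filter_upwards [isOpen_wrapDom.mem_nhds hz] with y hy
    exact (Set.indicator_of_mem (s := C.dom) hy Ψ).symm
  have h2 : C.monodromy L ⟨_, h1⟩ = ⟨_, h1⟩ := by rw [C.monodromy_eq_one ha hx₀ hL]; rfl
  have h3 : C.dom.indicator Ψ (turn z) = C.dom.indicator Ψ z :=
    congrFun (congrArg Subtype.val h2) z
  rwa [Set.indicator_of_mem hz, Set.indicator_of_mem (show turn z ∈ C.dom from turn_mem_wrapDom.2 hz)] at h3

end Monodromy

/-! ### Local form of solutions at generic points -/

section LocalForm

open Complex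

lemma slide_add_smul {n : ℕ} {a : Vec n} {c : ℂ} (ha : a ⬝ᵥ a ≠ 0) (t s : ℂ) (y : Vec n) :
    slide a c t (y + s • normalVec a) = slide a c t y := by
  rw [slide, aff_add_smul ha, slide, add_assoc, ← add_smul]
  congr 2
  ring

variable {n : ℕ} [NeZero n] {P : EllipticPotential n} {L : Fin n → DiffOp n} {lam : Fin n → ℂ}
  {a : Vec n} {c : ℂ} {m : ℕ} {x₀ : Vec n} {C : Chart P.u P.sing a c (lam 0) m x₀}
  {Ψ : ℂ × Vec n → ℂ}

/-- Iterated periodicity. For a negative multiple of `2πi` the roles of `w` and `w'` are exchanged.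
-/
lemma Chart.eq_of_exp_eq (ha : a ⬝ᵥ a ≠ 0) (hx₀ : aff a c x₀ = 0) (hL : P.StronglyIntegrable L)
    (hΨ : ∀ z ∈ C.dom, IsPullBack L lam a c Ψ z) {w w' : ℂ} {y : Vec n} (hw : (w, y) ∈ C.dom)
    (h : exp w = exp w') : Ψ (w, y) = Ψ (w', y) := by
  have h1 : ∀ k : ℕ, ∀ w : ℂ, (w, y) ∈ C.dom →
      (w + k * (2 * Real.pi * I), y) ∈ C.dom ∧ Ψ (w + k * (2 * Real.pi * I), y) = Ψ (w, y) := by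
    intro k
    induction k with
    | zero => intro w hw; simpa using hw
    | succ k ih =>
      intro w hw
      obtain ⟨h2, h3⟩ := ih w hw
      have h4 : (w + (k + 1 : ℕ) * (2 * Real.pi * I), y) =
          turn (w + k * (2 * Real.pi * I), y) := by
        rw [turn]
        congr 1
        push_cast
        ring
      rw [h4]
      exact ⟨turn_mem_wrapDom.2 h2, (Chart.periodic ha hx₀ hL hΨ h2).trans h3⟩
  have hw' : (w', y) ∈ C.dom := by
    refine ⟨?_, hw.2⟩
    have h2 := congrArg norm h
    rw [norm_exp, norm_exp] at h2
    simp only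
    rw [← Real.exp_injective h2]
    exact hw.1
  obtain ⟨k, hk⟩ := exp_eq_exp_iff_exists_int.1 h
  rcases Int.eq_nat_or_neg k with ⟨l, rfl | rfl⟩
  · rw [hk]
    exact_mod_cast (h1 l w' hw').2
  · have h2 : w' = w + l * (2 * Real.pi * I) := by
      rw [hk]
      push_cast
      ring
    rw [h2]
    exact ((h1 l w hw).2).symm

/-- Sections are constant along the normals of the hyperplane. -/
lemma Chart.add_normal (ha : a ⬝ᵥ a ≠ 0) (hΨ : ∀ z ∈ C.dom, IsPullBack L lam a c Ψ z) {w s : ℂ}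
    {y : Vec n} (hy : (w, y) ∈ C.dom) (hy' : (w, y + s • normalVec a) ∈ C.dom) :
    Ψ (w, y + s • normalVec a) = Ψ (w, y) := by
  have hmem : ∀ x ∈ Set.Icc (0 : ℝ) 1, (w, y + (x * s) • normalVec a) ∈ C.dom := by
    intro x hx
    have h1 := convex_wrapDom.add_smul_sub_mem hy hy' hx
    have h2 : (w, y) + x • ((w, y + s • normalVec a) - (w, y)) =
        ((w, y + (x * s) • normalVec a) : ℂ × Vec n) := by
      refine Prod.ext ?_ ?_
      · simp
      · simp [mul_smul]
    rwa [h2] at h1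
  have hcont : Continuous fun x : ℝ => ((w, y + (x * s) • normalVec a) : ℂ × Vec n) := by fun_prop
  have hder : ∀ x ∈ Set.Icc (0 : ℝ) 1,
      HasDerivAt (fun x : ℝ => Ψ (w, y + (x * s) • normalVec a)) 0 x := by
    intro x hx
    obtain ⟨ψ, -, h2⟩ := hΨ _ (hmem x hx)
    refine (hasDerivAt_const x (ψ (wrap a c (w, y)))).congr_of_eventuallyEq ?_
    filter_upwards [hcont.continuousAt.eventually h2] with x' hx'
    rw [hx', wrap, slide_add_smul ha]
    rfl
  have h1 := constant_of_has_deriv_right_zero (f := fun x : ℝ => Ψ (w, y + (x * s) • normalVec a))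
    (a := 0) (b := 1) (fun x hx => (hder x hx).continuousAt.continuousWithinAt)
    (fun x hx => (hder x (Set.Ico_subset_Icc_self hx)).hasDerivWithinAt) 1 (by simp)
  simpa using h1

lemma Chart.coef_slide (ha : a ⬝ᵥ a ≠ 0) (hΨ : ∀ z ∈ C.dom, IsPullBack L lam a c Ψ z) (μ : ℂ)
    (j : ℤ) {y : Vec n} (hy : y ∈ Metric.ball x₀ C.r)
    (hy' : slide a c 0 y ∈ Metric.ball x₀ C.r) : C.coef μ Ψ j (slide a c 0 y) = C.coef μ Ψ j y :=
  mode_congr (fun θ => Chart.add_normal ha hΨ (C.line_mem hy θ) (C.line_mem hy' θ)) _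

/-- The holomorphic factor `h` in `f = aff ^ e * h`. -/
def Chart.factor (C : Chart P.u P.sing a c (lam 0) m x₀) (e : ℤ) (Ψ : ℂ × Vec n → ℂ) (x : Vec n) : ℂ :=
  (2 * Real.pi : ℂ)⁻¹ * ∫ θ in (0 : ℝ)..2 * Real.pi, exp (C.t + θ * I) /
    (exp (C.t + θ * I) - aff a c x) * (exp (-(e * (C.t + θ * I))) * Ψ (C.t + θ * I, x))

lemma Chart.analyticOnNhd_factor (hΨ : AnalyticOnNhd ℂ Ψ C.dom) (e : ℤ) {ε : ℝ} (hε : ε ≤ C.r)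
    (hb : ∀ x ∈ Metric.ball x₀ ε, ‖aff a c x‖ < Real.exp C.t) :
    AnalyticOnNhd ℂ (C.factor e Ψ) (Metric.ball x₀ ε) := by
  have hne : ∀ θ : ℝ, ∀ x ∈ Metric.ball x₀ ε, exp (C.t + θ * I) - aff a c x ≠ 0 := by
    intro θ x hx h
    have h1 := hb x hx
    rw [← sub_eq_zero.1 h, norm_exp] at h1
    simp at h1
  have hsub : Metric.ball x₀ ε ⊆ Metric.ball x₀ C.r := Metric.ball_subset_ball hε
  have h1 := analyticOnNhd_intervalIntegral (a := 0) (b := 2 * Real.pi) (U := Metric.ball x₀ ε)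
    (g := fun θ x => exp (C.t + θ * I) / (exp (C.t + θ * I) - aff a c x) *
      (exp (-(e * (C.t + θ * I))) * Ψ (C.t + θ * I, x))) Real.two_pi_pos.le Metric.isOpen_ball
    (by
      have h2 := (continuous_mode_integrand hΨ C.t_lt e).mono
        (Set.prod_mono (Set.subset_univ (Set.Icc 0 (2 * Real.pi))) hsub)
      have h3 : ContinuousOn (fun z : ℝ × Vec n => exp (C.t + z.1 * I) /
          (exp (C.t + z.1 * I) - aff a c z.2)) (Set.Icc 0 (2 * Real.pi) ×ˢ Metric.ball x₀ ε) := by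
        have h4 : Continuous fun z : ℝ × Vec n => exp (C.t + z.1 * I) := by fun_prop
        have h5 : Continuous fun z : ℝ × Vec n => aff a c z.2 :=
          (continuous_aff a c).comp continuous_snd
        exact h4.continuousOn.div (h4.sub h5).continuousOn fun z hz => hne z.1 z.2 hz.2
      exact h3.mul h2)
    (fun θ _ => by
      have h2 := (differentiableOn_mode_integrand hΨ C.t_lt e θ).mono hsub
      have h3 : DifferentiableOn ℂ (fun x => exp (C.t + θ * I) /
          (exp (C.t + θ * I) - aff a c x)) (Metric.ball x₀ ε) := fun x hx =>
        ((analyticAt_const.div (analyticAt_const.sub (analyticAt_aff a c x))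
          (hne θ x hx)).differentiableAt).differentiableWithinAt
      exact h3.mul h2)
  exact fun x hx => analyticAt_const.mul (h1 x hx)

lemma Chart.factor_of_aff_eq_zero (e : ℤ) {x : Vec n} (hx : aff a c x = 0) :
    C.factor e Ψ x = (2 * Real.pi : ℂ)⁻¹ * C.coef 0 Ψ e x := by
  simp only [Chart.factor, Chart.coef, mode, hx, sub_zero, div_self (exp_ne_zero _), one_mul,
    zero_add]

/-- The function `exp (-(e w)) Ψ` is periodic and has no negative modes, so Cauchy's formula
recovers it from the line `Re w = C.t`. The integral depends on `w` through `exp w = aff a c x` only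
and stays holomorphic across the hyperplane. -/
lemma Chart.eq_factor (ha : a ⬝ᵥ a ≠ 0) (hx₀ : aff a c x₀ = 0) (hL : P.StronglyIntegrable L)
    (hΨ : ∀ z ∈ C.dom, IsPullBack L lam a c Ψ z) {e : ℤ}
    (he : ∀ j < e, ∀ y ∈ Metric.ball x₀ C.r, C.coef 0 Ψ j y = 0) {x : Vec n}
    (hx : x ∈ Metric.ball x₀ C.r) (hxb : ‖aff a c x‖ < Real.exp C.t) (hx0 : aff a c x ≠ 0) :
    Ψ (log (aff a c x), x) = aff a c x ^ e * C.factor e Ψ x := by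
  have hΨa : AnalyticOnNhd ℂ Ψ C.dom := fun z hz =>
    isGermClass_isPullBack.analytic _ _ (hΨ z hz)
  have hlog : (log (aff a c x)).re < C.t := by
    rw [log_re, ← Real.log_exp C.t]
    exact Real.log_lt_log (norm_pos_iff.2 hx0) hxb
  have h1 := eq_integral_of_mode_eq_zero (f := fun w => exp (-(e * w)) * Ψ (w, x)) (a := C.t)
    (b := C.b) (by
      have h2 := (analyticAt_fst_slice hΨa hx).differentiableOn
      exact DifferentiableOn.mul (by fun_prop) h2) C.t_lt (fun w hw => by
      have h2 : exp (-(e * (w + 2 * Real.pi * I))) = exp (-(e * w)) := by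
        refine exp_eq_exp_iff_exists_int.2 ⟨-e, ?_⟩
        push_cast
        ring
      have h3 := Chart.periodic ha hx₀ hL hΨ (z := (w, x)) ⟨hw, hx⟩
      rw [turn] at h3
      rw [h2, h3]) (fun j hj => by
      rw [← he (e + j) (by omega) x hx]
      unfold mode Chart.coef mode
      congr 1
      funext θ
      rw [← mul_assoc, ← exp_add]
      congr 2
      push_cast
      ring) hlog
  simp only [mode, zero_mul, neg_zero, exp_zero, one_mul, exp_log hx0] at h1
  rw [Chart.factor, ← h1, ← mul_assoc, ← exp_log hx0, ← exp_int_mul, ← exp_add, exp_log hx0]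
  simp

/-- The local form of the solutions near a generic point of a singular hyperplane. -/
theorem Chart.exists_local_form (C : Chart P.u P.sing a c (lam 0) m x₀) (ha : a ⬝ᵥ a ≠ 0)
    (hx₀ : aff a c x₀ = 0) (hL : P.StronglyIntegrable L) : ∃ ε > 0,
    (∀ x ∈ Metric.ball x₀ ε, aff a c x ≠ 0 → x ∉ P.sing) ∧
    ∀ x₁ ∈ Metric.ball x₀ ε, aff a c x₁ ≠ 0 → ∀ ψ, IsSol L lam ψ x₁ → (¬ ∀ᶠ x in 𝓝 x₁, ψ x = 0) →
      ∃ (e : ℤ) (h : Vec n → ℂ), (e = -(m : ℤ) ∨ e = (m : ℤ) + 1) ∧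
        AnalyticOnNhd ℂ h (Metric.ball x₀ ε) ∧
        (∃ y ∈ Metric.ball x₀ ε, aff a c y = 0 ∧ h y ≠ 0) ∧
        (∀ᶠ x in 𝓝 x₁, ψ x = aff a c x ^ e * h x) ∧
        ∀ x ∈ Metric.ball x₀ ε, aff a c x ≠ 0 → IsSol L lam (fun x => aff a c x ^ e * h x) x := by
  obtain ⟨ε', hε', hsub'⟩ : ∃ ε > 0, ∀ x ∈ Metric.ball x₀ ε, ‖aff a c x‖ < Real.exp C.t := by
    have h1 : ∀ᶠ x in 𝓝 x₀, ‖aff a c x‖ < Real.exp C.t := by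
      refine (continuous_aff a c).norm.continuousAt.eventually_lt continuousAt_const ?_
      rw [hx₀, norm_zero]
      exact Real.exp_pos _
    exact Metric.eventually_nhds_iff_ball.1 h1
  set ε := min ε' C.r with hεd
  have hε : 0 < ε := lt_min hε' C.r_pos
  have hεr : ε ≤ C.r := min_le_right _ _
  have hr : Metric.ball x₀ ε ⊆ Metric.ball x₀ C.r := Metric.ball_subset_ball hεr
  have hb : ∀ x ∈ Metric.ball x₀ ε, ‖aff a c x‖ < Real.exp C.t := fun x hx =>
    hsub' x (Metric.ball_subset_ball (min_le_left _ _) hx)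
  have hlog : ∀ x ∈ Metric.ball x₀ ε, aff a c x ≠ 0 → (log (aff a c x), x) ∈ C.dom := by
    intro x hx hx0
    refine ⟨?_, hr hx⟩
    rw [log_re, ← Real.log_exp C.b]
    exact (Real.log_lt_log (norm_pos_iff.2 hx0) (hb x hx)).trans_le
      (Real.log_le_log (Real.exp_pos _) (Real.exp_le_exp.2 C.t_lt.le))
  refine ⟨ε, hε, fun x hx hx0 => ?_, fun x₁ hx₁ hx₁0 ψ hψ hψ0 => ?_⟩
  · have h1 := C.notMem _ (hlog x hx hx0).1 (hlog x hx hx0).2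
    rwa [wrap_of_exp_eq (exp_log hx0)] at h1
  have hw₁ := exp_log hx₁0
  obtain ⟨Ψ, hΨ, hΨψ⟩ := C.extendsOn hL _ (hlog x₁ hx₁ hx₁0) (fun z => ψ (wrap a c z))
    ⟨ψ, by rwa [wrap_of_exp_eq hw₁], EventuallyEq.rfl⟩
  -- The branch cut of `log` does no harm, since sections depend on `w` through `exp w` only.
  set f : Vec n → ℂ := fun x => Ψ (log (aff a c x), x) with hf
  have hnear : ∀ x ∈ Metric.ball x₀ ε, aff a c x ≠ 0 →
      (fun x' => Ψ (lift a c (log (aff a c x)) x')) =ᶠ[𝓝 x] f := by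
    intro x hx hx0
    have h1 : Tendsto (lift a c (log (aff a c x))) (𝓝 x) (𝓝 (log (aff a c x), x)) := by
      have h2 := (analyticAt_lift (exp_log hx0)).continuousAt
      rwa [ContinuousAt, lift_self (exp_log hx0)] at h2
    filter_upwards [h1.eventually (isOpen_wrapDom.mem_nhds (hlog x hx hx0)),
      (continuous_aff a c).continuousAt.eventually_ne hx0] with x' h2 h3
    refine Chart.eq_of_exp_eq ha hx₀ hL hΨ h2 ?_
    rw [exp_add, exp_log hx0, exp_log h3, exp_log (div_ne_zero h3 hx0), mul_div_cancel₀ _ hx0]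
  have hfsol : ∀ x ∈ Metric.ball x₀ ε, aff a c x ≠ 0 → IsSol L lam f x := fun x hx hx0 =>
    (isGermClass_isSol L lam).congr _ _ _ (hnear x hx hx0)
      ((hΨ _ (hlog x hx hx0)).isSol_comp_lift (exp_log hx0))
  have hfψ : f =ᶠ[𝓝 x₁] ψ :=
    (hnear x₁ hx₁ hx₁0).symm.trans (IsPullBack.eventuallyEq_comp_lift hw₁ hΨψ)
  have hwave : C.Wave 0 0 Ψ := Chart.wave_of_eigenvector ha hL hΨ fun z hz => by
    rw [mul_zero, exp_zero, one_mul]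
    exact Chart.periodic ha hx₀ hL hΨ hz
  have h0 : ∀ j y, C.coef 0 0 j y = 0 := fun j y => by simp [Chart.coef, mode]
  have hlow : ∀ j : ℤ, j < -m → ∀ y ∈ Metric.ball x₀ C.r, C.coef 0 Ψ j y = 0 := fun j hj =>
    hwave.coef_eq_zero ha (by norm_num) (fun j _ y _ => h0 j y) hj
  -- Modes are constant along normals, so their vanishing on the part of the hyperplane in the small
  -- ball spreads to a neighbourhood of `x₀` and, by analyticity, to the ball of the chart.
  have hπ : ∀ j : ℤ, (∀ y ∈ Metric.ball x₀ ε, aff a c y = 0 → C.coef 0 Ψ j y = 0) →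
      ∀ y ∈ Metric.ball x₀ C.r, C.coef 0 Ψ j y = 0 := by
    intro j hj
    refine (hwave.analyticOnNhd_coef j).eqOn_zero_of_preconnected_of_eventuallyEq_zero
      (convex_ball x₀ C.r).isPreconnected (Metric.mem_ball_self C.r_pos) ?_
    have h1 : Tendsto (slide a c 0) (𝓝 x₀) (𝓝 x₀) := by
      have h2 : ContinuousAt (slide a c 0) x₀ :=
        ((continuous_slide a c).comp (by fun_prop : Continuous fun y : Vec n => ((0 : ℂ), y))).continuousAt
      have h3 : slide a c 0 x₀ = x₀ := by
        have := slide_aff (a := a) (c := c) x₀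
        rwa [hx₀] at this
      rwa [ContinuousAt, h3] at h2
    filter_upwards [h1.eventually (Metric.ball_mem_nhds x₀ hε), Metric.ball_mem_nhds x₀ C.r_pos]
      with y hy hyr
    rw [← Chart.coef_slide ha hΨ 0 j hyr (hr hy)]
    exact hj _ hy (aff_slide ha 0 y)
  -- The exponent is the lowest index with a non-zero mode, and the indicial equation leaves two
  -- candidates. If both failed, all modes and hence the solution would vanish.
  suffices key : ∃ e : ℤ, (e = -(m : ℤ) ∨ e = (m : ℤ) + 1) ∧
      (∀ j < e, ∀ y ∈ Metric.ball x₀ C.r, C.coef 0 Ψ j y = 0) ∧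
      ∃ y ∈ Metric.ball x₀ ε, aff a c y = 0 ∧ C.coef 0 Ψ e y ≠ 0 by
    obtain ⟨e, he, hj, y, hy, hy0, hyc⟩ := key
    have hff : ∀ x ∈ Metric.ball x₀ ε, aff a c x ≠ 0 →
        f =ᶠ[𝓝 x] fun x => aff a c x ^ e * C.factor e Ψ x := by
      intro x hx hx0
      filter_upwards [(continuous_aff a c).continuousAt.eventually_ne hx0,
        Metric.isOpen_ball.mem_nhds hx] with x' h1 h2 using
        Chart.eq_factor ha hx₀ hL hΨ hj (hr h2) (hb x' h2) h1
    refine ⟨e, C.factor e Ψ, he, Chart.analyticOnNhd_factor hwave.analytic e hεr hb,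
      ⟨y, hy, hy0, ?_⟩, hfψ.symm.trans (hff x₁ hx₁ hx₁0), fun x hx hx0 =>
      (isGermClass_isSol L lam).congr _ _ _ (hff x hx hx0) (hfsol x hx hx0)⟩
    rw [Chart.factor_of_aff_eq_zero e hy0]
    refine mul_ne_zero (inv_ne_zero ?_) hyc
    exact_mod_cast Real.two_pi_pos.ne'
  by_cases hm : ∃ y ∈ Metric.ball x₀ ε, aff a c y = 0 ∧ C.coef 0 Ψ (-m) y ≠ 0
  · exact ⟨-m, Or.inl rfl, hlow, hm⟩
  have hstep : ∀ j : ℤ, j ≠ -m → j ≠ m + 1 → (∀ k < j, ∀ y ∈ Metric.ball x₀ C.r,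
      C.coef 0 Ψ k y = 0) → ∀ y ∈ Metric.ball x₀ C.r, C.coef 0 Ψ j y = 0 := by
    intro j h1 h2 h3 y hy
    have h4 := hwave.indicial (j := j) (fun k hk => h3 k (by omega)) hy
    rw [h0, indicial_factor] at h4
    refine (mul_eq_zero.1 h4).resolve_left (mul_ne_zero ha (mul_ne_zero ?_ ?_))
    · intro h
      refine h1 ?_
      have h5 : ((j + m : ℤ) : ℂ) = 0 := by push_cast; linear_combination h
      have := Int.cast_eq_zero.1 h5
      omega
    · intro h
      refine h2 ?_
      have h5 : ((j - m - 1 : ℤ) : ℂ) = 0 := by push_cast; linear_combination h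
      have := Int.cast_eq_zero.1 h5
      omega
  have hm' : ∀ y ∈ Metric.ball x₀ C.r, C.coef 0 Ψ (-m) y = 0 := hπ _ fun y hy hy0 => by
    by_contra h
    exact hm ⟨y, hy, hy0, h⟩
  have hmid : ∀ N : ℕ, N ≤ 2 * m + 1 → ∀ j : ℤ, j < -m + N →
      ∀ y ∈ Metric.ball x₀ C.r, C.coef 0 Ψ j y = 0 := by
    intro N
    induction N with
    | zero => exact fun _ j hj => hlow j (by simpa using hj)
    | succ N ih =>
      intro hN j hj
      by_cases h1 : j = -m
      · rw [h1]; exact hm'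
      · exact hstep j h1 (by omega) fun k hk => ih (by omega) k (by omega)
  by_cases htop : ∃ y ∈ Metric.ball x₀ ε, aff a c y = 0 ∧ C.coef 0 Ψ (m + 1) y ≠ 0
  · exact ⟨m + 1, Or.inr rfl, fun j hj => hmid (2 * m + 1) le_rfl j (by push_cast; omega), htop⟩
  have htop' : ∀ y ∈ Metric.ball x₀ C.r, C.coef 0 Ψ (m + 1) y = 0 := hπ _ fun y hy hy0 => by
    by_contra h
    exact htop ⟨y, hy, hy0, h⟩
  have hall : ∀ N : ℕ, ∀ j : ℤ, j < -m + N → ∀ y ∈ Metric.ball x₀ C.r, C.coef 0 Ψ j y = 0 := by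
    intro N
    induction N with
    | zero => exact fun j hj => hlow j (by simpa using hj)
    | succ N ih =>
      intro j hj
      by_cases h1 : j = -m
      · rw [h1]; exact hm'
      by_cases h2 : j = m + 1
      · rw [h2]; exact htop'
      · exact hstep j h1 h2 fun k hk => ih k (by omega)
  have hzero := hwave.eq_zero fun j => hall (j + m + 1).toNat j (by
    have := Int.self_le_toNat (j + m + 1)
    omega)
  refine absurd ?_ hψ0
  filter_upwards [hfψ, (continuous_aff a c).continuousAt.eventually_ne hx₁0,
    Metric.isOpen_ball.mem_nhds hx₁] with x h1 h2 h3
  rw [← h1, hf]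
  exact hzero _ (hlog x h3 h2)

end LocalForm

/-! ### Local structure of the singular locus -/

section Sing

variable {n : ℕ} (P : EllipticPotential n)

/-- The singular hyperplanes which meet a small neighbourhood of `p` contain `p`. -/
lemma eventually_mem_hyperplane (p : Vec n) : ∀ᶠ x in 𝓝 p, ∀ α ∈ P.A, ∀ k l : ℤ,
    x ∈ hyperplane P.τ α k l → p ∈ hyperplane P.τ α k l := by
  refine (Filter.eventually_all_finset _).2 fun α _ => ?_
  set Λ := periodPair P.τ P.im_pos with hΛ
  have hc : ContinuousAt (fun x : Vec n => α.1 ⬝ᵥ x + α.2) p := (analyticAt_affine α p).continuousAt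
  have h1 : ∀ᶠ x in 𝓝 p, α.1 ⬝ᵥ x + α.2 ∉ (Λ.lattice : Set ℂ) \ {α.1 ⬝ᵥ p + α.2} :=
    hc.eventually ((Λ.isClosed_of_subset_lattice Set.sdiff_subset).isOpen_compl.mem_nhds
      (by simp))
  filter_upwards [h1] with x hx k l hkl
  have h2 : α.1 ⬝ᵥ x + α.2 = k + l * P.τ := by
    rw [hyperplane, Set.mem_ofPred_eq, shifted] at hkl
    linear_combination hkl
  have h3 : α.1 ⬝ᵥ x + α.2 ∈ Λ.lattice :=
    PeriodPair.mem_lattice.2 ⟨k, l, by rw [h2, hΛ]; simp [periodPair]⟩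
  have h4 : α.1 ⬝ᵥ x + α.2 = α.1 ⬝ᵥ p + α.2 := by
    by_contra hne
    exact hx ⟨h3, hne⟩
  rw [hyperplane, Set.mem_ofPred_eq, shifted, ← h4, h2]
  ring

variable {P} in
lemma dotProduct_sub_eq_zero {α : AffineFun n} {k l : ℤ} {x p : Vec n}
    (hx : x ∈ hyperplane P.τ α k l) (hp : p ∈ hyperplane P.τ α k l) : α.1 ⬝ᵥ (x - p) = 0 := by
  rw [hyperplane, Set.mem_ofPred_eq, shifted] at hx hp
  rw [dotProduct_sub]
  linear_combination hx - hp

lemma analyticAt_dotProduct_sub (a p x : Vec n) : AnalyticAt ℂ (fun x => a ⬝ᵥ (x - p)) x := by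
  simp only [dotProduct_sub]
  exact (analyticAt_dot a x).sub analyticAt_const

lemma not_eventually_dotProduct_eq_zero {a : Vec n} (ha : a ≠ 0) (p y : Vec n) :
    ¬ ∀ᶠ x in 𝓝 y, a ⬝ᵥ (x - p) = 0 := by
  intro h
  refine ha (funext fun i => ?_)
  have h1 : pd i (fun x : Vec n => a ⬝ᵥ (x - p)) y = a i := by
    have h2 : HasFDerivAt (fun x : Vec n => a ⬝ᵥ (x - p))
        (∑ j, a j • (ContinuousLinearMap.proj j : Vec n →L[ℂ] ℂ)) y := by
      unfold dotProduct
      exact HasFDerivAt.fun_sum fun j _ => ((ContinuousLinearMap.proj (R := ℂ)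
        (φ := fun _ : Fin n => ℂ) j).hasFDerivAt.comp y
          ((hasFDerivAt_id y).sub_const p)).const_mul (a j)
    rw [pd, h2.fderiv]
    simp [Pi.single_apply]
  rw [← h1, pd_congr_at (g := fun _ => 0) i h, pd_const]
  rfl

/-- Near `p` the singular locus lies in the zero set of the product of the non-zero forms `(α₀, x -
p)`. -/
lemma frequently_notMem_sing (p : Vec n) : ∃ᶠ x in 𝓝 p, x ∉ P.sing := by
  intro h
  refine not_eventually_prod_eq_zero P.A (h := fun α x => α.1 ⬝ᵥ (x - p)) (p := p)
    (fun α _ => analyticAt_dotProduct_sub _ _ _) (fun α hα =>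
      not_eventually_dotProduct_eq_zero (fun h0 => P.nonisotropic α hα (by simp [h0])) p p) ?_
  filter_upwards [h, eventually_mem_hyperplane P p] with x hx h1
  obtain ⟨α, hα, k, l, h2⟩ := not_not.1 hx
  exact Finset.prod_eq_zero hα (dotProduct_sub_eq_zero h2 (h1 α hα k l h2))

end Sing

/-! ### Solutions with their poles cleared -/

section Regularized

variable {n : ℕ} {P : EllipticPotential n} {L : Fin n → DiffOp n} {lam : Fin n → ℂ}

lemma exists_isGenericPoint_form [NeZero n] {P : EllipticPotential n} (hP : P.QuasiInvariant)
    {L : Fin n → DiffOp n} (hL : P.StronglyIntegrable L) (lam : Fin n → ℂ) {α : AffineFun n}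
    (hα : α ∈ P.A) {p q : ℤ} {x₀ : Vec n} (hx₀ : P.IsGenericPoint α p q x₀) : ∃ ε > 0,
    Metric.ball x₀ ε ∩ P.sing ⊆ hyperplane P.τ α p q ∧
    ∀ x₁ ∈ Metric.ball x₀ ε \ P.sing, ∀ ψ, IsSol L lam ψ x₁ → (¬ ∀ᶠ x in 𝓝 x₁, ψ x = 0) →
      ∃ (e : ℤ) (h : Vec n → ℂ), (e = -(P.m α : ℤ) ∨ e = (P.m α : ℤ) + 1) ∧
        AnalyticOnNhd ℂ h (Metric.ball x₀ ε) ∧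
        (∃ y ∈ Metric.ball x₀ ε ∩ hyperplane P.τ α p q, h y ≠ 0) ∧
        (∀ᶠ x in 𝓝 x₁, ψ x = shifted P.τ α p q x ^ e * h x) ∧
        ∀ x ∈ Metric.ball x₀ ε \ P.sing,
          IsSol L lam (fun x => shifted P.τ α p q x ^ e * h x) x := by
  obtain ⟨C⟩ := exists_chart_of_isGenericPoint P hP (lam 0) hα hx₀
  have h0 : aff α.1 (α.2 - p - q * P.τ) x₀ = 0 := by
    rw [← shifted_eq_aff]
    exact hx₀.1
  obtain ⟨ε, hε, hns, h⟩ := C.exists_local_form (P.nonisotropic α hα) h0 hL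
  have hsing : ∀ x, x ∉ P.sing → aff α.1 (α.2 - p - q * P.τ) x ≠ 0 := fun x hx h1 =>
    hx ⟨α, hα, p, q, by rw [hyperplane, Set.mem_ofPred_eq, shifted_eq_aff]; exact h1⟩
  refine ⟨ε, hε, fun x hx => ?_, fun x₁ hx₁ ψ hψ hψ0 => ?_⟩
  · rw [hyperplane, Set.mem_ofPred_eq, shifted_eq_aff]
    by_contra h1
    exact hns x hx.1 h1 hx.2
  · obtain ⟨e, k, he, hk, ⟨y, hy, hy0, hyk⟩, h1, h2⟩ := h x₁ hx₁.1 (hsing _ hx₁.2) ψ hψ hψ0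
    rw [shifted_eq_aff]
    refine ⟨e, k, he, hk, ⟨y, ⟨hy, ?_⟩, hyk⟩, h1, fun x hx => h2 x hx.1 (hsing x hx.2)⟩
    rw [hyperplane, Set.mem_ofPred_eq, shifted_eq_aff]
    exact hy0

lemma analyticAt_shifted (τ : ℂ) (α : AffineFun n) (p q : ℤ) (x : Vec n) :
    AnalyticAt ℂ (shifted τ α p q) x := by
  rw [shifted_eq_aff]
  exact analyticAt_aff _ _ x

/-- The product of the functions which define a finite set of singular hyperplanes, with
multiplicities. -/
def prodShift (P : EllipticPotential n) (T : Finset (AffineFun n × ℤ × ℤ)) (x : Vec n) : ℂ :=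
  ∏ t ∈ T, shifted P.τ t.1 t.2.1 t.2.2 x ^ P.m t.1

lemma analyticAt_prodShift (P : EllipticPotential n) (T : Finset (AffineFun n × ℤ × ℤ)) (x : Vec n) :
    AnalyticAt ℂ (prodShift P T) x :=
  Finset.analyticAt_fun_prod _ fun _ _ => (analyticAt_shifted _ _ _ _ x).fun_pow _

/-- The set `T` consists of singular hyperplanes and contains all those which meet `U`. -/
def Covers (P : EllipticPotential n) (T : Finset (AffineFun n × ℤ × ℤ)) (U : Set (Vec n)) : Prop :=
  (∀ t ∈ T, t.1 ∈ P.A) ∧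
    ∀ α ∈ P.A, ∀ p q : ℤ, ∀ x ∈ U, x ∈ hyperplane P.τ α p q → (α, p, q) ∈ T

variable {T : Finset (AffineFun n × ℤ × ℤ)} {U : Set (Vec n)}

lemma Covers.prodShift_ne_zero (hT : Covers P T U) {x : Vec n} (hx : x ∉ P.sing) :
    prodShift P T x ≠ 0 :=
  Finset.prod_ne_zero_iff.2 fun _ ht => pow_ne_zero _ fun h => hx ⟨_, hT.1 _ ht, _, _, h⟩

lemma Covers.notMem_sing (hT : Covers P T U) {x : Vec n} (hxU : x ∈ U) (hx : prodShift P T x ≠ 0) :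
    x ∉ P.sing := by
  rintro ⟨α, hα, p, q, h⟩
  have h1 := Finset.prod_ne_zero_iff.1 hx _ (hT.2 α hα p q x hxU h)
  exact h1 (by rw [show shifted P.τ α p q x = 0 from h, zero_pow (P.m_pos α hα).ne'])

/-- `F` is holomorphic and `F / prodShift P T` is a solution outside the singular locus. -/
def IsRegularized (P : EllipticPotential n) (L : Fin n → DiffOp n) (lam : Fin n → ℂ)
    (T : Finset (AffineFun n × ℤ × ℤ)) (F : Vec n → ℂ) (x : Vec n) : Prop :=
  AnalyticAt ℂ F x ∧ ∀ᶠ y in 𝓝 x, y ∉ P.sing → IsSol L lam (fun z => F z / prodShift P T z) y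

lemma isGermClass_isRegularized : IsGermClass (IsRegularized P L lam T) where
  congr f g x h := by
    rintro ⟨h1, h2⟩
    refine ⟨h1.congr h, ?_⟩
    filter_upwards [h2, h.eventually_nhds] with y h3 h4 h5
    refine (isGermClass_isSol L lam).congr _ _ _ ?_ (h3 h5)
    filter_upwards [h4] with z hz
    rw [hz]
  analytic f x h := h.1

/-- Where the coefficients are regular, `Lᵢ f - λᵢ f` is continuous, so it is enough that the
equation holds on a dense set. -/
lemma isSol_of_frequently {f : Vec n → ℂ} {x : Vec n} (hf : AnalyticAt ℂ f x)
    (h : ∀ᶠ y in 𝓝 x, ∃ᶠ z in 𝓝 y, IsSol L lam f z) : IsSol L lam f x := by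
  refine ⟨hf, ?_⟩
  filter_upwards [h, hf.eventually_analyticAt] with y h1 h2 i hi
  by_contra hne
  have h3 : ContinuousAt (fun z => (L i).apply f z - lam i * f z) y :=
    ((analyticAt_apply hi h2).sub (analyticAt_const.mul h2)).continuousAt
  have h4 := h3.eventually_ne (sub_ne_zero.2 hne)
  have h5 : ∀ᶠ z in 𝓝 y, (L i).RegularAt z := by
    have h6 : ∀ᶠ z in 𝓝 y, ∀ k ∈ (L i).support, AnalyticAt ℂ (L i k) z :=
      (Filter.eventually_all_finset _).2 fun k _ => (hi k).eventually_analyticAt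
    filter_upwards [h6] with z hz k
    by_cases hk : k ∈ (L i).support
    · exact hz k hk
    · rw [Finsupp.notMem_support_iff.1 hk]
      exact analyticAt_const
  obtain ⟨z, h7, h8, h9⟩ := (h1.and_eventually (h4.and h5)).exists
  exact h8 (sub_eq_zero.2 (h7.2.self_of_nhds i h9))

lemma isRegularized_of_frequently (hT : Covers P T U) {F : Vec n → ℂ} {x : Vec n}
    (hF : AnalyticAt ℂ F x) (h : ∀ᶠ y in 𝓝 x, ∃ᶠ z in 𝓝 y, IsRegularized P L lam T F z) :
    IsRegularized P L lam T F x := by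
  refine ⟨hF, ?_⟩
  filter_upwards [h.eventually_nhds, hF.eventually_analyticAt] with y h1 h2 hy
  refine isSol_of_frequently (h2.div (analyticAt_prodShift P T y) (hT.prodShift_ne_zero hy)) ?_
  filter_upwards [h1, (isClosed_sing P).isOpen_compl.mem_nhds hy] with z h3 h4
  refine (h3.and_eventually ((isClosed_sing P).isOpen_compl.mem_nhds h4)).mono ?_
  exact fun w hw => hw.1.2.self_of_nhds hw.2

lemma IsRegularized.eventually {F : Vec n → ℂ} {x : Vec n} (h : IsRegularized P L lam T F x) :
    ∀ᶠ y in 𝓝 x, IsRegularized P L lam T F y := by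
  filter_upwards [h.1.eventually_analyticAt, h.2.eventually_nhds] with y h1 h2 using ⟨h1, h2⟩

lemma IsSol.eventually {f : Vec n → ℂ} {x : Vec n} (h : IsSol L lam f x) :
    ∀ᶠ y in 𝓝 x, IsSol L lam f y := by
  filter_upwards [h.1.eventually_analyticAt, h.2.eventually_nhds] with y h1 h2 using ⟨h1, h2⟩

lemma isRegularized_of_isSol {F f : Vec n → ℂ} {x : Vec n} (hF : AnalyticAt ℂ F x)
    (h : ∀ᶠ y in 𝓝 x, y ∉ P.sing → F y / prodShift P T y = f y ∧ IsSol L lam f y) :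
    IsRegularized P L lam T F x := by
  refine ⟨hF, ?_⟩
  filter_upwards [h.eventually_nhds] with y h1 hy
  refine (isGermClass_isSol L lam).congr f _ y ?_ (h1.self_of_nhds hy).2
  filter_upwards [h1, (isClosed_sing P).isOpen_compl.mem_nhds hy] with z h2 h3
  exact (h2 h3).1.symm

lemma exists_extendsOn_of_notMem_sing [NeZero n] (hL : P.StronglyIntegrable L) (hT : Covers P T U)
    {p : Vec n} (hp : p ∉ P.sing) :
    ∃ r > 0, ExtendsOn (IsRegularized P L lam T) (Metric.ball p r) := by
  obtain ⟨N, hN⟩ := exists_extendsOn P hL lam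
  obtain ⟨⟨ε, hε, hext⟩, -⟩ := hN p hp
  obtain ⟨ε', hε', hns⟩ := Metric.isOpen_iff.1 (isClosed_sing P).isOpen_compl p hp
  refine ⟨min ε ε', lt_min hε hε', fun y hy F hF => ?_⟩
  have h1 : ∀ z ∈ Metric.ball p (min ε ε'), z ∉ P.sing := fun z hz =>
    hns (Metric.ball_subset_ball (min_le_right _ _) hz)
  obtain ⟨G, hG, hGF⟩ := hext y (Metric.ball_subset_ball (min_le_left _ _) hy) _
    (hF.2.self_of_nhds (h1 y hy))
  refine ⟨fun z => prodShift P T z * G z, fun z hz => isRegularized_of_isSol (f := G) ?_ ?_, ?_⟩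
  · exact (analyticAt_prodShift P T z).mul (hG z (Metric.ball_subset_ball (min_le_left _ _) hz)).1
  · filter_upwards [Metric.isOpen_ball.mem_nhds hz] with w hw hws
    exact ⟨mul_div_cancel_left₀ _ (hT.prodShift_ne_zero hws),
      hG w (Metric.ball_subset_ball (min_le_left _ _) hw)⟩
  · filter_upwards [hGF, Metric.isOpen_ball.mem_nhds hy] with z h2 h3
    rw [h2, mul_div_cancel₀ _ (hT.prodShift_ne_zero (h1 z h3))]

/-- The exponent in the local form is at least `-m`, and the factor of this hyperplane in
`prodShift` compensates exactly such a pole. -/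
lemma exists_extendsOn_of_isGenericPoint [NeZero n] (hP : P.QuasiInvariant)
    (hL : P.StronglyIntegrable L) (hT : Covers P T U) {α : AffineFun n} (hα : α ∈ P.A) {k l : ℤ}
    {p : Vec n} (hp : P.IsGenericPoint α k l p) (hpU : p ∈ U) :
    ∃ r > 0, ExtendsOn (IsRegularized P L lam T) (Metric.ball p r) := by
  classical
  obtain ⟨ε, hε, hsub, hform⟩ := exists_isGenericPoint_form hP hL lam hα hp
  refine ⟨ε, hε, fun y hy F hF => ?_⟩
  obtain ⟨δ, hδ, hball⟩ := Metric.eventually_nhds_iff_ball.1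
    ((Metric.isOpen_ball.eventually_mem hy).and hF.eventually)
  have hyδ := Metric.mem_ball_self (x := y) hδ
  have hFa : AnalyticOnNhd ℂ F (Metric.ball y δ) := fun z hz => (hball z hz).2.1
  obtain ⟨y', hyns, hy'⟩ := ((frequently_notMem_sing P y).and_eventually
    (Metric.isOpen_ball.mem_nhds hyδ)).exists
  have hsol := (hball y' hy').2.2.self_of_nhds hyns
  by_cases h0 : ∀ᶠ x in 𝓝 y', F x / prodShift P T x = 0
  · refine ⟨0, fun z _ => isRegularized_of_isSol (f := 0) analyticAt_const
      (Eventually.of_forall fun w _ => ⟨by simp, IsSol.zero L lam w⟩), ?_⟩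
    have h1 : F =ᶠ[𝓝 y'] 0 := by
      filter_upwards [h0, (isClosed_sing P).isOpen_compl.mem_nhds hyns] with x h2 h3
      exact (div_eq_zero_iff.1 h2).resolve_right (hT.prodShift_ne_zero h3)
    have h2 := hFa.eqOn_zero_of_preconnected_of_eventuallyEq_zero
      (convex_ball y δ).isPreconnected hy' h1
    filter_upwards [Metric.isOpen_ball.mem_nhds hyδ] with z hz using (h2 hz).symm
  · obtain ⟨e, h, he, hh, -, h1, h2⟩ := hform y' ⟨(hball y' hy').1, hyns⟩ _ hsol h0
    -- The exponent left after clearing the pole is `0` or `2 m + 1`.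
    obtain ⟨N, hN⟩ : ∃ N : ℕ, (N : ℤ) = e + P.m α := ⟨(e + P.m α).toNat,
      Int.toNat_of_nonneg (by rcases he with rfl | rfl <;> omega)⟩
    have ht := hT.2 α hα k l p hpU hp.1
    set G : Vec n → ℂ := fun x => prodShift P (T.erase (α, k, l)) x *
      (shifted P.τ α k l x ^ N * h x) with hG
    have hGa : AnalyticOnNhd ℂ G (Metric.ball p ε) := fun x hx =>
      (analyticAt_prodShift P _ x).mul (((analyticAt_shifted _ _ _ _ x).fun_pow N).mul (hh x hx))
    have hGf : ∀ x, x ∉ P.sing → G x / prodShift P T x = shifted P.τ α k l x ^ e * h x := by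
      intro x hx
      have h3 : shifted P.τ α k l x ≠ 0 := fun h3 => hx ⟨α, hα, k, l, h3⟩
      have h4 := hT.prodShift_ne_zero hx
      have h5 : prodShift P T x = shifted P.τ α k l x ^ P.m α *
          prodShift P (T.erase (α, k, l)) x := (Finset.mul_prod_erase T _ ht).symm
      have h6 : shifted P.τ α k l x ^ N = shifted P.τ α k l x ^ e *
          shifted P.τ α k l x ^ P.m α := by
        rw [← zpow_natCast, hN, zpow_add₀ h3, zpow_natCast]
      rw [div_eq_iff h4, h5, hG]
      simp only
      rw [h6]
      ring
    have hGF : G =ᶠ[𝓝 y'] F := by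
      filter_upwards [h1, (isClosed_sing P).isOpen_compl.mem_nhds hyns] with x h3 h4
      have h5 := (hGf x h4).trans h3.symm
      have h6 := hT.prodShift_ne_zero h4
      exact (div_left_inj' h6).1 h5
    refine ⟨G, fun z hz => isRegularized_of_isSol
      (f := fun x => shifted P.τ α k l x ^ e * h x) (hGa z hz) ?_, ?_⟩
    · filter_upwards [Metric.isOpen_ball.mem_nhds hz] with w hw hws
      exact ⟨hGf w hws, h2 w ⟨hw, hws⟩⟩
    · have h3 := AnalyticOnNhd.eqOn_of_preconnected_of_eventuallyEq
        (fun z hz => hGa z (hball z hz).1) hFa (convex_ball y δ).isPreconnected hy' hGF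
      filter_upwards [Metric.isOpen_ball.mem_nhds hyδ] with z hz using h3 hz

end Regularized

/-! ### Pull-backs of general germ classes -/

section PullClass

variable {E E' : Type*} [NormedAddCommGroup E] [NormedAddCommGroup E'] {S : (E → ℂ) → E → Prop} {g : E' → E}

/-- The pull-backs of the germs of a class. -/
def PullClass (S : (E → ℂ) → E → Prop) (g : E' → E) (Ψ : E' → ℂ) (z : E') : Prop :=
  ∃ ψ, S ψ (g z) ∧ Ψ =ᶠ[𝓝 z] fun z => ψ (g z)

lemma isGermClass_pullClass [NormedSpace ℂ E] [NormedSpace ℂ E'] (hS : IsGermClass S) (hg : ∀ z, AnalyticAt ℂ g z) :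
    IsGermClass (PullClass S g) where
  congr f k z h := by
    rintro ⟨ψ, h1, h2⟩
    exact ⟨ψ, h1, h.symm.trans h2⟩
  analytic f z := by
    rintro ⟨ψ, h1, h2⟩
    exact (AnalyticAt.fun_comp (g := ψ) (hS.analytic _ _ h1) (hg z)).congr h2.symm

lemma exists_extendsOn_pullClass (hg : Continuous g) {z : E'}
    (h : ∃ r > 0, ExtendsOn S (Metric.ball (g z) r)) :
    ∃ r > 0, ExtendsOn (PullClass S g) (Metric.ball z r) := by
  obtain ⟨ε, hε, hext⟩ := h
  obtain ⟨r, hr, hrε⟩ := Metric.mem_nhds_iff.1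
    (hg.continuousAt.preimage_mem_nhds (Metric.ball_mem_nhds (g z) hε))
  refine ⟨r, hr, ?_⟩
  rintro y hy Φ ⟨ψ, h1, h2⟩
  obtain ⟨F, hF, hFψ⟩ := hext _ (hrε hy) ψ h1
  have h3 : (fun z => F (g z)) =ᶠ[𝓝 y] fun z => ψ (g z) := hg.continuousAt.eventually hFψ
  exact ⟨fun z => F (g z), fun z hz => ⟨F, hF _ (hrε hz), EventuallyEq.rfl⟩, h3.trans h2.symm⟩

end PullClass

/-! ### Extension across the intersections of singular hyperplanes -/

section Hartogs

open Complex

variable {n : ℕ}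

/-- The parametrization of small circles in the direction `v`. -/
def poke (v : Vec n) (z : ℂ × Vec n) : Vec n := z.2 + exp z.1 • v

lemma analyticAt_poke (v : Vec n) (z : ℂ × Vec n) : AnalyticAt ℂ (poke v) z := by
  have h2 : AnalyticAt ℂ (fun z : ℂ × Vec n => exp z.1) z := analyticAt_fst.cexp
  exact analyticAt_snd.add (h2.smul analyticAt_const)

lemma continuous_poke (v : Vec n) : Continuous (poke v) := by unfold poke; fun_prop

/-- The product of a vertical strip and a set. -/
def strip (t : ℝ) (B : Set (Vec n)) : Set (ℂ × Vec n) :=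
  {w : ℂ | t - 1 < w.re ∧ w.re < t + 1} ×ˢ B

lemma isOpen_strip {t : ℝ} {B : Set (Vec n)} (hB : IsOpen B) : IsOpen (strip t B) :=
  ((isOpen_lt continuous_const continuous_re).inter
    (isOpen_lt continuous_re continuous_const)).prod hB

lemma convex_strip {t : ℝ} {B : Set (Vec n)} (hB : Convex ℝ B) : Convex ℝ (strip t B) :=
  ((convex_halfSpace_re_gt _).inter (convex_halfSpace_re_lt _)).prod hB

lemma mem_strip_line (t θ : ℝ) {B : Set (Vec n)} {x : Vec n} (hx : x ∈ B) :
    ((t + θ * I : ℂ), x) ∈ strip t B :=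
  ⟨⟨by simp, by simp⟩, hx⟩

/-- Closed discs in the direction `v`. -/
def disc (v : Vec n) (ρ : ℝ) (x : Vec n) : Set (Vec n) :=
  (fun s : ℂ => x + s • v) '' Metric.closedBall 0 ρ

lemma isCompact_disc (v : Vec n) (ρ : ℝ) (x : Vec n) : IsCompact (disc v ρ x) :=
  (isCompact_closedBall 0 ρ).image (by fun_prop)

lemma convex_disc (v : Vec n) (ρ : ℝ) (x : Vec n) : Convex ℝ (disc v ρ x) := by
  rintro _ ⟨s, hs, rfl⟩ _ ⟨s', hs', rfl⟩ c d hc hd hcd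
  refine ⟨c • s + d • s', convex_closedBall 0 ρ hs hs' hc hd hcd, ?_⟩
  have h1 : x = (c + d) • x := by rw [hcd, one_smul]
  simp only
  conv_lhs => rw [h1]
  simp only [add_smul, smul_add, smul_assoc]
  abel

variable {P : EllipticPotential n}

/-- Near each point there are discs, transversal to the singular hyperplanes, whose boundary circles
avoid the singular locus and most of which contain no points of two singular hyperplanes. -/
lemma exists_transversal (P : EllipticPotential n) {p : Vec n} {U : Set (Vec n)} (hU : IsOpen U)
    (hp : p ∈ U) : ∃ (v : Vec n) (t δ : ℝ), 0 < δ ∧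
      (∀ z ∈ strip t (Metric.ball p δ), poke v z ∉ P.sing) ∧
      (∀ x ∈ Metric.ball p δ, disc v (Real.exp (t + 1)) x ⊆ U) ∧
      ∀ x ∈ Metric.ball p δ, ∃ᶠ x' in 𝓝 x, ∀ y ∈ disc v (Real.exp (t + 1)) x',
        y ∉ P.sing ∨ ∃ α ∈ P.A, ∃ k l : ℤ, P.IsGenericPoint α k l y := by
  classical
  have hne : ∀ α ∈ P.A, α.1 ≠ 0 := fun α hα h => P.nonisotropic α hα (by simp [h])
  obtain ⟨r₀, hr₀, hball⟩ := Metric.eventually_nhds_iff_ball.1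
    ((hU.eventually_mem hp).and (eventually_mem_hyperplane P p))
  -- A direction transversal to the hyperplanes of all elements of `A` exists because a product of
  -- non-zero linear forms is not identically zero.
  obtain ⟨v, hv⟩ : ∃ v : Vec n, ∀ α ∈ P.A, α.1 ⬝ᵥ v ≠ 0 := by
    obtain ⟨x, hx⟩ := (not_eventually.1 (not_eventually_prod_eq_zero P.A
      (h := fun α x => α.1 ⬝ᵥ (x - p)) (p := p) (fun α _ => analyticAt_dotProduct_sub _ _ _)
      fun α hα => not_eventually_dotProduct_eq_zero (hne α hα) p p)).exists
    exact ⟨x - p, Finset.prod_ne_zero_iff.1 hx⟩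
  have hv0 : 0 < 4 * (‖v‖ + 1) := by positivity
  set t : ℝ := Real.log (r₀ / (4 * (‖v‖ + 1))) - 1 with ht
  have hexp : Real.exp (t + 1) = r₀ / (4 * (‖v‖ + 1)) := by
    rw [ht, sub_add_cancel, Real.exp_log (by positivity)]
  have hsmall : Real.exp (t + 1) * ‖v‖ < r₀ / 2 := by
    rw [hexp, div_mul_eq_mul_div, div_lt_div_iff₀ hv0 two_pos]
    nlinarith [norm_nonneg v]
  -- For `x` this close to `p`, a zero of `(α₀, x + s v - p)` has `‖s‖ < e ^ (t - 1)`. Hence the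
  -- annulus `e ^ (t - 1) < ‖s‖ < e ^ (t + 1)` contains no singular points.
  obtain ⟨δ', hδ', hδ⟩ := Metric.eventually_nhds_iff_ball.1
    ((Filter.eventually_all_finset P.A).2 fun α hα =>
      (analyticAt_dotProduct_sub α.1 p p).continuousAt.norm.eventually_lt
        (continuousAt_const (y := Real.exp (t - 1) * ‖α.1 ⬝ᵥ v‖))
        (by simpa using mul_pos (Real.exp_pos (t - 1)) (norm_pos_iff.2 (hv α hα))))
  have hmem : ∀ x ∈ Metric.ball p (r₀ / 2), ∀ s : ℂ, ‖s‖ ≤ Real.exp (t + 1) →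
      x + s • v ∈ Metric.ball p r₀ := by
    intro x hx s hs
    rw [mem_ball_iff_norm] at hx ⊢
    calc ‖x + s • v - p‖ = ‖(x - p) + s • v‖ := by congr 1; abel
      _ ≤ ‖x - p‖ + ‖s‖ * ‖v‖ := (norm_add_le _ _).trans (by rw [norm_smul])
      _ < r₀ / 2 + r₀ / 2 := add_lt_add_of_lt_of_le hx
          ((mul_le_mul_of_nonneg_right hs (norm_nonneg v)).trans hsmall.le)
      _ = r₀ := add_halves r₀
  have hsub : Metric.ball p (min δ' (r₀ / 2)) ⊆ Metric.ball p (r₀ / 2) :=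
    Metric.ball_subset_ball (min_le_right _ _)
  have hdot : ∀ (a x : Vec n) (s : ℂ), a ⬝ᵥ (x + s • v - p) = a ⬝ᵥ (x - p) + s * (a ⬝ᵥ v) := by
    intro a x s
    rw [add_sub_right_comm, dotProduct_add, dotProduct_smul, smul_eq_mul]
  refine ⟨v, t, min δ' (r₀ / 2), lt_min hδ' (half_pos hr₀), ?_, ?_, ?_⟩
  · rintro ⟨w, x⟩ ⟨hw, hx⟩ ⟨α, hα, k, l, h⟩
    have hn : ‖exp w‖ = Real.exp w.re := norm_exp w
    have h1 := hmem x (hsub hx) (exp w) (by rw [hn]; exact Real.exp_le_exp.2 hw.2.le)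
    have h2 := dotProduct_sub_eq_zero h ((hball _ h1).2 α hα k l h)
    simp only [poke] at h2
    rw [hdot] at h2
    have h3 := hδ x (Metric.ball_subset_ball (min_le_left _ _) hx) α hα
    rw [eq_neg_of_add_eq_zero_left h2, norm_neg, norm_mul, hn] at h3
    have h4 := lt_of_mul_lt_mul_right h3 (norm_nonneg _)
    exact absurd (Real.exp_lt_exp.1 h4) (not_lt.2 hw.1.le)
  · rintro x hx _ ⟨s, hs, rfl⟩
    exact (hball _ (hmem x (hsub hx) s (mem_closedBall_zero_iff.1 hs))).1
  · intro x hx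
    -- For two hyperplanes through `p` the form `(β₀, v) α₀ - (α₀, v) β₀` is constant along `v` and
    -- vanishes on `y - p` for each common point `y`. It is not the zero form because the
    -- hyperplanes differ. So the discs around most centres contain no common point.
    set Q := (P.A ×ˢ P.A).filter fun q => (∃ k l : ℤ, p ∈ hyperplane P.τ q.1 k l) ∧
      (∃ k l : ℤ, p ∈ hyperplane P.τ q.2 k l) ∧ q.1 ≠ q.2 with hQ
    have h1 := not_eventually.1 (not_eventually_prod_eq_zero Q (p := x)
      (h := fun q x => ((q.2.1 ⬝ᵥ v) • q.1.1 - (q.1.1 ⬝ᵥ v) • q.2.1) ⬝ᵥ (x - p))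
      (fun q _ => analyticAt_dotProduct_sub _ _ _) fun q hq => by
        obtain ⟨hqA, ⟨k, l, h2⟩, ⟨k', l', h3⟩, h4⟩ := Finset.mem_filter.1 hq
        obtain ⟨h5, h6⟩ := Finset.mem_product.1 hqA
        refine not_eventually_dotProduct_eq_zero (fun h7 => h4 ?_) p x
        refine (P.distinct q.1 h5 q.2 h6 k l k' l' ?_).1
        have h8 : ∀ y, (q.2.1 ⬝ᵥ v) * (q.1.1 ⬝ᵥ (y - p)) = (q.1.1 ⬝ᵥ v) * (q.2.1 ⬝ᵥ (y - p)) := by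
          intro y
          have h9 : ((q.2.1 ⬝ᵥ v) • q.1.1 - (q.1.1 ⬝ᵥ v) • q.2.1) ⬝ᵥ (y - p) = 0 := by
            rw [h7, zero_dotProduct]
          rw [sub_dotProduct, smul_dotProduct, smul_dotProduct, smul_eq_mul, smul_eq_mul] at h9
          exact sub_eq_zero.1 h9
        have h10 : ∀ (γ : AffineFun n) (a b : ℤ) (y : Vec n), p ∈ hyperplane P.τ γ a b →
            (y ∈ hyperplane P.τ γ a b ↔ γ.1 ⬝ᵥ (y - p) = 0) := by
          intro γ a b y hpy
          refine ⟨fun hy => dotProduct_sub_eq_zero hy hpy, fun hy => ?_⟩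
          rw [hyperplane, Set.mem_ofPred_eq, shifted] at hpy ⊢
          rw [dotProduct_sub] at hy
          linear_combination hy + hpy
        ext y
        rw [h10 _ _ _ _ h2, h10 _ _ _ _ h3]
        constructor
        · intro hy
          refine (mul_eq_zero.1 ((h8 y).symm.trans ?_)).resolve_left (hv _ h5)
          rw [hy, mul_zero]
        · intro hy
          refine (mul_eq_zero.1 ((h8 y).trans ?_)).resolve_left (hv _ h6)
          rw [hy, mul_zero])
    refine (h1.and_eventually (Metric.isOpen_ball.mem_nhds hx)).mono ?_
    rintro x' ⟨h2, hx'⟩ _ ⟨s, hs, rfl⟩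
    refine or_iff_not_imp_left.2 fun hsing => ?_
    obtain ⟨α, hα, k, l, hαy⟩ := not_not.1 hsing
    have hyb := hmem x' (hsub hx') s (mem_closedBall_zero_iff.1 hs)
    refine ⟨α, hα, k, l, hαy, fun β hβ k' l' hβy => ?_⟩
    have hpα := (hball _ hyb).2 α hα k l hαy
    have hpβ := (hball _ hyb).2 β hβ k' l' hβy
    have e1 := dotProduct_sub_eq_zero hαy hpα
    have e2 := dotProduct_sub_eq_zero hβy hpβ
    simp only at e1 e2
    rw [hdot] at e1 e2
    have hβα : β = α := by
      by_contra hne'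
      have h3 := Finset.prod_ne_zero_iff.1 h2 (α, β) (Finset.mem_filter.2
        ⟨Finset.mem_product.2 ⟨hα, hβ⟩, ⟨k, l, hpα⟩, ⟨k', l', hpβ⟩, fun h => hne' h.symm⟩)
      refine h3 ?_
      rw [sub_dotProduct, smul_dotProduct, smul_dotProduct, smul_eq_mul, smul_eq_mul]
      linear_combination (β.1 ⬝ᵥ v) * e1 - (α.1 ⬝ᵥ v) * e2
    subst hβα
    refine P.distinct β hβ β hβ k' l' k l ?_
    rw [hyperplane, Set.mem_ofPred_eq, shifted] at hpα hpβ
    ext y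
    simp only [hyperplane, Set.mem_ofPred_eq, shifted]
    constructor <;> intro hy
    · linear_combination hy + hpα - hpβ
    · linear_combination hy + hpβ - hpα

variable {L : Fin n → DiffOp n} {lam : Fin n → ℂ} {T : Finset (AffineFun n × ℤ × ℤ)}

lemma circle_average_disc {v x : Vec n} {t : ℝ} {F : Vec n → ℂ}
    (hF : ∀ y ∈ disc v (Real.exp t) x, AnalyticAt ℂ F y) :
    (2 * Real.pi : ℂ)⁻¹ * ∫ θ in (0 : ℝ)..2 * Real.pi, F (poke v (t + θ * I, x)) = F x := by
  have hd : ∀ s ∈ Metric.closedBall (0 : ℂ) (Real.exp t),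
      DifferentiableAt ℂ (fun s : ℂ => F (x + s • v)) s := fun s hs => by
    have h1 := (hF _ ⟨s, hs, rfl⟩).differentiableAt
    exact (hasDerivAt_line h1).differentiableAt
  have h1 := circleAverage_of_differentiable_on_off_countable (f := fun s : ℂ => F (x + s • v))
    (c := 0) (R := Real.exp t) Set.countable_empty (by
      rw [abs_of_pos (Real.exp_pos t)]
      exact fun s hs => (hd s hs).continuousAt.continuousWithinAt) (by
      rw [abs_of_pos (Real.exp_pos t)]
      exact fun s hs => hd s (Metric.ball_subset_closedBall hs.1))
  rw [zero_smul, add_zero] at h1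
  rw [← h1, Real.circleAverage_def]
  have h2 : ∀ θ : ℝ, poke v ((t : ℂ) + θ * I, x) = x + circleMap 0 (Real.exp t) θ • v := by
    intro θ
    rw [poke, circleMap, zero_add, ofReal_exp, ← exp_add]
  simp only [h2]
  rw [Complex.real_smul]
  push_cast
  rfl

/-- Hartogs' argument. The average over circles in a transversal direction uses values on an annulus
only, where germs extend by convexity, and it is holomorphic in the centre. For the dense set of
centres whose disc contains only regular and generic points, the function extends to a neighbourhood
of the disc and equals its average. -/
theorem exists_extendsOn_isRegularized [NeZero n] (hP : P.QuasiInvariant)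
    (hL : P.StronglyIntegrable L) {U : Set (Vec n)} (hU : IsOpen U) (hT : Covers P T U) {p : Vec n}
    (hp : p ∈ U) : ∃ r > 0, ExtendsOn (IsRegularized P L lam T) (Metric.ball p r) := by
  obtain ⟨v, t, δ, hδ, hstrip, hdisc, hgood⟩ := exists_transversal P hU hp
  set ρ := Real.exp (t + 1) with hρ
  set S := IsRegularized P L lam T with hS
  have hSc : IsGermClass S := isGermClass_isRegularized
  have hpull : IsGermClass (PullClass S (poke v)) := isGermClass_pullClass hSc (analyticAt_poke v)
  set Good : Vec n → Prop := fun x' => ∀ y ∈ disc v ρ x',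
    y ∉ P.sing ∨ ∃ α ∈ P.A, ∃ k l : ℤ, P.IsGenericPoint α k l y with hGood
  have hext : ExtendsOn (PullClass S (poke v)) (strip t (Metric.ball p δ)) :=
    hpull.extendsOn_convex (isOpen_strip Metric.isOpen_ball) (convex_strip (convex_ball p δ))
      fun z hz => exists_extendsOn_pullClass (continuous_poke v)
        (exists_extendsOn_of_notMem_sing hL hT (hstrip z hz))
  -- Such a disc is compact and convex, so some convex neighbourhood of it consists of points near
  -- which germs extend.
  have hdiscext : ∀ x ∈ Metric.ball p δ, Good x → ∃ η > 0,
      ExtendsOn S (Metric.thickening η (disc v ρ x)) := by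
    intro x hx hg
    have hadm : IsOpen {y | ∃ r > 0, ExtendsOn S (Metric.ball y r)} := by
      refine Metric.isOpen_iff.2 ?_
      rintro y ⟨r, hr, h⟩
      refine ⟨r / 2, half_pos hr, fun z hz => ⟨r / 2, half_pos hr, h.mono ?_⟩⟩
      refine Metric.ball_subset_ball' ?_
      linarith [Metric.mem_ball.1 hz]
    obtain ⟨η, hη, hsub⟩ := (isCompact_disc v ρ x).exists_thickening_subset_open hadm
      fun y hy => by
        rcases hg y hy with h | ⟨α, hα, k, l, h⟩
        · exact exists_extendsOn_of_notMem_sing hL hT h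
        · exact exists_extendsOn_of_isGenericPoint hP hL hT hα h (hdisc x hx hy)
    exact ⟨η, hη, hSc.extendsOn_convex Metric.isOpen_thickening ((convex_disc v ρ x).thickening η) hsub⟩
  have hcirc : ∀ w : ℂ, w.re < t + 1 → ∀ x, poke v (w, x) ∈ disc v ρ x := fun w hw x =>
    ⟨exp w, by rw [mem_closedBall_zero_iff, norm_exp]; exact Real.exp_le_exp.2 hw.le, rfl⟩
  have hcent : ∀ x, x ∈ disc v ρ x := fun x => ⟨0, by simp [hρ, Real.exp_nonneg], by simp⟩
  have hstart : ∀ {x}, x ∈ Metric.ball p δ → ((t : ℂ), x) ∈ strip t (Metric.ball p δ) := fun hx =>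
    ⟨⟨by simp, by simp⟩, hx⟩
  have havg : ∀ G : ℂ × Vec n → ℂ, (∀ z ∈ strip t (Metric.ball p δ), PullClass S (poke v) G z) →
      ∀ x ∈ Metric.ball p δ, ∀ η > 0, ∀ F : Vec n → ℂ,
      (∀ z ∈ Metric.thickening η (disc v ρ x), S F z) →
      G =ᶠ[𝓝 ((t : ℂ), x)] (fun z => F (poke v z)) →
      (fun y => (2 * Real.pi : ℂ)⁻¹ * ∫ θ in (0 : ℝ)..2 * Real.pi, G (t + θ * I, y)) =ᶠ[𝓝 x] F := by
    intro G hG x hx η hη F hF hGF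
    have hsh : ∀ y ∈ Metric.ball x η, ∀ s : ℂ, ‖s‖ ≤ ρ →
        y + s • v ∈ Metric.thickening η (disc v ρ x) := by
      intro y hy s hs
      rw [Metric.mem_thickening_iff]
      exact ⟨x + s • v, ⟨s, mem_closedBall_zero_iff.2 hs, rfl⟩, by simpa using hy⟩
    have hB : Convex ℝ (Metric.ball x η ∩ Metric.ball p δ) := (convex_ball x η).inter (convex_ball p δ)
    have heq := hpull.eqOn (convex_strip (t := t) hB).isPreconnected
      (fun z hz => hG z ⟨hz.1, hz.2.2⟩)
      (fun z hz => ⟨F, hF _ (hsh z.2 hz.2.1 (exp z.1)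
        (by rw [norm_exp]; exact Real.exp_le_exp.2 hz.1.2.le)), EventuallyEq.rfl⟩)
      (y := ((t : ℂ), x)) ⟨⟨by simp, by simp⟩, Metric.mem_ball_self hη, hx⟩ hGF
    filter_upwards [Metric.ball_mem_nhds x hη, Metric.isOpen_ball.mem_nhds hx] with y hy hyp
    have h1 : ∀ θ : ℝ, G (t + θ * I, y) = F (poke v (t + θ * I, y)) := fun θ =>
      heq (mem_strip_line t θ ⟨hy, hyp⟩)
    simp only [h1]
    refine circle_average_disc fun z hz => ?_
    obtain ⟨s, hs, rfl⟩ := hz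
    refine hSc.analytic _ _ (hF _ (hsh y hy s ?_))
    exact (mem_closedBall_zero_iff.1 hs).trans (Real.exp_le_exp.2 (by linarith))
  refine ⟨δ, hδ, fun y hy F hF => ?_⟩
  obtain ⟨δ₂, hδ₂, hball⟩ := Metric.eventually_nhds_iff_ball.1
    ((Metric.isOpen_ball.eventually_mem hy).and hF.eventually)
  have hyδ := Metric.mem_ball_self (x := y) hδ₂
  obtain ⟨y', hy'g, hy'⟩ := ((hgood y hy).and_eventually (Metric.isOpen_ball.mem_nhds hyδ)).exists
  have hy'p := (hball y' hy').1
  obtain ⟨η, hη, hdext⟩ := hdiscext y' hy'p hy'g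
  obtain ⟨F₁, hF₁, hF₁F⟩ := hdext y' (Metric.self_subset_thickening hη _ (hcent y')) F (hball y' hy').2
  obtain ⟨G, hG, hGF₁⟩ := hext _ (hstart hy'p) (fun z => F₁ (poke v z))
    ⟨F₁, hF₁ _ (Metric.self_subset_thickening hη _ (hcirc _ (by simp) y')), EventuallyEq.rfl⟩
  set E : Vec n → ℂ := fun y => (2 * Real.pi : ℂ)⁻¹ *
    ∫ θ in (0 : ℝ)..2 * Real.pi, G (t + θ * I, y) with hE
  have hEa : AnalyticOnNhd ℂ E (Metric.ball p δ) := by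
    have hGa : ∀ z ∈ strip t (Metric.ball p δ), AnalyticAt ℂ G z := fun z hz =>
      hpull.analytic _ _ (hG z hz)
    have h1 := analyticOnNhd_intervalIntegral (a := 0) (b := 2 * Real.pi)
      (g := fun (θ : ℝ) y => G (t + θ * I, y)) Real.two_pi_pos.le (Metric.isOpen_ball (x := p) (ε := δ))
      (fun z hz => by
        have h2 : ContinuousAt (fun z : ℝ × Vec n => ((t + z.1 * I : ℂ), z.2)) z := by fun_prop
        exact (ContinuousAt.comp (g := G) (f := fun z : ℝ × Vec n => ((t + z.1 * I : ℂ), z.2))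
          (hGa _ (mem_strip_line t z.1 hz.2)).continuousAt h2).continuousWithinAt)
      (fun θ _ y hy => (AnalyticAt.fun_comp (g := G) (f := fun y => ((t + θ * I : ℂ), y))
        (hGa _ (mem_strip_line t θ hy)) (by fun_prop)).differentiableAt.differentiableWithinAt)
    exact fun x hx => analyticAt_const.mul (h1 x hx)
  have hEgood : ∀ x ∈ Metric.ball p δ, Good x → S E x := by
    intro x hx hg
    obtain ⟨φ, h1, h2⟩ := hG _ (hstart hx)
    obtain ⟨η', hη', hdext'⟩ := hdiscext x hx hg
    obtain ⟨F₂, hF₂, hF₂φ⟩ := hdext' _ (Metric.self_subset_thickening hη' _ (hcirc _ (by simp) x)) φ h1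
    refine hSc.congr F₂ E x (havg G hG x hx η' hη' F₂ hF₂ (h2.trans ?_)).symm
      (hF₂ x (Metric.self_subset_thickening hη' _ (hcent x)))
    filter_upwards [(continuous_poke v).continuousAt.eventually hF₂φ] with z hz using hz.symm
  refine ⟨E, fun z hz => isRegularized_of_frequently hT (hEa z hz) ?_, ?_⟩
  · filter_upwards [Metric.isOpen_ball.mem_nhds hz] with w hw
    refine ((hgood w hw).and_eventually (Metric.isOpen_ball.mem_nhds hw)).mono ?_
    exact fun x hx => hEgood x hx.2 hx.1
  · have h1 : E =ᶠ[𝓝 y'] F := (havg G hG y' hy'p η hη F₁ hF₁ hGF₁).trans hF₁F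
    have h2 := AnalyticOnNhd.eqOn_of_preconnected_of_eventuallyEq
      (fun z hz => hEa z (hball z hz).1) (fun z hz => hSc.analytic _ _ (hball z hz).2)
      (convex_ball y δ₂).isPreconnected hy' h1
    filter_upwards [Metric.isOpen_ball.mem_nhds hyδ] with z hz using h2 hz

end Hartogs

/-! ### Global meromorphic extension of solutions -/

section Global

variable {n : ℕ} {P : EllipticPotential n} {L : Fin n → DiffOp n} {lam : Fin n → ℂ}

lemma eq_of_mem_hyperplane {α : AffineFun n} (hα : α ∈ P.A) {p q p' q' : ℤ} {x : Vec n}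
    (h : x ∈ hyperplane P.τ α p q) (h' : x ∈ hyperplane P.τ α p' q') : p = p' ∧ q = q' := by
  refine (P.distinct α hα α hα p q p' q' (Set.ext fun y => ?_)).2
  simp only [hyperplane, Set.mem_ofPred_eq, shifted] at *
  constructor <;> intro hy
  · linear_combination hy - h + h'
  · linear_combination hy + h - h'

/-- Near a point only hyperplanes through this point occur, at most one for each element of `A`.
Compactness does the rest. -/
lemma exists_covers (P : EllipticPotential n) {K : Set (Vec n)} (hK : IsCompact K) :
    ∃ T, Covers P T K := by
  have hfin : {t : AffineFun n × ℤ × ℤ | t.1 ∈ P.A ∧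
      ∃ x ∈ K, x ∈ hyperplane P.τ t.1 t.2.1 t.2.2}.Finite := by
    refine hK.induction_on (p := fun s => {t : AffineFun n × ℤ × ℤ | t.1 ∈ P.A ∧
      ∃ x ∈ s, x ∈ hyperplane P.τ t.1 t.2.1 t.2.2}.Finite) (by simp) ?_ ?_ ?_
    · exact fun s t hst ht => ht.subset fun u ⟨h1, x, hx, h2⟩ => ⟨h1, x, hst hx, h2⟩
    · refine fun s t hs ht => (hs.union ht).subset ?_
      rintro u ⟨h1, x, hx | hx, h2⟩
      · exact .inl ⟨h1, x, hx, h2⟩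
      · exact .inr ⟨h1, x, hx, h2⟩
    · intro x _
      refine ⟨_, mem_nhdsWithin_of_mem_nhds (eventually_mem_hyperplane P x), ?_⟩
      refine Set.Finite.of_injOn (f := Prod.fst) (t := P.A) (fun t ht => ht.1) ?_ P.A.finite_toSet
      rintro ⟨α, p, q⟩ ⟨hα, y, hy, h⟩ ⟨β, p', q'⟩ ⟨hβ, y', hy', h'⟩ (rfl : α = β)
      obtain ⟨rfl, rfl⟩ := eq_of_mem_hyperplane hα (hy α hα p q h) (hy' α hα p' q' h')
      rfl
  refine ⟨hfin.toFinset, fun t ht => ((hfin.mem_toFinset).1 ht).1, fun α hα p q x hx h => ?_⟩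
  exact hfin.mem_toFinset.2 ⟨hα, x, hx, h⟩

lemma Covers.mono {T : Finset (AffineFun n × ℤ × ℤ)} {U V : Set (Vec n)} (h : Covers P T V)
    (hUV : U ⊆ V) : Covers P T U :=
  ⟨h.1, fun α hα p q x hx => h.2 α hα p q x (hUV hx)⟩

/-- The complex line through the two points lies in no singular hyperplane, so it meets each in at
most one point. The complement of a countable set in the complex plane is path connected. -/
lemma joinedIn_compl_sing {x y : Vec n} (hx : x ∉ P.sing) (hy : y ∉ P.sing) :
    JoinedIn P.singᶜ x y := by
  set c : ℂ → Vec n := fun t => x + t • (y - x) with hc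
  have hcc : Continuous c := by fun_prop
  have hcount : (c ⁻¹' P.sing).Countable := by
    have h1 : c ⁻¹' P.sing ⊆ ⋃ α ∈ P.A, ⋃ p : ℤ, ⋃ q : ℤ, c ⁻¹' hyperplane P.τ α p q := by
      rintro t ⟨α, hα, p, q, h⟩
      simp only [Set.mem_iUnion]
      exact ⟨α, hα, p, q, h⟩
    refine (Set.Countable.biUnion P.A.countable_toSet fun α hα =>
      Set.countable_iUnion fun p => Set.countable_iUnion fun q => ?_).mono h1
    refine Set.Subsingleton.countable ?_
    intro s hs t ht
    simp only [hc, hyperplane, Set.mem_preimage, Set.mem_ofPred_eq, shifted, dotProduct_add,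
      dotProduct_smul, smul_eq_mul] at hs ht
    have h2 : (s - t) * (α.1 ⬝ᵥ (y - x)) = 0 := by linear_combination hs - ht
    rcases mul_eq_zero.1 h2 with h | h
    · exact sub_eq_zero.1 h
    · rw [h, mul_zero, add_zero] at hs
      exact absurd ⟨α, hα, p, q, hs⟩ hx
  have hpc := hcount.isPathConnected_compl_of_one_lt_rank
    (by rw [Complex.rank_real_complex]; exact Nat.one_lt_ofNat)
  obtain ⟨γ, hγ⟩ := hpc.joinedIn 0 (by simpa [hc] using hx) 1 (by simpa [hc] using hy)
  exact ⟨(γ.map hcc).cast (by simp [hc]) (by simp [hc]), fun t => by simpa using hγ t⟩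

lemma isPreconnected_compl_sing (P : EllipticPotential n) : IsPreconnected P.singᶜ := by
  refine isPreconnected_of_forall_pair fun x hx y hy => ?_
  obtain ⟨γ, hγ⟩ := joinedIn_compl_sing hx hy
  exact ⟨Set.range γ, Set.range_subset_iff.2 hγ, ⟨0, by simp⟩, ⟨1, by simp⟩,
    isPreconnected_range γ.continuous⟩

/-- In a ball finitely many hyperplanes matter, and the germ multiplied by the product of their
equations extends over the whole ball by convexity. Off `Sing` the quotients obtained from different
balls agree, so the value at `x` may be read off in the ball with number `⌈‖x‖⌉₊`. -/
theorem exists_global [NeZero n] (hP : P.QuasiInvariant) (hL : P.StronglyIntegrable L) {x₀ : Vec n}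
    (hx₀ : x₀ ∉ P.sing) {ψ : Vec n → ℂ} (hψ : IsSol L lam ψ x₀) :
    ∃ f : Vec n → ℂ, IsMeromorphic f ∧ (∀ x ∉ P.sing, IsSol L lam f x) ∧ f =ᶠ[𝓝 x₀] ψ := by
  have hsing := (isClosed_sing P).isOpen_compl.mem_nhds hx₀
  have hT : ∀ k : ℕ, ∃ T, Covers P T (Metric.ball 0 (‖x₀‖ + 1 + k)) := fun k =>
    (exists_covers P (isCompact_closedBall 0 _)).imp fun T h => h.mono Metric.ball_subset_closedBall
  choose T hT using hT
  have hx₀b : ∀ k : ℕ, x₀ ∈ Metric.ball (0 : Vec n) (‖x₀‖ + 1 + k) := fun k => by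
    rw [mem_ball_zero_iff]
    linarith [k.cast_nonneg (α := ℝ)]
  have hF : ∀ k : ℕ, ∃ F : Vec n → ℂ,
      (∀ z ∈ Metric.ball 0 (‖x₀‖ + 1 + k), IsRegularized P L lam (T k) F z) ∧
      F =ᶠ[𝓝 x₀] fun x => prodShift P (T k) x * ψ x := by
    intro k
    refine isGermClass_isRegularized.extendsOn_convex Metric.isOpen_ball (convex_ball _ _)
      (fun p hp => exists_extendsOn_isRegularized hP hL Metric.isOpen_ball (hT k) hp) x₀
      (hx₀b k) _ ?_
    refine isRegularized_of_isSol (f := ψ) ((analyticAt_prodShift P _ _).fun_mul hψ.1) ?_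
    filter_upwards [hψ.eventually] with y h1 h2
    exact ⟨mul_div_cancel_left₀ _ ((hT k).prodShift_ne_zero h2), h1⟩
  choose F hF hFψ using hF
  have hb : ∀ {k k' : ℕ}, k ≤ k' →
      Metric.ball (0 : Vec n) (‖x₀‖ + 1 + k) ⊆ Metric.ball 0 (‖x₀‖ + 1 + k') := fun h =>
    Metric.ball_subset_ball (by gcongr)
  have hcompat : ∀ k k' : ℕ, k ≤ k' → ∀ x ∈ Metric.ball (0 : Vec n) (‖x₀‖ + 1 + k), x ∉ P.sing →
      F k x / prodShift P (T k) x = F k' x / prodShift P (T k') x := by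
    intro k k' hk x hx hxs
    rw [div_eq_div_iff ((hT k).prodShift_ne_zero hxs) ((hT k').prodShift_ne_zero hxs)]
    refine AnalyticOnNhd.eqOn_of_preconnected_of_eventuallyEq (𝕜 := ℂ) (z₀ := x₀)
      (f := fun x => F k x * prodShift P (T k') x) (g := fun x => F k' x * prodShift P (T k) x)
      (fun z hz => (hF k z hz).1.fun_mul (analyticAt_prodShift P _ _))
      (fun z hz => (hF k' z (hb hk hz)).1.fun_mul (analyticAt_prodShift P _ _))
      (convex_ball _ _).isPreconnected (hx₀b k) ?_ hx
    filter_upwards [hFψ k, hFψ k'] with y h1 h2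
    rw [h1, h2]
    ring
  set f : Vec n → ℂ := fun x => F ⌈‖x‖⌉₊ x / prodShift P (T ⌈‖x‖⌉₊) x with hf
  have hmem : ∀ x : Vec n, x ∈ Metric.ball (0 : Vec n) (‖x₀‖ + 1 + (⌈‖x‖⌉₊ : ℕ)) := fun x => by
    rw [mem_ball_zero_iff]
    linarith [Nat.le_ceil ‖x‖, norm_nonneg x₀]
  have hval : ∀ k : ℕ, ∀ x ∈ Metric.ball (0 : Vec n) (‖x₀‖ + 1 + k), x ∉ P.sing →
      f x = F k x / prodShift P (T k) x := by
    intro k x hx hxs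
    rcases le_total k ⌈‖x‖⌉₊ with h | h
    · exact (hcompat _ _ h x hx hxs).symm
    · exact hcompat _ _ h x (hmem x) hxs
  refine ⟨f, fun p => ⟨F ⌈‖p‖⌉₊, prodShift P (T ⌈‖p‖⌉₊), (hF _ p (hmem p)).1,
    analyticAt_prodShift P _ _, fun h => ?_, ?_⟩, fun x hx => ?_, ?_⟩
  · obtain ⟨y, hy, hy'⟩ := ((frequently_notMem_sing P p).and_eventually h).exists
    exact (hT _).prodShift_ne_zero hy hy'
  · filter_upwards [Metric.isOpen_ball.mem_nhds (hmem p)] with x hx h0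
    exact hval _ x hx ((hT _).notMem_sing hx h0)
  · refine (isGermClass_isSol L lam).congr _ f x ?_ ((hF _ x (hmem x)).2.self_of_nhds hx)
    filter_upwards [Metric.isOpen_ball.mem_nhds (hmem x),
      (isClosed_sing P).isOpen_compl.mem_nhds hx] with y hy hys
    exact (hval _ y hy hys).symm
  · filter_upwards [hFψ ⌈‖x₀‖⌉₊, hsing, Metric.isOpen_ball.mem_nhds (hmem x₀)] with y h1 h2 h3
    rw [hval _ y h3 h2, h1]
    exact mul_div_cancel_left₀ _ ((hT _).prodShift_ne_zero h2)

lemma eqOn_compl_sing {f g : Vec n → ℂ} (hf : ∀ x ∉ P.sing, IsSol L lam f x)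
    (hg : ∀ x ∉ P.sing, IsSol L lam g x) {x₀ : Vec n} (hx₀ : x₀ ∉ P.sing) (h : f =ᶠ[𝓝 x₀] g) :
    Set.EqOn f g P.singᶜ :=
  (isGermClass_isSol L lam).eqOn (isPreconnected_compl_sing P) hf hg hx₀ h

end Global

/-! ### Periods, functions on the torus and analytic continuation -/

section Periods

variable {n : ℕ} (P : EllipticPotential n) {L : Fin n → DiffOp n} {lam : Fin n → ℂ}

lemma exists_dotProduct_period {l : Vec n} (hl : l ∈ P.periods) {α : AffineFun n} (hα : α ∈ P.A) :
    ∃ p q : ℤ, α.1 ⬝ᵥ l = p + q * P.τ := by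
  obtain ⟨a, ha, b, hb, rfl⟩ := AddSubgroup.mem_sup.1 hl
  obtain ⟨c, hc, rfl⟩ := hb
  obtain ⟨p, hp⟩ := ha α hα
  obtain ⟨q, hq⟩ := hc α hα
  refine ⟨p, q, ?_⟩
  simp [dotProduct_add, hp, hq, mul_comm]

/-- For a period `l` each `(α₀, l)` lies in the discrete group `ℤ + ℤ τ`, so it is zero when `l` is
small. Since the gradients span, such an `l` is zero. -/
lemma isDiscrete_periods : IsDiscrete (P.periods : Set (Vec n)) := by
  set Λ := periodPair P.τ P.im_pos with hΛ
  have hev : ∀ᶠ x : Vec n in 𝓝 0, ∀ α ∈ P.A, α.1 ⬝ᵥ x ∉ (Λ.lattice : Set ℂ) \ {0} := by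
    refine (Filter.eventually_all_finset _).2 fun α _ => ?_
    refine (analyticAt_dot α.1 0).continuousAt.eventually
      ((Λ.isClosed_of_subset_lattice Set.sdiff_subset).isOpen_compl.mem_nhds (by simp))
  have h0 : ∀ᶠ x : Vec n in 𝓝 0, x ∈ P.periods → x = 0 := by
    filter_upwards [hev] with x hx hxp
    have h1 : ∀ α ∈ P.A, α.1 ⬝ᵥ x = 0 := by
      intro α hα
      by_contra h
      refine hx α hα ⟨?_, h⟩
      obtain ⟨p, q, hpq⟩ := exists_dotProduct_period P hxp hα
      rw [hpq]
      exact Λ.mem_lattice.2 ⟨p, q, by simp [hΛ, periodPair]⟩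
    have h2 : ∀ v : Vec n, v ⬝ᵥ x = 0 := by
      intro v
      have hv : v ∈ Submodule.span ℂ (Prod.fst '' (P.A : Set (AffineFun n))) := by
        rw [P.span_eq_top]; trivial
      induction hv using Submodule.span_induction with
      | mem v hv =>
        obtain ⟨α, hα, rfl⟩ := hv
        exact h1 α hα
      | zero => simp
      | add v w _ _ hv hw => rw [add_dotProduct, hv, hw, add_zero]
      | smul c v _ hv => rw [smul_dotProduct, hv, smul_zero]
    exact funext fun i => by simpa using h2 (Pi.single i 1)
  refine ⟨discreteTopology_of_isOpen_singleton_zero ?_⟩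
  rw [isOpen_iff_mem_nhds]
  rintro _ rfl
  rw [nhds_subtype, mem_comap]
  exact ⟨_, h0, fun x hx => Subtype.ext (hx x.2)⟩

lemma isAddQuotientCoveringMap_proj : IsAddQuotientCoveringMap P.proj P.periods :=
  P.periods.isAddQuotientCoveringMap_of_comm (isDiscrete_periods P)

lemma isLocalHomeomorph_proj : IsLocalHomeomorph P.proj :=
  (isAddQuotientCoveringMap_proj P).isCoveringMap.isLocalHomeomorph

variable {P}

lemma add_period_notMem_sing {l x : Vec n} (hl : l ∈ P.periods) (hx : x ∉ P.sing) :
    x + l ∉ P.sing := by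
  rintro ⟨α, hα, p, q, h⟩
  obtain ⟨p', q', h'⟩ := exists_dotProduct_period P hl hα
  refine hx ⟨α, hα, p - p', q - q', ?_⟩
  simp only [hyperplane, Set.mem_ofPred_eq, shifted, dotProduct_add, h'] at h ⊢
  push_cast
  linear_combination h

lemma notMem_sing_of_proj_notMem {x : Vec n} (h : P.proj x ∉ P.proj '' P.sing) : x ∉ P.sing :=
  fun hx => h ⟨x, hx, rfl⟩

lemma proj_notMem_image_sing {x : Vec n} (hx : x ∉ P.sing) : P.proj x ∉ P.proj '' P.sing := by
  rintro ⟨y, hy, hyx⟩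
  have h1 := add_period_notMem_sing (QuotientAddGroup.eq.1 hyx.symm) hx
  rw [add_neg_cancel_left] at h1
  exact h1 hy

lemma proj_add_period {l : Vec n} (hl : l ∈ P.periods) (x : Vec n) : P.proj (x + l) = P.proj x :=
  QuotientAddGroup.eq.2 (by simpa using hl)

lemma mixedPd_comp_add_right (k : Fin n →₀ ℕ) (f : Vec n → ℂ) (l : Vec n) :
    mixedPd k (fun y => f (y + l)) = fun y => mixedPd k f (y + l) := by
  simp only [mixedPd_eq_pdList]
  induction multiList k with
  | nil => rfl
  | cons i m ih =>
    funext y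
    change pd i (pdList m fun y => f (y + l)) y = pd i (pdList m f) (y + l)
    rw [ih, pd, fderiv_comp_add_right, pd]

lemma IsSol.comp_add_right [NeZero n] (hL : P.StronglyIntegrable L) {l x : Vec n}
    (hl : l ∈ P.periods) {f : Vec n → ℂ} (h : IsSol L lam f (x + l)) :
    IsSol L lam (fun y => f (y + l)) x := by
  have hc : Tendsto (fun y => y + l) (𝓝 x) (𝓝 (x + l)) :=
    (continuous_add_const l).tendsto x
  refine ⟨AnalyticAt.fun_comp (g := f) (f := fun y => y + l) h.1 (analyticAt_id.add analyticAt_const), ?_⟩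
  filter_upwards [hc.eventually h.2] with y hy i hi
  have hreg : (L i).RegularAt (y + l) := by
    intro k
    have h1 : AnalyticAt ℂ (fun z => L i k (z + -l)) (y + l) :=
      AnalyticAt.fun_comp (g := L i k) (f := fun z => z + -l) (by simpa using hi k)
        (analyticAt_id.add analyticAt_const)
    exact h1.congr (.of_forall fun z => hL.periodic i k _ (P.periods.neg_mem hl) z)
  rw [← hy i hreg]
  simp only [DiffOp.apply, Finsupp.sum, mixedPd_comp_add_right, hL.periodic i _ l hl]

/-- The coefficients are periodic, so checking a single lift suffices. -/
lemma isSolAt_proj_iff [NeZero n] (hL : P.StronglyIntegrable L) {f : P.Torus → ℂ} {x : Vec n} :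
    P.IsSolAt L lam f (P.proj x) ↔ IsSol L lam (fun y => f (P.proj y)) x := by
  refine ⟨fun h => h x rfl, fun h y hy => ?_⟩
  have hl : -y + x ∈ P.periods := QuotientAddGroup.eq.1 hy
  rw [← add_neg_cancel_left y x] at h
  have h1 := h.comp_add_right hL hl
  simpa only [proj_add_period hl] using h1

lemma eventuallyEq_proj {f g : P.Torus → ℂ} {x : Vec n} :
    f =ᶠ[𝓝 (P.proj x)] g ↔ (fun y => f (P.proj y)) =ᶠ[𝓝 x] fun y => g (P.proj y) := by
  rw [← (isLocalHomeomorph_proj P).map_nhds_eq x]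
  rfl

/-- The function near `P.proj x` on the torus whose pull-back is `f` near `x`. -/
def descend (P : EllipticPotential n) (x : Vec n) (f : Vec n → ℂ) : P.Torus → ℂ :=
  fun t => f (((isLocalHomeomorph_proj P) x).choose.symm t)

lemma descend_proj (x : Vec n) (f : Vec n → ℂ) :
    (fun y => descend P x f (P.proj y)) =ᶠ[𝓝 x] f := by
  obtain ⟨h1, h2⟩ := ((isLocalHomeomorph_proj P) x).choose_spec
  filter_upwards [((isLocalHomeomorph_proj P) x).choose.open_source.mem_nhds h1] with y hy
  exact congrArg f ((congrArg _ (congrFun h2 y)).trans (OpenPartialHomeomorph.left_inv _ hy))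

lemma isSolAt_descend [NeZero n] (hL : P.StronglyIntegrable L) {x : Vec n} {f : Vec n → ℂ}
    (h : IsSol L lam f x) : P.IsSolAt L lam (descend P x f) (P.proj x) :=
  (isSolAt_proj_iff hL).2 ((isGermClass_isSol L lam).congr _ _ _ (descend_proj x f).symm h)

/-- A solution on all of `V ∖ Sing` provides continuation along every path: at the parameter `r` its
germ at the lifted point `δ r` is taken. -/
lemma continuesAlong_of_lift [NeZero n] (hL : P.StronglyIntegrable L) {f : Vec n → ℂ}
    (hf : ∀ x ∉ P.sing, IsSol L lam f x) {a b : P.RegTorus} (γ : Path a b) {δ : unitInterval → Vec n}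
    (hδ : Continuous δ) (hδγ : ∀ r, P.proj (δ r) = γ r) {F₀ F₁ : P.Torus → ℂ}
    (h₀ : (fun y => F₀ (P.proj y)) =ᶠ[𝓝 (δ 0)] f) (h₁ : (fun y => F₁ (P.proj y)) =ᶠ[𝓝 (δ 1)] f) :
    P.ContinuesAlong L lam γ F₀ F₁ := by
  have hsing : ∀ r, δ r ∉ P.sing := fun r =>
    notMem_sing_of_proj_notMem (by rw [hδγ]; exact (γ r).2)
  refine ⟨fun r => descend P (δ r) f, fun r => ?_, fun r => ?_, Germ.coe_eq.2 ?_, Germ.coe_eq.2 ?_⟩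
  · rw [← hδγ]
    exact isSolAt_descend hL (hf _ (hsing r))
  · have h1 : ∀ᶠ y in 𝓝 (δ r), (fun z => descend P (δ r) f (P.proj z)) =ᶠ[𝓝 y] f :=
      (descend_proj (δ r) f).eventually_nhds
    filter_upwards [hδ.continuousAt.eventually h1] with s hs
    rw [← hδγ, eventuallyEq_proj]
    exact (descend_proj (δ s) f).trans hs.symm
  · have h2 : (a : P.Torus) = P.proj (δ 0) := by rw [hδγ, γ.source]
    rw [h2, eventuallyEq_proj]
    exact (descend_proj _ f).trans h₀.symm
  · have h2 : (b : P.Torus) = P.proj (δ 1) := by rw [hδγ, γ.target]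
    rw [h2, eventuallyEq_proj]
    exact (descend_proj _ f).trans h₁.symm

lemma eventually_eventuallyEq_iff {F G : P.Torus → ℂ} {t : P.Torus} (hF : P.IsSolAt L lam F t)
    (hG : P.IsSolAt L lam G t) : ∀ᶠ s in 𝓝 t, (F =ᶠ[𝓝 s] G ↔ F =ᶠ[𝓝 t] G) := by
  obtain ⟨x, rfl⟩ := QuotientAddGroup.mk_surjective t
  change ∀ᶠ s in 𝓝 (P.proj x), (F =ᶠ[𝓝 s] G ↔ F =ᶠ[𝓝 (P.proj x)] G)
  rw [← (isLocalHomeomorph_proj P).map_nhds_eq x, eventually_map,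
    (isLocalHomeomorph_proj P).map_nhds_eq x]
  obtain ⟨r, hr, hb⟩ := Metric.eventually_nhds_iff_ball.1
    ((hF x rfl).1.eventually_analyticAt.and (hG x rfl).1.eventually_analyticAt)
  have key : ∀ {y z}, y ∈ Metric.ball x r → z ∈ Metric.ball x r → F =ᶠ[𝓝 (P.proj y)] G →
      F =ᶠ[𝓝 (P.proj z)] G := by
    intro y z hy hz h
    have h1 := AnalyticOnNhd.eqOn_of_preconnected_of_eventuallyEq (fun w hw => (hb w hw).1)
      (fun w hw => (hb w hw).2) (convex_ball x r).isPreconnected hy (eventuallyEq_proj.1 h)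
    rw [eventuallyEq_proj]
    filter_upwards [Metric.isOpen_ball.mem_nhds hz] with w hw using h1 hw
  filter_upwards [Metric.ball_mem_nhds x hr] with y hy
  exact ⟨key hy (Metric.mem_ball_self hr), key (Metric.mem_ball_self hr) hy⟩

/-- Equality of the two continued germs is a locally constant property of the parameter, and the
unit interval is connected. -/
lemma EllipticPotential.ContinuesAlong.unique {a b : P.RegTorus} {γ : Path a b} {φ : Germ (𝓝 (a : P.Torus)) ℂ}
    {χ χ' : Germ (𝓝 (b : P.Torus)) ℂ} (h : P.ContinuesAlong L lam γ φ χ)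
    (h' : P.ContinuesAlong L lam γ φ χ') : χ = χ' := by
  obtain ⟨F, h1, h2, h3, h4⟩ := h
  obtain ⟨G, g1, g2, g3, g4⟩ := h'
  have hlc : IsLocallyConstant fun r => F r =ᶠ[𝓝 (γ r : P.Torus)] G r := by
    rw [IsLocallyConstant.iff_eventually_eq]
    intro r
    have hc : Tendsto (fun s => (γ s : P.Torus)) (𝓝 r) (𝓝 (γ r : P.Torus)) :=
      (continuous_subtype_val.comp γ.continuous).tendsto r
    filter_upwards [h2 r, g2 r, hc.eventually (eventually_eventuallyEq_iff (h1 r) (g1 r))]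
      with s hs1 hs2 hs3
    refine propext ⟨fun h => hs3.1 ((hs1.symm.trans h).trans hs2), fun h => ?_⟩
    exact (hs1.trans (hs3.2 h)).trans hs2.symm
  have h5 : F 0 =ᶠ[𝓝 (γ 0 : P.Torus)] G 0 := by
    rw [γ.source]
    exact Germ.coe_eq.1 (h3.trans g3.symm)
  have h6 : F 1 =ᶠ[𝓝 (γ 1 : P.Torus)] G 1 := by
    have h7 := hlc.apply_eq_of_isPreconnected (s := Set.univ) isPreconnected_univ
      (Set.mem_univ 0) (Set.mem_univ 1)
    exact h7.mp h5
  rw [γ.target] at h6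
  rw [← h4, ← g4]
  exact Germ.coe_eq.2 h6

end Periods

/-! ### The monodromy representation -/

section MonodromyRepresentation

variable {n : ℕ} {P : EllipticPotential n} {L : Fin n → DiffOp n} {lam : Fin n → ℂ}

/-- Numerator and denominator are multiplied by a function which vanishes at the nearby points of
`Sing`, so that the values there become irrelevant. -/
lemma IsMeromorphic.congr_of_notMem_sing {f g : Vec n → ℂ} (hf : IsMeromorphic f)
    (hfg : ∀ x ∉ P.sing, g x = f x) : IsMeromorphic g := by
  intro p
  obtain ⟨T, hT⟩ := exists_covers P (isCompact_closedBall p 1)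
  obtain ⟨a, h, ha, hh, h0, hah⟩ := hf p
  have hΦ := analyticAt_prodShift P T p
  refine ⟨fun x => a x * prodShift P T x, fun x => h x * prodShift P T x, ha.fun_mul hΦ,
    hh.fun_mul hΦ, fun hz => h0 ?_, ?_⟩
  · by_contra hne
    obtain ⟨y, ⟨hy, hyz⟩, hys⟩ := (((frequently_of_not_eventually_zero hh hne).and
      hz.eventually_nhds).and_frequently (frequently_notMem_sing P p)).exists
    obtain ⟨w, hw, hwz, hws⟩ := (hy.and_eventually
      (hyz.and ((isClosed_sing P).isOpen_compl.mem_nhds hys))).exists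
    exact (mul_ne_zero hw (hT.prodShift_ne_zero hws)) hwz
  · filter_upwards [hah, Metric.closedBall_mem_nhds p one_pos] with x hx hxb hne
    rw [hfg x (hT.notMem_sing hxb (right_ne_zero_of_mul hne)), hx (left_ne_zero_of_mul hne),
      mul_div_mul_right _ _ (right_ne_zero_of_mul hne)]

/-- The period by which a loop in the torus moves the base point. -/
def deck (P : EllipticPotential n) (x : Vec n) :
    FundamentalGroup P.Torus (P.proj x) →* Multiplicative P.periods :=
  MonoidHom.comp (MulOpposite.opMulEquiv (M := Multiplicative P.periods)).symm.toMonoidHom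
    ((isAddQuotientCoveringMap_proj P).fundamentalGroupToMulOpposite (x := P.proj x) ⟨x, rfl⟩)

lemma deck_eq_of_lift {x : Vec n} (γ : Path (P.proj x) (P.proj x)) {δ : unitInterval → Vec n}
    (hδ : Continuous δ) (hδγ : ∀ r, P.proj (δ r) = γ r) (h0 : δ 0 = x) :
    δ 1 = x + (deck P x (FundamentalGroup.fromPath (Path.Homotopic.Quotient.mk γ))).toAdd := by
  have hcov := (isAddQuotientCoveringMap_proj P).isCoveringMap
  have h1 := (isAddQuotientCoveringMap_proj P).unop_fundamentalGroupToMulOpposite_smul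
    (x := P.proj x) (e := ⟨x, rfl⟩)
    (γ := FundamentalGroup.fromPath (Path.Homotopic.Quotient.mk γ))
  have h2 : δ = hcov.liftPath γ x γ.source :=
    (hcov.eq_liftPath_iff (γ := γ.toContinuousMap) γ.source).2 ⟨hδ, funext hδγ, h0⟩
  have h3 : δ 1 = (hcov.monodromy (Path.Homotopic.Quotient.mk γ) ⟨x, rfl⟩ : Vec n) := by
    rw [h2]
    rfl
  rw [h3, add_comm]
  exact h1.symm

variable [NeZero n]

/-- The solutions on the complement of the singular locus, extended by zero. -/
def globalSolutions (P : EllipticPotential n) (L : Fin n → DiffOp n) (lam : Fin n → ℂ) :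
    Submodule ℂ (Vec n → ℂ) where
  carrier := {f | (∀ x ∉ P.sing, IsSol L lam f x) ∧ ∀ x ∈ P.sing, f x = 0}
  zero_mem' := ⟨fun x _ => IsSol.zero L lam x, fun _ _ => rfl⟩
  add_mem' := fun hf hg => ⟨fun x hx => (hf.1 x hx).add (hg.1 x hx), fun x hx => by
    simp [hf.2 x hx, hg.2 x hx]⟩
  smul_mem' := fun c f hf => ⟨fun x hx => (hf.1 x hx).smul c, fun x hx => by simp [hf.2 x hx]⟩

lemma exists_mem_globalSolutions (hP : P.QuasiInvariant) (hL : P.StronglyIntegrable L) {x₀ : Vec n}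
    (hx₀ : x₀ ∉ P.sing) {ψ : Vec n → ℂ} (hψ : IsSol L lam ψ x₀) :
    ∃ f ∈ globalSolutions P L lam, IsMeromorphic f ∧ f =ᶠ[𝓝 x₀] ψ := by
  classical
  obtain ⟨f, hm, hf, hfψ⟩ := exists_global hP hL hx₀ hψ
  have h1 : ∀ x ∉ P.sing, P.sing.piecewise 0 f =ᶠ[𝓝 x] f := fun x hx => by
    filter_upwards [(isClosed_sing P).isOpen_compl.mem_nhds hx] with y hy
    exact Set.piecewise_eq_of_notMem _ _ _ hy
  exact ⟨P.sing.piecewise 0 f, ⟨fun x hx => (isGermClass_isSol L lam).congr _ _ _ (h1 x hx).symm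
    (hf x hx), fun x hx => Set.piecewise_eq_of_mem _ _ _ hx⟩,
    hm.congr_of_notMem_sing fun x hx => (h1 x hx).self_of_nhds, (h1 x₀ hx₀).trans hfψ⟩

/-- The germ at `P.proj x` of a global solution. -/
def germMap (hL : P.StronglyIntegrable L) {x : Vec n} (hx : x ∉ P.sing) :
    globalSolutions P L lam →ₗ[ℂ] P.solutionSpace L lam (P.proj x) where
  toFun f := ⟨(descend P x f : P.Torus → ℂ), descend P x f, isSolAt_descend hL (f.2.1 x hx), rfl⟩
  map_add' _ _ := rfl
  map_smul' _ _ := rfl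

lemma germMap_bijective (hP : P.QuasiInvariant) (hL : P.StronglyIntegrable L) {x : Vec n}
    (hx : x ∉ P.sing) : Function.Bijective (germMap (lam := lam) hL hx) := by
  constructor
  · intro f g hfg
    have h1 : descend P x f =ᶠ[𝓝 (P.proj x)] descend P x g := Germ.coe_eq.1 (congrArg Subtype.val hfg)
    rw [eventuallyEq_proj] at h1
    have h2 := eqOn_compl_sing f.2.1 g.2.1 hx
      (((descend_proj x f).symm.trans h1).trans (descend_proj x g))
    refine Subtype.ext (funext fun y => ?_)
    by_cases hy : y ∈ P.sing
    · rw [f.2.2 y hy, g.2.2 y hy]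
    · exact h2 hy
  · rintro ⟨_, F, hF, rfl⟩
    obtain ⟨f, hf, -, hfF⟩ := exists_mem_globalSolutions hP hL hx (hF x rfl)
    refine ⟨⟨f, hf⟩, Subtype.ext (Germ.coe_eq.2 ?_)⟩
    rw [eventuallyEq_proj]
    exact (descend_proj x f).trans hfF

/-- Global solutions are determined by their germs on the torus, and every germ extends. -/
def germEquiv (hP : P.QuasiInvariant) (hL : P.StronglyIntegrable L) {x : Vec n} (hx : x ∉ P.sing) :
    globalSolutions P L lam ≃ₗ[ℂ] P.solutionSpace L lam (P.proj x) :=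
  LinearEquiv.ofBijective (germMap hL hx) (germMap_bijective hP hL hx)

/-- The translation of global solutions by a period. -/
def translate (lam : Fin n → ℂ) (hL : P.StronglyIntegrable L) (l : P.periods) :
    globalSolutions P L lam →ₗ[ℂ] globalSolutions P L lam where
  toFun f := ⟨fun x => f.1 (x + l), fun x hx =>
      (f.2.1 _ (add_period_notMem_sing l.2 hx)).comp_add_right hL l.2, fun x hx => f.2.2 _ (by
        by_contra h
        have h1 := add_period_notMem_sing (P.periods.neg_mem l.2) h
        rw [add_neg_cancel_right] at h1
        exact h1 hx)⟩
  map_add' _ _ := rfl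
  map_smul' _ _ := rfl

lemma translate_add (hL : P.StronglyIntegrable L) (l l' : P.periods) (f : globalSolutions P L lam) :
    translate lam hL (l + l') f = translate lam hL l (translate lam hL l' f) :=
  Subtype.ext (funext fun x => congrArg f.1 (by
    change x + (l + l' : Vec n) = x + l + l'
    rw [add_assoc]))

lemma translate_zero (hL : P.StronglyIntegrable L) (f : globalSolutions P L lam) :
    translate lam hL 0 f = f :=
  Subtype.ext (funext fun x => congrArg f.1 (add_zero x))

/-- The action of the periods on the solution germs at a point of the torus. -/
def periodAction (lam : Fin n → ℂ) (hP : P.QuasiInvariant) (hL : P.StronglyIntegrable L) {x : Vec n}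
    (hx : x ∉ P.sing) : Multiplicative P.periods →*
      (P.solutionSpace L lam (P.proj x) ≃ₗ[ℂ] P.solutionSpace L lam (P.proj x)) :=
  (LinearMap.GeneralLinearGroup.generalLinearEquiv ℂ _).toMonoidHom.comp (MonoidHom.toHomUnits
    { toFun := fun l => (germEquiv hP hL hx).conj (translate lam hL l.toAdd)
      map_one' := LinearMap.ext fun φ => by
        simp [LinearEquiv.conj_apply, translate_zero]
      map_mul' := fun l l' => LinearMap.ext fun φ => by
        simp [LinearEquiv.conj_apply, translate_add] })

lemma periodAction_apply (hP : P.QuasiInvariant) (hL : P.StronglyIntegrable L) {x : Vec n}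
    (hx : x ∉ P.sing) (l : Multiplicative P.periods) (f : globalSolutions P L lam) :
    periodAction lam hP hL hx l (germEquiv hP hL hx f) =
      germEquiv hP hL hx (translate lam hL l.toAdd f) := by
  change (germEquiv hP hL hx).conj (translate lam hL l.toAdd) (germEquiv hP hL hx f) = _
  simp [LinearEquiv.conj_apply]

/-- Solutions are single-valued on `V ∖ Sing`, so continuation along a loop is translation by the
period that joins the ends of its lift. This period depends only on the class of the loop in the
torus, and translations commute. -/
theorem exists_monodromyRep (hP : P.QuasiInvariant) (hL : P.StronglyIntegrable L)
    (t₀ : P.RegTorus) :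
    ∃ ρ : FundamentalGroup P.RegTorus t₀ →*
        (P.solutionSpace L lam t₀ ≃ₗ[ℂ] P.solutionSpace L lam t₀),
      P.IsMonodromyRep L lam t₀ ρ ∧
      (∀ ρ₁, P.IsMonodromyRep L lam t₀ ρ₁ → ρ₁ = ρ) ∧
      (∃ ρ' : FundamentalGroup P.Torus (P.incl t₀) →*
          (P.solutionSpace L lam t₀ ≃ₗ[ℂ] P.solutionSpace L lam t₀),
        ρ = ρ'.comp (FundamentalGroup.map P.incl t₀) ∧ ρ.range = ρ'.range) ∧
      ∀ a ∈ ρ.range, ∀ b ∈ ρ.range, a * b = b * a := by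
  obtain ⟨t, ht⟩ := t₀
  obtain ⟨x, rfl⟩ : ∃ x, P.proj x = t := QuotientAddGroup.mk_surjective t
  have hx : x ∉ P.sing := notMem_sing_of_proj_notMem ht
  set t₀ : P.RegTorus := ⟨P.proj x, ht⟩ with ht₀
  set ρ' : FundamentalGroup P.Torus (P.incl t₀) →*
      (P.solutionSpace L lam t₀ ≃ₗ[ℂ] P.solutionSpace L lam t₀) :=
    (periodAction lam hP hL hx).comp (deck P x) with hρ'
  have hcov := (isAddQuotientCoveringMap_proj P).isCoveringMap
  have hrep : P.IsMonodromyRep L lam t₀ (ρ'.comp (FundamentalGroup.map P.incl t₀)) := by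
    intro γ ψ
    obtain ⟨f, rfl⟩ := (germEquiv hP hL hx).surjective ψ
    set γ' : Path (P.proj x) (P.proj x) := γ.map P.incl.continuous with hγ'
    set δ := hcov.liftPath γ' x γ'.source with hδ
    have hδγ : ∀ r, P.proj (δ r) = γ' r := fun r =>
      congrFun (hcov.liftPath_lifts γ'.toContinuousMap x γ'.source) r
    have h0 : δ 0 = x := hcov.liftPath_zero γ'.toContinuousMap x γ'.source
    have h1 := deck_eq_of_lift γ' δ.continuous hδγ h0
    have h2 : (ρ'.comp (FundamentalGroup.map P.incl t₀))
        (FundamentalGroup.fromPath (Path.Homotopic.Quotient.mk γ)) (germEquiv hP hL hx f) =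
        germEquiv hP hL hx (translate lam hL (deck P x (FundamentalGroup.fromPath
          (Path.Homotopic.Quotient.mk γ'))).toAdd f) :=
      periodAction_apply hP hL hx _ f
    rw [h2]
    set l := (deck P x (FundamentalGroup.fromPath (Path.Homotopic.Quotient.mk γ'))).toAdd with hl
    -- At the end `x + l` of the lift, the descended translate takes over the point `y` the value `f
    -- ((y - l) + l)`, so its germ is that of `f`.
    refine continuesAlong_of_lift hL f.2.1 γ δ.continuous hδγ (F₀ := descend P x f)
      (F₁ := descend P x (translate lam hL l f)) (by rw [h0]; exact descend_proj x f) ?_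
    have h3 := descend_proj (P := P) x (translate lam hL l f)
    rw [h1]
    have hc : Tendsto (fun y => y + -(l : Vec n)) (𝓝 (x + l)) (𝓝 x) := by
      simpa using (continuous_add_const (-(l : Vec n))).tendsto (x + (l : Vec n))
    filter_upwards [hc.eventually h3] with y hy
    rw [proj_add_period (P.periods.neg_mem l.2)] at hy
    rw [hy]
    exact congrArg f.1 (neg_add_cancel_right y (l : Vec n))
  refine ⟨_, hrep, fun ρ₁ hρ₁ => ?_, ⟨ρ', rfl, le_antisymm ?_ ?_⟩, ?_⟩
  · refine MonoidHom.ext fun g => LinearEquiv.ext fun ψ => Subtype.ext ?_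
    obtain ⟨γ, rfl⟩ := Path.Homotopic.Quotient.mk_surjective g
    exact (hρ₁ γ ψ).unique (hrep γ ψ)
  · rintro _ ⟨g, rfl⟩
    exact ⟨_, rfl⟩
  · rintro _ ⟨g, rfl⟩
    set l := (deck P x g).toAdd with hl
    -- The image of `ρ` is not smaller than that of `ρ'`: each period is realised by a path from `x`
    -- to `x + l` which avoids `Sing`, and its projection is a loop in `T ∖ Sing`.
    obtain ⟨δ, hδ⟩ := joinedIn_compl_sing hx (add_period_notMem_sing l.2 hx)
    have hc : Continuous fun r => P.proj (δ r) :=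
      (isLocalHomeomorph_proj P).continuous.comp δ.continuous
    set γ : Path t₀ t₀ :=
      { toFun := fun r => ⟨P.proj (δ r), proj_notMem_image_sing (hδ r)⟩
        continuous_toFun := hc.subtype_mk _
        source' := Subtype.ext (by simp [ht₀])
        target' := Subtype.ext (by simp [ht₀, proj_add_period l.2]) } with hγ
    refine ⟨FundamentalGroup.fromPath (Path.Homotopic.Quotient.mk γ), ?_⟩
    have h1 := deck_eq_of_lift (P := P) (γ.map P.incl.continuous) δ.continuous (fun r => rfl)
      δ.source
    rw [δ.target] at h1
    have h2 := Subtype.ext (add_left_cancel h1)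
    exact congrArg (periodAction lam hP hL hx) (Multiplicative.toAdd.injective h2.symm)
  · rintro _ ⟨g, rfl⟩ _ ⟨g', rfl⟩
    change periodAction lam hP hL hx _ * periodAction lam hP hL hx _ =
      periodAction lam hP hL hx _ * periodAction lam hP hL hx _
    rw [← map_mul, ← map_mul, mul_comm]

end MonodromyRepresentation

/-! ### Meromorphic germs and the functions they describe -/

section DifferentialField

variable {n : ℕ} {x : Vec n}

/-- The germ at `x` of a holomorphic function as a meromorphic germ. -/
abbrev MerGerm.of (f : Vec n → ℂ) (hf : AnalyticAt ℂ f x) : MerGerm x :=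
  algebraMap (AnGerm x) (MerGerm x) (AnGerm.of f hf)

lemma AnGerm.of_eq_of_iff {f g : Vec n → ℂ} {hf : AnalyticAt ℂ f x} {hg : AnalyticAt ℂ g x} :
    AnGerm.of f hf = AnGerm.of g hg ↔ f =ᶠ[𝓝 x] g :=
  Subtype.ext_iff.trans Germ.coe_eq

lemma AnGerm.of_eq_zero_iff {f : Vec n → ℂ} {hf : AnalyticAt ℂ f x} :
    AnGerm.of f hf = 0 ↔ ∀ᶠ y in 𝓝 x, f y = 0 :=
  AnGerm.of_eq_of_iff (g := 0) (hg := analyticAt_const)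

lemma MerGerm.of_eq_of_iff {f g : Vec n → ℂ} {hf : AnalyticAt ℂ f x} {hg : AnalyticAt ℂ g x} :
    MerGerm.of f hf = MerGerm.of g hg ↔ f =ᶠ[𝓝 x] g :=
  (FaithfulSMul.algebraMap_injective (AnGerm x) (MerGerm x)).eq_iff.trans AnGerm.of_eq_of_iff

lemma MerGerm.of_eq_zero_iff {f : Vec n → ℂ} {hf : AnalyticAt ℂ f x} :
    MerGerm.of f hf = 0 ↔ ∀ᶠ y in 𝓝 x, f y = 0 :=
  (map_eq_zero_iff _ (FaithfulSMul.algebraMap_injective (AnGerm x) (MerGerm x))).trans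
    AnGerm.of_eq_zero_iff

lemma MerGerm.of_add {f g : Vec n → ℂ} (hf : AnalyticAt ℂ f x) (hg : AnalyticAt ℂ g x) :
    MerGerm.of (fun y => f y + g y) (hf.add hg) = MerGerm.of f hf + MerGerm.of g hg :=
  map_add (algebraMap (AnGerm x) (MerGerm x)) (AnGerm.of f hf) (AnGerm.of g hg)

lemma MerGerm.of_mul {f g : Vec n → ℂ} (hf : AnalyticAt ℂ f x) (hg : AnalyticAt ℂ g x) :
    MerGerm.of (fun y => f y * g y) (hf.mul hg) = MerGerm.of f hf * MerGerm.of g hg :=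
  map_mul (algebraMap (AnGerm x) (MerGerm x)) (AnGerm.of f hf) (AnGerm.of g hg)

lemma MerGerm.of_sub {f g : Vec n → ℂ} (hf : AnalyticAt ℂ f x) (hg : AnalyticAt ℂ g x) :
    MerGerm.of (fun y => f y - g y) (hf.sub hg) = MerGerm.of f hf - MerGerm.of g hg := by
  rw [eq_sub_iff_add_eq, ← MerGerm.of_add, MerGerm.of_eq_of_iff]
  exact .of_forall fun y => sub_add_cancel _ _

lemma MerGerm.pd_of (i : Fin n) {f : Vec n → ℂ} (hf : AnalyticAt ℂ f x) :
    MerGerm.pd i (MerGerm.of f hf) = MerGerm.of (GenLame.pd i f) (analyticAt_pd i hf) :=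
  MerGerm.pd_algebraMap i _

/-- An iterated partial derivative of a meromorphic germ. -/
def MerGerm.pdList (l : List (Fin n)) (k : MerGerm x) : MerGerm x := l.foldr MerGerm.pd k

/-- The germ `q` is a fraction whose denominator does not vanish where `h ≠ 0`, and `f` is the
corresponding function there. -/
def MerGerm.Describes (h : Vec n → ℂ) (q : MerGerm x) (f : Vec n → ℂ) : Prop :=
  ∃ (G D : Vec n → ℂ) (hG : AnalyticAt ℂ G x) (hD : AnalyticAt ℂ D x),
    q * MerGerm.of D hD = MerGerm.of G hG ∧ ∀ᶠ y in 𝓝 x, h y ≠ 0 → D y ≠ 0 ∧ f y * D y = G y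

variable {h : Vec n → ℂ} {q q' : MerGerm x} {f g : Vec n → ℂ}

lemma MerGerm.describes_of (hf : AnalyticAt ℂ f x) : (MerGerm.of f hf).Describes h f :=
  ⟨f, 1, hf, analyticAt_const, (congrArg _ (map_one _)).trans (mul_one _), .of_forall fun _ _ => ⟨one_ne_zero, mul_one _⟩⟩

lemma MerGerm.Describes.add (h1 : q.Describes h f) (h2 : q'.Describes h g) :
    (q + q').Describes h fun y => f y + g y := by
  obtain ⟨G, D, hG, hD, e1, e2⟩ := h1
  obtain ⟨G', D', hG', hD', e1', e2'⟩ := h2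
  refine ⟨fun y => G y * D' y + G' y * D y, fun y => D y * D' y,
    (hG.fun_mul hD').fun_add (hG'.fun_mul hD), hD.fun_mul hD', ?_, ?_⟩
  · rw [MerGerm.of_mul hD hD', MerGerm.of_add (hG.fun_mul hD') (hG'.fun_mul hD),
      MerGerm.of_mul hG hD', MerGerm.of_mul hG' hD, ← e1, ← e1']
    ring
  · filter_upwards [e2, e2'] with y h1 h2 hy
    refine ⟨mul_ne_zero (h1 hy).1 (h2 hy).1, ?_⟩
    rw [← (h1 hy).2, ← (h2 hy).2]
    ring

lemma MerGerm.Describes.mul (h1 : q.Describes h f) (h2 : q'.Describes h g) :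
    (q * q').Describes h fun y => f y * g y := by
  obtain ⟨G, D, hG, hD, e1, e2⟩ := h1
  obtain ⟨G', D', hG', hD', e1', e2'⟩ := h2
  refine ⟨fun y => G y * G' y, fun y => D y * D' y, hG.fun_mul hG', hD.fun_mul hD', ?_, ?_⟩
  · rw [MerGerm.of_mul hD hD', MerGerm.of_mul hG hG', ← e1, ← e1']
    ring
  · filter_upwards [e2, e2'] with y h1 h2 hy
    refine ⟨mul_ne_zero (h1 hy).1 (h2 hy).1, ?_⟩
    rw [← (h1 hy).2, ← (h2 hy).2]
    ring

lemma MerGerm.Describes.sum {ι : Type*} (s : Finset ι) {q : ι → MerGerm x} {f : ι → Vec n → ℂ}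
    (h1 : ∀ i ∈ s, (q i).Describes h (f i)) : (∑ i ∈ s, q i).Describes h fun y => ∑ i ∈ s, f i y := by
  classical
  induction s using Finset.induction_on with
  | empty =>
    simp only [Finset.sum_empty]
    rw [← MerGerm.of_eq_zero_iff.2 (.of_forall fun _ => rfl)]
    exact MerGerm.describes_of (f := fun _ => 0) analyticAt_const
  | insert i s hi ih =>
    simp only [Finset.sum_insert hi]
    exact (h1 i (Finset.mem_insert_self i s)).add
      (ih fun j hj => h1 j (Finset.mem_insert_of_mem hj))

lemma MerGerm.Describes.pd (hh : AnalyticAt ℂ h x) (i : Fin n) (h1 : q.Describes h f) :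
    (MerGerm.pd i q).Describes h (GenLame.pd i f) := by
  obtain ⟨G, D, hG, hD, e1, e2⟩ := h1
  have hG' := analyticAt_pd i hG
  have hD' := analyticAt_pd i hD
  refine ⟨fun y => D y * GenLame.pd i G y - G y * GenLame.pd i D y, fun y => D y * D y,
    (hD.fun_mul hG').fun_sub (hG.fun_mul hD'), hD.fun_mul hD, ?_, ?_⟩
  · have h2 := congrArg (MerGerm.pd i) e1
    rw [MerGerm.pd_mul, MerGerm.pd_of, MerGerm.pd_of] at h2
    rw [MerGerm.of_mul hD hD, MerGerm.of_sub (hD.fun_mul hG') (hG.fun_mul hD'),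
      MerGerm.of_mul hD hG', MerGerm.of_mul hG hD', ← e1]
    linear_combination (MerGerm.of D hD) * h2
  · filter_upwards [e2.eventually_nhds, hh.eventually_analyticAt, hG.eventually_analyticAt,
      hD.eventually_analyticAt] with y h2 h3 h4 h5 hy
    have h6 : ∀ᶠ z in 𝓝 y, D z ≠ 0 ∧ f z * D z = G z := by
      filter_upwards [h2, h3.continuousAt.eventually_ne hy] with z hz hz' using hz hz'
    have hD0 := h6.self_of_nhds.1
    have hf : AnalyticAt ℂ f y := (h4.div h5 hD0).congr (by
      filter_upwards [h6] with z hz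
      exact (eq_div_of_mul_eq hz.1 hz.2).symm)
    have h7 : GenLame.pd i (fun z => f z * D z) y = GenLame.pd i G y :=
      pd_congr_at i (h6.mono fun z hz => hz.2)
    rw [GenLame.pd_mul i hf h5] at h7
    refine ⟨mul_ne_zero hD0 hD0, ?_⟩
    rw [← h7, ← h6.self_of_nhds.2]
    ring

lemma MerGerm.Describes.pdList (hh : AnalyticAt ℂ h x) (l : List (Fin n)) (h1 : q.Describes h f) :
    (MerGerm.pdList l q).Describes h (GenLame.pdList l f) := by
  induction l with
  | nil => exact h1
  | cons i l ih => exact ih.pd hh i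

/-- Transfers identities in the field of germs to identities between functions off a zero set. -/
lemma MerGerm.Describes.eventually_eq (h1 : q.Describes h f) (h2 : q.Describes h g) :
    ∀ᶠ y in 𝓝 x, h y ≠ 0 → f y = g y := by
  obtain ⟨G, D, hG, hD, e1, e2⟩ := h1
  obtain ⟨G', D', hG', hD', e1', e2'⟩ := h2
  have h3 : MerGerm.of (fun y => G y * D' y) (hG.fun_mul hD') =
      MerGerm.of (fun y => G' y * D y) (hG'.fun_mul hD) := by
    rw [MerGerm.of_mul hG hD', MerGerm.of_mul hG' hD, ← e1, ← e1']
    ring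
  filter_upwards [MerGerm.of_eq_of_iff.1 h3, e2, e2'] with y h3 h4 h5 hy
  refine mul_right_cancel₀ (mul_ne_zero (h4 hy).1 (h5 hy).1) ?_
  rw [← (h4 hy).2, ← (h5 hy).2] at h3
  linear_combination h3

/-- The action of an operator with holomorphic coefficients on meromorphic germs. -/
def germApply (D : DiffOp n) (hD : D.RegularAt x) (q : MerGerm x) : MerGerm x :=
  ∑ k ∈ D.support, MerGerm.of (D k) (hD k) * MerGerm.pdList (multiList k) q

lemma MerGerm.Describes.apply (hh : AnalyticAt ℂ h x) {D : DiffOp n} (hD : D.RegularAt x)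
    (h1 : q.Describes h f) : (germApply D hD q).Describes h (D.apply f) := by
  have h2 := MerGerm.Describes.sum D.support fun k _ =>
    (MerGerm.describes_of (h := h) (hD k)).mul (h1.pdList hh (multiList k))
  have h3 : D.apply f = fun y => ∑ k ∈ D.support, D k y * GenLame.pdList (multiList k) f y := by
    funext y
    simp only [DiffOp.apply, Finsupp.sum, mixedPd_eq_pdList]
  rw [h3]
  exact h2

lemma MerGerm.Describes.eq_of (h1 : q.Describes (fun _ => 1) f) (hf : AnalyticAt ℂ f x) :
    q = MerGerm.of f hf := by
  obtain ⟨G, D, hG, hD, e1, e2⟩ := h1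
  have h0 : MerGerm.of D hD ≠ 0 := fun h0 => by
    obtain ⟨y, h1, h2⟩ := ((MerGerm.of_eq_zero_iff.1 h0).and e2).exists
    exact (h2 one_ne_zero).1 h1
  refine mul_right_cancel₀ h0 ?_
  rw [e1, ← MerGerm.of_mul hf hD]
  refine MerGerm.of_eq_of_iff.2 ?_
  filter_upwards [e2] with y hy using (hy one_ne_zero).2.symm

lemma germApply_of {D : DiffOp n} (hD : D.RegularAt x) (hf : AnalyticAt ℂ f x) :
    germApply D hD (MerGerm.of f hf) = MerGerm.of (D.apply f) (analyticAt_apply hD hf) :=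
  (MerGerm.Describes.apply analyticAt_const hD (MerGerm.describes_of hf)).eq_of _

end DifferentialField

/-! ### Operators with elliptic coefficients and the Galois group -/

section Galois

variable {n : ℕ} {P : EllipticPotential n} {L : Fin n → DiffOp n} {lam : Fin n → ℂ} {x : Vec n}

lemma of_mem_ellipticGerms {f c h : Vec n → ℂ} (hf : IsMeromorphic f)
    (hper : ∀ l ∈ P.periods, ∀ y, f (y + l) = f y) (hc : AnalyticAt ℂ c x) (hh : AnalyticAt ℂ h x)
    (h0 : ¬ ∀ᶠ y in 𝓝 x, h y = 0) (hfc : ∀ᶠ y in 𝓝 x, h y ≠ 0 → f y = c y) :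
    MerGerm.of c hc ∈ P.ellipticGerms x := by
  have h1 : AnGerm.of h hh ≠ 0 := fun h => h0 (AnGerm.of_eq_zero_iff.1 h)
  refine ⟨f, hf, hper, fun y => c y * h y, h, hc.fun_mul hh, hh, h1, ?_, ?_⟩
  · rw [eq_div_iff fun h => h0 (MerGerm.of_eq_zero_iff.1 h)]
    exact (MerGerm.of_mul hc hh).symm
  · filter_upwards [hfc] with y hy hy0
    rw [hy hy0, mul_div_cancel_right₀ _ hy0]

lemma of_const_mem_ellipticGerms (c : ℂ) :
    MerGerm.of (fun _ : Vec n => c) analyticAt_const ∈ P.ellipticGerms x :=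
  have h1 : ∀ p : Vec n, ¬ ∀ᶠ _ in 𝓝 p, (1 : ℂ) = 0 := fun p h => one_ne_zero h.self_of_nhds
  of_mem_ellipticGerms (f := fun _ => c) (h := fun _ => 1) (fun p => ⟨fun _ => c, fun _ => 1,
    analyticAt_const, analyticAt_const, h1 p, by simp⟩) (fun _ _ _ => rfl) _ analyticAt_const (h1 x)
    (by simp)

lemma ellipticGerms_subset : P.ellipticGerms x ⊆ P.solutionField L lam x := fun k hk => by
  simp only [EllipticPotential.solutionField, SetLike.mem_coe, Subfield.mem_sInf]
  exact fun S hS => hS.1 hk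

lemma solutionGerms_subset : EllipticPotential.solutionGerms L lam x ⊆ P.solutionField L lam x := fun k hk => by
  simp only [EllipticPotential.solutionField, SetLike.mem_coe, Subfield.mem_sInf]
  exact fun S hS => hS.2.1 hk

lemma Dgal.coe_map_pd {σ : RingAut (P.solutionField L lam x)} (hσ : σ ∈ P.Dgal L lam x) (i : Fin n)
    (k : P.solutionField L lam x) :
    ((σ (EllipticPotential.solutionField.pd P L lam i k) : P.solutionField L lam x) : MerGerm x) =
      MerGerm.pd i ((σ k : P.solutionField L lam x) : MerGerm x) :=
  congrArg Subtype.val (hσ.1 i k)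

lemma exists_pdList_solutionField (l : List (Fin n)) (a : P.solutionField L lam x) :
    ∃ b : P.solutionField L lam x, (b : MerGerm x) = MerGerm.pdList l a ∧
      ∀ σ ∈ P.Dgal L lam x, ((σ b : P.solutionField L lam x) : MerGerm x) =
        MerGerm.pdList l ((σ a : P.solutionField L lam x) : MerGerm x) := by
  induction l with
  | nil => exact ⟨a, rfl, fun _ _ => rfl⟩
  | cons i l ih =>
    obtain ⟨b, h1, h2⟩ := ih
    refine ⟨EllipticPotential.solutionField.pd P L lam i b, ?_, fun σ hσ => ?_⟩
    · exact congrArg (MerGerm.pd i) h1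
    · exact (Dgal.coe_map_pd hσ i b).trans (congrArg (MerGerm.pd i) (h2 σ hσ))

lemma exists_sum_solutionField {ι : Type*} (s : Finset ι) {κ : ι → MerGerm x}
    (hκ : ∀ i ∈ s, κ i ∈ P.ellipticGerms x) (l : ι → List (Fin n)) (a : P.solutionField L lam x) :
    ∃ b : P.solutionField L lam x, (b : MerGerm x) = ∑ i ∈ s, κ i * MerGerm.pdList (l i) a ∧
      ∀ σ ∈ P.Dgal L lam x, ((σ b : P.solutionField L lam x) : MerGerm x) =
        ∑ i ∈ s, κ i * MerGerm.pdList (l i) ((σ a : P.solutionField L lam x) : MerGerm x) := by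
  classical
  induction s using Finset.induction_on with
  | empty =>
    refine ⟨0, rfl, fun σ _ => ?_⟩
    rw [RingEquiv.map_zero]
    rfl
  | insert i s hi ih =>
    obtain ⟨b, h1, h2⟩ := ih fun j hj => hκ j (Finset.mem_insert_of_mem hj)
    obtain ⟨d, h3, h4⟩ := exists_pdList_solutionField (P := P) (L := L) (lam := lam) (l i) a
    have hi' := hκ i (Finset.mem_insert_self i s)
    set κi : P.solutionField L lam x := ⟨κ i, ellipticGerms_subset hi'⟩ with hκi
    refine ⟨κi * d + b, ?_, fun σ hσ => ?_⟩
    · rw [Finset.sum_insert hi, ← h3, ← h1]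
      rfl
    · have h5 : σ κi = κi := hσ.2 κi hi'
      have h6 : σ (κi * d + b) = κi * σ d + σ b := by
        rw [RingEquiv.map_add σ, RingEquiv.map_mul σ, h5]
      rw [Finset.sum_insert hi, ← h4 σ hσ, ← h2 σ hσ, h6]
      rfl

/-- Differential operators with elliptic coefficients commute with the Galois group. -/
lemma coe_map_eq_sum {ι : Type*} (s : Finset ι) {κ : ι → MerGerm x}
    (hκ : ∀ i ∈ s, κ i ∈ P.ellipticGerms x) (l : ι → List (Fin n)) {a b : P.solutionField L lam x}
    (hab : (b : MerGerm x) = ∑ i ∈ s, κ i * MerGerm.pdList (l i) a)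
    {σ : RingAut (P.solutionField L lam x)} (hσ : σ ∈ P.Dgal L lam x) :
    ((σ b : P.solutionField L lam x) : MerGerm x) =
      ∑ i ∈ s, κ i * MerGerm.pdList (l i) ((σ a : P.solutionField L lam x) : MerGerm x) := by
  obtain ⟨b', h1, h2⟩ := exists_sum_solutionField (lam := lam) (L := L) s hκ l a
  rw [Subtype.ext (hab.trans h1.symm)]
  exact h2 σ hσ

end Galois

/-! ### The linear action of the Galois group on solutions -/

section GaloisAction

variable {n : ℕ} [NeZero n] {P : EllipticPotential n} {L : Fin n → DiffOp n} {lam : Fin n → ℂ}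

/-- Guarantees that the image of a solution under the Galois group acquires no pole. A quotient `g /
h` satisfying the system is a solution at nearby points with `h ≠ 0`, and the global extension of
this solution is holomorphic at `x₀`. -/
lemma mem_solutionGerms_of_germApply (hP : P.QuasiInvariant) (hL : P.StronglyIntegrable L) {x₀ : Vec n}
    (hx₀ : x₀ ∉ P.sing) {r : ℝ} (hr : 0 < r) {D : Fin n → DiffOp n}
    (hD : ∀ y ∈ Metric.ball x₀ r, ∀ ψ : Vec n → ℂ, IsSol L lam ψ y ↔
      AnalyticAt ℂ ψ y ∧ ∀ᶠ x in 𝓝 y, ∀ i, (D i).apply ψ x = lam i * ψ x) {q : MerGerm x₀}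
    (hreg : ∀ i, (D i).RegularAt x₀) (hq : ∀ i, germApply (D i) (hreg i) q =
      MerGerm.of (fun _ => lam i) analyticAt_const * q) :
    ∃ f, ∃ hf : IsSol L lam f x₀, q = MerGerm.of f hf.1 := by
  obtain ⟨⟨_, g, hg, rfl⟩, ⟨_, h, hh, rfl⟩, hb, rfl⟩ :=
    IsFractionRing.div_surjective (A := AnGerm x₀) q
  change ∀ i, germApply (D i) _ (MerGerm.of g hg / MerGerm.of h hh) =
    _ * (MerGerm.of g hg / MerGerm.of h hh) at hq
  have hh0 : MerGerm.of h hh ≠ 0 := IsFractionRing.to_map_ne_zero_of_mem_nonZeroDivisors hb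
  have hhz : ¬ ∀ᶠ y in 𝓝 x₀, h y = 0 := fun h1 => hh0 (MerGerm.of_eq_zero_iff.2 h1)
  have hdes : (MerGerm.of g hg / MerGerm.of h hh).Describes h fun y => g y / h y :=
    ⟨g, h, hg, hh, div_mul_cancel₀ _ hh0, .of_forall fun y hy => ⟨hy, div_mul_cancel₀ _ hy⟩⟩
  have hev : ∀ᶠ y in 𝓝 x₀, ∀ i, h y ≠ 0 →
      (D i).apply (fun y => g y / h y) y = lam i * (g y / h y) := by
    refine Filter.eventually_all.2 fun i => ?_
    have h1 := hdes.apply hh (hreg i)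
    rw [hq i] at h1
    exact h1.eventually_eq ((MerGerm.describes_of analyticAt_const).mul hdes)
  have hns : ∀ᶠ y in 𝓝 x₀, y ∉ P.sing := (isClosed_sing P).isOpen_compl.mem_nhds hx₀
  obtain ⟨ε, hε, hb⟩ := Metric.eventually_nhds_iff_ball.1
    (hg.eventually_analyticAt.and (hh.eventually_analyticAt.and (hev.eventually_nhds.and
      (hns.and (eventually_mem_set.2 (Metric.ball_mem_nhds x₀ hr))))))
  obtain ⟨y, hy, hyε⟩ := ((not_eventually.1 hhz).and_eventually (Metric.ball_mem_nhds x₀ hε)).exists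
  obtain ⟨hgy, hhy, hevy, hys, hyr⟩ := hb y hyε
  have hsol : IsSol L lam (fun y => g y / h y) y := by
    refine (hD y hyr _).2 ⟨hgy.div hhy hy, ?_⟩
    filter_upwards [hevy, hhy.continuousAt.eventually_ne hy] with z h1 h2 i using h1 i h2
  obtain ⟨f, -, hf, hfg⟩ := exists_global hP hL hys hsol
  refine ⟨f, hf x₀ hx₀, ?_⟩
  refine (div_eq_iff hh0).2 ?_
  rw [← MerGerm.of_mul (hf x₀ hx₀).1 hh]
  refine (MerGerm.of_eq_of_iff (hf := hg)).2 ?_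
  have h1 : Set.EqOn g (fun z => f z * h z) (Metric.ball x₀ ε) := by
    refine AnalyticOnNhd.eqOn_of_preconnected_of_eventuallyEq (𝕜 := ℂ) (fun z hz => (hb z hz).1)
      (fun z hz => (hf z (hb z hz).2.2.2.1).1.fun_mul (hb z hz).2.1)
      (convex_ball x₀ ε).isPreconnected hyε ?_
    filter_upwards [hfg, hhy.continuousAt.eventually_ne hy] with z h1 h2
    rw [h1, div_mul_cancel₀ _ h2]
  filter_upwards [Metric.ball_mem_nhds x₀ hε] with z hz using h1 hz

/-- The germ of a solution as an element of the solution field. -/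
def solutionElement {f : Vec n → ℂ} {x₀ : Vec n} (P : EllipticPotential n) (hf : IsSol L lam f x₀) :
    P.solutionField L lam x₀ :=
  ⟨MerGerm.of f hf.1, solutionGerms_subset ⟨f, hf, rfl⟩⟩

/-- A Galois element commutes with derivatives and fixes both the coefficients of the operators and
the constants `λᵢ`, so it preserves the equations. -/
lemma exists_map_solution (hP : P.QuasiInvariant) (hL : P.StronglyIntegrable L) {x₀ : Vec n}
    (hx₀ : x₀ ∉ P.sing) {σ : RingAut (P.solutionField L lam x₀)} (hσ : σ ∈ P.Dgal L lam x₀)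
    {f : Vec n → ℂ} (hf : IsSol L lam f x₀) :
    ∃ f', ∃ hf' : IsSol L lam f' x₀, σ (solutionElement P hf) = solutionElement P hf' := by
  obtain ⟨s, d, hs, -, -⟩ := hL.symbols
  obtain ⟨r, hr, D, hDa, -, hD, h, hh, h0, hLD⟩ := exists_regular_system P hL lam hs hx₀
  have hxr := Metric.mem_ball_self (x := x₀) hr
  have hreg : ∀ i, (D i).RegularAt x₀ := fun i k => hDa i k x₀ hxr
  obtain ⟨f', hf', h1⟩ := mem_solutionGerms_of_germApply hP hL hx₀ hr hD
    (q := ((σ (solutionElement P hf) : P.solutionField L lam x₀) : MerGerm x₀)) hreg fun i => by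
      set C : P.solutionField L lam x₀ := ⟨MerGerm.of (fun _ => lam i) analyticAt_const,
        ellipticGerms_subset (of_const_mem_ellipticGerms (lam i))⟩ with hC
      have h2 : germApply (D i) (hreg i) (MerGerm.of f hf.1) =
          MerGerm.of (fun _ => lam i) analyticAt_const * MerGerm.of f hf.1 := by
        rw [germApply_of (hreg i) hf.1, ← MerGerm.of_mul analyticAt_const hf.1, MerGerm.of_eq_of_iff]
        exact ((hD x₀ hxr f).1 hf).2.mono fun y hy => hy i
      have h3 := coe_map_eq_sum (a := solutionElement P hf) (b := C * solutionElement P hf)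
        (D i).support (κ := fun k => MerGerm.of (D i k) (hreg i k))
        (fun k _ => of_mem_ellipticGerms (hL.meromorphic i k) (hL.periodic i k) _ hh h0 (hLD i k))
        multiList h2.symm hσ
      have h4 : σ C = C := hσ.2 C (of_const_mem_ellipticGerms (lam i))
      rw [RingEquiv.map_mul σ, h4] at h3
      exact h3.symm
  exact ⟨f', hf', Subtype.ext h1⟩

/-- Complex constants are elliptic functions, hence fixed, which makes the induced map complex
linear. -/
lemma exists_galoisMap (hP : P.QuasiInvariant) (hL : P.StronglyIntegrable L) {x₀ : Vec n}
    (hx₀ : x₀ ∉ P.sing) {σ : RingAut (P.solutionField L lam x₀)} (hσ : σ ∈ P.Dgal L lam x₀) :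
    ∃ S : globalSolutions P L lam →ₗ[ℂ] globalSolutions P L lam, ∀ w,
      σ (solutionElement P (w.2.1 x₀ hx₀)) = solutionElement P ((S w).2.1 x₀ hx₀) := by
  have h1 : ∀ w : globalSolutions P L lam, ∃ w' : globalSolutions P L lam,
      σ (solutionElement P (w.2.1 x₀ hx₀)) = solutionElement P (w'.2.1 x₀ hx₀) := by
    intro w
    obtain ⟨f', hf', h2⟩ := exists_map_solution hP hL hx₀ hσ (w.2.1 x₀ hx₀)
    obtain ⟨f, hf, -, hff'⟩ := exists_mem_globalSolutions hP hL hx₀ hf'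
    exact ⟨⟨f, hf⟩, h2.trans (Subtype.ext (MerGerm.of_eq_of_iff.2 hff'.symm))⟩
  choose S hS using h1
  have hinj : ∀ w w' : globalSolutions P L lam, solutionElement P (w.2.1 x₀ hx₀) =
      solutionElement P (w'.2.1 x₀ hx₀) → w = w' := by
    intro w w' h
    have h2 := eqOn_compl_sing w.2.1 w'.2.1 hx₀ (MerGerm.of_eq_of_iff.1 (congrArg Subtype.val h))
    refine Subtype.ext (funext fun y => ?_)
    by_cases hy : y ∈ P.sing
    · rw [w.2.2 y hy, w'.2.2 y hy]
    · exact h2 hy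
  have hadd : ∀ w w' : globalSolutions P L lam, solutionElement P ((w + w').2.1 x₀ hx₀) =
      solutionElement P (w.2.1 x₀ hx₀) + solutionElement P (w'.2.1 x₀ hx₀) := fun w w' =>
    Subtype.ext (MerGerm.of_add _ _)
  have hcst : ∀ c : ℂ, ∃ C : P.solutionField L lam x₀, σ C = C ∧
      (C : MerGerm x₀) = MerGerm.of (fun _ => c) analyticAt_const := fun c =>
    ⟨⟨_, ellipticGerms_subset (of_const_mem_ellipticGerms c)⟩,
      hσ.2 ⟨_, ellipticGerms_subset (of_const_mem_ellipticGerms c)⟩ (of_const_mem_ellipticGerms c), rfl⟩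
  choose C hC hCc using hcst
  have hsmul : ∀ (c : ℂ) (w : globalSolutions P L lam), solutionElement P ((c • w).2.1 x₀ hx₀) =
      C c * solutionElement P (w.2.1 x₀ hx₀) := fun c w => Subtype.ext <| by
    refine (MerGerm.of_mul (f := fun _ => c) analyticAt_const (w.2.1 x₀ hx₀).1).trans ?_
    rw [← hCc]
    rfl
  refine ⟨⟨⟨S, fun w w' => hinj _ _ ?_⟩, fun c w => hinj _ _ ?_⟩, hS⟩
  · rw [← hS, hadd, RingEquiv.map_add σ, hS, hS, hadd]
  · refine (hS (c • w)).symm.trans (((congrArg σ (hsmul c w)).trans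
      (RingEquiv.map_mul σ _ _)).trans ?_)
    exact (congrArg₂ (· * ·) (hC c) (hS w)).trans (hsmul c (S w)).symm

end GaloisAction

/-! ### Functions holomorphic off `Sing` and meromorphic along it -/

section MeromorphicOff

variable {n : ℕ} {P : EllipticPotential n} {f g : Vec n → ℂ}

lemma not_eventually_mul_eq_zero {p : Vec n} (hf : AnalyticAt ℂ f p) (hg : AnalyticAt ℂ g p)
    (hf0 : ¬ ∀ᶠ x in 𝓝 p, f x = 0) (hg0 : ¬ ∀ᶠ x in 𝓝 p, g x = 0) :
    ¬ ∀ᶠ x in 𝓝 p, f x * g x = 0 := by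
  intro h
  have h1 : AnGerm.of f hf * AnGerm.of g hg = 0 :=
    AnGerm.of_eq_zero_iff (f := fun x => f x * g x) (hf := hf.mul hg) |>.2 h
  rcases mul_eq_zero.1 h1 with h2 | h2
  · exact hf0 (AnGerm.of_eq_zero_iff.1 h2)
  · exact hg0 (AnGerm.of_eq_zero_iff.1 h2)

/-- `f` is holomorphic off the singular locus and meromorphic along it. -/
def MeromorphicOff (P : EllipticPotential n) (f : Vec n → ℂ) : Prop :=
  (∀ x ∉ P.sing, AnalyticAt ℂ f x) ∧ ∀ p, ∃ g h : Vec n → ℂ, AnalyticAt ℂ g p ∧ AnalyticAt ℂ h p ∧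
    (¬ ∀ᶠ x in 𝓝 p, h x = 0) ∧ ∀ᶠ x in 𝓝 p, x ∉ P.sing → f x * h x = g x

lemma meromorphicOff_const (c : ℂ) : MeromorphicOff P fun _ => c :=
  ⟨fun _ _ => analyticAt_const, fun _ => ⟨fun _ => c, fun _ => 1, analyticAt_const, analyticAt_const,
    fun h => one_ne_zero h.self_of_nhds, .of_forall fun _ _ => mul_one _⟩⟩

lemma MeromorphicOff.add (hf : MeromorphicOff P f) (hg : MeromorphicOff P g) :
    MeromorphicOff P fun x => f x + g x := by
  refine ⟨fun x hx => (hf.1 x hx).fun_add (hg.1 x hx), fun p => ?_⟩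
  obtain ⟨a, h, ha, hh, h0, e⟩ := hf.2 p
  obtain ⟨a', h', ha', hh', h0', e'⟩ := hg.2 p
  refine ⟨fun x => a x * h' x + a' x * h x, fun x => h x * h' x,
    (ha.fun_mul hh').fun_add (ha'.fun_mul hh), hh.fun_mul hh',
    not_eventually_mul_eq_zero hh hh' h0 h0', ?_⟩
  filter_upwards [e, e'] with x h1 h2 hx
  rw [← h1 hx, ← h2 hx]
  ring

lemma MeromorphicOff.mul (hf : MeromorphicOff P f) (hg : MeromorphicOff P g) :
    MeromorphicOff P fun x => f x * g x := by
  refine ⟨fun x hx => (hf.1 x hx).fun_mul (hg.1 x hx), fun p => ?_⟩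
  obtain ⟨a, h, ha, hh, h0, e⟩ := hf.2 p
  obtain ⟨a', h', ha', hh', h0', e'⟩ := hg.2 p
  refine ⟨fun x => a x * a' x, fun x => h x * h' x, ha.fun_mul ha', hh.fun_mul hh',
    not_eventually_mul_eq_zero hh hh' h0 h0', ?_⟩
  filter_upwards [e, e'] with x h1 h2 hx
  rw [← h1 hx, ← h2 hx]
  ring

lemma MeromorphicOff.sum {ι : Type*} (s : Finset ι) {f : ι → Vec n → ℂ}
    (hf : ∀ i ∈ s, MeromorphicOff P (f i)) : MeromorphicOff P fun x => ∑ i ∈ s, f i x := by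
  classical
  induction s using Finset.induction_on with
  | empty => simpa using meromorphicOff_const 0
  | insert i s hi ih =>
    simp only [Finset.sum_insert hi]
    exact (hf i (Finset.mem_insert_self i s)).add
      (ih fun j hj => hf j (Finset.mem_insert_of_mem hj))

lemma MeromorphicOff.prod {ι : Type*} (s : Finset ι) {f : ι → Vec n → ℂ}
    (hf : ∀ i ∈ s, MeromorphicOff P (f i)) : MeromorphicOff P fun x => ∏ i ∈ s, f i x := by
  classical
  induction s using Finset.induction_on with
  | empty => simpa using meromorphicOff_const 1
  | insert i s hi ih =>
    simp only [Finset.prod_insert hi]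
    exact (hf i (Finset.mem_insert_self i s)).mul
      (ih fun j hj => hf j (Finset.mem_insert_of_mem hj))

lemma MeromorphicOff.det {r : ℕ} {A : Vec n → Matrix (Fin r) (Fin r) ℂ}
    (hA : ∀ i j, MeromorphicOff P fun x => A x i j) : MeromorphicOff P fun x => (A x).det := by
  simp only [Matrix.det_apply']
  exact MeromorphicOff.sum _ fun σ _ =>
    (meromorphicOff_const _).mul (MeromorphicOff.prod _ fun i _ => hA _ _)

lemma MeromorphicOff.pd (i : Fin n) (hf : MeromorphicOff P f) : MeromorphicOff P (pd i f) := by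
  refine ⟨fun x hx => analyticAt_pd i (hf.1 x hx), fun p => ?_⟩
  obtain ⟨a, h, ha, hh, h0, e⟩ := hf.2 p
  refine ⟨fun x => h x * GenLame.pd i a x - a x * GenLame.pd i h x, fun x => h x * h x,
    (hh.fun_mul (analyticAt_pd i ha)).fun_sub (ha.fun_mul (analyticAt_pd i hh)), hh.fun_mul hh,
    not_eventually_mul_eq_zero hh hh h0 h0, ?_⟩
  filter_upwards [e.eventually_nhds, hh.eventually_analyticAt] with x h1 h2 hx
  have h3 : GenLame.pd i (fun y => f y * h y) x = GenLame.pd i a x := by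
    refine pd_congr_at i ?_
    filter_upwards [h1, (isClosed_sing P).isOpen_compl.mem_nhds hx] with y hy hys using hy hys
  rw [GenLame.pd_mul i (hf.1 x hx) h2] at h3
  rw [← h3, ← h1.self_of_nhds hx]
  ring

lemma MeromorphicOff.mixedPd (k : Fin n →₀ ℕ) (hf : MeromorphicOff P f) :
    MeromorphicOff P (mixedPd k f) := by
  rw [mixedPd_eq_pdList]
  induction multiList k with
  | nil => exact hf
  | cons i l ih => exact ih.pd i

lemma IsMeromorphic.meromorphicOff (hf : IsMeromorphic f) (ha : ∀ x ∉ P.sing, AnalyticAt ℂ f x) :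
    MeromorphicOff P f := by
  refine ⟨ha, fun p => ?_⟩
  obtain ⟨g, h, hg, hh, h0, e⟩ := hf p
  refine ⟨g, h, hg, hh, h0, ?_⟩
  filter_upwards [e.eventually_nhds, frequently_of_not_eventually_zero hh h0,
    hg.eventually_analyticAt, hh.eventually_analyticAt] with x h1 h2 h3 h4 hx
  by_contra hne
  have h5 := (((ha x hx).mul h4).sub h3).continuousAt.eventually_ne (sub_ne_zero.2 hne)
  obtain ⟨y, hy, hy1, hy2⟩ := (h2.and_eventually (h1.and h5)).exists
  exact hy2 (sub_eq_zero.2 (by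
    simp only [Pi.mul_apply]
    rw [hy1 hy, div_mul_cancel₀ _ hy]))

/-- The complement of `Sing` is connected, so `g x₀ ≠ 0` prevents `g` from vanishing identically
near any regular point, and its local numerators are not zero. -/
lemma MeromorphicOff.isMeromorphic_div (hf : MeromorphicOff P f) (hg : MeromorphicOff P g) {x₀ : Vec n}
    (hx₀ : x₀ ∉ P.sing) (hg0 : g x₀ ≠ 0) {c : Vec n → ℂ} (hc : ∀ x ∉ P.sing, c x = f x / g x) :
    IsMeromorphic c := by
  refine IsMeromorphic.congr_of_notMem_sing (P := P) (f := fun x => f x / g x) (fun p => ?_) hc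
  obtain ⟨T, hT⟩ := exists_covers P (isCompact_closedBall p 1)
  obtain ⟨a, h, ha, hh, h0, e⟩ := hf.2 p
  obtain ⟨a', h', ha', hh', h0', e'⟩ := hg.2 p
  have hΦ := analyticAt_prodShift P T p
  have hg1 : ∀ x ∉ P.sing, ¬ g =ᶠ[𝓝 x] 0 := fun x hx h1 => hg0
    (AnalyticOnNhd.eqOn_zero_of_preconnected_of_eventuallyEq_zero hg.1
      (isPreconnected_compl_sing P) hx h1 hx₀)
  have hΦ0 : ¬ ∀ᶠ x in 𝓝 p, prodShift P T x = 0 := fun h1 => by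
    obtain ⟨y, hy, hy'⟩ := ((frequently_notMem_sing P p).and_eventually h1).exists
    exact hT.prodShift_ne_zero hy hy'
  have ha0 : ¬ ∀ᶠ x in 𝓝 p, a' x = 0 := fun h1 => by
    obtain ⟨y, hy, hy1, hy2, hy3⟩ := ((frequently_notMem_sing P p).and_eventually
      (h1.eventually_nhds.and (e'.eventually_nhds.and
        (hh'.eventually_analyticAt.and (frequently_of_not_eventually_zero hh' h0'))))).exists
    refine not_eventually_mul_eq_zero (hg.1 y hy) hy3.1 (hg1 y hy)
      (fun h3 => hy3.2 (h3.mono fun z hz => not_not.2 hz)) ?_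
    filter_upwards [hy1, hy2, (isClosed_sing P).isOpen_compl.mem_nhds hy] with z h3 h4 h5
    rw [h4 h5, h3]
  refine ⟨fun x => a x * h' x * prodShift P T x, fun x => h x * a' x * prodShift P T x,
    (ha.fun_mul hh').fun_mul hΦ, (hh.fun_mul ha').fun_mul hΦ,
    not_eventually_mul_eq_zero (hh.fun_mul ha') hΦ (not_eventually_mul_eq_zero hh ha' h0 ha0) hΦ0, ?_⟩
  filter_upwards [e, e', Metric.closedBall_mem_nhds p one_pos] with x h1 h2 hxb hne
  have hΦx := right_ne_zero_of_mul hne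
  have hx := hT.notMem_sing hxb hΦx
  have ha'x := right_ne_zero_of_mul (left_ne_zero_of_mul hne)
  have hhx := left_ne_zero_of_mul (left_ne_zero_of_mul hne)
  rw [← h2 hx] at ha'x ⊢
  rw [← h1 hx]
  have h3 := left_ne_zero_of_mul ha'x
  have h4 := right_ne_zero_of_mul ha'x
  field_simp

end MeromorphicOff

/-! ### Derivatives which form a basis of the dual of the solution space -/

section EllipticOperators

variable {n : ℕ} [NeZero n] {P : EllipticPotential n} {L : Fin n → DiffOp n} {lam : Fin n → ℂ}

lemma meromorphicOff_of_mem (hP : P.QuasiInvariant) (hL : P.StronglyIntegrable L) {x₀ : Vec n}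
    (hx₀ : x₀ ∉ P.sing) (w : globalSolutions P L lam) : MeromorphicOff P w.1 := by
  obtain ⟨f, hm, hf, hfw⟩ := exists_global hP hL hx₀ (w.2.1 x₀ hx₀)
  exact (hm.congr_of_notMem_sing (P := P) fun x hx =>
    eqOn_compl_sing w.2.1 hf hx₀ hfw.symm hx).meromorphicOff fun x hx => (w.2.1 x hx).1

/-- The value of a derivative of a global solution at a regular point. -/
def derivAt (L : Fin n → DiffOp n) (lam : Fin n → ℂ) {x : Vec n} (hx : x ∉ P.sing)
    (k : Fin n →₀ ℕ) : Module.Dual ℂ (globalSolutions P L lam) where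
  toFun w := mixedPd k w.1 x
  map_add' w w' := ((goodOp_mixedPd k x).add _ _ (w.2.1 x hx).1 (w'.2.1 x hx).1).eq_of_nhds
  map_smul' c w := ((goodOp_mixedPd k x).smul c _ (w.2.1 x hx).1).eq_of_nhds

/-- The derivatives of order below `N` at `x` separate solutions, so as functionals they span the
dual space. As many of them as the dimension already span, which will give a square invertible
matrix. -/
lemma exists_dual_basis (hL : P.StronglyIntegrable L) {x : Vec n} (hx : x ∉ P.sing) :
    ∃ (r : ℕ) (_ : Module.Basis (Fin r) ℂ (globalSolutions P L lam)) (a : Fin r → Fin n →₀ ℕ),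
      ∀ w : globalSolutions P L lam, (∀ i, mixedPd (a i) w.1 x = 0) → w = 0 := by
  obtain ⟨N, hN⟩ := exists_extendsOn P hL lam
  have hinj : ∀ w : globalSolutions P L lam, (∀ k ∈ degLT n N, mixedPd k w.1 x = 0) → w = 0 := by
    intro w hw
    have h1 := eqOn_compl_sing w.2.1 (fun y _ => IsSol.zero L lam y) hx
      ((hN x hx).2 w.1 (w.2.1 x hx) hw)
    refine Subtype.ext (funext fun y => ?_)
    by_cases hy : y ∈ P.sing
    · exact w.2.2 y hy
    · exact h1 hy
  have hfd : FiniteDimensional ℂ (globalSolutions P L lam) := by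
    refine FiniteDimensional.of_injective
      (LinearMap.pi fun k : degLT n N => derivAt (P := P) L lam hx k) ?_
    rw [← LinearMap.ker_eq_bot, LinearMap.ker_eq_bot']
    exact fun w hw => hinj w fun k hk => congrFun hw ⟨k, hk⟩
  set e : degLT n N → Module.Dual ℂ (globalSolutions P L lam) := fun k => derivAt L lam hx k with he
  have hspan : Submodule.span ℂ (Set.range e) = ⊤ := by
    rw [← Subspace.dualCoannihilator_dualAnnihilator_eq (W := Submodule.span ℂ (Set.range e))]
    have h1 : (Submodule.span ℂ (Set.range e)).dualCoannihilator = ⊥ := by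
      refine (Submodule.eq_bot_iff _).2 fun w hw => hinj w fun k hk => ?_
      exact (Submodule.mem_dualCoannihilator w).1 hw _ (Submodule.subset_span ⟨⟨k, hk⟩, rfl⟩)
    rw [h1, Submodule.dualAnnihilator_bot]
  have h2 := Submodule.exists_fun_fin_finrank_span_eq ℂ (Set.range e)
  rw [hspan, finrank_top, Subspace.dual_finrank_eq] at h2
  obtain ⟨d, hd, hds, -⟩ := h2
  choose k hk using hd
  refine ⟨_, Module.finBasis ℂ _, fun i => k i, fun w hw => ?_⟩
  have h3 : ∀ φ : Module.Dual ℂ (globalSolutions P L lam), φ w = 0 := by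
    intro φ
    have hφ : φ ∈ Submodule.span ℂ (Set.range d) := hds ▸ Submodule.mem_top
    induction hφ using Submodule.span_induction with
    | mem φ hφ =>
      obtain ⟨i, rfl⟩ := hφ
      rw [← hk i]
      exact hw i
    | zero => rfl
    | add φ χ _ _ h4 h5 => rw [LinearMap.add_apply, h4, h5, add_zero]
    | smul c φ _ h4 => rw [LinearMap.smul_apply, h4, smul_zero]
  exact (Module.forall_dual_apply_eq_zero_iff ℂ w).1 h3

end EllipticOperators

/-! ### Commutativity of the differential Galois group -/

section Commutativity

open scoped Matrix

variable {n : ℕ} [NeZero n] {P : EllipticPotential n} {L : Fin n → DiffOp n} {lam : Fin n → ℂ}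

/-- An endomorphism of the solution space which commutes with the translations by periods is a
differential operator with elliptic coefficients. -/
theorem exists_elliptic_operator (hP : P.QuasiInvariant) (hL : P.StronglyIntegrable L) {x₀ : Vec n}
    (hx₀ : x₀ ∉ P.sing) (B : globalSolutions P L lam →ₗ[ℂ] globalSolutions P L lam)
    (hB : ∀ l w, B (translate lam hL l w) = translate lam hL l (B w)) :
    ∃ (r : ℕ) (a : Fin r → Fin n →₀ ℕ) (c : Fin r → Vec n → ℂ) (hc : ∀ i, AnalyticAt ℂ (c i) x₀),
      (∀ i, MerGerm.of (c i) (hc i) ∈ P.ellipticGerms x₀) ∧ ∀ w : globalSolutions P L lam,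
        (B w).1 =ᶠ[𝓝 x₀] fun x => ∑ i, c i x * mixedPd (a i) w.1 x := by
  classical
  obtain ⟨r, b, a, ha⟩ := exists_dual_basis (lam := lam) hL hx₀
  set Ψ : Vec n → Matrix (Fin r) (Fin r) ℂ := fun x => Matrix.of fun i j => mixedPd (a i) (b j).1 x
    with hΨ
  set v : Vec n → Fin r → ℂ := fun x j => (B (b j)).1 x with hv
  -- The solution of the linear equations `∑ i, c i * ∂^(a i) b_j = B b_j`. The value `0` on `Sing`
  -- makes the coefficients periodic at every point.
  set c : Fin r → Vec n → ℂ := fun i x => if x ∈ P.sing then 0 else (v x ᵥ* (Ψ x)⁻¹) i with hc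
  have hΨw : ∀ x ∉ P.sing, ∀ w : globalSolutions P L lam,
      Ψ x *ᵥ b.equivFun w = fun i => mixedPd (a i) w.1 x := by
    intro x hx w
    funext i
    have h1 : derivAt (P := P) L lam hx (a i) w = derivAt L lam hx (a i) (∑ j, b.equivFun w j • b j) := by
      rw [b.sum_equivFun]
    rw [map_sum] at h1
    refine Eq.trans ?_ h1.symm
    simp only [map_smul, smul_eq_mul, Matrix.mulVec, dotProduct]
    exact Finset.sum_congr rfl fun j _ => mul_comm _ _
  have hvw : ∀ (x : Vec n) (w : globalSolutions P L lam), v x ⬝ᵥ b.equivFun w = (B w).1 x := by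
    intro x w
    have h1 : (B w).1 = (∑ j, b.equivFun w j • B (b j) : globalSolutions P L lam).1 := by
      conv_lhs => rw [← b.sum_equivFun w]
      simp only [map_sum, map_smul]
    rw [h1, AddSubmonoidClass.coe_finsetSum, Finset.sum_apply, dotProduct]
    exact Finset.sum_congr rfl fun j _ => mul_comm _ _
  have hdet : (Ψ x₀).det ≠ 0 := by
    intro h0
    obtain ⟨t, ht, ht0⟩ := Matrix.exists_mulVec_eq_zero_iff.2 h0
    refine ht ?_
    have h1 := hΨw x₀ hx₀ (b.equivFun.symm t)
    rw [LinearEquiv.apply_symm_apply, ht0] at h1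
    have h2 := ha (b.equivFun.symm t) fun i => (congrFun h1 i).symm
    exact (map_eq_zero_iff b.equivFun.symm b.equivFun.symm.injective).1 h2
  have hper : ∀ i, ∀ l ∈ P.periods, ∀ x, c i (x + l) = c i x := by
    intro i l hl x
    by_cases hx : x ∈ P.sing
    · have hxl : x + l ∈ P.sing := by
        by_contra h
        have h1 := add_period_notMem_sing (P.periods.neg_mem hl) h
        rw [add_neg_cancel_right] at h1
        exact h1 hx
      simp only [hc, if_pos hx, if_pos hxl]
    · have hxl := add_period_notMem_sing hl hx
      simp only [hc, if_neg hx, if_neg hxl]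
      -- Translation by `l` multiplies `Ψ` on the right by the matrix `M`. It does the same with `v`
      -- because `B` commutes with translations. So `v Ψ⁻¹` does not change.
      set M := LinearMap.toMatrix b b (translate lam hL ⟨l, hl⟩) with hM
      have hMM : M * LinearMap.toMatrix b b (translate lam hL (-⟨l, hl⟩)) = 1 := by
        rw [hM, ← LinearMap.toMatrix_comp]
        refine (congrArg _ (LinearMap.ext fun w => ?_)).trans (LinearMap.toMatrix_id b)
        rw [LinearMap.comp_apply, ← translate_add, add_neg_cancel, translate_zero, LinearMap.id_apply]
      have hcol : ∀ j, (fun i => M i j) = b.equivFun (translate lam hL ⟨l, hl⟩ (b j)) := by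
        intro j
        funext i
        rw [hM, LinearMap.toMatrix_apply]
        rfl
      have h1 : Ψ (x + l) = Ψ x * M := by
        ext i j
        have h2 := congrFun (hΨw x hx (translate lam hL ⟨l, hl⟩ (b j))) i
        rw [← hcol] at h2
        refine Eq.trans ?_ h2.symm
        exact (congrFun (mixedPd_comp_add_right (a i) (b j).1 l) x).symm
      have h2 : v (x + l) = v x ᵥ* M := by
        funext j
        have h3 := hvw x (translate lam hL ⟨l, hl⟩ (b j))
        rw [← hcol, hB] at h3
        exact h3.symm
      rw [h1, h2, Matrix.mul_inv_rev, Matrix.vecMul_vecMul, ← mul_assoc,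
        Matrix.inv_eq_right_inv hMM, hMM, one_mul]
  have hmero : ∀ j, MeromorphicOff P (b j).1 := fun j => meromorphicOff_of_mem hP hL hx₀ _
  have hmv : ∀ j, MeromorphicOff P fun x => v x j := fun j => meromorphicOff_of_mem hP hL hx₀ _
  have hmΨ : ∀ i j, MeromorphicOff P fun x => Ψ x i j := fun i j => (hmero j).mixedPd (a i)
  -- By Cramer's rule the coefficients are quotients of polynomials in derivatives of solutions,
  -- hence meromorphic.
  have hadj : ∀ i j, MeromorphicOff P fun x => (Ψ x).adjugate i j := by
    intro i j
    simp only [Matrix.adjugate_apply]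
    refine MeromorphicOff.det fun i' j' => ?_
    by_cases h : i' = j
    · subst h
      simp only [Matrix.updateRow_self]
      exact meromorphicOff_const _
    · simp only [Matrix.updateRow_ne h]
      exact hmΨ i' j'
  have hnum : ∀ i, MeromorphicOff P fun x => ∑ j, v x j * (Ψ x).adjugate j i := fun i =>
    MeromorphicOff.sum _ fun j _ => (hmv j).mul (hadj j i)
  have hmdet := MeromorphicOff.det hmΨ
  have hcq : ∀ i, ∀ x ∉ P.sing, c i x = (∑ j, v x j * (Ψ x).adjugate j i) / (Ψ x).det := by
    intro i x hx
    simp only [hc, if_neg hx, Matrix.inv_def, Ring.inverse_eq_inv', Matrix.vecMul, dotProduct,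
      Matrix.smul_apply, smul_eq_mul, Finset.sum_div]
    exact Finset.sum_congr rfl fun j _ => by ring
  have hns : ∀ᶠ x in 𝓝 x₀, x ∉ P.sing := (isClosed_sing P).isOpen_compl.mem_nhds hx₀
  have hca : ∀ i, AnalyticAt ℂ (c i) x₀ := fun i =>
    (((hnum i).1 x₀ hx₀).div (hmdet.1 x₀ hx₀) hdet).congr (by
      filter_upwards [hns] with x hx using (hcq i x hx).symm)
  refine ⟨r, a, c, hca, fun i => ?_, fun w => ?_⟩
  · exact of_mem_ellipticGerms ((hnum i).isMeromorphic_div hmdet hx₀ hdet (hcq i)) (hper i) (hca i)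
      (h := fun _ => 1) analyticAt_const (fun h => one_ne_zero h.self_of_nhds) (by simp)
  · filter_upwards [hns, (hmdet.1 x₀ hx₀).continuousAt.eventually_ne hdet] with x hx hx0
    have h1 : (fun i => c i x) = v x ᵥ* (Ψ x)⁻¹ := by
      funext i
      simp only [hc, if_neg hx]
    have h2 : ∑ i, c i x * mixedPd (a i) w.1 x = (v x ᵥ* (Ψ x)⁻¹) ⬝ᵥ (Ψ x *ᵥ b.equivFun w) := by
      rw [← h1, hΨw x hx w]
      rfl
    rw [h2, Matrix.dotProduct_mulVec, Matrix.vecMul_vecMul,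
      Matrix.nonsing_inv_mul _ (isUnit_iff_ne_zero.2 hx0), Matrix.vecMul_one, hvw]

/-- The endomorphism `B` is a differential operator with elliptic coefficients. The automorphism
fixes these coefficients and commutes with derivatives. -/
lemma galoisMap_comm (hP : P.QuasiInvariant) (hL : P.StronglyIntegrable L) {x₀ : Vec n}
    (hx₀ : x₀ ∉ P.sing) {σ : RingAut (P.solutionField L lam x₀)} (hσ : σ ∈ P.Dgal L lam x₀)
    {S B : globalSolutions P L lam →ₗ[ℂ] globalSolutions P L lam}
    (hS : ∀ w, σ (solutionElement P (w.2.1 x₀ hx₀)) = solutionElement P ((S w).2.1 x₀ hx₀))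
    (hB : ∀ l w, B (translate lam hL l w) = translate lam hL l (B w))
    (w : globalSolutions P L lam) : S (B w) = B (S w) := by
  obtain ⟨r, a, c, hc, hce, hBc⟩ := exists_elliptic_operator hP hL hx₀ B hB
  have key : ∀ w : globalSolutions P L lam, MerGerm.of (B w).1 ((B w).2.1 x₀ hx₀).1 =
      ∑ i, MerGerm.of (c i) (hc i) *
        MerGerm.pdList (multiList (a i)) (MerGerm.of w.1 (w.2.1 x₀ hx₀).1) := by
    intro w
    have h1 := MerGerm.Describes.sum (h := fun _ => 1) (x := x₀) Finset.univ fun i _ =>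
      (MerGerm.describes_of (h := fun _ => 1) (hc i)).mul ((MerGerm.describes_of (h := fun _ => 1)
        (w.2.1 x₀ hx₀).1).pdList analyticAt_const (multiList (a i)))
    have h2 : (B w).1 =ᶠ[𝓝 x₀] fun x => ∑ i, c i x * pdList (multiList (a i)) w.1 x := by
      filter_upwards [hBc w] with x hx
      rw [hx]
      exact Finset.sum_congr rfl fun i _ => by rw [mixedPd_eq_pdList]
    rw [h1.eq_of (((B w).2.1 x₀ hx₀).1.congr h2)]
    exact MerGerm.of_eq_of_iff.2 h2
  have h1 := coe_map_eq_sum Finset.univ (fun i _ => hce i) (fun i => multiList (a i))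
    (a := solutionElement P (w.2.1 x₀ hx₀)) (b := solutionElement P ((B w).2.1 x₀ hx₀)) (key w) hσ
  rw [hS, hS] at h1
  have h2 : MerGerm.of (S (B w)).1 ((S (B w)).2.1 x₀ hx₀).1 =
      MerGerm.of (B (S w)).1 ((B (S w)).2.1 x₀ hx₀).1 := h1.trans (key (S w)).symm
  have h3 := eqOn_compl_sing (S (B w)).2.1 (B (S w)).2.1 hx₀ (MerGerm.of_eq_of_iff.1 h2)
  refine Subtype.ext (funext fun y => ?_)
  by_cases hy : y ∈ P.sing
  · rw [(S (B w)).2.2 y hy, (B (S w)).2.2 y hy]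
  · exact h3 hy

/-- Two uses of `galoisMap_comm`. With a translation as `B` it shows that Galois maps commute with
translations. This makes the Galois map of `σ'` admissible as `B`, and the second use gives
commutation with the Galois map of `σ`. -/
theorem Dgal_comm (hP : P.QuasiInvariant) (hL : P.StronglyIntegrable L) {x₀ : Vec n}
    (hx₀ : x₀ ∉ P.sing) {σ σ' : RingAut (P.solutionField L lam x₀)} (hσ : σ ∈ P.Dgal L lam x₀)
    (hσ' : σ' ∈ P.Dgal L lam x₀) : σ * σ' = σ' * σ := by
  obtain ⟨S, hS⟩ := exists_galoisMap hP hL hx₀ hσ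
  obtain ⟨S', hS'⟩ := exists_galoisMap hP hL hx₀ hσ'
  have hT : ∀ l l' (w : globalSolutions P L lam), translate lam hL l (translate lam hL l' w) =
      translate lam hL l' (translate lam hL l w) := fun l l' w => by
    rw [← translate_add, ← translate_add, add_comm]
  have hSS : ∀ w, S (S' w) = S' (S w) := fun w => galoisMap_comm hP hL hx₀ hσ hS
    (fun l w => galoisMap_comm hP hL hx₀ hσ' hS' (hT l) w) w
  -- The elements on which both products agree form a subfield closed under the derivations, so
  -- agreement on elliptic functions and on solutions is enough.
  set E : Subfield (MerGerm x₀) := (RingHom.eqLocusField (σ * σ' : RingAut _).toRingHom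
    (σ' * σ : RingAut _).toRingHom).map (P.solutionField L lam x₀).subtype with hE
  have hle : P.solutionField L lam x₀ ≤ E := by
    refine sInf_le ⟨fun k hk => ?_, ?_, ?_⟩
    · refine ⟨⟨k, ellipticGerms_subset hk⟩, ?_, rfl⟩
      have h1 : σ ⟨k, ellipticGerms_subset hk⟩ = ⟨k, ellipticGerms_subset hk⟩ := hσ.2 _ hk
      have h2 : σ' ⟨k, ellipticGerms_subset hk⟩ = ⟨k, ellipticGerms_subset hk⟩ := hσ'.2 _ hk
      change σ (σ' _) = σ' (σ _)
      rw [h1, h2, h1]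
    · rintro _ ⟨f, hf, rfl⟩
      obtain ⟨w, hw, -, hwf⟩ := exists_mem_globalSolutions hP hL hx₀ hf
      have h1 : solutionElement P (hw.1 x₀ hx₀) = solutionElement P hf :=
        Subtype.ext (MerGerm.of_eq_of_iff.2 hwf)
      refine ⟨solutionElement P hf, ?_, rfl⟩
      change σ (σ' _) = σ' (σ _)
      rw [← h1]
      refine (congrArg σ (hS' ⟨w, hw⟩)).trans ((hS _).trans ?_)
      rw [hSS]
      exact ((congrArg σ' (hS ⟨w, hw⟩)).trans (hS' _)).symm
    · rintro i _ ⟨k, hk, rfl⟩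
      refine ⟨EllipticPotential.solutionField.pd P L lam i k, ?_, rfl⟩
      change σ (σ' _) = σ' (σ _)
      rw [hσ'.1, hσ.1, hσ.1, hσ'.1]
      exact congrArg _ hk
  refine RingEquiv.ext fun k => ?_
  obtain ⟨k', hk', hkk⟩ := hle k.2
  rw [← Subtype.ext hkk]
  exact hk'

end Commutativity

end

end GenLame

theorem mainTheorem6 {n : ℕ} [NeZero n] (P : GenLame.EllipticPotential n)
    (hP : P.QuasiInvariant) (L : Fin n → GenLame.DiffOp n) (hL : P.StronglyIntegrable L)
    (lam : Fin n → ℂ) :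
    -- local monodromy around each singular hyperplane: integer exponents, no logarithms, and
    -- trivial analytic continuation along all loops near a generic point of the hyperplane
    (∀ α ∈ P.A, ∀ (p q : ℤ) (x₀ : GenLame.Vec n), P.IsGenericPoint α p q x₀ →
      ∃ ε > 0, Metric.ball x₀ ε ∩ P.sing ⊆ GenLame.hyperplane P.τ α p q ∧
        (∀ x₁ ∈ Metric.ball x₀ ε \ P.sing, ∀ ψ : GenLame.Vec n → ℂ, GenLame.IsSol L lam ψ x₁ →
          (¬ ∀ᶠ x in 𝓝 x₁, ψ x = 0) →
          ∃ (e : ℤ) (h : GenLame.Vec n → ℂ), (e = -(P.m α : ℤ) ∨ e = (P.m α : ℤ) + 1) ∧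
            AnalyticOnNhd ℂ h (Metric.ball x₀ ε) ∧
            (∃ y ∈ Metric.ball x₀ ε ∩ GenLame.hyperplane P.τ α p q, h y ≠ 0) ∧
            ∀ᶠ x in 𝓝 x₁, ψ x = GenLame.shifted P.τ α p q x ^ e * h x) ∧
        (∀ (t₁ : P.RegTorus) (γ : Path t₁ t₁) (x₁ : GenLame.Vec n) (δ : Path x₁ x₁),
          (∀ r, δ r ∈ Metric.ball x₀ ε ∧ P.proj (δ r) = γ r) →
          ∀ ψ ∈ P.solutionSpace L lam t₁, P.ContinuesAlong L lam γ ψ ψ)) ∧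
    -- the monodromy representation exists, is unique, factors through `π₁(T)`, and the
    -- monodromy group is a commutative homomorphic image of `π₁(T)`
    (∀ t₀ : P.RegTorus,
      ∃ ρ : FundamentalGroup P.RegTorus t₀ →*
          (P.solutionSpace L lam t₀ ≃ₗ[ℂ] P.solutionSpace L lam t₀),
        P.IsMonodromyRep L lam t₀ ρ ∧
        (∀ ρ₁, P.IsMonodromyRep L lam t₀ ρ₁ → ρ₁ = ρ) ∧
        (∃ ρ' : FundamentalGroup P.Torus (P.incl t₀) →*
            (P.solutionSpace L lam t₀ ≃ₗ[ℂ] P.solutionSpace L lam t₀),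
          ρ = ρ'.comp (FundamentalGroup.map P.incl t₀) ∧ ρ.range = ρ'.range) ∧
        ∀ a ∈ ρ.range, ∀ b ∈ ρ.range, a * b = b * a) ∧
    -- every local solution extends to a solution on the complement of the singular locus which
    -- is meromorphic on the whole space
    (∀ x₀ ∉ P.sing, ∀ ψ : GenLame.Vec n → ℂ, GenLame.IsSol L lam ψ x₀ →
      ∃ f : GenLame.Vec n → ℂ, GenLame.IsMeromorphic f ∧ (∀ x ∉ P.sing, GenLame.IsSol L lam f x) ∧
        f =ᶠ[𝓝 x₀] ψ) ∧
    -- the differential Galois group is commutative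
    (∀ x₀ ∉ P.sing, ∀ σ ∈ P.Dgal L lam x₀, ∀ σ' ∈ P.Dgal L lam x₀, σ * σ' = σ' * σ) := by
  refine ⟨fun α hα p q x₀ hx₀ => ?_, GenLame.exists_monodromyRep hP hL,
    fun x₀ hx₀ ψ hψ => GenLame.exists_global hP hL hx₀ hψ,
    fun x₀ hx₀ σ hσ σ' hσ' => GenLame.Dgal_comm hP hL hx₀ hσ hσ'⟩
  obtain ⟨ε, hε, hsing, hform⟩ := GenLame.exists_isGenericPoint_form hP hL lam hα hx₀
  refine ⟨ε, hε, hsing, fun x₁ hx₁ ψ hψ hne => ?_, ?_⟩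
  · obtain ⟨e, h, he, hh, hy, hψh, -⟩ := hform x₁ hx₁ ψ hψ hne
    exact ⟨e, h, he, hh, hy, hψh⟩
  -- The lift `δ` is closed, so the global solution with the given germ has the same germ at both
  -- ends of the path.
  · rintro t₁ γ x₁ δ hδ _ ⟨F, hF, rfl⟩
    have ht : P.proj x₁ = t₁ := by simpa using (hδ 0).2
    have hx₁ : x₁ ∉ P.sing := GenLame.notMem_sing_of_proj_notMem (ht ▸ t₁.2)
    obtain ⟨f, -, hf, hfF⟩ := GenLame.exists_global hP hL hx₁ (hF x₁ ht)
    exact GenLame.continuesAlong_of_lift hL hf γ δ.continuous (fun r => (hδ r).2)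
      (by rw [δ.source]; exact hfF.symm) (by rw [δ.target]; exact hfF.symm)
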